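/- **Notation.** All graphs are finite, simple and without isolated vertices; a subgraph $H\subseteq K$ is given by its edge set, and $V(H)$ is the set of its non-isolated vertices, $v(H)=|V(H)|$, $e(H)=|E(H)|$. A fractional vertex cover of $H$ is a tuple $(c_v)_{v\in V(H)}$ with $c_v\ge 0$ and $c_v+c_w\ge 1$ for every $vw\in E(H)$; $c(H)$ is the minimum of $\sum_v c_v$ over them, and a cover attaining it is called minimum. Let $\gamma(K)=\max_{\emptyset\ne H\subseteq K}\frac{e(H)-v(H)}{c(H)}$. A subgraph $H\subseteq K$ (possibly empty) is contributing if it has minimum degree at least $2$ and $e(H)-v(H)=c(H)\gamma(K)$. A set $A\subseteq V(H)$ is valid if some minimum fractional vertex cover of $H$ has $c_v=1$ on $A$ and $c_v\in\{0,\frac12\}$ on $V(H)\setminus A$. Put $$P_K(z,w)=\sum_{H\subseteq K\text{ contributing}}\ \sum_{A\subseteq V(H)\text{ valid}} z^{|A|}w^{c(H)-|A|},\qquad \rho(K,\delta)=\min_{z,w\ge 0,\ P_K(z,w)\ge 1+\delta}\Big(z+\frac w2\Big).$$ A maximum fractional matching of $H$ is a tuple $(w_e)_{e\in E(H)}$ with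 $w_e\ge0$, $\sum_{e\ni v}w_e\le 1$ for all $v\in V(H)$ and $\sum_e w_e=c(H)$; an edge $e_0$ of $H$ is bad if $w_{e_0}=1$ for every maximum fractional matching of $H$. The $2$-core of $K$ is its largest subgraph of minimum degree at least $2$. A graphon is a symmetric measurable $W:[0,1]^2\to[0,1]$; it is $p$-regular if $\int_0^1W(x,y)\,dy=p$ for every $x\in[0,1]$. Let $I_p(x)=x\log\frac xp+(1-x)\log\frac{1-x}{1-p}$ (with $0\log 0=0$), $I_p(W)=\int_{[0,1]^2}I_p(W(x,y))\,dx\,dy$, and $\mathrm{Hom}(K,W)=\int_{[0,1]^{V(K)}}\prod_{uv\in E(K)}W(x_u,x_v)\,dx$ (for every symmetric measurable bounded $W$). A block graphon on $k$ blocks takes a constant value $w_{ij}$ on each $S_i\times S_j$ for some partition $[0,1]=S_1\cup\dots\cup S_k$ into intervals, of lengths $m(S_i)$. For $B:V(K)\to[k]$, $\mathrm{Hom}_B(K,W)$ is the part of the integral $\mathrm{Hom}(K,W)$ over $\{x: x_v\in S_{B(v)}\ \forall v\}$. **Conditions (\*).** Let $p\to0$, $n\to\infty$, and let $W$ be a block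 graphon on a fixed number $k$ of blocks, depending on the same parameter as $p$ and $n$. $f\ll g$ means $f=o(g)$. Call $B$ negligible if $\mathrm{Hom}_B(K,W)=o(p^{e(K)})$. Call $(i,j)$ important if $i,j\le k-1$ and $m(S_i)m(S_j)w_{ij}\ll(\log\log\log\frac1p)^{-1}I_p(W)$, and unimportant otherwise; an important block is very important if $w_{ij}=1$ eventually and somewhat important otherwise. The conditions are: $n^{-1}\log\log n\ll p\ll1$, and 1. $W$ is $p$-regular; 2. $m(S_k)\ge 1-p$; 3. $\mathrm{Hom}(K,W)\ge(1+\Omega(1))p^{e(K)}$; 4. $n^{-1}\log n\ll I_p(W)\ll p^{2e(K)}n$; 5. $m(S_i)\gg n^{-1}$ for all $i$; 6. for all $i,j\le k-1$, $w_{ij}\ge p$, and either $w_{ij}=p$ or $m(S_i)m(S_j)w_{ij}\ll(\log\log\log\frac1p)^{-1}I_p(W)$; 7. if $B$ is non-negligible, the edges of $K$ that $B$ sends into somewhat important blocks are pairwise disjoint; 8. if $B$ is non-negligible and $(i,j)$ is an unimportant block containing the image of an edge of $K$ under $B$, then $m(S_i)m(S_j)\ge(1+o(1))p^{-1}I_p(W)$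 and $w_{ij}=p+o(p)$; 9. $w_{ij}m(S_i)\gg n^{-1}\log n$ for all important $(i,j)$; 10. $\mathrm{Hom}(K,W+p)=O(p^{e(K)})$. (Conditions 1, 2, 6 are required for all sufficiently late values of the parameter.) **Theorem.** Let $\delta>0$ and let $K$ be a graph whose $2$-core is not a (possibly empty) disjoint union of cycles, such that no contributing subgraph of $K$ has a bad edge. Then the minimum defining $\rho(K,\delta)$ exists, and as $p\to0^+$ $$\inf_{\substack{W\ p\text{-regular}\\ \mathrm{Hom}(K,W)\ge(1+\delta)p^{e(K)}}}I_p(W)=(2+o(1))\,\rho(K,\delta)\,p^{2+\gamma(K)}\log\frac1p .$$ Furthermore, the upper bound is attained by suitable graphons: there are a fixed $k$ and block graphons $W_p$ on $k$ blocks such that, for all small $p>0$, $W_p$ is $p$-regular with $\mathrm{Hom}(K,W_p)\ge(1+\delta)p^{e(K)}$, such that $I_p(W_p)=(2+o(1))\rho(K,\delta)p^{2+\gamma(K)}\log\frac1p$ as $p\to0^+$, and such that, whenever $n\to\infty$ and $p\to0^+$ jointly with $(n^{-1}\log n)^{\frac1{2e(K)-2-\gamma(K)}}\ll p$, the graphons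 $W_p$ satisfy Conditions (\*). -/

import Mathlib

open Filter Topology Asymptotics MeasureTheory

namespace RegularTail

noncomputable section

/-! ### Graph parameters

A subgraph of a finite graph `K` is identified with its set of edges, i.e. it is a simple graph
`H ≤ K` on the same vertex type; its vertex set `V(H)` is the set of non-isolated vertices. -/

/-- `V(H)`: the set of non-isolated vertices of `H`. -/
def verts {V : Type*} [Fintype V] (H : SimpleGraph V) : Finset V := by
  classical exact Finset.univ.filter (fun v => ∃ w, H.Adj v w)

/-- `E(H)`: the set of edges of `H`. -/
def edges {V : Type*} [Fintype V] (H : SimpleGraph V) : Finset (Sym2 V) := by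
  classical exact Finset.univ.filter (fun e => e ∈ H.edgeSet)

/-- `(c_v)` is a fractional vertex cover of `H` (only the values on `V(H)` matter). -/
def IsFracVertexCover {V : Type*} [Fintype V] (H : SimpleGraph V) (c : V → ℝ) : Prop :=
  (∀ v ∈ verts H, 0 ≤ c v) ∧ ∀ v w, H.Adj v w → 1 ≤ c v + c w

/-- `c(H)`: the minimum total weight of a fractional vertex cover of `H`. -/
def coverNum {V : Type*} [Fintype V] (H : SimpleGraph V) : ℝ :=
  sInf {s : ℝ | ∃ c : V → ℝ, IsFracVertexCover H c ∧ s = ∑ v ∈ verts H, c v}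

/-- `(c_v)` is a minimum fractional vertex cover of `H`. -/
def IsMinFracVertexCover {V : Type*} [Fintype V] (H : SimpleGraph V) (c : V → ℝ) : Prop :=
  IsFracVertexCover H c ∧ ∑ v ∈ verts H, c v = coverNum H

/-- `γ(K)`: the maximum of `(e(H) - v(H)) / c(H)` over the nonempty subgraphs `H` of `K`. -/
def gam {V : Type*} [Fintype V] (K : SimpleGraph V) : ℝ :=
  sSup {s : ℝ | ∃ H : SimpleGraph V, H ≤ K ∧ H ≠ ⊥ ∧
    s = (((edges H).card : ℝ) - ((verts H).card : ℝ)) / coverNum H}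

/-- `H` has minimum degree at least `2` (on its set of non-isolated vertices). -/
def MinDegTwo {V : Type*} [Fintype V] (H : SimpleGraph V) : Prop :=
  ∀ v ∈ verts H, 2 ≤ (H.neighborSet v).ncard

/-- `H` is a contributing subgraph of `K`. The empty subgraph is contributing. -/
def IsContributing {V : Type*} [Fintype V] (K H : SimpleGraph V) : Prop :=
  H ≤ K ∧ MinDegTwo H ∧
    ((edges H).card : ℝ) - ((verts H).card : ℝ) = coverNum H * gam K

/-- The `2`-core of `K`: the largest subgraph of `K` all of whose (non-isolated) vertices have
degree at least `2`. -/
def twoCore {V : Type*} [Fintype V] (K : SimpleGraph V) : SimpleGraph V :=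
  sSup {H : SimpleGraph V | H ≤ K ∧ MinDegTwo H}

/-- `A ⊆ V(H)` is valid: some minimum fractional vertex cover equals `1` on `A` and takes values
in `{0, 1/2}` on `V(H) \ A`. -/
def IsValid {V : Type*} [Fintype V] (H : SimpleGraph V) (A : Finset V) : Prop :=
  A ⊆ verts H ∧ ∃ c : V → ℝ, IsMinFracVertexCover H c ∧ (∀ v ∈ A, c v = 1) ∧
    ∀ v ∈ verts H, v ∉ A → c v = 0 ∨ c v = 1 / 2

open Classical in
/-- `P_K(z, w) = ∑_{H contributing} ∑_{A valid} z ^ |A| * w ^ (c(H) - |A|)`. The exponent of `w` is a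
nonnegative half-integer, and `0 ^ 0 = 1`. -/
def contribPoly {V : Type*} [Fintype V] (K : SimpleGraph V) (z w : ℝ) : ℝ :=
  ∑ H ∈ (Finset.univ : Finset (SimpleGraph V)).filter (fun H => IsContributing K H),
    ∑ A ∈ (Finset.univ : Finset (Finset V)).filter (fun A => IsValid H A),
      z ^ A.card * w ^ (coverNum H - (A.card : ℝ))

/-- The set of values `z + w / 2` with `z, w ≥ 0` and `P_K(z, w) ≥ 1 + δ`. -/
def rhoValues {V : Type*} [Fintype V] (K : SimpleGraph V) (δ : ℝ) : Set ℝ :=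
  {s : ℝ | ∃ z w : ℝ, 0 ≤ z ∧ 0 ≤ w ∧ 1 + δ ≤ contribPoly K z w ∧ s = z + w / 2}

/-- `ρ(K, δ)`: the minimum of `z + w / 2` over `z, w ≥ 0` with `P_K(z, w) ≥ 1 + δ`. -/
def rho {V : Type*} [Fintype V] (K : SimpleGraph V) (δ : ℝ) : ℝ :=
  sInf (rhoValues K δ)

/-- `(w_e)` is a fractional matching of `H` (only the values on `E(H)` matter). -/
def IsFracMatching {V : Type*} [Fintype V] (H : SimpleGraph V) (w : Sym2 V → ℝ) : Prop := by
  classical exact (∀ e ∈ edges H, 0 ≤ w e) ∧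
    ∀ v ∈ verts H, ∑ e ∈ (edges H).filter (fun e => v ∈ e), w e ≤ 1

/-- A fractional matching is maximum if its total weight is `c(H)`. -/
def IsMaxFracMatching {V : Type*} [Fintype V] (H : SimpleGraph V) (w : Sym2 V → ℝ) : Prop :=
  IsFracMatching H w ∧ ∑ e ∈ edges H, w e = coverNum H

/-- An edge of `H` is bad if it has weight `1` in every maximum fractional matching of `H`. -/
def IsBadEdge {V : Type*} [Fintype V] (H : SimpleGraph V) (e : Sym2 V) : Prop :=
  e ∈ edges H ∧ ∀ w : Sym2 V → ℝ, IsMaxFracMatching H w → w e = 1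

/-! ### Graphons -/

/-- A symmetric measurable function `[0,1]² → ℝ`. -/
structure SymKernel where
  toFun : unitInterval → unitInterval → ℝ
  measurable' : Measurable (Function.uncurry toFun)
  symm' : ∀ x y, toFun x y = toFun y x

/-- A graphon: a symmetric measurable function `[0,1]² → [0,1]`. -/
structure Graphon extends SymKernel where
  nonneg' : ∀ x y, 0 ≤ toFun x y
  le_one' : ∀ x y, toFun x y ≤ 1

/-- The kernel `F + a`. -/
def SymKernel.addConst (F : SymKernel) (a : ℝ) : SymKernel where
  toFun x y := F.toFun x y + a
  measurable' := F.measurable'.add_const a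
  symm' x y := by rw [F.symm' x y]

/-- The value `F(x, y)` at an unordered pair `{x, y}`. -/
def SymKernel.onPair (F : SymKernel) : Sym2 unitInterval → ℝ :=
  Sym2.lift ⟨F.toFun, F.symm'⟩

/-- `∏_{uv ∈ E(K)} F(x_u, x_v)`. -/
def edgeProd {V : Type*} [Fintype V] (K : SimpleGraph V) (F : SymKernel)
    (x : V → unitInterval) : ℝ :=
  ∏ e ∈ edges K, F.onPair (e.map x)

/-- `Hom(K, F)`. An isolated vertex of `K` would only contribute a factor `1`. -/
def hom {V : Type*} [Fintype V] (K : SimpleGraph V) (F : SymKernel) : ℝ :=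
  ∫ x : V → unitInterval, edgeProd K F x

/-- The `p`-entropy `I_p(x)` of a number `x ∈ [0,1]`; as `Real.log 0 = 0`, the formula takes the
limiting values `log (1 / (1 - p))` at `x = 0` and `log (1 / p)` at `x = 1`. -/
def entropyFn (p x : ℝ) : ℝ :=
  x * Real.log (x / p) + (1 - x) * Real.log ((1 - x) / (1 - p))

/-- The total entropy `I_p(W)` of a graphon. -/
def entropy (p : ℝ) (W : Graphon) : ℝ :=
  ∫ x : unitInterval, ∫ y : unitInterval, entropyFn p (W.toFun x y)

/-- `W` is `p`-regular. -/
def IsRegular (p : ℝ) (W : Graphon) : Prop :=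
  ∀ x : unitInterval, ∫ y : unitInterval, W.toFun x y = p

/-- `W` is admissible in the variational problem: `p`-regular with
`Hom(K, W) ≥ (1 + δ) p ^ e(K)`. -/
def IsAdmissible {V : Type*} [Fintype V] (K : SimpleGraph V) (δ p : ℝ) (W : Graphon) : Prop :=
  IsRegular p W ∧ (1 + δ) * p ^ (edges K).card ≤ hom K W.toSymKernel

/-- The infimum of `I_p(W)` over the admissible graphons. -/
def minEntropy {V : Type*} [Fintype V] (K : SimpleGraph V) (δ p : ℝ) : ℝ :=
  sInf {s : ℝ | ∃ W : Graphon, IsAdmissible K δ p W ∧ s = entropy p W}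

/-! ### Block graphons -/

/-- A block graphon on `k = m + 1` blocks, together with its partition `part` of `[0,1]` into
intervals and its value `val i j` on `part i ×ˢ part j`. The index `Fin.last m` plays the role of
`k`. -/
structure BlockGraphon (m : ℕ) extends Graphon where
  part : Fin (m + 1) → Set unitInterval
  interval : ∀ i, (part i).OrdConnected
  disj : Pairwise (fun i j => Disjoint (part i) (part j))
  cover : ⋃ i, part i = Set.univ
  val : Fin (m + 1) → Fin (m + 1) → ℝ
  const : ∀ i j, ∀ x ∈ part i, ∀ y ∈ part j, toFun x y = val i j

/-- The length `m(S_i)` of the `i`-th interval. -/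
def BlockGraphon.len {m : ℕ} (W : BlockGraphon m) (i : Fin (m + 1)) : ℝ :=
  (volume : Measure unitInterval).real (W.part i)

/-- `Hom_B(K, W)` for a `K`-block `B`. -/
def homBlock {V : Type*} [Fintype V] {m : ℕ} (K : SimpleGraph V) (W : BlockGraphon m)
    (B : V → Fin (m + 1)) : ℝ :=
  ∫ x in {x : V → unitInterval | ∀ v, x v ∈ W.part (B v)}, edgeProd K W.toSymKernel x

section Conditions

/-! In this section `W`, `p` and `n` vary with a parameter `t`, and all asymptotic notation refers
to the filter `l`. The number of blocks is fixed. -/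

/-- The `K`-block `B` is negligible: `Hom_B(K, W) = o(p ^ e(K))`. -/
def IsNegligible {V : Type*} [Fintype V] {m : ℕ} {ι : Type*} (K : SimpleGraph V) (l : Filter ι)
    (p : ι → ℝ) (W : ι → BlockGraphon m) (B : V → Fin (m + 1)) : Prop :=
  (fun t => homBlock K (W t) B) =o[l] fun t => p t ^ (edges K).card

/-- `m(S_i) m(S_j) w_ij ≪ (log log log (1/p))⁻¹ I_p(W)`. -/
def IsSmallBlock {m : ℕ} {ι : Type*} (l : Filter ι) (p : ι → ℝ) (W : ι → BlockGraphon m)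
    (i j : Fin (m + 1)) : Prop :=
  (fun t => (W t).len i * (W t).len j * (W t).val i j) =o[l]
    fun t => (Real.log (Real.log (Real.log (1 / p t))))⁻¹ * entropy (p t) (W t).toGraphon

/-- The block `(i, j)` is important. -/
def IsImportant {m : ℕ} {ι : Type*} (l : Filter ι) (p : ι → ℝ) (W : ι → BlockGraphon m)
    (i j : Fin (m + 1)) : Prop :=
  i ≠ Fin.last m ∧ j ≠ Fin.last m ∧ IsSmallBlock l p W i j

/-- The block `(i, j)` is somewhat important, i.e. important but not very important: it is not
the case that `w_ij = 1` (eventually). -/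
def IsSomewhatImportant {m : ℕ} {ι : Type*} (l : Filter ι) (p : ι → ℝ) (W : ι → BlockGraphon m)
    (i j : Fin (m + 1)) : Prop :=
  IsImportant l p W i j ∧ ¬ ∀ᶠ t in l, (W t).val i j = 1

/-- The conditions under which a family of block graphons `W` with a fixed number of blocks yields
a large deviation lower bound for random regular graphs of density `p` on `n` vertices. -/
structure LowerBoundConditions {V : Type*} [Fintype V] {m : ℕ} {ι : Type*} (K : SimpleGraph V)
    (l : Filter ι) (n : ι → ℕ) (p : ι → ℝ) (W : ι → BlockGraphon m) : Prop where
  /-- The range `n⁻¹ log log n ≪ p ≪ 1`. -/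
  range_left : (fun t => Real.log (Real.log (n t)) / (n t : ℝ)) =o[l] p
  range_right : p =o[l] fun _ => (1 : ℝ)
  /-- Regularity. -/
  regular : ∀ᶠ t in l, IsRegular (p t) (W t).toGraphon
  /-- One block dominates in size. -/
  dominant : ∀ᶠ t in l, 1 - p t ≤ (W t).len (Fin.last m)
  /-- Many copies of `K`. -/
  many : ∃ ε : ℝ, 0 < ε ∧
    ∀ᶠ t in l, (1 + ε) * p t ^ (edges K).card ≤ hom K (W t).toSymKernel
  /-- Bounded entropy. -/
  entropy_lower : (fun t => Real.log (n t) / (n t : ℝ)) =o[l]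
    fun t => entropy (p t) (W t).toGraphon
  entropy_upper : (fun t => entropy (p t) (W t).toGraphon) =o[l]
    fun t => p t ^ (2 * (edges K).card) * (n t : ℝ)
  /-- Blocks are not too small. -/
  blocks_large : ∀ i, (fun t => (n t : ℝ)⁻¹) =o[l] fun t => (W t).len i
  /-- Dichotomy on small blocks. -/
  dichotomy : ∀ i j, i ≠ Fin.last m → j ≠ Fin.last m →
    (∀ᶠ t in l, p t ≤ (W t).val i j) ∧
      ((∀ᶠ t in l, (W t).val i j = p t) ∨ IsSmallBlock l p W i j)
  /-- Distinct edges sent into somewhat important blocks by a non-negligible `K`-block do not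
  share a vertex `u`. -/
  somewhat : ∀ B : V → Fin (m + 1), ¬ IsNegligible K l p W B →
    ∀ u v v', K.Adj u v → K.Adj u v' → IsSomewhatImportant l p W (B u) (B v) →
      IsSomewhatImportant l p W (B u) (B v') → v = v'
  /-- Unimportant blocks are large: `m(S_i) m(S_j) ≥ (1 + o(1)) p⁻¹ I_p(W)` and
  `w_ij = p + o(p)`. -/
  unimportant : ∀ B : V → Fin (m + 1), ¬ IsNegligible K l p W B →
    ∀ u v, K.Adj u v → ¬ IsImportant l p W (B u) (B v) →
      (∀ ε : ℝ, 0 < ε → ∀ᶠ t in l,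
        (1 - ε) * ((p t)⁻¹ * entropy (p t) (W t).toGraphon) ≤
          (W t).len (B u) * (W t).len (B v)) ∧
      (fun t => (W t).val (B u) (B v) - p t) =o[l] p
  /-- High degrees within important blocks. -/
  high_degrees : ∀ i j, IsImportant l p W i j →
    (fun t => Real.log (n t) / (n t : ℝ)) =o[l] fun t => (W t).val i j * (W t).len i
  /-- Not too many copies of `K`. -/
  not_too_many : (fun t => hom K ((W t).toSymKernel.addConst (p t))) =O[l]
    fun t => p t ^ (edges K).card

end Conditions

end

end RegularTail

/-!
# The regular upper tail: minimum entropy of regular graphons with many copies of a graph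

**Lower bound for the entropy.** Write `W = p + U` for a `p`-regular graphon `W`. The expansion
`hom_addConst` of `Hom(K, W)` over the subgraphs `H` of `K` loses all the `H` with a vertex of degree
`1`, because `U` has zero marginals (`hom_eq_zero`). The other terms are estimated by a combination of
Hölder's inequality and half-integral duality. A minimum fractional vertex cover of `H` is dual to a
*two-matching*, a permutation `π` of a vertex set `D` along edges with `|D| = 2 c(H)`
(`exists_halfCover_twoMatching`). Hölder's inequality with exponent `1 / 2` on each arc `v → π v`
bounds the integral by the masses of the arcs, and the remaining vertices are leaves, which integrate
to a degree, at most `p` (`lintegral_edges_le`, `lintegral_edgeFun_le`). If the entropy is of order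
`p ^ (2 + γ) log (1 / p)`, the values of `W` well above `p` have mass of order `p ^ (2 + γ)`, so that
such values yield at most order `p ^ (v(H) + γ c(H))` (`lintegral_big_le`). By definition of `γ` this
is at most `p ^ e(H)`, and much smaller unless `H` is contributing.

Values close to `p` have to be excluded separately: if they occur on the edges of `H` outside `H₁`,
then a two-matching of `H` that uses some of these edges has a better exponent than one of `H₁`
(`exists_gain`, `lintegral_small_mul_big_le`). Here, and in the reduction to values above a small
constant (`lintegral_big_le_add`), the absence of bad edges is essential: it provides a maximum
two-matching that does not use a given edge twice (`exists_twoMatching_not_swap`). Values above a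
constant cost `(1 + o(1)) log (1 / p)` per unit of mass.

Finally, the points are split into hubs, whose degree is comparable to `p`, and points of small
degree (`exists_hubs`). Only copies of `H` whose set `S` of hubs is valid matter, and they contribute
`z ^ |S| w ^ (c(H) - |S|)`, where `z` is the normalized mass at the hubs and `w` the normalized mass
of the other values (`lintegral_hubs_le`). The entropy is about `2 z + w`, as edges at hubs count
twice. Hence `P_K(z, w) ≥ 1 + δ - o(1)` (`exists_hom_le`), and compactness gives
`eventually_le_entropy`.

**The extremal graphons.** Given a minimizer `(z, w)`, the graphon `extremal` has four blocks: hubs of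
measure about `z p ^ (1 + γ)`, joined with value `1` to a set of measure `p` containing them, inside
that set a clique of measure about `√w p ^ (1 + γ / 2)`, and the rest, where the values are adjusted
to make the graphon `p`-regular. For each pair of a contributing `H` and a valid `S`, mapping `S` to
the hubs and the vertices with weight `1 / 2` of a witnessing cover to the clique is an injective
choice of a block for each vertex of `K` (`position`), with density about
`z ^ |S| w ^ (c(H) - |S|) p ^ e(K)`. This gives the number of copies (`le_hom_blockGraphon`), and the
entropy is `(2 z + w + o(1)) p ^ (2 + γ) log (1 / p)` (`tendsto_entropy_extremal`).

The conditions on non-negligible positions follow since, for such a position, the edges in blocks of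
value `1` attain the maximum in the definition of `γ(K)` (`oneGraph_of_tight`): adding further edges
to them would increase it (`two_le_gam_mul`).
-/

namespace RegularTail

set_option linter.unusedSectionVars false

/-! ### Fractional covers and two-matchings -/

section Combinatorics

variable {V : Type*} [Fintype V]

theorem mem_verts {H : SimpleGraph V} {v : V} : v ∈ verts H ↔ ∃ w, H.Adj v w := by
  simp [verts]

theorem mem_edges {H : SimpleGraph V} {e : Sym2 V} : e ∈ edges H ↔ e ∈ H.edgeSet := by
  simp [edges]

theorem mk_mem_edges {H : SimpleGraph V} {u v : V} : s(u, v) ∈ edges H ↔ H.Adj u v := by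
  simp [mem_edges]

theorem verts_mono {G H : SimpleGraph V} (h : G ≤ H) : verts G ⊆ verts H := by
  intro v hv
  obtain ⟨w, hw⟩ := mem_verts.1 hv
  exact mem_verts.2 ⟨w, h hw⟩

theorem edges_mono {G H : SimpleGraph V} (h : G ≤ H) : edges G ⊆ edges H := by
  intro e he
  exact mem_edges.2 (SimpleGraph.edgeSet_mono h (mem_edges.1 he))

theorem left_mem_verts {H : SimpleGraph V} {u v : V} (h : H.Adj u v) : u ∈ verts H :=
  mem_verts.2 ⟨v, h⟩

theorem right_mem_verts {H : SimpleGraph V} {u v : V} (h : H.Adj u v) : v ∈ verts H :=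
  mem_verts.2 ⟨u, h.symm⟩

theorem coverNum_le {H : SimpleGraph V} {c : V → ℝ} (hc : IsFracVertexCover H c) :
    coverNum H ≤ ∑ v ∈ verts H, c v := by
  refine csInf_le ⟨0, ?_⟩ ⟨c, hc, rfl⟩
  rintro s ⟨c, hc, rfl⟩
  exact Finset.sum_nonneg hc.1

theorem le_coverNum {H : SimpleGraph V} {a : ℝ}
    (h : ∀ c, IsFracVertexCover H c → a ≤ ∑ v ∈ verts H, c v) : a ≤ coverNum H := by
  refine le_csInf ⟨_, fun _ => 1, ⟨fun _ _ => zero_le_one, fun _ _ _ => by norm_num⟩, rfl⟩ ?_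
  rintro s ⟨c, hc, rfl⟩
  exact h c hc

theorem coverNum_nonneg (H : SimpleGraph V) : 0 ≤ coverNum H :=
  le_coverNum fun _ hc => Finset.sum_nonneg hc.1

theorem coverNum_mono {G H : SimpleGraph V} (h : G ≤ H) : coverNum G ≤ coverNum H := by
  refine le_coverNum fun c hc => ?_
  have hG : IsFracVertexCover G c := ⟨fun v hv => hc.1 v (verts_mono h hv), fun v w hvw => hc.2 v w (h hvw)⟩
  exact (coverNum_le hG).trans
    (Finset.sum_le_sum_of_subset_of_nonneg (verts_mono h) fun v hv _ => hc.1 v hv)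

/-- A two-matching of `H`: a permutation `π` of a vertex set `D` that moves every vertex along an
edge. Giving weight `1 / 2` to each arc `v → π v` turns it into a fractional matching of total
weight `|D| / 2`. -/
def IsTwoMatching (H : SimpleGraph V) (D : Finset V) (π : V → V) : Prop :=
  (∀ v ∈ D, π v ∈ D) ∧ Set.InjOn π D ∧ ∀ v ∈ D, H.Adj v (π v)

theorem IsTwoMatching.mono {G H : SimpleGraph V} (h : G ≤ H) {D : Finset V} {π : V → V}
    (hD : IsTwoMatching G D π) : IsTwoMatching H D π :=
  ⟨hD.1, hD.2.1, fun v hv => h (hD.2.2 v hv)⟩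

theorem IsTwoMatching.subset_verts {H : SimpleGraph V} {D : Finset V} {π : V → V}
    (hD : IsTwoMatching H D π) : D ⊆ verts H :=
  fun v hv => left_mem_verts (hD.2.2 v hv)

theorem IsTwoMatching.surj {H : SimpleGraph V} {D : Finset V} {π : V → V}
    (hD : IsTwoMatching H D π) : ∀ v ∈ D, ∃ u ∈ D, π u = v := by
  intro v hv
  obtain ⟨u, hu, h⟩ := Finset.surj_on_of_inj_on_of_card_le (s := D) (t := D) (fun a _ => π a)
    (fun a ha => hD.1 a ha) (fun a b ha hb h => hD.2.1 ha hb h) le_rfl v hv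
  exact ⟨u, hu, h.symm⟩

theorem IsTwoMatching.sum_comp {H : SimpleGraph V} {D : Finset V} {π : V → V}
    (hD : IsTwoMatching H D π) (c : V → ℝ) : ∑ v ∈ D, c (π v) = ∑ v ∈ D, c v := by
  refine Finset.sum_bij (fun a _ => π a) (fun a ha => hD.1 a ha)
    (fun a ha b hb h => hD.2.1 ha hb h) (fun b hb => ?_) fun _ _ => rfl
  obtain ⟨u, hu, h⟩ := hD.surj b hb
  exact ⟨u, hu, h⟩

theorem IsTwoMatching.card_le_sum {H : SimpleGraph V} {D : Finset V} {π : V → V}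
    (hD : IsTwoMatching H D π) {c : V → ℝ} (hc : IsFracVertexCover H c) :
    (D.card : ℝ) ≤ 2 * ∑ v ∈ verts H, c v := by
  have h1 : (D.card : ℝ) ≤ ∑ v ∈ D, (c v + c (π v)) := by
    rw [Finset.card_eq_sum_ones]; push_cast
    exact Finset.sum_le_sum fun v hv => hc.2 _ _ (hD.2.2 v hv)
  rw [Finset.sum_add_distrib, hD.sum_comp] at h1
  have h2 : ∑ v ∈ D, c v ≤ ∑ v ∈ verts H, c v :=
    Finset.sum_le_sum_of_subset_of_nonneg hD.subset_verts fun v hv _ => hc.1 v hv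
  linarith

theorem IsTwoMatching.card_le {H : SimpleGraph V} {D : Finset V} {π : V → V}
    (hD : IsTwoMatching H D π) : (D.card : ℝ) ≤ 2 * coverNum H := by
  have : (D.card : ℝ) / 2 ≤ coverNum H := le_coverNum fun c hc => by
    linarith [hD.card_le_sum hc]
  linarith

/-- Complementary slackness: a minimum cover vanishes off a maximum two-matching and is tight on
its arcs. -/
theorem IsTwoMatching.slack {H : SimpleGraph V} {D : Finset V} {π : V → V}
    (hD : IsTwoMatching H D π) (hcard : (D.card : ℝ) = 2 * coverNum H) {c : V → ℝ}
    (hc : IsMinFracVertexCover H c) :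
    (∀ v ∈ D, c v + c (π v) = 1) ∧ ∀ v ∈ verts H, v ∉ D → c v = 0 := by
  classical
  have h1 : ∑ v ∈ D, (c v + c (π v) - 1) = 2 * ∑ v ∈ D, c v - D.card := by
    rw [Finset.sum_sub_distrib, Finset.sum_add_distrib, hD.sum_comp]
    simp; ring
  have h2 := Finset.sum_sdiff (f := c) hD.subset_verts
  have h3 := hc.2
  have h4 : ∀ v ∈ D, 0 ≤ c v + c (π v) - 1 := fun v hv => by
    linarith [hc.1.2 _ _ (hD.2.2 v hv)]
  have h5 : ∀ v ∈ verts H \ D, 0 ≤ c v := fun v hv => hc.1.1 v (Finset.mem_sdiff.1 hv).1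
  have h6 := Finset.sum_nonneg h4
  have h7 := Finset.sum_nonneg h5
  have h8 : ∑ v ∈ D, (c v + c (π v) - 1) = 0 := by linarith
  have h9 : ∑ v ∈ verts H \ D, c v = 0 := by linarith
  rw [Finset.sum_eq_zero_iff_of_nonneg h4] at h8
  rw [Finset.sum_eq_zero_iff_of_nonneg h5] at h9
  exact ⟨fun v hv => by linarith [h8 v hv], fun v hv hvD => h9 v (Finset.mem_sdiff.2 ⟨hv, hvD⟩)⟩

/-- The half-integral function with value `1` on `A`, `1 / 2` on `C` and `0` elsewhere. -/
noncomputable def halfFun [DecidableEq V] (A C : Finset V) (v : V) : ℝ :=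
  if v ∈ A then 1 else if v ∈ C then 1 / 2 else 0

/-- The half-integral function of `A`, `C` is a fractional vertex cover of `H`. -/
def IsHalfCover (H : SimpleGraph V) (A C : Finset V) : Prop :=
  A ⊆ verts H ∧ C ⊆ verts H ∧ Disjoint A C ∧
    ∀ u v, H.Adj u v → u ∈ A ∨ v ∈ A ∨ (u ∈ C ∧ v ∈ C)

variable [DecidableEq V]

theorem sum_halfFun {A C S : Finset V} (hA : A ⊆ S) (hC : C ⊆ S)
    (h : Disjoint A C) : ∑ v ∈ S, halfFun A C v = A.card + C.card / 2 := by
  have h0 : ∀ v, halfFun A C v = (if v ∈ A then 1 else 0) + (if v ∈ C then 1 / 2 else 0) := by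
    intro v
    unfold halfFun
    by_cases h1 : v ∈ A
    · simp [h1, Finset.disjoint_left.1 h h1]
    · simp [h1]
  simp only [h0]
  rw [Finset.sum_add_distrib, ← Finset.sum_filter, ← Finset.sum_filter,
    Finset.filter_mem_eq_inter, Finset.filter_mem_eq_inter, Finset.inter_eq_right.2 hA,
    Finset.inter_eq_right.2 hC]
  simp [div_eq_mul_inv]

theorem IsHalfCover.isFracVertexCover {H : SimpleGraph V} {A C : Finset V}
    (h : IsHalfCover H A C) : IsFracVertexCover H (halfFun A C) := by
  have h0 : ∀ v, 0 ≤ halfFun A C v := fun v => by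
    unfold halfFun; split_ifs <;> norm_num
  refine ⟨fun v _ => h0 v, fun v w hvw => ?_⟩
  rcases h.2.2.2 v w hvw with h1 | h1 | ⟨h1, h2⟩
  · have := h0 w
    simp only [halfFun, h1, if_true] at *
    linarith
  · have := h0 v
    simp only [halfFun, h1, if_true] at *
    linarith
  · have e1 := Finset.disjoint_right.1 h.2.2.1 h1
    have e2 := Finset.disjoint_right.1 h.2.2.1 h2
    simp only [halfFun, h1, h2, e1, e2, if_true, if_false]
    norm_num

/-- Hall's theorem for the elements of a finset `S`. -/
theorem hall_on (S : Finset V) (t : V → Finset V)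
    (h : ∀ s ⊆ S, s.card ≤ (s.biUnion t).card) :
    ∃ f : V → V, Set.InjOn f S ∧ ∀ x ∈ S, f x ∈ t x := by
  have h1 := (Finset.all_card_le_biUnion_card_iff_exists_injective
    (fun x : S => t x)).1 (fun s => by
      have h2 := h (s.map (Function.Embedding.subtype _)) (fun x hx => by
        obtain ⟨y, _, rfl⟩ := Finset.mem_map.1 hx
        exact y.2)
      rw [Finset.card_map] at h2
      convert h2 using 2
      ext x
      simp)
  obtain ⟨f, hf, hft⟩ := h1
  refine ⟨fun x => if hx : x ∈ S then f ⟨x, hx⟩ else x, ?_, ?_⟩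
  · intro x hx y hy hxy
    have hx' : x ∈ S := hx
    have hy' : y ∈ S := hy
    simp only [hx', hy', dif_pos] at hxy
    simpa using hf hxy
  · intro x hx
    simp only [hx, dif_pos]
    exact hft _

/-- A half-integral cover `(A, C)` whose two Hall conditions hold along the relation `R` yields a
two-matching of the same weight: `A` is matched into the zero set of the cover, and `C` is
permuted. -/
theorem exists_twoMatching_of_hall {H : SimpleGraph V} {A C : Finset V}
    (hAC : Disjoint A C) (R : V → V → Prop) [DecidableRel R] (hR : ∀ u v, R u v → H.Adj u v)
    (hallA : ∀ s ⊆ A, s.card ≤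
      (s.biUnion fun a => Finset.univ.filter fun z => R a z ∧ z ∉ A ∧ z ∉ C).card)
    (hallC : ∀ s ⊆ C, s.card ≤ (s.biUnion fun a => Finset.univ.filter fun z => R a z ∧ z ∈ C).card) :
    ∃ D π, IsTwoMatching H D π ∧ D.card = 2 * A.card + C.card ∧
      ∀ v ∈ D, (v ∈ A ∧ R v (π v) ∧ π v ∉ A) ∨ (π v ∈ A ∧ R (π v) v ∧ v ∉ A) ∨
        (v ∈ C ∧ π v ∈ C ∧ R v (π v)) := by
  obtain ⟨m, hm, hmt⟩ := hall_on A _ hallA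
  obtain ⟨f, hf, hft⟩ := hall_on C _ hallC
  simp only [Finset.mem_filter, Finset.mem_univ, true_and] at hmt hft
  have hinv : ∀ z ∈ A.image m, ∃ a ∈ A, m a = z := fun z hz => by simpa using hz
  choose! k hkA hkm using hinv
  have hCA : ∀ v ∈ C, v ∉ A := fun v hv => Finset.disjoint_right.1 hAC hv
  have him : ∀ v ∈ A.image m, v ∉ A ∧ v ∉ C := by
    intro v hv
    obtain ⟨a, ha, rfl⟩ := Finset.mem_image.1 hv
    exact (hmt a ha).2
  have hkm' : ∀ a ∈ A, k (m a) = a := fun a ha =>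
    hm (hkA _ (Finset.mem_image_of_mem m ha)) ha (hkm _ (Finset.mem_image_of_mem m ha))
  -- A vertex of `A` and its partner are swapped; this is a cycle of length `2` of the permutation.
  set π : V → V := fun v => if v ∈ A then m v else if v ∈ C then f v else k v with hπ
  have πA : ∀ v ∈ A, π v = m v := fun v hv => by simp [hπ, hv]
  have πC : ∀ v ∈ C, π v = f v := fun v hv => by simp [hπ, hv, hCA v hv]
  have πk : ∀ v ∈ A.image m, π v = k v := fun v hv => by
    simp only [hπ, (him v hv).1, (him v hv).2, if_false]
  have hmem : ∀ v, v ∈ A ∪ A.image m ∪ C ↔ v ∈ A ∨ v ∈ A.image m ∨ v ∈ C := by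
    intro v; simp only [Finset.mem_union]; tauto
  refine ⟨A ∪ A.image m ∪ C, π, ⟨?_, ?_, ?_⟩, ?_, ?_⟩
  · intro v hv
    rw [hmem] at hv ⊢
    rcases hv with h | h | h
    · rw [πA v h]; exact Or.inr (Or.inl (Finset.mem_image_of_mem m h))
    · rw [πk v h]; exact Or.inl (hkA v h)
    · rw [πC v h]; exact Or.inr (Or.inr (hft v h).2)
  · intro v hv w hw hvw
    rw [Finset.mem_coe, hmem] at hv hw
    rcases hv with h | h | h <;> rcases hw with h' | h' | h'
    · rw [πA v h, πA w h'] at hvw; exact hm h h' hvw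
    · rw [πA v h, πk w h'] at hvw
      exact absurd (hvw ▸ hkA w h') (hmt v h).2.1
    · rw [πA v h, πC w h'] at hvw
      exact absurd (hvw ▸ (hft w h').2) (hmt v h).2.2
    · rw [πk v h, πA w h'] at hvw
      exact absurd (hvw ▸ hkA v h) (hmt w h').2.1
    · rw [πk v h, πk w h'] at hvw
      rw [← hkm v h, ← hkm w h', hvw]
    · rw [πk v h, πC w h'] at hvw
      exact absurd (hvw ▸ hkA v h) (hCA _ (hft w h').2)
    · rw [πC v h, πA w h'] at hvw
      exact absurd (hvw ▸ (hft v h).2) (hmt w h').2.2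
    · rw [πC v h, πk w h'] at hvw
      exact absurd (hvw ▸ hkA w h') (hCA _ (hft v h).2)
    · rw [πC v h, πC w h'] at hvw; exact hf h h' hvw
  · intro v hv
    rw [hmem] at hv
    rcases hv with h | h | h
    · rw [πA v h]; exact hR _ _ (hmt v h).1
    · rw [πk v h]
      have := (hmt _ (hkA v h)).1
      rw [hkm v h] at this
      exact (hR _ _ this).symm
    · rw [πC v h]; exact hR _ _ (hft v h).1
  · rw [Finset.card_union_of_disjoint, Finset.card_union_of_disjoint, Finset.card_image_of_injOn hm]
    · ring
    · exact Finset.disjoint_left.2 fun v hv hv' => (him v hv').1 hv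
    · refine Finset.disjoint_left.2 fun v hv hv' => ?_
      rcases Finset.mem_union.1 hv with h | h
      · exact hCA v hv' h
      · exact (him v h).2 hv'
  · intro v hv
    rw [hmem] at hv
    rcases hv with h | h | h
    · rw [πA v h]; exact Or.inl ⟨h, (hmt v h).1, (hmt v h).2.1⟩
    · rw [πk v h]
      have := (hmt _ (hkA v h)).1
      rw [hkm v h] at this
      exact Or.inr (Or.inl ⟨hkA v h, this, (him v h).1⟩)
    · rw [πC v h]; exact Or.inr (Or.inr ⟨h, (hft v h).2, (hft v h).1⟩)

/-- A half-integral cover of least weight among the half-integral ones is dual to a two-matching,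
and therefore it is a minimum fractional vertex cover. -/
theorem exists_halfCover_twoMatching (H : SimpleGraph V) :
    ∃ A C D π, IsHalfCover H A C ∧ IsTwoMatching H D π ∧ (D.card : ℝ) = 2 * coverNum H ∧
      IsMinFracVertexCover H (halfFun A C) ∧ (A.card : ℝ) + C.card / 2 = coverNum H := by
  classical
  have hne : ((Finset.univ : Finset (Finset V × Finset V)).filter
      fun q => IsHalfCover H q.1 q.2).Nonempty :=
    ⟨(verts H, ∅), by
      simp only [Finset.mem_filter, Finset.mem_univ, true_and]
      exact ⟨subset_rfl, Finset.empty_subset _, Finset.disjoint_empty_right _,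
        fun u v h => Or.inl (left_mem_verts h)⟩⟩
  obtain ⟨⟨A, C⟩, hq, hmin⟩ := Finset.exists_min_image _
    (fun q : Finset V × Finset V => 2 * q.1.card + q.2.card) hne
  simp only [Finset.mem_filter, Finset.mem_univ, true_and, Prod.forall] at hq hmin
  obtain ⟨hA, hC, hAC, hcov⟩ := hq
  -- If `s` violates the condition, lowering `s` from `1` to `1 / 2` and raising its neighbors `N` with
  -- value `0` to `1 / 2` yields a lighter half-integral cover.
  have hallA : ∀ s ⊆ A, s.card ≤
      (s.biUnion fun a => Finset.univ.filter fun z => H.Adj a z ∧ z ∉ A ∧ z ∉ C).card := by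
    intro s hs
    set N := s.biUnion fun a => Finset.univ.filter fun z => H.Adj a z ∧ z ∉ A ∧ z ∉ C with hN
    have hNm : ∀ z, z ∈ N ↔ (∃ a ∈ s, H.Adj a z) ∧ z ∉ A ∧ z ∉ C := by
      intro z; simp only [hN, Finset.mem_biUnion, Finset.mem_filter, Finset.mem_univ, true_and]
      constructor
      · rintro ⟨a, h1, h2, h3⟩; exact ⟨⟨a, h1, h2⟩, h3⟩
      · rintro ⟨⟨a, h1, h2⟩, h3⟩; exact ⟨a, h1, h2, h3⟩
    have := hmin (A \ s) (C ∪ s ∪ N) ⟨Finset.sdiff_subset.trans hA, ?_, ?_, ?_⟩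
    · have e1 := Finset.card_sdiff_add_card_eq_card hs
      have e2 := Finset.card_union_le (C ∪ s) N
      have e3 := Finset.card_union_le C s
      omega
    · refine Finset.union_subset (Finset.union_subset hC (hs.trans hA)) fun z hz => ?_
      obtain ⟨⟨a, _, h⟩, _⟩ := (hNm z).1 hz
      exact right_mem_verts h
    · refine Finset.disjoint_left.2 fun v hv hv' => ?_
      rw [Finset.mem_sdiff] at hv
      simp only [Finset.mem_union] at hv'
      rcases hv' with (h | h) | h
      · exact Finset.disjoint_left.1 hAC hv.1 h
      · exact hv.2 h
      · exact ((hNm v).1 h).2.1 hv.1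
    · have key : ∀ u v, H.Adj u v → u ∈ A → u ∈ A \ s ∨ v ∈ A \ s ∨
          (u ∈ C ∪ s ∪ N ∧ v ∈ C ∪ s ∪ N) := by
        intro u v h hu
        by_cases hus : u ∈ s
        · simp only [Finset.mem_sdiff, Finset.mem_union, hNm]
          by_cases hv : v ∈ A
          · tauto
          · by_cases hv' : v ∈ C
            · tauto
            · exact Or.inr (Or.inr ⟨Or.inl (Or.inr hus), Or.inr ⟨⟨u, hus, h⟩, hv, hv'⟩⟩)
        · exact Or.inl (Finset.mem_sdiff.2 ⟨hu, hus⟩)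
      intro u v h
      rcases hcov u v h with h1 | h1 | ⟨h1, h2⟩
      · exact key u v h h1
      · have := key v u h.symm h1; tauto
      · simp only [Finset.mem_union]; tauto
  -- If `s` violates the condition, lowering `s \ N` from `1 / 2` to `0` and raising `N \ s` to `1`
  -- yields a lighter half-integral cover.
  have hallC : ∀ s ⊆ C, s.card ≤
      (s.biUnion fun a => Finset.univ.filter fun z => H.Adj a z ∧ z ∈ C).card := by
    intro s hs
    set N := s.biUnion fun a => Finset.univ.filter fun z => H.Adj a z ∧ z ∈ C with hN
    have hNm : ∀ z, z ∈ N ↔ (∃ a ∈ s, H.Adj a z) ∧ z ∈ C := by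
      intro z; simp only [hN, Finset.mem_biUnion, Finset.mem_filter, Finset.mem_univ, true_and]
      constructor
      · rintro ⟨a, h1, h2, h3⟩; exact ⟨⟨a, h1, h2⟩, h3⟩
      · rintro ⟨⟨a, h1, h2⟩, h3⟩; exact ⟨a, h1, h2, h3⟩
    have hNC : N ⊆ C := fun z hz => ((hNm z).1 hz).2
    have := hmin (A ∪ (N \ s)) (C \ ((s \ N) ∪ (N \ s))) ⟨?_, Finset.sdiff_subset.trans hC, ?_, ?_⟩
    · have e1 : (s \ N).card + (s ∩ N).card = s.card := Finset.card_sdiff_add_card_inter s N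
      have e2 : (N \ s).card + (N ∩ s).card = N.card := Finset.card_sdiff_add_card_inter N s
      rw [Finset.inter_comm] at e2
      have hsub : (s \ N) ∪ (N \ s) ⊆ C :=
        Finset.union_subset (Finset.sdiff_subset.trans hs) (Finset.sdiff_subset.trans hNC)
      have e3 := Finset.card_sdiff_add_card_eq_card hsub
      have e4 : ((s \ N) ∪ (N \ s)).card = (s \ N).card + (N \ s).card :=
        Finset.card_union_of_disjoint (Finset.disjoint_left.2 fun v hv hv' =>
          (Finset.mem_sdiff.1 hv).2 (Finset.mem_sdiff.1 hv').1)
      have e5 := Finset.card_union_le A (N \ s)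
      omega
    · exact Finset.union_subset hA (Finset.sdiff_subset.trans (hNC.trans hC))
    · refine Finset.disjoint_left.2 fun v hv hv' => ?_
      simp only [Finset.mem_union, Finset.mem_sdiff] at hv hv'
      rcases hv with h | h
      · exact Finset.disjoint_left.1 hAC h hv'.1
      · tauto
    · intro u v h
      have hu := hNm u
      have hv := hNm v
      have huv : u ∈ s → v ∈ C → v ∈ N := fun h1 h2 => hv.2 ⟨⟨u, h1, h⟩, h2⟩
      have hvu : v ∈ s → u ∈ C → u ∈ N := fun h1 h2 => hu.2 ⟨⟨v, h1, h.symm⟩, h2⟩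
      simp only [Finset.mem_union, Finset.mem_sdiff]
      rcases hcov u v h with h1 | h1 | ⟨h1, h2⟩
      · exact Or.inl (Or.inl h1)
      · exact Or.inr (Or.inl (Or.inl h1))
      · have h3 := fun h0 => huv h0 h2
        have h4 := fun h0 => hvu h0 h1
        clear hu hv huv hvu hNm
        by_cases a1 : u ∈ s <;> by_cases a2 : v ∈ s <;> by_cases a3 : u ∈ N <;>
          by_cases a4 : v ∈ N <;> simp_all
  -- By weak duality, the two-matching certifies that the cover is a minimum one among all.
  obtain ⟨D, π, hD, hcard, -⟩ := exists_twoMatching_of_hall hAC H.Adj (fun _ _ h => h) hallA hallC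
  have hhc : IsHalfCover H A C := ⟨hA, hC, hAC, hcov⟩
  have hs := sum_halfFun hA hC hAC
  have h1 := coverNum_le hhc.isFracVertexCover
  have h2 := hD.card_le
  have h3 : (D.card : ℝ) = 2 * A.card + C.card := by exact_mod_cast hcard
  have h4 : (A.card : ℝ) + C.card / 2 = coverNum H := by linarith
  exact ⟨A, C, D, π, hhc, hD, by linarith, ⟨hhc.isFracVertexCover, by linarith⟩, h4⟩

theorem exists_twoMatching (H : SimpleGraph V) :
    ∃ D π, IsTwoMatching H D π ∧ (D.card : ℝ) = 2 * coverNum H := by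
  obtain ⟨A, C, D, π, -, hD, hc, -⟩ := exists_halfCover_twoMatching H
  exact ⟨D, π, hD, hc⟩

/-- The vertices missed by a maximum two-matching are independent. -/
theorem IsTwoMatching.mem_of_adj {H : SimpleGraph V} {D : Finset V} {π : V → V}
    (hD : IsTwoMatching H D π) (hcard : (D.card : ℝ) = 2 * coverNum H) {z u : V}
    (h : H.Adj z u) (hz : z ∉ D) : u ∈ D := by
  obtain ⟨A, C, -, -, -, -, -, hmin, -⟩ := exists_halfCover_twoMatching H
  by_contra hu
  have h1 := (hD.slack hcard hmin).2 z (left_mem_verts h) hz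
  have h2 := (hD.slack hcard hmin).2 u (right_mem_verts h) hu
  have := hmin.1.2 z u h
  linarith

end Combinatorics

/-! ### The exponent `γ(K)` and contributing subgraphs -/

section Contributing

variable {V : Type*} [Fintype V] [DecidableEq V]

theorem verts_bot : verts (⊥ : SimpleGraph V) = ∅ := by
  ext v; simp [mem_verts]

theorem edges_bot : edges (⊥ : SimpleGraph V) = ∅ := by
  ext v; simp [mem_edges]

theorem coverNum_bot : coverNum (⊥ : SimpleGraph V) = 0 := by
  refine le_antisymm ?_ (coverNum_nonneg _)
  have := coverNum_le (H := (⊥ : SimpleGraph V)) (c := fun _ => 1)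
    ⟨fun _ _ => zero_le_one, fun _ _ _ => by norm_num⟩
  simpa [verts_bot] using this

theorem one_le_coverNum {H : SimpleGraph V} (h : H ≠ ⊥) : 1 ≤ coverNum H := by
  obtain ⟨u, v, huv⟩ := SimpleGraph.ne_bot_iff_exists_adj.1 h
  refine le_coverNum fun c hc => (hc.2 u v huv).trans ?_
  rw [← Finset.sum_pair huv.ne]
  refine Finset.sum_le_sum_of_subset_of_nonneg ?_ fun v hv _ => hc.1 v hv
  intro x hx
  simp only [Finset.mem_insert, Finset.mem_singleton] at hx
  rcases hx with rfl | rfl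
  · exact left_mem_verts huv
  · exact right_mem_verts huv

theorem sub_le_gam_mul {K H : SimpleGraph V} (h : H ≤ K) :
    ((edges H).card : ℝ) - (verts H).card ≤ gam K * coverNum H := by
  by_cases hb : H = ⊥
  · subst hb; simp [verts_bot, edges_bot, coverNum_bot]
  · have h1 := one_le_coverNum hb
    rw [← div_le_iff₀ (by linarith)]
    refine le_csSup ?_ ⟨H, h, hb, rfl⟩
    refine (Set.Finite.subset (Set.finite_range fun H : SimpleGraph V =>
      (((edges H).card : ℝ) - ((verts H).card : ℝ)) / coverNum H) ?_).bddAbove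
    rintro s ⟨H, -, -, rfl⟩
    exact ⟨H, rfl⟩

theorem two_mul_card_edges (H : SimpleGraph V) :
    2 * (edges H).card = ∑ v ∈ verts H, (H.neighborSet v).ncard := by
  classical
  have h1 := H.sum_degrees_eq_twice_card_edges
  have h2 : H.edgeFinset = edges H := by ext e; simp [mem_edges]
  rw [← h2, ← h1]
  symm
  rw [Finset.sum_subset (Finset.subset_univ (verts H))]
  · refine Finset.sum_congr rfl fun v _ => ?_
    rw [← SimpleGraph.card_neighborFinset_eq_degree, ← Set.ncard_coe_finset]
    simp
  · intro v _ hv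
    rw [mem_verts] at hv
    push Not at hv
    rw [Set.ncard_eq_zero]
    ext w; simp [hv w]

/-- If the `2`-core of `K` is not a union of cycles, then it has more edges than vertices. -/
theorem gam_pos {K : SimpleGraph V} (hcore : ¬ (twoCore K).IsCycles) : 0 < gam K := by
  have hle : twoCore K ≤ K := sSup_le fun H hH => hH.1
  have hmin : MinDegTwo (twoCore K) := by
    intro v hv
    obtain ⟨w, hw⟩ := mem_verts.1 hv
    simp only [twoCore, SimpleGraph.sSup_adj] at hw
    obtain ⟨H, hH, hw⟩ := hw
    refine (hH.2 v (left_mem_verts hw)).trans (Set.ncard_le_ncard ?_ (Set.toFinite _))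
    intro x hx
    exact (le_sSup hH : H ≤ twoCore K) hx
  simp only [SimpleGraph.IsCycles, not_forall] at hcore
  obtain ⟨v, hv, hne⟩ := hcore
  have hvm : v ∈ verts (twoCore K) := by
    obtain ⟨w, hw⟩ := hv; exact mem_verts.2 ⟨w, hw⟩
  have h3 : 2 < ((twoCore K).neighborSet v).ncard := lt_of_le_of_ne (hmin v hvm) (Ne.symm hne)
  have h4 := two_mul_card_edges (twoCore K)
  have h5 : ∑ v ∈ verts (twoCore K), 2 < ∑ v ∈ verts (twoCore K),
      ((twoCore K).neighborSet v).ncard :=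
    Finset.sum_lt_sum hmin ⟨v, hvm, h3⟩
  rw [← h4, Finset.sum_const, smul_eq_mul] at h5
  have h6 : ((verts (twoCore K)).card : ℝ) < (edges (twoCore K)).card := by
    exact_mod_cast (by omega : (verts (twoCore K)).card < (edges (twoCore K)).card)
  have h7 := sub_le_gam_mul hle
  by_contra hg
  nlinarith [coverNum_nonneg (twoCore K)]

/-- A subgraph attaining the maximum in the definition of `γ(K)` contains a contributing subgraph
with the same cover number: prune vertices of degree `1`. -/
theorem exists_contributing_le {K H₀ : SimpleGraph V} (hγ : 0 < gam K) (hle : H₀ ≤ K)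
    (hext : gam K * coverNum H₀ ≤ ((edges H₀).card : ℝ) - (verts H₀).card) :
    ∃ H ≤ H₀, IsContributing K H ∧ coverNum H = coverNum H₀ := by
  classical
  have hne : ((Finset.univ : Finset (SimpleGraph V)).filter fun H => H ≤ H₀ ∧
      gam K * coverNum H₀ ≤ ((edges H).card : ℝ) - (verts H).card).Nonempty :=
    ⟨H₀, by simpa using hext⟩
  -- In a subgraph with the fewest edges there is no vertex of degree `1`, since deleting its edge
  -- would lower `e` by one and `v` by at least one.
  obtain ⟨H, hH, hmin⟩ := Finset.exists_min_image _ (fun H => (edges H).card) hne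
  simp only [Finset.mem_filter, Finset.mem_univ, true_and] at hH hmin
  have h1 := sub_le_gam_mul (hH.1.trans hle)
  have h2 := coverNum_mono hH.1
  have h3 : coverNum H = coverNum H₀ := le_antisymm h2 (by
    have : gam K * coverNum H₀ ≤ gam K * coverNum H := hH.2.trans h1
    exact le_of_mul_le_mul_left this hγ)
  refine ⟨H, hH.1, ⟨hH.1.trans hle, ?_, ?_⟩, h3⟩
  · intro v hv
    by_contra hdeg
    obtain ⟨u, hu⟩ := mem_verts.1 hv
    have hcard : (H.neighborSet v).ncard = 1 := by
      have : 0 < (H.neighborSet v).ncard := (Set.ncard_pos (Set.toFinite _)).2 ⟨u, hu⟩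
      omega
    obtain ⟨u', hu'⟩ := Set.ncard_eq_one.1 hcard
    have huu : ∀ x, H.Adj v x → x = u := by
      intro x hx
      have e1 : x ∈ H.neighborSet v := hx
      have e2 : u ∈ H.neighborSet v := hu
      rw [hu'] at e1 e2
      exact e1.trans e2.symm
    set G := H.deleteEdges {s(v, u)} with hG
    have hGH : G ≤ H := SimpleGraph.deleteEdges_le _
    have e1 : edges G = (edges H).erase s(v, u) := by
      ext e; simp [mem_edges, hG, SimpleGraph.edgeSet_deleteEdges, and_comm]
    have e2 : (edges G).card = (edges H).card - 1 := by
      rw [e1, Finset.card_erase_of_mem (mk_mem_edges.2 hu)]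
    have e3 : 0 < (edges H).card := Finset.card_pos.2 ⟨_, mk_mem_edges.2 hu⟩
    have e4 : verts G ⊆ (verts H).erase v := by
      intro x hx
      refine Finset.mem_erase.2 ⟨?_, verts_mono hGH hx⟩
      rintro rfl
      obtain ⟨y, hy⟩ := mem_verts.1 hx
      have := huu y (hGH hy)
      subst this
      simp [hG, SimpleGraph.deleteEdges_adj] at hy
    have e5 : (verts G).card ≤ (verts H).card - 1 := by
      rw [← Finset.card_erase_of_mem hv]; exact Finset.card_le_card e4
    have e6 : 0 < (verts H).card := Finset.card_pos.2 ⟨v, hv⟩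
    have e7 : ((edges G).card : ℝ) = (edges H).card - 1 := by
      rw [e2, Nat.cast_sub e3]; simp
    have e8 : ((verts G).card : ℝ) ≤ (verts H).card - 1 := by
      have : (verts G).card + 1 ≤ (verts H).card := by omega
      have : ((verts G).card : ℝ) + 1 ≤ (verts H).card := by exact_mod_cast this
      linarith
    have := hmin G ⟨hGH.trans hH.1, by linarith [hH.2]⟩
    omega
  · rw [h3] at h1 ⊢
    linarith [hH.2, mul_comm (gam K) (coverNum H₀)]

theorem exists_contributing {K : SimpleGraph V} (hγ : 0 < gam K) :
    ∃ H, H ≠ ⊥ ∧ IsContributing K H := by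
  have hfin : {s : ℝ | ∃ H : SimpleGraph V, H ≤ K ∧ H ≠ ⊥ ∧
      s = (((edges H).card : ℝ) - ((verts H).card : ℝ)) / coverNum H}.Finite := by
    refine Set.Finite.subset (Set.finite_range fun H : SimpleGraph V =>
      (((edges H).card : ℝ) - ((verts H).card : ℝ)) / coverNum H) ?_
    rintro s ⟨H, -, -, rfl⟩
    exact ⟨H, rfl⟩
  have hne : {s : ℝ | ∃ H : SimpleGraph V, H ≤ K ∧ H ≠ ⊥ ∧
      s = (((edges H).card : ℝ) - ((verts H).card : ℝ)) / coverNum H}.Nonempty := by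
    by_contra h
    rw [Set.not_nonempty_iff_eq_empty] at h
    rw [gam, h, Real.sSup_empty] at hγ
    exact lt_irrefl _ hγ
  obtain ⟨H, hH, hb, hs⟩ := hne.csSup_mem hfin
  have h1 := one_le_coverNum hb
  have h2 : gam K * coverNum H = ((edges H).card : ℝ) - (verts H).card := by
    rw [gam, hs]; field_simp
  obtain ⟨G, -, hG, hc⟩ := exists_contributing_le hγ hH h2.le
  refine ⟨G, ?_, hG⟩
  rintro rfl
  rw [coverNum_bot] at hc
  linarith

theorem isContributing_bot (K : SimpleGraph V) : IsContributing K ⊥ := by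
  refine ⟨bot_le, ?_, ?_⟩
  · intro v hv; simp [verts_bot] at hv
  · simp [verts_bot, edges_bot, coverNum_bot]

theorem MinDegTwo.exists_ne {H : SimpleGraph V} (h : MinDegTwo H) {v : V} (hv : v ∈ verts H)
    (u : V) : ∃ w, H.Adj v w ∧ w ≠ u := by
  obtain ⟨w, hw, hne⟩ := Set.exists_ne_of_one_lt_ncard (lt_of_lt_of_le one_lt_two (h v hv)) u
  exact ⟨w, hw, hne⟩

/-- A nonempty contributing subgraph has cover number at least `1` and at least three vertices, hence
at least `γ(K) + 3` edges. -/
theorem gam_add_three_le {K : SimpleGraph V} (hγ : 0 < gam K) :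
    gam K + 3 ≤ (edges K).card := by
  obtain ⟨H, hb, hle, hmin, heq⟩ := exists_contributing hγ
  obtain ⟨u, v, huv⟩ := SimpleGraph.ne_bot_iff_exists_adj.1 hb
  obtain ⟨w, hw, hne⟩ := hmin.exists_ne (left_mem_verts huv) v
  have h3 : 3 ≤ (verts H).card := by
    have : ({u, v, w} : Finset V) ⊆ verts H := by
      intro x hx
      simp only [Finset.mem_insert, Finset.mem_singleton] at hx
      rcases hx with rfl | rfl | rfl
      · exact left_mem_verts huv
      · exact right_mem_verts huv
      · exact right_mem_verts hw
    refine le_trans (le_of_eq ?_) (Finset.card_le_card this)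
    rw [Finset.card_eq_three.2 ⟨u, v, w, huv.ne, hw.ne, hne.symm, rfl⟩]
  have h4 : (3 : ℝ) ≤ (verts H).card := by exact_mod_cast h3
  have h5 := one_le_coverNum hb
  have h6 : ((edges H).card : ℝ) ≤ (edges K).card := by
    exact_mod_cast Finset.card_le_card (edges_mono hle)
  nlinarith

/-! ### Edges that are not bad -/

theorem sum_incident {H : SimpleGraph V} (w : Sym2 V → ℝ) (v : V) [DecidableRel H.Adj] :
    ∑ e ∈ (edges H).filter (fun e => v ∈ e), w e = ∑ y, if H.Adj v y then w s(v, y) else 0 := by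
  rw [← Finset.sum_filter]
  symm
  refine Finset.sum_bij (fun y _ => s(v, y)) ?_ ?_ ?_ fun _ _ => rfl
  · intro y hy
    simp only [Finset.mem_filter, Finset.mem_univ, true_and] at hy
    simp [mk_mem_edges, hy]
  · intro y _ z _ h
    exact Sym2.congr_right.1 h
  · intro e he
    rw [Finset.mem_filter] at he
    obtain ⟨y, rfl⟩ := he.2
    exact ⟨y, by simpa using mk_mem_edges.1 he.1, rfl⟩

/-- Complementary slackness between a maximum fractional matching and a minimum fractional
cover. -/
theorem IsMaxFracMatching.slack {H : SimpleGraph V} {w : Sym2 V → ℝ} (hw : IsMaxFracMatching H w)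
    {c : V → ℝ} (hc : IsMinFracVertexCover H c) [DecidableRel H.Adj] :
    (∀ v ∈ verts H, c v ≠ 0 → ∑ y, (if H.Adj v y then w s(v, y) else 0) = 1) ∧
      ∀ x y, H.Adj x y → w s(x, y) ≠ 0 → c x + c y = 1 := by
  classical
  have hinc : ∀ v ∈ verts H, ∑ y, (if H.Adj v y then w s(v, y) else 0) ≤ 1 := by
    intro v hv
    rw [← sum_incident]
    convert hw.1.2 v hv
  have hpair : ∀ x y, H.Adj x y → ∑ v ∈ (verts H).filter (fun v => v ∈ s(x, y)), c v = c x + c y := by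
    intro x y h
    rw [← Finset.sum_pair h.ne]
    refine Finset.sum_congr ?_ fun _ _ => rfl
    ext v
    simp only [Finset.mem_filter, Sym2.mem_iff, Finset.mem_insert, Finset.mem_singleton]
    constructor
    · exact fun h => h.2
    · rintro (rfl | rfl)
      · exact ⟨left_mem_verts h, Or.inl rfl⟩
      · exact ⟨right_mem_verts h, Or.inr rfl⟩
  have hge : ∀ e ∈ edges H, 0 ≤ ∑ v ∈ (verts H).filter (fun v => v ∈ e), c v - 1 := by
    intro e
    induction e using Sym2.ind with
    | _ x y =>
      intro h
      rw [mk_mem_edges] at h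
      rw [hpair x y h]
      linarith [hc.1.2 x y h]
  have hsw : ∑ v ∈ verts H, c v * ∑ e ∈ (edges H).filter (fun e => v ∈ e), w e =
      ∑ e ∈ edges H, w e * ∑ v ∈ (verts H).filter (fun v => v ∈ e), c v := by
    simp only [Finset.mul_sum]
    rw [Finset.sum_comm' (t' := edges H) (s' := fun e => (verts H).filter (fun v => v ∈ e))]
    · exact Finset.sum_congr rfl fun _ _ => Finset.sum_congr rfl fun _ _ => mul_comm _ _
    · intro v e; simp only [Finset.mem_filter]; tauto
  have h1 : ∑ v ∈ verts H, c v * (1 - ∑ e ∈ (edges H).filter (fun e => v ∈ e), w e) +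
      ∑ e ∈ edges H, w e * (∑ v ∈ (verts H).filter (fun v => v ∈ e), c v - 1) = 0 := by
    simp only [mul_sub, mul_one, Finset.sum_sub_distrib]
    rw [hsw, hc.2, hw.2]; ring
  have h2 : ∀ v ∈ verts H, 0 ≤ c v * (1 - ∑ e ∈ (edges H).filter (fun e => v ∈ e), w e) := by
    intro v hv
    refine mul_nonneg (hc.1.1 v hv) ?_
    rw [sum_incident]; linarith [hinc v hv]
  have h3 : ∀ e ∈ edges H, 0 ≤ w e * (∑ v ∈ (verts H).filter (fun v => v ∈ e), c v - 1) :=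
    fun e he => mul_nonneg (hw.1.1 e he) (hge e he)
  have h4 := Finset.sum_nonneg h2
  have h5 := Finset.sum_nonneg h3
  have h6 := (Finset.sum_eq_zero_iff_of_nonneg h2).1 (by linarith)
  have h7 := (Finset.sum_eq_zero_iff_of_nonneg h3).1 (by linarith)
  constructor
  · intro v hv hne
    have := (mul_eq_zero.1 (h6 v hv)).resolve_left hne
    rw [sum_incident] at this; linarith
  · intro x y h hne
    have := (mul_eq_zero.1 (h7 _ (mk_mem_edges.2 h))).resolve_left hne
    rw [hpair x y h] at this; linarith

/-- A double-counting form of Hall's condition: a fractional matching `W` saturating `s`, supported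
on arcs into `N` apart from one arc of weight less than `1`. -/
theorem card_le_card_of_weights (W : V → V → ℝ) (hW : ∀ x y, 0 ≤ W x y) (hsymm : ∀ x y, W x y = W y x)
    (s N : Finset V) (u v : V) (hN : ∀ a ∈ s, ∀ y, W a y ≠ 0 → y ∈ N ∨ (a = u ∧ y = v))
    (hs : ∀ a ∈ s, ∑ y, W a y = 1) (hle : ∀ y ∈ N, ∑ a, W y a ≤ 1) (huv : W u v < 1) :
    s.card ≤ N.card := by
  have h1 : (s.card : ℝ) = ∑ a ∈ s, ∑ y, W a y := by
    rw [Finset.sum_congr rfl hs]; simp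
  have h2 : ∑ a ∈ s, ∑ y, W a y ≤ ∑ a ∈ s, ∑ y ∈ N, W a y + W u v := by
    have h3 : ∀ a ∈ s, ∑ y, W a y ≤ ∑ y ∈ N, W a y + if a = u then W u v else 0 := by
      intro a ha
      rw [← Finset.sum_add_sum_compl N]
      gcongr
      have : ∀ y ∈ Nᶜ, W a y ≤ if y = v then (if a = u then W u v else 0) else 0 := by
        intro y hy
        rw [Finset.mem_compl] at hy
        by_cases h0 : W a y = 0
        · rw [h0]; split_ifs
          · exact hW _ _
          · exact le_rfl
          · exact le_rfl
        · obtain ⟨rfl, rfl⟩ := (hN a ha y h0).resolve_left hy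
          simp
      refine (Finset.sum_le_sum this).trans ?_
      rw [Finset.sum_ite_eq']
      split_ifs <;> first | exact le_rfl | exact hW _ _
    refine (Finset.sum_le_sum h3).trans ?_
    rw [Finset.sum_add_distrib, Finset.sum_ite_eq']
    gcongr
    split_ifs <;> first | exact le_rfl | exact hW _ _
  have h4 : ∑ a ∈ s, ∑ y ∈ N, W a y ≤ N.card := by
    rw [Finset.sum_comm]
    have : ∀ y ∈ N, ∑ a ∈ s, W a y ≤ 1 := fun y hy => by
      refine le_trans ?_ (hle y hy)
      simp only [hsymm _ y]
      exact Finset.sum_le_sum_of_subset_of_nonneg (Finset.subset_univ _) fun _ _ _ => hW _ _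
    simpa using Finset.sum_le_sum this
  have h5 : (s.card : ℝ) < N.card + 1 := by linarith
  exact Nat.lt_succ_iff.1 (by exact_mod_cast h5)

/-- If `uv` is not a bad edge, some maximum two-matching does not swap `u` and `v`, that is, it
gives the edge `uv` weight at most `1 / 2`. -/
theorem exists_twoMatching_not_swap {H : SimpleGraph V} {u v : V} (huv : H.Adj u v)
    (hbad : ¬ IsBadEdge H s(u, v)) :
    ∃ D π, IsTwoMatching H D π ∧ (D.card : ℝ) = 2 * coverNum H ∧ ¬ (u ∈ D ∧ π u = v ∧ π v = u) := by
  classical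
  simp only [IsBadEdge, not_and, not_forall] at hbad
  obtain ⟨w, hw, hne⟩ := hbad (mk_mem_edges.2 huv)
  obtain ⟨A, C, -, -, hhc, -, -, hmin, hcard⟩ := exists_halfCover_twoMatching H
  obtain ⟨hs1, hs2⟩ := hw.slack hmin
  -- By complementary slackness, the weights `w` of the maximum matching run between `A` and the
  -- zero set of the cover, or within `C`. They serve as a fractional solution of Hall's conditions.
  set W : V → V → ℝ := fun x y => if H.Adj x y then w s(x, y) else 0 with hW
  have hW0 : ∀ x y, 0 ≤ W x y := by
    intro x y; simp only [hW]; split_ifs with h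
    · exact hw.1.1 _ (mk_mem_edges.2 h)
    · exact le_rfl
  have hWs : ∀ x y, W x y = W y x := by
    intro x y; simp only [hW, SimpleGraph.adj_comm H x y, Sym2.eq_swap (a := x)]
  have hWsum : ∀ y ∈ verts H, ∑ a, W y a ≤ 1 := by
    intro y hy
    have := hw.1.2 y hy
    simp only [hW, ← sum_incident]
    convert this
  have hWadj : ∀ x y, W x y ≠ 0 → H.Adj x y ∧ w s(x, y) ≠ 0 := by
    intro x y h; simp only [hW] at h; split_ifs at h with h1
    · exact ⟨h1, h⟩
    · exact absurd rfl h
  have hlt : W u v < 1 := by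
    refine lt_of_le_of_ne ?_ (by simpa only [hW, huv, if_true] using hne)
    exact (Finset.single_le_sum (fun a _ => hW0 u a) (Finset.mem_univ v)).trans
      (hWsum u (left_mem_verts huv))
  -- The arc from `u` to `v` is forbidden; when an end of the edge lies in `A`, let `u` be one.
  have main : ∀ u v, W u v < 1 → (v ∈ A → u ∈ A) → ∃ D π, IsTwoMatching H D π ∧
      (D.card : ℝ) = 2 * coverNum H ∧ ¬ (u ∈ D ∧ π u = v ∧ π v = u) := by
    intro u v hlt hor
    have hallA : ∀ s ⊆ A, s.card ≤ (s.biUnion fun a => Finset.univ.filter fun z =>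
        (H.Adj a z ∧ ¬ (a = u ∧ z = v)) ∧ z ∉ A ∧ z ∉ C).card := by
      intro s hs
      refine card_le_card_of_weights W hW0 hWs s _ u v ?_ ?_ ?_ hlt
      · intro a ha y hy
        obtain ⟨h1, h2⟩ := hWadj a y hy
        have h3 := hs2 a y h1 h2
        by_cases h4 : a = u ∧ y = v
        · exact Or.inr h4
        · left
          have h5 : halfFun A C y = 0 := by
            have : halfFun A C a = 1 := by simp [halfFun, hs ha]
            linarith
          simp only [Finset.mem_biUnion, Finset.mem_filter, Finset.mem_univ, true_and]
          refine ⟨a, ha, ⟨h1, h4⟩, ?_, ?_⟩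
          · intro h; simp [halfFun, h] at h5
          · intro h; simp [halfFun, h, Finset.disjoint_right.1 hhc.2.2.1 h] at h5
      · intro a ha
        refine hs1 a (hhc.1 (hs ha)) ?_
        simp [halfFun, hs ha]
      · intro y hy
        simp only [Finset.mem_biUnion, Finset.mem_filter, Finset.mem_univ, true_and] at hy
        obtain ⟨a, _, h, _⟩ := hy
        exact hWsum y (right_mem_verts h.1)
    have hallC : ∀ s ⊆ C, s.card ≤ (s.biUnion fun a => Finset.univ.filter fun z =>
        (H.Adj a z ∧ ¬ (a = u ∧ z = v)) ∧ z ∈ C).card := by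
      intro s hs
      have hCA : ∀ x ∈ C, x ∉ A := fun x hx => Finset.disjoint_right.1 hhc.2.2.1 hx
      refine card_le_card_of_weights W hW0 hWs s _ u v ?_ ?_ ?_ hlt
      · intro a ha y hy
        obtain ⟨h1, h2⟩ := hWadj a y hy
        have h3 := hs2 a y h1 h2
        by_cases h4 : a = u ∧ y = v
        · exact Or.inr h4
        · left
          have h5 : halfFun A C y = 1 / 2 := by
            have : halfFun A C a = 1 / 2 := by simp [halfFun, hs ha, hCA a (hs ha)]
            linarith
          simp only [Finset.mem_biUnion, Finset.mem_filter, Finset.mem_univ, true_and]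
          refine ⟨a, ha, ⟨h1, h4⟩, ?_⟩
          by_contra h
          unfold halfFun at h5
          split_ifs at h5 <;> norm_num at h5
      · intro a ha
        refine hs1 a (hhc.2.1 (hs ha)) ?_
        simp [halfFun, hs ha, hCA a (hs ha)]
      · intro y hy
        simp only [Finset.mem_biUnion, Finset.mem_filter, Finset.mem_univ, true_and] at hy
        obtain ⟨a, _, h, _⟩ := hy
        exact hWsum y (right_mem_verts h.1)
    obtain ⟨D, π, hD, hDc, hDR⟩ := exists_twoMatching_of_hall (H := H) hhc.2.2.1
      (fun x y => H.Adj x y ∧ ¬ (x = u ∧ y = v)) (fun _ _ h => h.1) hallA hallC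
    refine ⟨D, π, hD, ?_, ?_⟩
    · rw [hDc]; push_cast; linarith
    · rintro ⟨hu, h1, h2⟩
      rcases hDR u hu with ⟨_, h, _⟩ | ⟨h, _, h'⟩ | ⟨_, _, h⟩
      · exact h.2 ⟨rfl, h1⟩
      · rw [h1] at h; exact h' (hor h)
      · exact h.2 ⟨rfl, h1⟩
  by_cases hv : v ∈ A → u ∈ A
  · exact main u v hlt hv
  · push Not at hv
    obtain ⟨D, π, hD, hc, h⟩ := main v u (by rw [hWs]; exact hlt) (fun _ => hv.1)
    refine ⟨D, π, hD, hc, ?_⟩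
    rintro ⟨h1, h2, h3⟩
    exact h ⟨h2 ▸ hD.1 u h1, h3, h2⟩

end Contributing

/-! ### Combinatorial gains -/

section Gains

variable {V : Type*} [Fintype V] [DecidableEq V]

theorem edges_sup_edge {G : SimpleGraph V} {u v : V} (h : u ≠ v) :
    edges (G ⊔ SimpleGraph.edge u v) = insert s(u, v) (edges G) := by
  ext e
  simp [mem_edges, SimpleGraph.edgeSet_sup, SimpleGraph.edgeSet_edge_of_ne h]

theorem card_edges_sup_edge {G : SimpleGraph V} {u v : V} (h : u ≠ v) (huv : ¬ G.Adj u v) :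
    ((edges (G ⊔ SimpleGraph.edge u v)).card : ℝ) = (edges G).card + 1 := by
  rw [edges_sup_edge h, Finset.card_insert_of_notMem (by rwa [mk_mem_edges])]
  push_cast; rfl

theorem verts_sup_edge {G : SimpleGraph V} {u v : V} (h : u ≠ v) :
    verts (G ⊔ SimpleGraph.edge u v) = verts G ∪ {u, v} := by
  ext x
  simp only [mem_verts, SimpleGraph.sup_adj, SimpleGraph.edge_adj, Finset.mem_union,
    Finset.mem_insert, Finset.mem_singleton]
  constructor
  · rintro ⟨w, hw | ⟨⟨rfl, rfl⟩ | ⟨rfl, rfl⟩, -⟩⟩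
    · exact Or.inl ⟨w, hw⟩
    · exact Or.inr (Or.inl rfl)
    · exact Or.inr (Or.inr rfl)
  · rintro (⟨w, hw⟩ | rfl | rfl)
    · exact ⟨w, Or.inl hw⟩
    · exact ⟨v, Or.inr ⟨Or.inl ⟨rfl, rfl⟩, h⟩⟩
    · exact ⟨u, Or.inr ⟨Or.inr ⟨rfl, rfl⟩, h.symm⟩⟩

theorem sup_edge_adj {G : SimpleGraph V} {u v x y : V} (h : (G ⊔ SimpleGraph.edge u v).Adj x y) :
    G.Adj x y ∨ (x = u ∧ y = v) ∨ (x = v ∧ y = u) := by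
  rw [SimpleGraph.sup_adj, SimpleGraph.edge_adj] at h
  tauto

/-- Let `H₁` attain the maximum in the definition of `γ(K)`, and let `H ⊋ H₁` have minimum degree
at least `2`. Then some two-matching of `H`, completed by leaves attached through edges of `H₁`,
beats the exponent `e(H₁)`, even if each of its arcs outside `H₁` is charged an extra `1 / 2`. -/
theorem exists_gain {K H H₁ : SimpleGraph V} (hγ : 0 < gam K)
    (hbad : ∀ H, IsContributing K H → ∀ e, ¬ IsBadEdge H e) (hHK : H ≤ K) (hmin : MinDegTwo H)
    (h₁ : H₁ ≤ H) (hne : H₁ ≠ H)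
    (hext : ((edges H₁).card : ℝ) - (verts H₁).card = gam K * coverNum H₁) [DecidableRel H₁.Adj] :
    ∃ (D : Finset V) (π : V → V) (L : Finset V), IsTwoMatching H D π ∧ Disjoint D L ∧
      (∀ z ∈ L, ∃ u ∈ D, H₁.Adj z u) ∧
      ((edges H₁).card : ℝ) < L.card + D.card + gam K * D.card / 2 -
        (D.filter fun v => ¬ H₁.Adj v (π v)).card / 2 := by
  have hmissing : ∃ u v, H.Adj u v ∧ ¬ H₁.Adj u v := by
    by_contra hcon
    push Not at hcon
    exact hne (le_antisymm h₁ fun u v h => hcon u v h)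
  have vc : ∀ {G : SimpleGraph V} {D : Finset V}, D ⊆ verts G →
      ((verts G \ D).card : ℝ) + D.card = (verts G).card := fun {G D} h => by
    exact_mod_cast Finset.card_sdiff_add_card_eq_card h
  -- An edge of `H` disjoint from `H₁`: swap its ends, and add this to a maximum two-matching of `H₁`.
  -- The gain is `2 + γ`, the charge at most `1`.
  by_cases hII : ∃ u v, H.Adj u v ∧ u ∉ verts H₁ ∧ v ∉ verts H₁
  · obtain ⟨u, v, huv, hu, hv⟩ := hII
    obtain ⟨D, π, hD, hc⟩ := exists_twoMatching H₁
    have hDv := hD.subset_verts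
    have huD : u ∉ D := fun h => hu (hDv h)
    have hvD : v ∉ D := fun h => hv (hDv h)
    set π' : V → V := fun x => if x = u then v else if x = v then u else π x with hπ'
    have πu : π' u = v := by simp [hπ']
    have πv : π' v = u := by simp [hπ', huv.ne.symm]
    have πD : ∀ x ∈ D, π' x = π x := fun x hx => by
      have h1 : x ≠ u := fun h => huD (h ▸ hx)
      have h2 : x ≠ v := fun h => hvD (h ▸ hx)
      simp [hπ', h1, h2]
    have hmem : ∀ x, x ∈ insert u (insert v D) ↔ x = u ∨ x = v ∨ x ∈ D := by
      intro x; simp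
    have hcard : (insert u (insert v D)).card = D.card + 2 := by
      rw [Finset.card_insert_of_notMem (by simp [huD, huv.ne]), Finset.card_insert_of_notMem hvD]
    refine ⟨insert u (insert v D), π', verts H₁ \ D, ⟨?_, ?_, ?_⟩, ?_, ?_, ?_⟩
    · intro x hx
      rcases (hmem x).1 hx with rfl | rfl | h
      · rw [πu]; simp
      · rw [πv]; simp
      · rw [πD x h]; simp [hD.1 x h]
    · intro x hx y hy hxy
      rcases (hmem x).1 hx with rfl | rfl | h <;> rcases (hmem y).1 hy with rfl | rfl | h'
      · rfl
      · rw [πu, πv] at hxy; exact hxy.symm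
      · rw [πu, πD y h'] at hxy; exact absurd (hxy ▸ hD.1 y h') hvD
      · rw [πu, πv] at hxy; exact hxy.symm
      · rfl
      · rw [πv, πD y h'] at hxy; exact absurd (hxy ▸ hD.1 y h') huD
      · rw [πu, πD x h] at hxy; exact absurd (hxy ▸ hD.1 x h) hvD
      · rw [πv, πD x h] at hxy; exact absurd (hxy ▸ hD.1 x h) huD
      · rw [πD x h, πD y h'] at hxy; exact hD.2.1 h h' hxy
    · intro x hx
      rcases (hmem x).1 hx with rfl | rfl | h
      · rw [πu]; exact huv
      · rw [πv]; exact huv.symm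
      · rw [πD x h]; exact h₁ (hD.2.2 x h)
    · refine Finset.disjoint_left.2 fun x hx hx' => ?_
      rw [Finset.mem_sdiff] at hx'
      rcases (hmem x).1 hx with rfl | rfl | h
      · exact hu hx'.1
      · exact hv hx'.1
      · exact hx'.2 h
    · intro z hz
      rw [Finset.mem_sdiff] at hz
      obtain ⟨w, hw⟩ := mem_verts.1 hz.1
      exact ⟨w, by simp [hD.mem_of_adj hc hw hz.2], hw⟩
    · have hk : ((insert u (insert v D)).filter fun x => ¬ H₁.Adj x (π' x)).card ≤ 2 := by
        refine (Finset.card_le_card (t := {u, v}) ?_).trans Finset.card_le_two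
        intro x hx
        rw [Finset.mem_filter, hmem] at hx
        rcases hx.1 with rfl | rfl | h
        · simp
        · simp
        · exact absurd (πD x h ▸ hD.2.2 x h) hx.2
      have hk' : (((insert u (insert v D)).filter fun x => ¬ H₁.Adj x (π' x)).card : ℝ) ≤ 2 := by
        exact_mod_cast hk
      have := vc hDv
      rw [hcard]; push_cast
      nlinarith
  · push Not at hII
    -- A vertex `u` of `H` outside `H₁`: it sends two edges `ua`, `ub` to `H₁`. Adding them to `H₁` gains
    -- two edges and one vertex, so `γ` times the cover number grows by at least `1`; adding `u` to the
    -- vertices gains another `1`, and the charge is at most `1`.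
    by_cases hIII : ∃ u ∈ verts H, u ∉ verts H₁
    · obtain ⟨u, hu, hu1⟩ := hIII
      obtain ⟨a, ha⟩ := mem_verts.1 hu
      obtain ⟨b, hb, hba⟩ := hmin.exists_ne hu a
      have haV := hII u a ha hu1
      have hbV := hII u b hb hu1
      set G := H₁ ⊔ SimpleGraph.edge u a with hG
      set H₀ := G ⊔ SimpleGraph.edge u b with hH0
      have hn1 : ¬ H₁.Adj u a := fun h => hu1 (left_mem_verts h)
      have hn2 : ¬ G.Adj u b := by
        intro h
        rcases sup_edge_adj h with h | ⟨-, h⟩ | ⟨h, -⟩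
        · exact hu1 (left_mem_verts h)
        · exact hba h
        · exact ha.ne h
      have hle : H₀ ≤ H := sup_le (sup_le h₁ ((SimpleGraph.edge_le_iff H).2 (Or.inr ha)))
        ((SimpleGraph.edge_le_iff H).2 (Or.inr hb))
      have hadj : ∀ x y, H₀.Adj x y → H₁.Adj x y ∨ x = u ∨ y = u := by
        intro x y h
        rcases sup_edge_adj h with h | h | h
        · rcases sup_edge_adj h with h | h | h <;> tauto
        · tauto
        · tauto
      have hE : ((edges H₀).card : ℝ) = (edges H₁).card + 2 := by
        rw [hH0, card_edges_sup_edge hb.ne hn2, hG, card_edges_sup_edge ha.ne hn1]; ring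
      have hVs : verts H₀ = insert u (verts H₁) := by
        rw [hH0, verts_sup_edge hb.ne, hG, verts_sup_edge ha.ne]
        ext x; simp only [Finset.mem_union, Finset.mem_insert, Finset.mem_singleton]
        constructor
        · rintro ((h | rfl | rfl) | rfl | rfl) <;> tauto
        · rintro (rfl | h) <;> tauto
      have hVc : ((verts H₀).card : ℝ) = (verts H₁).card + 1 := by
        rw [hVs, Finset.card_insert_of_notMem hu1]; push_cast; rfl
      obtain ⟨D, π, hD, hc⟩ := exists_twoMatching H₀
      have hgam := sub_le_gam_mul (hle.trans hHK)
      -- Otherwise this would be a two-matching of `H₁`, which has a smaller cover number.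
      have huD : u ∈ D := by
        by_contra huD
        have : IsTwoMatching H₁ D π := by
          refine ⟨hD.1, hD.2.1, fun v hv => ?_⟩
          rcases hadj _ _ (hD.2.2 v hv) with h | h | h
          · exact h
          · exact absurd (h ▸ hv) huD
          · exact absurd (h ▸ hD.1 v hv) huD
        have := this.card_le
        nlinarith
      refine ⟨D, π, verts H₀ \ D, hD.mono hle, Finset.disjoint_sdiff, ?_, ?_⟩
      · intro z hz
        rw [Finset.mem_sdiff, hVs, Finset.mem_insert] at hz
        have hz1 := hz.1.resolve_left (fun h => hz.2 (h ▸ huD))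
        obtain ⟨w, hw⟩ := mem_verts.1 hz1
        exact ⟨w, hD.mem_of_adj hc (show H₀.Adj z w from Or.inl (Or.inl hw)) hz.2, hw⟩
      · obtain ⟨x₀, hx₀, hx₀u⟩ := hD.surj u huD
        have hk : (D.filter fun x => ¬ H₁.Adj x (π x)).card ≤ 2 := by
          refine (Finset.card_le_card (t := {u, x₀}) ?_).trans Finset.card_le_two
          intro x hx
          rw [Finset.mem_filter] at hx
          rcases hadj _ _ (hD.2.2 x hx.1) with h | h | h
          · exact absurd h hx.2
          · simp [h]
          · simp [hD.2.1 hx.1 hx₀ (h.trans hx₀u.symm)]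
        have hk' : ((D.filter fun x => ¬ H₁.Adj x (π x)).card : ℝ) ≤ 2 := by exact_mod_cast hk
        have := vc hD.subset_verts
        nlinarith
    · push Not at hIII
      -- All the vertices of `H` are in `H₁`: add a missing edge `uv` to `H₁`. Then `γ` times the cover
      -- number grows by at least `1`, and it remains to see that the charge is less than that.
      obtain ⟨u, v, huv, hn⟩ := hmissing
      have huV := hIII u (left_mem_verts huv)
      have hvV := hIII v (right_mem_verts huv)
      set H₀ := H₁ ⊔ SimpleGraph.edge u v with hH0
      have hle : H₀ ≤ H := sup_le h₁ ((SimpleGraph.edge_le_iff H).2 (Or.inr huv))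
      have hE : ((edges H₀).card : ℝ) = (edges H₁).card + 1 := card_edges_sup_edge huv.ne hn
      have hVs : verts H₀ = verts H₁ := by
        rw [hH0, verts_sup_edge huv.ne]
        ext x; simp only [Finset.mem_union, Finset.mem_insert, Finset.mem_singleton]
        constructor
        · rintro (h | rfl | rfl) <;> assumption
        · exact Or.inl
      have hgam := sub_le_gam_mul (hle.trans hHK)
      rw [hVs, hE] at hgam
      -- Any maximum two-matching of `H₀` with a small charge will do.
      have main : ∀ D π, IsTwoMatching H₀ D π → (D.card : ℝ) = 2 * coverNum H₀ →
          ((D.filter fun x => ¬ H₁.Adj x (π x)).card : ℝ) / 2 <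
            gam K * (coverNum H₀ - coverNum H₁) →
          ∃ (D : Finset V) (π : V → V) (L : Finset V), IsTwoMatching H D π ∧ Disjoint D L ∧
            (∀ z ∈ L, ∃ u ∈ D, H₁.Adj z u) ∧
            ((edges H₁).card : ℝ) < L.card + D.card + gam K * D.card / 2 -
              (D.filter fun v => ¬ H₁.Adj v (π v)).card / 2 := by
        intro D π hD hc hk
        refine ⟨D, π, verts H₀ \ D, hD.mono hle, Finset.disjoint_sdiff, ?_, ?_⟩
        · intro z hz
          rw [Finset.mem_sdiff, hVs] at hz
          obtain ⟨w, hw⟩ := mem_verts.1 hz.1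
          exact ⟨w, hD.mem_of_adj hc (show H₀.Adj z w from Or.inl hw) hz.2, hw⟩
        · have := vc hD.subset_verts
          rw [hVs] at this ⊢
          nlinarith
      have hk2 : ∀ D π, IsTwoMatching H₀ D π →
          ((D.filter fun x => ¬ H₁.Adj x (π x)).card : ℝ) ≤ 2 := by
        intro D π hD
        have : (D.filter fun x => ¬ H₁.Adj x (π x)).card ≤ 2 := by
          refine (Finset.card_le_card (t := {u, v}) ?_).trans Finset.card_le_two
          intro x hx
          rw [Finset.mem_filter] at hx
          rcases sup_edge_adj (hD.2.2 x hx.1) with h | h | h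
          · exact absurd h hx.2
          · simp [h.1]
          · simp [h.1]
        exact_mod_cast this
      have hk1 : ∀ D π, IsTwoMatching H₀ D π → ¬ (u ∈ D ∧ π u = v ∧ π v = u) →
          ((D.filter fun x => ¬ H₁.Adj x (π x)).card : ℝ) ≤ 1 := by
        intro D π hD hsw
        have : (D.filter fun x => ¬ H₁.Adj x (π x)).card ≤ 1 := by
          rw [Finset.card_le_one]
          have key : ∀ x ∈ D.filter (fun x => ¬ H₁.Adj x (π x)),
              x ∈ D ∧ ((x = u ∧ π x = v) ∨ (x = v ∧ π x = u)) := by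
            intro x hx
            rw [Finset.mem_filter] at hx
            exact ⟨hx.1, (sup_edge_adj (hD.2.2 x hx.1)).resolve_left hx.2⟩
          intro x hx y hy
          obtain ⟨hx1, ⟨rfl, hx3⟩ | ⟨rfl, hx3⟩⟩ := key x hx <;>
            obtain ⟨hy1, ⟨hy2, hy3⟩ | ⟨hy2, hy3⟩⟩ := key y hy
          · exact hy2.symm
          · subst hy2; exact absurd ⟨hx1, hx3, hy3⟩ hsw
          · subst hy2; exact absurd ⟨hy1, hy3, hx3⟩ hsw
          · exact hy2.symm
        exact_mod_cast this
      by_cases hgt : 1 < gam K * (coverNum H₀ - coverNum H₁)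
      · obtain ⟨D, π, hD, hc⟩ := exists_twoMatching H₀
        exact main D π hD hc (by linarith [hk2 D π hD])
      · -- Now `H₀` attains the maximum as well, and `uv` survives in its pruned subgraph.
        obtain ⟨G, hGle, hG, hGc⟩ := exists_contributing_le hγ (hle.trans hHK)
          (H₀ := H₀) (by rw [hE, hVs]; linarith)
        have hGuv : G.Adj u v := by
          by_contra hnot
          have : G ≤ H₁ := by
            intro x y hxy
            rcases sup_edge_adj (hGle hxy) with h | ⟨rfl, rfl⟩ | ⟨rfl, rfl⟩
            · exact h
            · exact absurd hxy hnot
            · exact absurd hxy.symm hnot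
          have := coverNum_mono this
          nlinarith
        obtain ⟨D, π, hD, hc, hsw⟩ := exists_twoMatching_not_swap hGuv (hbad G hG _)
        refine main D π (hD.mono hGle) (by rw [hc, hGc]) ?_
        have := hk1 D π (hD.mono hGle) hsw
        linarith

/-! ### Valid sets -/

/-- The subgraph of `H` spanned by the edges that avoid `S`. -/
def deleteVerts (H : SimpleGraph V) (S : Finset V) : SimpleGraph V where
  Adj u v := H.Adj u v ∧ u ∉ S ∧ v ∉ S
  symm := ⟨fun _ _ h => ⟨h.1.symm, h.2.2, h.2.1⟩⟩
  loopless := ⟨fun v h => H.loopless.irrefl v h.1⟩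

theorem deleteVerts_le (H : SimpleGraph V) (S : Finset V) : deleteVerts H S ≤ H :=
  fun _ _ h => h.1

theorem verts_deleteVerts {H : SimpleGraph V} {S : Finset V} {v : V}
    (hv : v ∈ verts (deleteVerts H S)) : v ∈ verts H ∧ v ∉ S := by
  obtain ⟨w, hw⟩ := mem_verts.1 hv
  exact ⟨left_mem_verts hw.1, hw.2.1⟩

/-- A set `S` that extends to minimum covers of `H` and for which the rest of `H` has a perfect
two-matching is valid: put `1 / 2` on the rest. -/
theorem isValid_of_perfect {H : SimpleGraph V} {S : Finset V} (hS : S ⊆ verts H)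
    {D : Finset V} (hc : (D.card : ℝ) = 2 * coverNum (deleteVerts H S))
    (hmin : (S.card : ℝ) + coverNum (deleteVerts H S) ≤ coverNum H)
    (hD : verts (deleteVerts H S) ⊆ D) : IsValid H S := by
  set C := verts (deleteVerts H S) with hC
  have hSC : Disjoint S C := Finset.disjoint_right.2 fun v hv => (verts_deleteVerts hv).2
  have hhc : IsHalfCover H S C := by
    refine ⟨hS, verts_mono (deleteVerts_le H S), hSC, fun u v h => ?_⟩
    by_cases hu : u ∈ S
    · exact Or.inl hu
    · by_cases hv : v ∈ S
      · exact Or.inr (Or.inl hv)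
      · have : (deleteVerts H S).Adj u v := ⟨h, hu, hv⟩
        exact Or.inr (Or.inr ⟨left_mem_verts this, right_mem_verts this⟩)
  have h1 := sum_halfFun hhc.1 hhc.2.1 hSC
  have h2 := coverNum_le hhc.isFracVertexCover
  have h3 : (C.card : ℝ) ≤ D.card := by exact_mod_cast Finset.card_le_card hD
  refine ⟨hS, halfFun S C, ⟨hhc.isFracVertexCover, by linarith⟩, ?_, ?_⟩
  · intro v hv; simp [halfFun, hv]
  · intro v _ hv
    simp only [halfFun, hv, if_false]
    split_ifs
    · exact Or.inr rfl
    · exact Or.inl rfl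

/-- In a maximum two-matching, a valid set `S` meets every arc at most once, so exactly `2 |S|`
arcs meet `S`. -/
theorem IsValid.arcs {H : SimpleGraph V} {S : Finset V} (hS : IsValid H S) {D : Finset V}
    {π : V → V} (hD : IsTwoMatching H D π) (hc : (D.card : ℝ) = 2 * coverNum H) :
    S ⊆ D ∧ (∀ v ∈ D, v ∈ S → π v ∉ S) ∧ (D.filter fun v => v ∈ S ∨ π v ∈ S).card = 2 * S.card := by
  obtain ⟨hSv, c, hmin, h1, -⟩ := hS
  obtain ⟨e1, e2⟩ := hD.slack hc hmin
  have hSD : S ⊆ D := by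
    intro v hv
    by_contra h
    have := e2 v (hSv hv) h
    rw [h1 v hv] at this
    norm_num at this
  have hind : ∀ v ∈ D, v ∈ S → π v ∉ S := by
    intro v hv hvS hπ
    have := e1 v hv
    rw [h1 v hvS, h1 _ hπ] at this
    norm_num at this
  refine ⟨hSD, hind, ?_⟩
  rw [Finset.filter_or, Finset.card_union_of_disjoint, Finset.filter_mem_eq_inter,
    Finset.inter_eq_right.2 hSD, two_mul]
  · congr 1
    refine Finset.card_bij (fun v _ => π v) ?_ ?_ ?_
    · intro v hv; exact (Finset.mem_filter.1 hv).2
    · intro v hv w hw h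
      exact hD.2.1 (Finset.mem_filter.1 hv).1 (Finset.mem_filter.1 hw).1 h
    · intro v hv
      obtain ⟨u, hu, rfl⟩ := hD.surj v (hSD hv)
      exact ⟨u, Finset.mem_filter.2 ⟨hu, hv⟩, rfl⟩
  · refine Finset.disjoint_left.2 fun v hv hv' => ?_
    rw [Finset.mem_filter] at hv hv'
    exact hind v hv.1 hv.2 hv'.2

theorem IsValid.card_le {H : SimpleGraph V} {S : Finset V} (hS : IsValid H S) :
    (S.card : ℝ) ≤ coverNum H := by
  obtain ⟨hSv, c, hmin, h1, -⟩ := hS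
  rw [← hmin.2, Finset.card_eq_sum_ones]
  push_cast
  rw [Finset.sum_congr rfl fun v hv => (h1 v hv).symm]
  exact Finset.sum_le_sum_of_subset_of_nonneg hSv fun v hv _ => hmin.1.1 v hv

theorem exists_isValid (H : SimpleGraph V) : ∃ S, IsValid H S := by
  obtain ⟨A, C, -, -, hhc, -, -, hmin, -⟩ := exists_halfCover_twoMatching H
  refine ⟨A, hhc.1, _, hmin, ?_, ?_⟩
  · intro v hv; simp [halfFun, hv]
  · intro v _ hv
    simp only [halfFun, hv, if_false]
    split_ifs
    · exact Or.inr rfl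
    · exact Or.inl rfl

end Gains

/-! ### Hölder bounds for products over edges -/

section Finner

open scoped ENNReal
open Function (update)

variable {V Ω : Type*} [Fintype V] [DecidableEq V] [MeasurableSpace Ω] {μ : Measure Ω}
  [IsProbabilityMeasure μ]

/-- Hölder's inequality on a probability space needs exponents of sum at most `1` only. -/
theorem lintegral_prod_rpow_le_of_sum_le_one {I : Type*} [DecidableEq I] (J : Finset I) (w : I → ℝ)
    (hw : ∀ i ∈ J, 0 ≤ w i) (g : I → Ω → ℝ≥0∞) (hg : ∀ i ∈ J, Measurable (g i))
    (hsum : ∑ i ∈ J, w i ≤ 1) :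
    ∫⁻ t, ∏ i ∈ J, g i t ^ w i ∂μ ≤ ∏ i ∈ J, (∫⁻ t, g i t ∂μ) ^ w i := by
  have h := ENNReal.lintegral_mul_prod_norm_pow_le (μ := μ) J (g := fun _ => 1) (f := g)
    aemeasurable_const (fun i hi => (hg i hi).aemeasurable) (1 - ∑ i ∈ J, w i) (p := w)
    (by ring) (by linarith) hw
  simpa using h

/-- Hölder's inequality for functions of overlapping sets of coordinates (Finner's inequality),
in a form that can be proved one coordinate at a time. -/
theorem lmarginal_prod_rpow_le {I : Type*} [DecidableEq I] (s : Finset V) (J : Finset I) (w : I → ℝ)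
    (hw : ∀ i ∈ J, 0 ≤ w i) (E : I → Finset V) (hsum : ∀ v, ∑ i ∈ J with v ∈ E i, w i ≤ 1)
    (h : I → (V → Ω) → ℝ≥0∞) (hm : ∀ i ∈ J, Measurable (h i))
    (hdep : ∀ i ∈ J, ∀ v, v ∉ E i → ∀ x t, h i (update x v t) = h i x) (x : V → Ω) :
    lmarginal (fun _ => μ) s (fun x => ∏ i ∈ J, h i x ^ w i) x ≤
      ∏ i ∈ J, (lmarginal (fun _ => μ) s (h i) x) ^ w i := by
  induction s using Finset.induction generalizing h x with
  | empty => simp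
  | insert v s hv ih =>
    rw [lmarginal_insert' _ (Finset.measurable_prod _ fun i hi => (hm i hi).pow_const _) hv]
    set h' : I → (V → Ω) → ℝ≥0∞ := fun i x => ∫⁻ t, h i (update x v t) ∂μ with hh'
    have hm' : ∀ i ∈ J, Measurable (h' i) := fun i hi => by
      have : h' i = lmarginal (fun _ => μ) {v} (h i) := by rw [lmarginal_singleton]
      rw [this]; exact (hm i hi).lmarginal _
    have h1 : ∀ x, ∫⁻ t, ∏ i ∈ J, h i (update x v t) ^ w i ∂μ ≤ ∏ i ∈ J, h' i x ^ w i := by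
      intro x
      rw [← Finset.prod_filter_mul_prod_filter_not J (fun i => v ∈ E i)]
      have e1 : ∀ t, ∏ i ∈ J, h i (update x v t) ^ w i =
          (∏ i ∈ J with v ∈ E i, h i (update x v t) ^ w i) *
            ∏ i ∈ J with v ∉ E i, h i x ^ w i := by
        intro t
        rw [← Finset.prod_filter_mul_prod_filter_not J (fun i => v ∈ E i)]
        congr 1
        refine Finset.prod_congr rfl fun i hi => ?_
        rw [Finset.mem_filter] at hi
        rw [hdep i hi.1 v hi.2]
      have e2 : ∏ i ∈ J with v ∉ E i, h i x ^ w i = ∏ i ∈ J with v ∉ E i, h' i x ^ w i := by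
        refine Finset.prod_congr rfl fun i hi => ?_
        rw [Finset.mem_filter] at hi
        simp [hh', hdep i hi.1 v hi.2]
      have hmu : ∀ i ∈ J, Measurable fun t => h i (update x v t) := fun i hi =>
        (hm i hi).comp (measurable_update x)
      simp only [e1]
      rw [lintegral_mul_const _ (Finset.measurable_prod _ fun i hi =>
        (hmu i (Finset.mem_filter.1 hi).1).pow_const _), e2]
      gcongr
      exact lintegral_prod_rpow_le_of_sum_le_one _ w (fun i hi => hw i (Finset.mem_filter.1 hi).1) _
        (fun i hi => hmu i (Finset.mem_filter.1 hi).1) (hsum v)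
    refine (lmarginal_mono (μ := fun _ => μ) (s := s) (fun x => h1 x) x).trans ?_
    refine (ih h' hm' ?_ x).trans (le_of_eq ?_)
    · intro i hi u hu x t
      simp only [hh']
      refine lintegral_congr fun r => ?_
      by_cases huv : u = v
      · subst huv; simp
      · rw [Function.update_comm huv, hdep i hi u hu]
    · refine Finset.prod_congr rfl fun i hi => ?_
      rw [lmarginal_insert' _ (hm i hi) hv]

theorem lintegral_pi_eq_update (F : (V → Ω) → ℝ≥0∞) (hF : Measurable F) (z : V) :
    ∫⁻ x, F x ∂Measure.pi (fun _ => μ) =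
      ∫⁻ x, ∫⁻ t, F (update x z t) ∂μ ∂Measure.pi (fun _ => μ) := by
  obtain ⟨ω⟩ := μ.nonempty_of_neZero
  have h1 := lmarginal_eq_of_subset (μ := fun _ => μ) (f := F)
    (g := lmarginal (fun _ => μ) {z} F) (Finset.subset_univ {z}) hF (hF.lmarginal _) (by
      ext x
      rw [lmarginal_singleton (f := lmarginal (fun _ => μ) {z} F)]
      simp only [lmarginal_update_of_mem _ (Finset.mem_singleton_self z)]
      simp)
  have h2 := congrFun h1 (fun _ => ω)
  rw [lmarginal_univ, lmarginal_univ, lmarginal_singleton] at h2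
  exact h2

/-- Integrating out leaves `z ∈ L`, each of which occurs in a single factor. -/
theorem lintegral_mul_prod_leaves (L : Finset V) (G : (V → Ω) → ℝ≥0∞) (hGm : Measurable G)
    (hG : ∀ z ∈ L, ∀ x t, G (update x z t) = G x) (f : V → (V → Ω) → ℝ≥0∞)
    (hfm : ∀ z ∈ L, Measurable (f z))
    (hf : ∀ z ∈ L, ∀ z' ∈ L, z ≠ z' → ∀ x t, f z (update x z' t) = f z x) (d : V → ℝ≥0∞)
    (hd : ∀ z ∈ L, ∀ x, ∫⁻ t, f z (update x z t) ∂μ ≤ d z) :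
    ∫⁻ x, G x * ∏ z ∈ L, f z x ∂Measure.pi (fun _ => μ) ≤
      (∏ z ∈ L, d z) * ∫⁻ x, G x ∂Measure.pi (fun _ => μ) := by
  induction L using Finset.induction with
  | empty => simp
  | insert z L hz ih =>
    have hm : Measurable fun x => G x * ∏ z ∈ L, f z x :=
      hGm.mul (Finset.measurable_prod _ fun i hi => hfm i (Finset.mem_insert_of_mem hi))
    have hfz := hfm z (Finset.mem_insert_self _ _)
    have e0 : ∀ x, G x * ∏ z ∈ insert z L, f z x = (G x * ∏ z ∈ L, f z x) * f z x := fun x => by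
      rw [Finset.prod_insert hz]; ring
    simp only [e0]
    rw [lintegral_pi_eq_update (fun x => (G x * ∏ z ∈ L, f z x) * f z x) (hm.mul hfz) z]
    have e1 : ∀ x t, G (update x z t) * ∏ z' ∈ L, f z' (update x z t) =
        G x * ∏ z' ∈ L, f z' x := by
      intro x t
      rw [hG z (Finset.mem_insert_self _ _)]
      congr 1
      refine Finset.prod_congr rfl fun i hi => ?_
      exact hf i (Finset.mem_insert_of_mem hi) z (Finset.mem_insert_self _ _)
        (fun h => hz (h ▸ hi)) x t
    simp only [e1]
    have e2 : ∀ x, ∫⁻ t, (G x * ∏ z' ∈ L, f z' x) * f z (update x z t) ∂μ ≤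
        d z * (G x * ∏ z' ∈ L, f z' x) := by
      intro x
      have hmz : Measurable fun t => f z (update x z t) := hfz.comp (measurable_update x)
      rw [lintegral_const_mul _ hmz, mul_comm]
      gcongr
      exact hd z (Finset.mem_insert_self _ _) x
    refine (lintegral_mono e2).trans ?_
    rw [lintegral_const_mul _ hm, Finset.prod_insert hz, mul_assoc]
    gcongr
    exact ih (fun z' h => hG z' (Finset.mem_insert_of_mem h))
      (fun z' h => hfm z' (Finset.mem_insert_of_mem h))
      (fun z h z' h' => hf z (Finset.mem_insert_of_mem h) z' (Finset.mem_insert_of_mem h'))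
      (fun z h => hd z (Finset.mem_insert_of_mem h))

/-- The product over the edges of `H` is bounded by a product over the arcs of a two-matching,
each with exponent `1 / 2`, and over the edges at a set of leaves. -/
theorem prod_edges_le {H : SimpleGraph V} {D L : Finset V} {π g : V → V} (hD : IsTwoMatching H D π)
    (hDL : Disjoint D L) (hg : ∀ z ∈ L, g z ∉ L ∧ H.Adj z (g z)) (f : Sym2 V → ℝ≥0∞)
    (hf : ∀ e, f e ≤ 1) :
    ∏ e ∈ edges H, f e ≤ (∏ v ∈ D, f s(v, π v) ^ (1 / 2 : ℝ)) * ∏ z ∈ L, f s(z, g z) := by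
  -- An edge whose ends are swapped by `π` carries two arcs, and then its exponent is `1`.
  have e1 : ∏ e ∈ D.image (fun v => s(v, π v)), f e ≤ ∏ v ∈ D, f s(v, π v) ^ (1 / 2 : ℝ) := by
    rw [Finset.prod_comp (fun e => f e ^ (1 / 2 : ℝ)) (fun v => s(v, π v))]
    refine Finset.prod_le_prod' fun e he => ?_
    have hk : (D.filter fun v => s(v, π v) = e).card ≤ 2 := by
      induction e using Sym2.ind with
      | _ a b =>
        refine (Finset.card_le_card (t := {a, b}) ?_).trans Finset.card_le_two
        intro v hv
        have := (Finset.mem_filter.1 hv).2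
        rw [Sym2.eq_iff] at this
        rcases this with h | h <;> simp [h.1]
    calc f e = (f e ^ (1 / 2 : ℝ)) ^ 2 := by
          rw [← ENNReal.rpow_natCast, ← ENNReal.rpow_mul]; norm_num
      _ ≤ _ := pow_le_pow_right_of_le_one' (ENNReal.rpow_le_one (hf e) (by norm_num)) hk
  have e2 : ∏ e ∈ L.image (fun z => s(z, g z)), f e = ∏ z ∈ L, f s(z, g z) := by
    refine Finset.prod_image fun z hz z' hz' h => ?_
    rcases Sym2.eq_iff.1 h with h | h
    · exact h.1
    · exact absurd (h.1 ▸ hz) (hg z' hz').1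
  rw [← e2]
  refine le_trans ?_ (mul_le_mul_left e1 _)
  rw [← Finset.prod_union]
  · refine Finset.prod_le_prod_of_subset_of_le_one' ?_ fun e _ _ => hf e
    intro e he
    rcases Finset.mem_union.1 he with h | h
    · obtain ⟨v, hv, rfl⟩ := Finset.mem_image.1 h
      exact mk_mem_edges.2 (hD.2.2 v hv)
    · obtain ⟨v, hv, rfl⟩ := Finset.mem_image.1 h
      exact mk_mem_edges.2 (hg v hv).2
  · refine Finset.disjoint_left.2 fun e he he' => ?_
    obtain ⟨v, hv, rfl⟩ := Finset.mem_image.1 he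
    obtain ⟨z, hz, h⟩ := Finset.mem_image.1 he'
    rcases Sym2.eq_iff.1 h with h | h
    · exact Finset.disjoint_left.1 hDL hv (h.1 ▸ hz)
    · exact Finset.disjoint_left.1 hDL (hD.1 v hv) (h.1 ▸ hz)

/-- The basic estimate: a two-matching on `D`, leaves `L`, and vertices `S` confined to a set `X`
bound an integral over the copies of `H`. -/
theorem lintegral_edges_le {H : SimpleGraph V} {D L S : Finset V} {π g : V → V}
    (hD : IsTwoMatching H D π) (hDL : Disjoint D L) (hSD : Disjoint S D) (hSL : Disjoint S L)
    (hg : ∀ z ∈ L, g z ∉ L ∧ H.Adj z (g z)) (f : Sym2 V → (V → Ω) → ℝ≥0∞)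
    (hfm : ∀ e, Measurable (f e)) (hf : ∀ e x, f e x ≤ 1)
    (hdep : ∀ e v, v ∉ e → ∀ x t, f e (update x v t) = f e x) (X : Set Ω) (hX : MeasurableSet X)
    (d : V → ℝ≥0∞) (hd : ∀ z ∈ L, ∀ x, ∫⁻ t, f s(z, g z) (update x z t) ∂μ ≤ d z) :
    ∫⁻ x, (∏ e ∈ edges H, f e x) * ∏ s ∈ S, X.indicator 1 (x s) ∂Measure.pi (fun _ => μ) ≤
      (∏ v ∈ D, (∫⁻ x, f s(v, π v) x ∂Measure.pi (fun _ => μ)) ^ (1 / 2 : ℝ)) *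
        (∏ z ∈ L, d z) * μ X ^ S.card := by
  obtain ⟨ω⟩ := μ.nonempty_of_neZero
  set h : V → (V → Ω) → ℝ≥0∞ := fun v x =>
    if v ∈ D then f s(v, π v) x else X.indicator 1 (x v) with hh
  set w : V → ℝ := fun v => if v ∈ D then 1 / 2 else 1 with hw
  have hSD' : ∀ v ∈ S, v ∉ D := fun v hv => Finset.disjoint_left.1 hSD hv
  have hhm : ∀ v, Measurable (h v) := by
    intro v
    simp only [hh]
    split_ifs
    · exact hfm _
    · exact (measurable_one.indicator hX).comp (measurable_pi_apply v)
  have hprod : ∀ x, ∏ v ∈ D ∪ S, h v x ^ w v =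
      (∏ v ∈ D, f s(v, π v) x ^ (1 / 2 : ℝ)) * ∏ s ∈ S, X.indicator 1 (x s) := by
    intro x
    rw [Finset.prod_union hSD.symm]
    congr 1
    · exact Finset.prod_congr rfl fun v hv => by simp [hh, hw, hv]
    · exact Finset.prod_congr rfl fun v hv => by simp [hh, hw, hSD' v hv]
  have hdeph : ∀ v z, (v ∈ D → z ≠ v ∧ z ≠ π v) → (v ∉ D → z ≠ v) → ∀ x t,
      h v (update x z t) = h v x := by
    intro v z h1 h2 x t
    simp only [hh]
    split_ifs with hv
    · refine hdep _ _ ?_ x t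
      rw [Sym2.mem_iff]; have := h1 hv; tauto
    · rw [Function.update_of_ne (h2 hv).symm]
  have step1 : ∀ x, (∏ e ∈ edges H, f e x) * ∏ s ∈ S, X.indicator 1 (x s) ≤
      (∏ v ∈ D ∪ S, h v x ^ w v) * ∏ z ∈ L, f s(z, g z) x := by
    intro x
    rw [hprod, mul_right_comm]
    gcongr
    exact prod_edges_le hD hDL hg (fun e => f e x) (fun e => hf e x)
  refine (lintegral_mono step1).trans ?_
  refine (lintegral_mul_prod_leaves L _
    (Finset.measurable_prod _ fun v _ => (hhm v).pow_const _) ?_ (fun z => f s(z, g z))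
    (fun z _ => hfm _) ?_ d hd).trans ?_
  · intro z hz x t
    refine Finset.prod_congr rfl fun v hv => ?_
    congr 1
    refine hdeph v z ?_ ?_ x t
    · intro hvD
      constructor
      · rintro rfl; exact Finset.disjoint_left.1 hDL hvD hz
      · rintro rfl; exact Finset.disjoint_left.1 hDL (hD.1 v hvD) hz
    · intro hvD
      rintro rfl
      exact Finset.disjoint_left.1 hSL ((Finset.mem_union.1 hv).resolve_left hvD) hz
  · intro z hz z' hz' hne x t
    refine hdep _ _ ?_ x t
    rw [Sym2.mem_iff]
    rintro (rfl | rfl)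
    · exact hne rfl
    · exact (hg z hz).1 hz'
  · rw [mul_comm, mul_right_comm]
    gcongr
    rw [lintegral_eq_lmarginal_univ (fun _ => ω)]
    -- Each vertex of `D` lies in two arcs, of exponent `1 / 2` each, and each vertex of `S` in a single
    -- factor of exponent `1`, so the exponents at a vertex have sum at most `1`.
    refine (lmarginal_prod_rpow_le Finset.univ (D ∪ S) w ?_
      (fun v => if v ∈ D then {v, π v} else {v}) ?_ h (fun i _ => hhm i) ?_ _).trans ?_
    · intro v _; simp only [hw]; split_ifs <;> norm_num
    · intro u
      by_cases hu : u ∈ D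
      · obtain ⟨u', hu', rfl⟩ := hD.surj u hu
        have hsub : ((D ∪ S).filter fun i => π u' ∈ if i ∈ D then ({i, π i} : Finset V) else {i}) ⊆
            {π u', u'} := by
          intro i hi
          rw [Finset.mem_filter] at hi
          by_cases hiD : i ∈ D
          · simp only [hiD, if_true, Finset.mem_insert, Finset.mem_singleton] at hi ⊢
            rcases hi.2 with h | h
            · exact Or.inl h.symm
            · exact Or.inr (hD.2.1 hiD hu' h.symm)
          · simp only [hiD, if_false, Finset.mem_singleton] at hi
            exact absurd (hi.2 ▸ hu) hiD
        refine (Finset.sum_le_sum_of_subset_of_nonneg hsub fun i _ _ => ?_).trans ?_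
        · simp only [hw]; split_ifs <;> norm_num
        · rw [Finset.sum_pair (hD.2.2 u' hu').ne.symm]
          simp only [hw, hu', hu, if_true]; norm_num
      · have hsub : ((D ∪ S).filter fun i => u ∈ if i ∈ D then ({i, π i} : Finset V) else {i}) ⊆
            {u} := by
          intro i hi
          rw [Finset.mem_filter] at hi
          by_cases hiD : i ∈ D
          · simp only [hiD, if_true, Finset.mem_insert, Finset.mem_singleton] at hi ⊢
            rcases hi.2 with h | h
            · exact h.symm
            · exact absurd (h ▸ hD.1 i hiD) hu
          · simp only [hiD, if_false, Finset.mem_singleton] at hi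
            simp [hi.2]
        refine (Finset.sum_le_sum_of_subset_of_nonneg hsub fun i _ _ => ?_).trans ?_
        · simp only [hw]; split_ifs <;> norm_num
        · simp [hw, hu]
    · intro v hv z hz x t
      refine hdeph v z ?_ ?_ x t
      · intro h; simp only [h, if_true, Finset.mem_insert, Finset.mem_singleton] at hz; tauto
      · intro h; simpa only [h, if_false, Finset.mem_singleton] using hz
    · rw [Finset.prod_union hSD.symm]
      refine mul_le_mul' (Finset.prod_le_prod' fun v hv => ?_) ?_
      · rw [lmarginal_univ]; simp [hh, hw, hv]
      · rw [← Finset.prod_const]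
        refine Finset.prod_le_prod' fun v hv => ?_
        rw [lmarginal_univ]
        simp only [hh, hw, hSD' v hv, if_false, ENNReal.rpow_one]
        have hmp : MeasurePreserving (fun x : V → Ω => x v) (Measure.pi fun _ => μ) μ :=
          measurePreserving_eval _ v
        rw [hmp.lintegral_comp (f := X.indicator 1) (measurable_one.indicator hX),
          lintegral_indicator_one hX]

end Finner

/-! ### Expansion of homomorphism densities around the constant graphon -/

section Expansion

open scoped ENNReal
open Function (update)

variable {V : Type*} [Fintype V] [DecidableEq V]

theorem onPair_mk (F : SymKernel) (x y : unitInterval) : F.onPair s(x, y) = F.toFun x y := rfl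

theorem measurable_onPair_map (F : SymKernel) (e : Sym2 V) :
    Measurable fun x : V → unitInterval => F.onPair (e.map x) := by
  induction e using Sym2.ind with
  | _ u v =>
    simp only [Sym2.map_mk, onPair_mk]
    have h : Measurable fun x : V → unitInterval => (x u, x v) :=
      (measurable_pi_apply u).prodMk (measurable_pi_apply v)
    exact F.measurable'.comp h

theorem map_update_of_notMem {Ω : Type*} {e : Sym2 V} {v : V} (hv : v ∉ e) (x : V → Ω) (t : Ω) :
    e.map (update x v t) = e.map x := by
  refine Sym2.map_congr fun u hu => ?_
  rw [Function.update_of_ne]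
  rintro rfl; exact hv hu

theorem integrable_edgeProd (H : SimpleGraph V) {F : SymKernel} {C : ℝ}
    (hF : ∀ x y, |F.toFun x y| ≤ C) : Integrable (edgeProd H F) := by
  refine Integrable.of_bound (C := C ^ (edges H).card)
    (Finset.measurable_prod _ fun e _ => measurable_onPair_map F e).aestronglyMeasurable
    (Filter.Eventually.of_forall fun x => ?_)
  rw [edgeProd, norm_prod, ← Finset.prod_const]
  refine Finset.prod_le_prod (fun _ _ => norm_nonneg _) fun e _ => ?_
  induction e using Sym2.ind with
  | _ u v => exact hF _ _

theorem edges_fromEdgeSet {K : SimpleGraph V} {T : Finset (Sym2 V)} (hT : T ⊆ edges K) :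
    edges (SimpleGraph.fromEdgeSet (T : Set (Sym2 V))) = T := by
  ext e
  simp only [mem_edges, SimpleGraph.edgeSet_fromEdgeSet, Set.mem_sdiff, Finset.mem_coe,
    and_iff_left_iff_imp]
  intro he hd
  have := mem_edges.1 (hT he)
  exact K.not_isDiag_of_mem_edgeSet this (by simpa using hd)

theorem fromEdgeSet_edges (H : SimpleGraph V) :
    SimpleGraph.fromEdgeSet (edges H : Set (Sym2 V)) = H := by
  ext u v
  simp only [SimpleGraph.fromEdgeSet_adj, Finset.mem_coe, mk_mem_edges]
  exact ⟨fun h => h.1, fun h => ⟨h, h.ne⟩⟩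

theorem fromEdgeSet_le {K : SimpleGraph V} {T : Finset (Sym2 V)} (hT : T ⊆ edges K) :
    SimpleGraph.fromEdgeSet (T : Set (Sym2 V)) ≤ K := by
  intro u v h
  exact mk_mem_edges.1 (hT (SimpleGraph.fromEdgeSet_adj _ |>.1 h).1)

open Classical in
/-- Sums over the subgraphs of `K` are sums over sets of edges. -/
theorem sum_powerset_edges {M : Type*} [AddCommMonoid M] (K : SimpleGraph V)
    (f : Finset (Sym2 V) → M) :
    ∑ T ∈ (edges K).powerset, f T =
      ∑ H ∈ (Finset.univ : Finset (SimpleGraph V)) with H ≤ K, f (edges H) := by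
  symm
  refine Finset.sum_bij (fun H _ => edges H) ?_ ?_ ?_ fun _ _ => rfl
  · intro H hH
    exact Finset.mem_powerset.2 (edges_mono (Finset.mem_filter.1 hH).2)
  · intro G _ H _ h
    rw [← fromEdgeSet_edges G, h, fromEdgeSet_edges]
  · intro T hT
    rw [Finset.mem_powerset] at hT
    exact ⟨SimpleGraph.fromEdgeSet (T : Set (Sym2 V)), by simpa using fromEdgeSet_le hT,
      edges_fromEdgeSet hT⟩

open Classical in
/-- Expanding the product over the edges of `K` gives a sum over its subgraphs. -/
theorem hom_addConst (K : SimpleGraph V) (F : SymKernel) {C : ℝ} (hF : ∀ x y, |F.toFun x y| ≤ C)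
    (p : ℝ) : hom K (F.addConst p) =
      ∑ H ∈ (Finset.univ : Finset (SimpleGraph V)) with H ≤ K,
        p ^ ((edges K).card - (edges H).card) * hom H F := by
  have h1 : ∀ x, edgeProd K (F.addConst p) x =
      ∑ H ∈ (Finset.univ : Finset (SimpleGraph V)) with H ≤ K,
        p ^ ((edges K).card - (edges H).card) * edgeProd H F x := by
    intro x
    have h2 : edgeProd K (F.addConst p) x = ∏ e ∈ edges K, (F.onPair (e.map x) + p) := by
      refine Finset.prod_congr rfl fun e _ => ?_
      induction e using Sym2.ind with
      | _ u v => rfl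
    rw [h2, Finset.prod_add]
    rw [sum_powerset_edges K fun T => (∏ e ∈ T, F.onPair (e.map x)) * ∏ e ∈ edges K \ T, p]
    refine Finset.sum_congr rfl fun H hH => ?_
    rw [Finset.prod_const, Finset.card_sdiff_of_subset (edges_mono (Finset.mem_filter.1 hH).2),
      mul_comm]
    rfl
  simp only [hom, h1]
  rw [integral_finsetSum _ fun H _ => (integrable_edgeProd H hF).const_mul _]
  simp only [integral_const_mul]

theorem measurePreserving_update {Ω : Type*} [MeasurableSpace Ω] (μ : Measure Ω)
    [IsProbabilityMeasure μ] (z : V) :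
    MeasurePreserving (fun q : (V → Ω) × Ω => update q.1 z q.2)
      ((Measure.pi fun _ => μ).prod μ) (Measure.pi fun _ => μ) := by
  have hm : Measurable fun q : (V → Ω) × Ω => update q.1 z q.2 := measurable_update'.comp measurable_id
  refine ⟨hm, Measure.ext_of_lintegral _ fun f hf => ?_⟩
  have hfm : Measurable fun q : (V → Ω) × Ω => f (update q.1 z q.2) := hf.comp hm
  rw [lintegral_map hf hm, lintegral_prod _ hfm.aemeasurable, ← lintegral_pi_eq_update f hf z]

/-- The contribution of a graph with a vertex of degree `1` vanishes, as `F` has zero marginals. -/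
theorem hom_eq_zero {H : SimpleGraph V} (hH : ¬ MinDegTwo H) {F : SymKernel} {C : ℝ}
    (hF : ∀ x y, |F.toFun x y| ≤ C) (h0 : ∀ x, ∫ y, F.toFun x y = 0) : hom H F = 0 := by
  simp only [MinDegTwo, not_forall, not_le] at hH
  obtain ⟨v, hv, hdeg⟩ := hH
  obtain ⟨u, hu⟩ := mem_verts.1 hv
  have huu : ∀ x, H.Adj v x → x = u := by
    intro x hx
    have := Set.ncard_le_one (Set.toFinite (H.neighborSet v)) |>.1 (by omega)
    exact this x hx u hu
  have hmp := measurePreserving_update (volume : Measure unitInterval) v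
  have hint := integrable_edgeProd H hF
  rw [hom, volume_pi, ← hmp.map_eq]
  rw [volume_pi, ← hmp.map_eq] at hint
  have hint' : Integrable (fun q : (V → unitInterval) × unitInterval =>
      edgeProd H F (update q.1 v q.2)) ((Measure.pi fun _ => volume).prod volume) :=
    hint.comp_measurable hmp.measurable
  rw [integral_map hmp.measurable.aemeasurable hint.aestronglyMeasurable, integral_prod _ hint']
  have : ∀ x : V → unitInterval, ∫ t, edgeProd H F (update x v t) = 0 := by
    intro x
    have h1 : ∀ t, edgeProd H F (update x v t) =
        F.toFun (x u) t * ∏ e ∈ (edges H).erase s(u, v), F.onPair (e.map x) := by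
      intro t
      rw [edgeProd, ← Finset.mul_prod_erase _ _ (mk_mem_edges.2 hu.symm)]
      congr 1
      · simp [onPair_mk, Function.update_of_ne hu.ne.symm]
      · refine Finset.prod_congr rfl fun e he => ?_
        rw [map_update_of_notMem]
        intro hve
        rw [Finset.mem_erase] at he
        obtain ⟨y, rfl⟩ := hve
        have := huu y (mk_mem_edges.1 he.2)
        subst this
        exact he.1 Sym2.eq_swap
    simp only [h1]
    rw [integral_mul_const, h0, zero_mul]
  simp [this]

/-! ### Bounds for products of kernels -/

/-- The measurable kernel `k`, with the end at each vertex `v` of the edge `e` confined to `X v`. -/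
noncomputable def edgeFun (k : Sym2 V → Sym2 unitInterval → ℝ≥0∞) (X : V → Set unitInterval)
    (e : Sym2 V) (x : V → unitInterval) : ℝ≥0∞ :=
  {x : V → unitInterval | ∀ v ∈ e, x v ∈ X v}.indicator (fun x => k e (e.map x)) x

theorem edgeFun_eq {k : Sym2 V → Sym2 unitInterval → ℝ≥0∞} {X : V → Set unitInterval} {e : Sym2 V}
    {x : V → unitInterval} (h : ∀ v ∈ e, x v ∈ X v) : edgeFun k X e x = k e (e.map x) :=
  Set.indicator_of_mem (s := {x : V → unitInterval | ∀ v ∈ e, x v ∈ X v}) h _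

theorem edgeFun_eq_zero {k : Sym2 V → Sym2 unitInterval → ℝ≥0∞} {X : V → Set unitInterval}
    {e : Sym2 V} {x : V → unitInterval} (h : ¬ ∀ v ∈ e, x v ∈ X v) : edgeFun k X e x = 0 :=
  Set.indicator_of_notMem (s := {x : V → unitInterval | ∀ v ∈ e, x v ∈ X v}) h _

theorem lintegral_pair (k : Sym2 unitInterval → ℝ≥0∞) (hk : Measurable fun q : _ × _ => k s(q.1, q.2))
    {X Y : Set unitInterval} (hX : MeasurableSet X) (hY : MeasurableSet Y) {u v : V} (huv : u ≠ v) :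
    ∫⁻ x : V → unitInterval, {x : V → unitInterval | x u ∈ X ∧ x v ∈ Y}.indicator
      (fun x => k s(x u, x v)) x = ∫⁻ a in X, ∫⁻ b in Y, k s(a, b) := by
  set F : (V → unitInterval) → ℝ≥0∞ := fun x =>
    {x : V → unitInterval | x u ∈ X ∧ x v ∈ Y}.indicator (fun x => k s(x u, x v)) x with hF
  have hFm : Measurable F := by
    have h : Measurable fun x : V → unitInterval => (x u, x v) :=
      (measurable_pi_apply u).prodMk (measurable_pi_apply v)
    refine Measurable.indicator (f := fun x : V → unitInterval => k s(x u, x v)) (hk.comp h) ?_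
    exact (measurable_pi_apply u hX).inter (measurable_pi_apply v hY)
  have hFm' : Measurable fun x => ∫⁻ t, F (update x v t) := by
    have : (fun x => ∫⁻ t, F (update x v t)) = lmarginal (fun _ => volume) {v} F := by
      rw [lmarginal_singleton]
    rw [this]; exact hFm.lmarginal _
  rw [volume_pi, lintegral_pi_eq_update F hFm v, lintegral_pi_eq_update _ hFm' u]
  have h1 : ∀ (x : V → unitInterval) a b, F (update (update x u a) v b) =
      X.indicator (fun a => Y.indicator (fun b => k s(a, b)) b) a := by
    intro x a b
    have e1 : update (update x u a) v b u = a := by simp [Function.update_of_ne huv]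
    have e2 : update (update x u a) v b v = b := by simp
    by_cases h : a ∈ X ∧ b ∈ Y
    · rw [Set.indicator_of_mem h.1, Set.indicator_of_mem h.2]
      simp only [hF]
      rw [Set.indicator_of_mem, e1, e2]
      show _ ∈ X ∧ _ ∈ Y
      rwa [e1, e2]
    · simp only [hF]
      rw [Set.indicator_of_notMem]
      · by_cases ha : a ∈ X
        · rw [Set.indicator_of_mem ha, Set.indicator_of_notMem fun hb => h ⟨ha, hb⟩]
        · rw [Set.indicator_of_notMem ha]
      · show ¬ (_ ∈ X ∧ _ ∈ Y)
        rwa [e1, e2]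
  simp only [h1, lintegral_const, measure_univ, mul_one]
  rw [← lintegral_indicator hX]
  refine lintegral_congr fun a => ?_
  by_cases ha : a ∈ X
  · simp only [Set.indicator_of_mem ha]
    rw [lintegral_indicator hY]
  · simp [Set.indicator_of_notMem ha]

/-- The estimate `lintegral_edges_le` for symmetric kernels: `N` bounds the masses of the kernels
on the arcs of a two-matching, `d` the degrees of the kernels at the leaves, and `b` the measure of
the set `Y` containing the positions of the vertices of `S`. -/
theorem lintegral_edgeFun_le {H : SimpleGraph V} {D L S : Finset V} {π g : V → V}
    (hD : IsTwoMatching H D π) (hDL : Disjoint D L) (hSD : Disjoint S D) (hSL : Disjoint S L)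
    (hg : ∀ z ∈ L, g z ∉ L ∧ H.Adj z (g z)) (k : Sym2 V → Sym2 unitInterval → ℝ≥0∞)
    (hkm : ∀ e, Measurable fun q : _ × _ => k e s(q.1, q.2)) (hk : ∀ e q, k e q ≤ 1)
    (X : V → Set unitInterval) (hX : ∀ v, MeasurableSet (X v)) (N d : V → ℝ) (b : ℝ)
    (hb : 0 ≤ b) (hN0 : ∀ v, 0 ≤ N v) (hd0 : ∀ v, 0 ≤ d v)
    (hN : ∀ v ∈ D, ∫⁻ a in X v, ∫⁻ c in X (π v), k s(v, π v) s(a, c) ≤ ENNReal.ofReal (N v))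
    (hd : ∀ z ∈ L, ∀ a ∈ X (g z), ∫⁻ t, k s(z, g z) s(t, a) ≤ ENNReal.ofReal (d z))
    (Y : Set unitInterval) (hY : MeasurableSet Y) (hYb : volume Y ≤ ENNReal.ofReal b) :
    ∫⁻ x : V → unitInterval, (∏ e ∈ edges H, edgeFun k X e x) * ∏ s ∈ S, Y.indicator 1 (x s) ≤
      ENNReal.ofReal ((∏ v ∈ D, N v ^ (1 / 2 : ℝ)) * (∏ z ∈ L, d z) * b ^ S.card) := by
  have hmem : ∀ e : Sym2 V, MeasurableSet {x : V → unitInterval | ∀ v ∈ e, x v ∈ X v} := by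
    intro e
    induction e using Sym2.ind with
    | _ u v =>
      simp only [Sym2.mem_iff, forall_eq_or_imp, forall_eq]
      exact (measurable_pi_apply u (hX u)).inter (measurable_pi_apply v (hX v))
  have hfm : ∀ e, Measurable (edgeFun k X e) := by
    intro e
    refine Measurable.indicator ?_ (hmem e)
    induction e using Sym2.ind with
    | _ u v =>
      have h : Measurable fun x : V → unitInterval => (x u, x v) :=
        (measurable_pi_apply u).prodMk (measurable_pi_apply v)
      exact (hkm s(u, v)).comp h
  have hf1 : ∀ e x, edgeFun k X e x ≤ 1 := by
    intro e x
    refine (Set.indicator_le_self _ _ _).trans (hk _ _)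
  have hdep : ∀ e v, v ∉ e → ∀ x t, edgeFun k X e (update x v t) = edgeFun k X e x := by
    intro e v hv x t
    have h1 : (∀ u ∈ e, update x v t u ∈ X u) ↔ ∀ u ∈ e, x u ∈ X u := by
      refine forall₂_congr fun u hu => ?_
      rw [Function.update_of_ne]
      rintro rfl; exact hv hu
    by_cases h : ∀ u ∈ e, x u ∈ X u
    · rw [edgeFun_eq h, edgeFun_eq (h1.2 h), map_update_of_notMem hv]
    · rw [edgeFun_eq_zero h, edgeFun_eq_zero (mt h1.1 h)]
  have h := lintegral_edges_le (μ := (volume : Measure unitInterval)) hD hDL hSD hSL hg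
    (edgeFun k X) hfm hf1 hdep Y hY (fun z => ENNReal.ofReal (d z)) ?_
  · rw [volume_pi]
    refine h.trans ?_
    rw [ENNReal.ofReal_mul (mul_nonneg (Finset.prod_nonneg fun v _ => Real.rpow_nonneg (hN0 v) _)
      (Finset.prod_nonneg fun v _ => hd0 v)), ENNReal.ofReal_mul
      (Finset.prod_nonneg fun v _ => Real.rpow_nonneg (hN0 v) _),
      ENNReal.ofReal_prod_of_nonneg fun v _ => Real.rpow_nonneg (hN0 v) _,
      ENNReal.ofReal_prod_of_nonneg fun v _ => hd0 v, ENNReal.ofReal_pow hb]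
    refine mul_le_mul' (mul_le_mul' (Finset.prod_le_prod' fun v hv => ?_) le_rfl)
      (pow_le_pow_left' hYb _)
    rw [← ENNReal.ofReal_rpow_of_nonneg (hN0 v) (by norm_num)]
    refine ENNReal.rpow_le_rpow ?_ (by norm_num)
    refine le_trans (le_of_eq ?_) (hN v hv)
    rw [← lintegral_pair (k s(v, π v)) (hkm _) (hX v) (hX (π v)) (hD.2.2 v hv).ne, volume_pi]
    refine lintegral_congr fun x => ?_
    have : {x : V → unitInterval | ∀ u ∈ s(v, π v), x u ∈ X u} =
        {x | x v ∈ X v ∧ x (π v) ∈ X (π v)} := by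
      ext x; simp
    simp only [edgeFun, this, Sym2.map_mk]
  · intro z hz x
    have hzg := (hg z hz).2.ne
    by_cases hx : x (g z) ∈ X (g z)
    · refine le_trans (lintegral_mono fun t => ?_) (hd z hz _ hx)
      refine (Set.indicator_le_self _ _ _).trans (le_of_eq ?_)
      simp [Function.update_of_ne hzg.symm]
    · have h0 : ∀ t, edgeFun k X s(z, g z) (update x z t) = 0 := fun t => by
        refine edgeFun_eq_zero fun hall => ?_
        have := hall (g z) (by simp)
        rw [Function.update_of_ne hzg.symm] at this
        exact hx this
      simp [h0]

end Expansion

/-! ### Entropy estimates -/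

section Entropy

open scoped ENNReal

theorem sub_le_one_sub_mul_log {p x : ℝ} (hp1 : p < 1) (hx1 : x ≤ 1) :
    p - x ≤ (1 - x) * Real.log ((1 - x) / (1 - p)) := by
  rcases hx1.eq_or_lt with rfl | hx
  · simp; linarith
  · have h1 : 0 < (1 - x) / (1 - p) := div_pos (by linarith) (by linarith)
    have h2 := Real.one_sub_inv_le_log_of_pos h1
    have h3 : (1 - x) * (1 - ((1 - x) / (1 - p))⁻¹) = p - x := by
      have : (1 - x) ≠ 0 := by linarith
      rw [inv_div]; field_simp; ring
    rw [← h3]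
    exact mul_le_mul_of_nonneg_left h2 (by linarith)

/-- The relative entropy is at least the squared Hellinger distance. -/
theorem sqrt_sub_sq_le_entropyFn {p x : ℝ} (hp : 0 < p) (hp1 : p < 1) (hx0 : 0 ≤ x) (hx1 : x ≤ 1) :
    (√x - √p) ^ 2 ≤ entropyFn p x := by
  have h1 := sub_le_one_sub_mul_log hp1 hx1
  have h2 : 2 * x - 2 * (√x * √p) ≤ x * Real.log (x / p) := by
    rcases hx0.eq_or_lt with rfl | hx
    · simp
    · have h3 : 0 < √(x / p) := Real.sqrt_pos.2 (div_pos hx hp)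
      have h4 := Real.one_sub_inv_le_log_of_pos h3
      have h5 : Real.log (x / p) = 2 * Real.log √(x / p) := by
        rw [Real.log_sqrt (div_pos hx hp).le]; ring
      have h6 : x * (√(x / p))⁻¹ = √x * √p := by
        rw [Real.sqrt_div hx.le, inv_div]
        have hs : √x ≠ 0 := (Real.sqrt_pos.2 hx).ne'
        field_simp
        rw [Real.sq_sqrt hx.le]
      rw [h5]
      nlinarith [mul_le_mul_of_nonneg_left h4 hx.le]
  have h3 : (√x - √p) ^ 2 = x - 2 * (√x * √p) + p := by
    rw [sub_sq, Real.sq_sqrt hx0, Real.sq_sqrt hp.le]; ring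
  rw [h3, entropyFn]
  linarith

theorem entropyFn_nonneg {p x : ℝ} (hp : 0 < p) (hp1 : p < 1) (hx0 : 0 ≤ x) (hx1 : x ≤ 1) :
    0 ≤ entropyFn p x :=
  (sq_nonneg _).trans (sqrt_sub_sq_le_entropyFn hp hp1 hx0 hx1)

/-- Values that are at least `a` cost entropy at rate at least `log (a / p) - 1`. -/
theorem mul_log_sub_one_le_entropyFn {p a x : ℝ} (hp : 0 < p) (hp1 : p < 1) (ha : 0 < a) (hax : a ≤ x)
    (hx1 : x ≤ 1) : x * (Real.log (a / p) - 1) ≤ entropyFn p x := by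
  have h1 := sub_le_one_sub_mul_log hp1 hx1
  have h2 : Real.log (a / p) ≤ Real.log (x / p) :=
    Real.log_le_log (div_pos ha hp) (by gcongr)
  have h3 := mul_le_mul_of_nonneg_left h2 (ha.trans_le hax).le
  rw [entropyFn]
  nlinarith

/-- Values at distance more than `p ^ (1 + k)` from `p` cost entropy at least of order
`p ^ (1 + 2 k)`. -/
theorem rpow_le_entropyFn {p x k : ℝ} (hp : 0 < p) (hp1 : p < 1) (hk : 0 ≤ k) (hx0 : 0 ≤ x)
    (hx1 : x ≤ 1) (h : p ^ (1 + k) < |x - p|) : p ^ (1 + 2 * k) / 9 ≤ entropyFn p x := by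
  refine le_trans ?_ (sqrt_sub_sq_le_entropyFn hp hp1 hx0 hx1)
  have hs : 0 ≤ √x := Real.sqrt_nonneg x
  have hq : 0 < √p := Real.sqrt_pos.2 hp
  have hsx := Real.sq_sqrt hx0
  have hsp := Real.sq_sqrt hp.le
  have hpk : p ^ (1 + 2 * k) ≤ p := by
    calc p ^ (1 + 2 * k) ≤ p ^ (1 : ℝ) :=
          Real.rpow_le_rpow_of_exponent_ge hp hp1.le (by linarith)
      _ = p := Real.rpow_one p
  -- For `x ≤ 4 p` the difference `√x - √p` is comparable to `(x - p) / √p`; for larger `x` it is at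
  -- least `√p`.
  by_cases hx : x ≤ 4 * p
  · have h1 : √x ≤ 2 * √p := by
      rw [Real.sqrt_le_left (by positivity)]
      nlinarith
    have h2 : (x - p) ^ 2 ≤ (√x - √p) ^ 2 * (9 * p) := by
      have : (x - p) = (√x - √p) * (√x + √p) := by nlinarith
      rw [this, mul_pow]
      gcongr
      nlinarith
    have h3 : p ^ (1 + 2 * k) * p ≤ (x - p) ^ 2 := by
      calc p ^ (1 + 2 * k) * p = (p ^ (1 + k)) ^ 2 := by
            rw [← Real.rpow_natCast, ← Real.rpow_mul hp.le]
            nth_rewrite 2 [← Real.rpow_one p]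
            rw [← Real.rpow_add hp]
            congr 1; push_cast; ring
        _ ≤ |x - p| ^ 2 := by gcongr
        _ = _ := sq_abs _
    have h4 : p ^ (1 + 2 * k) * p ≤ ((√x - √p) ^ 2 * 9) * p := by linarith
    have h5 := le_of_mul_le_mul_right h4 hp
    linarith
  · push Not at hx
    have h1 : 2 * √p ≤ √x := by
      rw [Real.le_sqrt (by positivity) hx0]
      nlinarith
    nlinarith

theorem continuous_entropyFn {p : ℝ} (hp : 0 < p) (hp1 : p < 1) : Continuous (entropyFn p) := by
  have h : entropyFn p = fun x => (x * Real.log x - x * Real.log p) +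
      ((1 - x) * Real.log (1 - x) - (1 - x) * Real.log (1 - p)) := by
    have key : ∀ y q : ℝ, 0 < q → y * Real.log (y / q) = y * Real.log y - y * Real.log q := by
      intro y q hq
      rcases eq_or_ne y 0 with rfl | hy
      · simp
      · rw [Real.log_div hy hq.ne']; ring
    ext x
    rw [entropyFn, key x p hp, key (1 - x) (1 - p) (by linarith)]
  rw [h]
  have h1 := Real.continuous_mul_log
  have h2 : Continuous fun x : ℝ => (1 - x) * Real.log (1 - x) :=
    h1.comp (continuous_const.sub continuous_id)
  fun_prop

theorem exists_entropyFn_le {p : ℝ} (hp : 0 < p) (hp1 : p < 1) :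
    ∃ C, ∀ x, 0 ≤ x → x ≤ 1 → |entropyFn p x| ≤ C := by
  obtain ⟨C, hC⟩ := isCompact_Icc.exists_bound_of_continuousOn (s := Set.Icc (0 : ℝ) 1)
    (continuous_entropyFn hp hp1).continuousOn
  exact ⟨C, fun x h0 h1 => hC x ⟨h0, h1⟩⟩

theorem lintegral_lintegral_ofReal {g : unitInterval → unitInterval → ℝ}
    (hg : Measurable (Function.uncurry g)) {C : ℝ} (hC : ∀ a b, |g a b| ≤ C)
    (h0 : ∀ a b, 0 ≤ g a b) :
    ∫⁻ a, ∫⁻ b, ENNReal.ofReal (g a b) = ENNReal.ofReal (∫ a, ∫ b, g a b) := by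
  have hint : Integrable (Function.uncurry g) (volume.prod volume) :=
    Integrable.of_bound (C := C) hg.aestronglyMeasurable
      (Filter.Eventually.of_forall fun q => hC q.1 q.2)
  have h1 : ∫ a, ∫ b, g a b = ∫ q, Function.uncurry g q ∂(volume.prod volume) := by
    rw [integral_prod _ hint]; rfl
  have h2 : ∫⁻ a, ∫⁻ b, ENNReal.ofReal (g a b) =
      ∫⁻ q, ENNReal.ofReal (Function.uncurry g q) ∂(volume.prod volume) := by
    rw [lintegral_prod _ hg.ennreal_ofReal.aemeasurable]; rfl
  rw [h1, h2, ofReal_integral_eq_lintegral_ofReal hint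
    (Filter.Eventually.of_forall fun q => h0 q.1 q.2)]

theorem measurable_entropyFn_graphon {p : ℝ} (hp : 0 < p) (hp1 : p < 1) (W : Graphon) :
    Measurable (Function.uncurry fun a b => entropyFn p (W.toFun a b)) :=
  (continuous_entropyFn hp hp1).measurable.comp W.measurable'

theorem entropy_nonneg {p : ℝ} (hp : 0 < p) (hp1 : p < 1) (W : Graphon) : 0 ≤ entropy p W :=
  integral_nonneg fun _ => integral_nonneg fun _ =>
    entropyFn_nonneg hp hp1 (W.nonneg' _ _) (W.le_one' _ _)

/-- A kernel dominated pointwise by a multiple of the entropy density. -/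
theorem lintegral_le_of_le_entropyFn {p c : ℝ} (hp : 0 < p) (hp1 : p < 1) (hc : 0 ≤ c) (W : Graphon)
    (φ : ℝ → ℝ≥0∞) (h : ∀ x, 0 ≤ x → x ≤ 1 → φ x ≤ ENNReal.ofReal (c * entropyFn p x)) :
    ∫⁻ a, ∫⁻ b, φ (W.onPair s(a, b)) ≤ ENNReal.ofReal (c * entropy p W) := by
  have h1 : ∫⁻ a, ∫⁻ b, φ (W.onPair s(a, b)) ≤
      ∫⁻ a, ∫⁻ b, ENNReal.ofReal (c * entropyFn p (W.toFun a b)) :=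
    lintegral_mono fun a => lintegral_mono fun b => h _ (W.nonneg' a b) (W.le_one' a b)
  refine h1.trans (le_of_eq ?_)
  obtain ⟨C, hC⟩ := exists_entropyFn_le hp hp1
  rw [lintegral_lintegral_ofReal (C := c * C)]
  · simp only [integral_const_mul, entropy]
  · exact (measurable_entropyFn_graphon hp hp1 W).const_mul c
  · intro a b
    rw [abs_mul, abs_of_nonneg hc]
    exact mul_le_mul_of_nonneg_left (hC _ (W.nonneg' a b) (W.le_one' a b)) hc
  · intro a b
    exact mul_nonneg hc (entropyFn_nonneg hp hp1 (W.nonneg' _ _) (W.le_one' _ _))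

/-- The part of the value `x` above the threshold `a`. -/
noncomputable def bigPart (a x : ℝ) : ℝ≥0∞ := {x : ℝ | a ≤ x}.indicator ENNReal.ofReal x

theorem bigPart_of_le {a x : ℝ} (h : a ≤ x) : bigPart a x = ENNReal.ofReal x :=
  Set.indicator_of_mem (s := {x : ℝ | a ≤ x}) h _

theorem bigPart_of_lt {a x : ℝ} (h : x < a) : bigPart a x = 0 :=
  Set.indicator_of_notMem (s := {x : ℝ | a ≤ x}) (not_le.2 h) _

theorem bigPart_le (a x : ℝ) : bigPart a x ≤ ENNReal.ofReal x := Set.indicator_le_self _ _ _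

theorem measurable_bigPart (a : ℝ) : Measurable (bigPart a) :=
  ENNReal.measurable_ofReal.indicator measurableSet_Ici

/-- The total mass of the values above `a` is at most the entropy divided by `log (a / p) - 1`. -/
theorem mass_bigPart_le {p a : ℝ} (hp : 0 < p) (hp1 : p < 1) (ha : 0 < a)
    (hlog : 0 < Real.log (a / p) - 1) (W : Graphon) :
    ∫⁻ x, ∫⁻ y, bigPart a (W.onPair s(x, y)) ≤
      ENNReal.ofReal ((Real.log (a / p) - 1)⁻¹ * entropy p W) := by
  refine lintegral_le_of_le_entropyFn hp hp1 (inv_nonneg.2 hlog.le) W _ fun x h0 h1 => ?_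
  rcases le_or_gt a x with hx | hx
  · rw [bigPart_of_le hx]
    refine ENNReal.ofReal_le_ofReal ?_
    rw [inv_mul_eq_div, le_div_iff₀ hlog]
    exact mul_log_sub_one_le_entropyFn hp hp1 ha hx h1
  · rw [bigPart_of_lt hx]; exact bot_le

theorem degree_le {p : ℝ} {W : Graphon} (hW : IsRegular p W) (y : unitInterval) :
    ∫⁻ t, ENNReal.ofReal (W.onPair s(t, y)) ≤ ENNReal.ofReal p := by
  have hm : Measurable fun t => W.toFun y t := W.measurable'.comp measurable_prodMk_left
  have hint : Integrable fun t => W.toFun y t :=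
    Integrable.of_bound (C := 1) hm.aestronglyMeasurable
      (Filter.Eventually.of_forall fun t => by
        rw [Real.norm_eq_abs, abs_of_nonneg (W.nonneg' _ _)]; exact W.le_one' _ _)
  rw [← hW y, ofReal_integral_eq_lintegral_ofReal hint
    (Filter.Eventually.of_forall fun t => W.nonneg' _ _)]
  refine le_of_eq (lintegral_congr fun t => ?_)
  rw [onPair_mk, W.symm']

theorem degree_bigPart_le {p a : ℝ} {W : Graphon} (hW : IsRegular p W) (y : unitInterval) :
    ∫⁻ t, bigPart a (W.onPair s(t, y)) ≤ ENNReal.ofReal p :=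
  (lintegral_mono fun _ => bigPart_le _ _).trans (degree_le hW y)

theorem measurable_comp_onPair (W : Graphon) {φ : ℝ → ℝ≥0∞} (hφ : Measurable φ) :
    Measurable fun q : unitInterval × unitInterval => φ (W.onPair s(q.1, q.2)) :=
  hφ.comp W.measurable'

theorem onPair_mem (W : Graphon) (q : Sym2 unitInterval) : 0 ≤ W.onPair q ∧ W.onPair q ≤ 1 := by
  induction q using Sym2.ind with
  | _ x y => exact ⟨W.nonneg' x y, W.le_one' x y⟩

theorem bigPart_onPair_le_one (a : ℝ) (W : Graphon) (q : Sym2 unitInterval) :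
    bigPart a (W.onPair q) ≤ 1 :=
  (bigPart_le _ _).trans (ENNReal.ofReal_le_one.2 (onPair_mem W q).2)

end Entropy

/-! ### The part of the kernel with small values -/

section SmallValues

open scoped ENNReal

variable {V : Type*} [Fintype V] [DecidableEq V]

open Classical in
/-- `κ` is so small that `B κ` is at most all the gaps between exponents that occur for the
subgraphs of `K`: the gap `v(H) + γ c(H) - e(H)` for a subgraph `H` that does not attain the maximum
in the definition of `γ(K)`, and the gain of `exists_gain` for one that does. -/
def IsGoodExponent (K : SimpleGraph V) (B κ : ℝ) : Prop :=
  (∀ H ≤ K, ((edges H).card : ℝ) - (verts H).card ≠ gam K * coverNum H →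
    (edges H).card + B * κ ≤ (verts H).card + gam K * coverNum H) ∧
  ∀ H H₁ : SimpleGraph V, H ≤ K → MinDegTwo H → H₁ ≤ H → H₁ ≠ H →
    ((edges H₁).card : ℝ) - (verts H₁).card = gam K * coverNum H₁ →
    ∃ (D : Finset V) (π : V → V) (L : Finset V), IsTwoMatching H D π ∧ Disjoint D L ∧
      (∀ z ∈ L, ∃ u ∈ D, H₁.Adj z u) ∧
      ((edges H₁).card : ℝ) + B * κ ≤ L.card + D.card + gam K * D.card / 2 -
        (D.filter fun v => ¬ H₁.Adj v (π v)).card / 2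

theorem eventually_isGoodExponent {K : SimpleGraph V} (hγ : 0 < gam K)
    (hbad : ∀ H, IsContributing K H → ∀ e, ¬ IsBadEdge H e) (B : ℝ) :
    ∀ᶠ κ in 𝓝[>] (0 : ℝ), IsGoodExponent K B κ := by
  classical
  have key : ∀ a b : ℝ, a < b → ∀ᶠ κ in 𝓝[>] (0 : ℝ), a + B * κ ≤ b := by
    intro a b hab
    have h1 : Tendsto (fun κ : ℝ => a + B * κ) (𝓝[>] 0) (𝓝 (a + B * 0)) :=
      (Continuous.tendsto (by fun_prop) 0).mono_left nhdsWithin_le_nhds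
    rw [mul_zero, add_zero] at h1
    exact (h1.eventually (gt_mem_nhds hab)).mono fun κ h => h.le
  unfold IsGoodExponent
  simp only [eventually_and, eventually_all]
  constructor
  · intro H hH hne
    refine key _ _ ?_
    have := lt_of_le_of_ne (sub_le_gam_mul hH) hne
    linarith
  · intro H H₁ hH hmin h₁ hne hext
    obtain ⟨D, π, L, hD, hDL, hL, hlt⟩ := exists_gain hγ hbad hH hmin h₁ hne hext
    filter_upwards [key _ _ hlt] with κ hκ
    exact ⟨D, π, L, hD, hDL, hL, by convert hκ⟩

theorem prod_half_rpow_le {m p : ℝ} (hm : 1 ≤ m) (hp : 0 < p) (D : Finset V) (α : V → ℝ) :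
    ∏ v ∈ D, (m * p ^ α v) ^ (1 / 2 : ℝ) ≤
      m ^ Fintype.card V * p ^ ((∑ v ∈ D, α v) / 2) := by
  have h0 : 0 ≤ m := zero_le_one.trans hm
  have h1 : ∀ v, (m * p ^ α v) ^ (1 / 2 : ℝ) = m ^ (1 / 2 : ℝ) * p ^ (α v / 2) := by
    intro v
    rw [Real.mul_rpow h0 (Real.rpow_nonneg hp.le _), ← Real.rpow_mul hp.le]
    congr 2; ring
  simp only [h1]
  rw [Finset.prod_mul_distrib, Finset.prod_const, Finset.sum_div, Real.rpow_sum_of_pos hp]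
  refine mul_le_mul_of_nonneg_right ?_ (Finset.prod_nonneg fun _ _ => Real.rpow_nonneg hp.le _)
  have h2 : m ^ (1 / 2 : ℝ) ≤ m := by
    calc m ^ (1 / 2 : ℝ) ≤ m ^ (1 : ℝ) := Real.rpow_le_rpow_of_exponent_le hm (by norm_num)
      _ = m := Real.rpow_one m
  calc (m ^ (1 / 2 : ℝ)) ^ D.card ≤ m ^ D.card := by gcongr
    _ ≤ m ^ Fintype.card V := pow_le_pow_right₀ hm (Finset.card_le_univ D)

/-- `lintegral_edgeFun_le` for kernels whose masses are bounded by powers of `p`. -/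
theorem lintegral_kernels_le {H : SimpleGraph V} {D L : Finset V} {π : V → V}
    (hD : IsTwoMatching H D π) (hDL : Disjoint D L) {m p : ℝ} (hm : 1 ≤ m) (hp : 0 < p)
    (k : Sym2 V → Sym2 unitInterval → ℝ≥0∞)
    (hkm : ∀ e, Measurable fun q : _ × _ => k e s(q.1, q.2)) (hk : ∀ e q, k e q ≤ 1) (α : V → ℝ)
    (hN : ∀ v ∈ D, ∫⁻ a, ∫⁻ c, k s(v, π v) s(a, c) ≤ ENNReal.ofReal (m * p ^ α v))
    (hd : ∀ z ∈ L, ∃ u, u ∉ L ∧ H.Adj z u ∧ ∀ a, ∫⁻ t, k s(z, u) s(t, a) ≤ ENNReal.ofReal p) :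
    ∫⁻ x : V → unitInterval, ∏ e ∈ edges H, k e (e.map x) ≤
      ENNReal.ofReal (m ^ Fintype.card V * p ^ ((∑ v ∈ D, α v) / 2 + L.card)) := by
  choose! g hg1 hg2 hg3 using hd
  have h := lintegral_edgeFun_le (S := ∅) hD hDL (Finset.disjoint_empty_left _)
    (Finset.disjoint_empty_left _) (fun z hz => ⟨hg1 z hz, hg2 z hz⟩) k hkm hk (fun _ => Set.univ)
    (fun _ => MeasurableSet.univ) (fun v => m * p ^ α v) (fun _ => p) 0 le_rfl
    (fun v => by positivity) (fun _ => hp.le) (by simpa using hN)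
    (fun z hz a _ => hg3 z hz a) ∅ MeasurableSet.empty (by simp)
  have e1 : ∀ x : V → unitInterval, (∏ e ∈ edges H, edgeFun k (fun _ => Set.univ) e x) *
      ∏ s ∈ (∅ : Finset V), (∅ : Set unitInterval).indicator (1 : unitInterval → ℝ≥0∞) (x s) =
      ∏ e ∈ edges H, k e (e.map x) := by
    intro x
    rw [Finset.prod_empty, mul_one]
    exact Finset.prod_congr rfl fun e _ => edgeFun_eq fun _ _ => Set.mem_univ _
  simp only [e1] at h
  refine h.trans (ENNReal.ofReal_le_ofReal ?_)
  rw [Finset.card_empty, pow_zero, mul_one, Finset.prod_const, Real.rpow_add hp, ← mul_assoc,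
    Real.rpow_natCast]
  exact mul_le_mul_of_nonneg_right (prod_half_rpow_le hm hp D α) (by positivity)

theorem card_sdiff_verts {H : SimpleGraph V} {D : Finset V} (h : D ⊆ verts H) :
    ((verts H \ D).card : ℝ) = (verts H).card - D.card := by
  have : ((verts H \ D).card : ℝ) + D.card = (verts H).card := by
    exact_mod_cast Finset.card_sdiff_add_card_eq_card h
  linarith

/-- Large values alone contribute at most order `p ^ (v(H) + γ c(H))`: take a maximum two-matching, and
attach the remaining vertices to it as leaves, each of which contributes a factor `p`. -/
theorem lintegral_big_le (H : SimpleGraph V) {m p γ a : ℝ} (hm : 1 ≤ m) (hp : 0 < p) {W : Graphon}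
    (hW : IsRegular p W)
    (hmass : ∫⁻ x, ∫⁻ y, bigPart a (W.onPair s(x, y)) ≤ ENNReal.ofReal (m * p ^ (2 + γ))) :
    ∫⁻ x : V → unitInterval, ∏ e ∈ edges H, bigPart a (W.onPair (e.map x)) ≤
      ENNReal.ofReal (m ^ Fintype.card V * p ^ ((verts H).card + γ * coverNum H)) := by
  obtain ⟨D, π, hD, hc⟩ := exists_twoMatching H
  have h := lintegral_kernels_le (L := verts H \ D) hD Finset.disjoint_sdiff hm hp
    (fun _ q => bigPart a (W.onPair q)) (fun _ => measurable_comp_onPair W (measurable_bigPart a))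
    (fun _ q => bigPart_onPair_le_one a W q) (fun _ => 2 + γ) (fun v _ => hmass) (by
      intro z hz
      rw [Finset.mem_sdiff] at hz
      obtain ⟨u, hu⟩ := mem_verts.1 hz.1
      exact ⟨u, fun h => (Finset.mem_sdiff.1 h).2 (hD.mem_of_adj hc hu hz.2), hu,
        degree_bigPart_le hW⟩)
  refine h.trans (le_of_eq ?_)
  rw [card_sdiff_verts hD.subset_verts, Finset.sum_const, nsmul_eq_mul]
  congr 3
  rw [hc]; ring

/-- The set of values that differ from `p` by more than `b`. -/
noncomputable def farPart (p b x : ℝ) : ℝ≥0∞ := {x : ℝ | b < |x - p|}.indicator 1 x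

theorem farPart_of_lt {p b x : ℝ} (h : b < |x - p|) : farPart p b x = 1 :=
  Set.indicator_of_mem (s := {x : ℝ | b < |x - p|}) h _

theorem farPart_of_le {p b x : ℝ} (h : |x - p| ≤ b) : farPart p b x = 0 :=
  Set.indicator_of_notMem (s := {x : ℝ | b < |x - p|}) (not_lt.2 h) _

theorem farPart_le_one (p b x : ℝ) : farPart p b x ≤ 1 := Set.indicator_le_self _ _ _

theorem measurable_farPart (p b : ℝ) : Measurable (farPart p b) := by
  refine measurable_one.indicator ?_
  exact measurableSet_lt measurable_const (by fun_prop)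

/-- The deviation from `p` of the values below the threshold `a`. -/
noncomputable def smallPart (p a x : ℝ) : ℝ≥0∞ :=
  {x : ℝ | x < a}.indicator (fun x => ENNReal.ofReal |x - p|) x

theorem smallPart_of_lt {p a x : ℝ} (h : x < a) : smallPart p a x = ENNReal.ofReal |x - p| :=
  Set.indicator_of_mem (s := {x : ℝ | x < a}) h _

theorem measurable_smallPart (p a : ℝ) : Measurable (smallPart p a) := by
  refine Measurable.indicator ?_ measurableSet_Iio
  fun_prop

theorem smallPart_le {p a x : ℝ} (hx : 0 ≤ x) (ha : p ≤ a) (hp : 0 ≤ p) :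
    smallPart p a x ≤ ENNReal.ofReal a := by
  by_cases h : x < a
  · rw [smallPart_of_lt h]
    refine ENNReal.ofReal_le_ofReal (abs_le.2 ⟨by linarith, by linarith⟩)
  · rw [smallPart, Set.indicator_of_notMem (s := {x : ℝ | x < a}) h]; exact bot_le

theorem smallPart_le_abs {p a x : ℝ} : smallPart p a x ≤ ENNReal.ofReal |x - p| :=
  Set.indicator_le_self _ (fun x => ENNReal.ofReal |x - p|) _

theorem abs_sub_le_small_add_big {p a x : ℝ} (hp : 0 ≤ p) (ha : p ≤ a) :
    ENNReal.ofReal |x - p| ≤ smallPart p a x + bigPart a x := by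
  rcases lt_or_ge x a with h | h
  · rw [smallPart_of_lt h]; exact le_self_add
  · rw [bigPart_of_le h]
    refine le_trans (ENNReal.ofReal_le_ofReal ?_) le_add_self
    rw [abs_of_nonneg (by linarith)]; linarith

/-- The measure of the set of values far from `p`, in terms of the entropy. -/
theorem mass_farPart_le {p k : ℝ} (hp : 0 < p) (hp1 : p < 1) (hk : 0 ≤ k) (W : Graphon) :
    ∫⁻ x, ∫⁻ y, farPart p (p ^ (1 + k)) (W.onPair s(x, y)) ≤
      ENNReal.ofReal (9 * p ^ (-(1 + 2 * k)) * entropy p W) := by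
  refine lintegral_le_of_le_entropyFn hp hp1 (by positivity) W _ fun x h0 h1 => ?_
  rcases le_or_gt |x - p| (p ^ (1 + k)) with hx | hx
  · rw [farPart_of_le hx]; exact bot_le
  · rw [farPart_of_lt hx, ENNReal.one_le_ofReal, Real.rpow_neg hp.le]
    have h2 := rpow_le_entropyFn hp hp1 hk h0 h1 hx
    have h3 : 0 < p ^ (1 + 2 * k) := Real.rpow_pos_of_pos hp _
    rw [mul_assoc, inv_mul_eq_div]
    rw [div_le_iff₀ (by norm_num)] at h2
    rw [← mul_div_assoc, le_div_iff₀ h3]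
    linarith

/-- Products in which some edge carries a small value are negligible. Let `H₁` consist of the edges
with large values. If `H₁` does not attain the maximum in the definition of `γ(K)`, the large values
alone leave a gap. If it does, the set of points where the values on the other edges are not very
close to `p` is so small that the gain of `exists_gain` applies: an arc outside `H₁` has mass about
`p ^ (1 + γ)` instead of `p ^ (2 + γ)`, and each small value is at most `p ^ (1 - κ)`. -/
theorem lintegral_small_mul_big_le {K H : SimpleGraph V} (hHK : H ≤ K) (hmin : MinDegTwo H)
    {m p κ : ℝ} (hm : 1 ≤ m) (hp : 0 < p) (hp1 : p < 1) (hκ : 0 < κ)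
    (hgood : IsGoodExponent K (((edges K).card + 1) * (2 * Fintype.card V + 2)) κ)
    {W : Graphon} (hW : IsRegular p W)
    (hmass : ∫⁻ x, ∫⁻ y, bigPart (p ^ (1 - κ)) (W.onPair s(x, y)) ≤
      ENNReal.ofReal (m * p ^ (2 + gam K)))
    (hfar : ∫⁻ x, ∫⁻ y, farPart p (p ^ (1 + ((edges K).card + 1) * κ)) (W.onPair s(x, y)) ≤
      ENNReal.ofReal (m * p ^ (1 + gam K - 3 * (((edges K).card + 1) * κ))))
    {T : Finset (Sym2 V)} (hT : T ⊆ edges H) (hTne : T.Nonempty) :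
    ∫⁻ x : V → unitInterval, (∏ e ∈ T, smallPart p (p ^ (1 - κ)) (W.onPair (e.map x))) *
        ∏ e ∈ edges H \ T, bigPart (p ^ (1 - κ)) (W.onPair (e.map x)) ≤
      ENNReal.ofReal (((edges K).card + 1) * (m ^ Fintype.card V * p ^ ((edges H).card + κ))) := by
  classical
  set E : ℝ := ((edges K).card : ℝ) with hE
  set n : ℝ := (Fintype.card V : ℝ) with hn
  set a := p ^ (1 - κ) with ha
  set k := (E + 1) * κ with hk
  have hE0 : 0 ≤ E := Nat.cast_nonneg _
  have hn0 : 0 ≤ n := Nat.cast_nonneg _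
  have hpa : p ≤ a := by
    calc p = p ^ (1 : ℝ) := (Real.rpow_one p).symm
      _ ≤ a := Real.rpow_le_rpow_of_exponent_ge hp hp1.le (by linarith)
  have hTE : (T.card : ℝ) ≤ E := by
    rw [hE]; exact_mod_cast Finset.card_le_card (hT.trans (edges_mono hHK))
  set H₁ := SimpleGraph.fromEdgeSet ((edges H \ T : Finset (Sym2 V)) : Set (Sym2 V)) with hH₁
  have hsub : edges H \ T ⊆ edges H := Finset.sdiff_subset
  have hE₁ : edges H₁ = edges H \ T := edges_fromEdgeSet hsub
  have h₁ : H₁ ≤ H := fromEdgeSet_le hsub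
  have hne : H₁ ≠ H := by
    intro h
    obtain ⟨e, he⟩ := hTne
    have : e ∈ edges H₁ := by rw [h]; exact hT he
    rw [hE₁, Finset.mem_sdiff] at this
    exact this.2 he
  have hcard : ((edges H).card : ℝ) = T.card + (edges H₁).card := by
    have : (edges H \ T).card + T.card = (edges H).card := Finset.card_sdiff_add_card_eq_card hT
    rw [hE₁, ← this]; push_cast; ring
  have hgam₁ := sub_le_gam_mul (h₁.trans hHK)
  have hbig := lintegral_big_le (γ := gam K) H₁ hm hp hW hmass
  have hm0 : 0 ≤ m := zero_le_one.trans hm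
  set M := m ^ Fintype.card V with hM
  have hM0 : 0 ≤ M := by positivity
  have rp : ∀ r : ℝ, 0 < p ^ r := fun r => Real.rpow_pos_of_pos hp r
  have hbm : ∀ s : Finset (Sym2 V), Measurable fun x : V → unitInterval =>
      ∏ e ∈ s, bigPart a (W.onPair (e.map x)) := fun s =>
    Finset.measurable_prod _ fun e _ => (measurable_bigPart a).comp (measurable_onPair_map W.toSymKernel e)
  -- If some edge carries a value very close to `p`, the trivial bound suffices.
  have htiny : ∀ (x : V → unitInterval), ∀ e₀ ∈ T, |W.onPair (e₀.map x) - p| ≤ p ^ (1 + k) →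
      ∏ e ∈ T, smallPart p a (W.onPair (e.map x)) ≤ ENNReal.ofReal (p ^ (T.card + κ)) := by
    intro x e₀ he₀ hsm
    rw [← Finset.mul_prod_erase _ _ he₀]
    have h2 : ∏ e ∈ T.erase e₀, smallPart p a (W.onPair (e.map x)) ≤
        ENNReal.ofReal a ^ (T.card - 1) := by
      rw [← Finset.card_erase_of_mem he₀, ← Finset.prod_const]
      exact Finset.prod_le_prod' fun e _ => smallPart_le (onPair_mem W _).1 hpa hp.le
    have h3 : smallPart p a (W.onPair (e₀.map x)) ≤ ENNReal.ofReal (p ^ (1 + k)) :=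
      smallPart_le_abs.trans (ENNReal.ofReal_le_ofReal hsm)
    refine (mul_le_mul' h3 h2).trans ?_
    rw [← ENNReal.ofReal_pow (rp _).le, ← ENNReal.ofReal_mul (rp _).le]
    refine ENNReal.ofReal_le_ofReal ?_
    rw [← Real.rpow_mul_natCast hp.le, ← Real.rpow_add hp]
    refine Real.rpow_le_rpow_of_exponent_ge hp hp1.le ?_
    have : 1 ≤ T.card := Finset.card_pos.2 hTne
    rw [Nat.cast_sub this]
    push_cast
    nlinarith
  -- Otherwise each small value is bounded by the threshold `a` times the indicator of being far
  -- from `p`.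
  have hmid : ∀ (x : V → unitInterval), (∀ e ∈ T, p ^ (1 + k) < |W.onPair (e.map x) - p|) →
      ∏ e ∈ T, smallPart p a (W.onPair (e.map x)) ≤ ENNReal.ofReal (p ^ ((1 - κ) * T.card)) *
        ∏ e ∈ T, farPart p (p ^ (1 + k)) (W.onPair (e.map x)) := by
    intro x hx
    rw [Real.rpow_mul_natCast hp.le, ENNReal.ofReal_pow (rp _).le, ← Finset.prod_const,
      ← Finset.prod_mul_distrib]
    refine Finset.prod_le_prod' fun e he => ?_
    rw [farPart_of_lt (hx e he), mul_one]
    exact smallPart_le (onPair_mem W _).1 hpa hp.le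
  have hpt : ∀ x : V → unitInterval, (∏ e ∈ T, smallPart p a (W.onPair (e.map x))) *
      ∏ e ∈ edges H \ T, bigPart a (W.onPair (e.map x)) ≤
      ENNReal.ofReal (p ^ (T.card + κ)) * ∏ e ∈ edges H₁, bigPart a (W.onPair (e.map x)) +
      ENNReal.ofReal (p ^ ((1 - κ) * T.card)) *
        ((∏ e ∈ T, farPart p (p ^ (1 + k)) (W.onPair (e.map x))) *
          ∏ e ∈ edges H \ T, bigPart a (W.onPair (e.map x))) := by
    intro x
    by_cases h : ∃ e₀ ∈ T, |W.onPair (e₀.map x) - p| ≤ p ^ (1 + k)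
    · obtain ⟨e₀, he₀, hsm⟩ := h
      rw [hE₁]
      exact (mul_le_mul' (htiny x e₀ he₀ hsm) le_rfl).trans le_self_add
    · push Not at h
      refine le_trans ?_ le_add_self
      rw [← mul_assoc]
      exact mul_le_mul' (hmid x h) le_rfl
  have hfm : Measurable fun x : V → unitInterval =>
      ∏ e ∈ T, farPart p (p ^ (1 + k)) (W.onPair (e.map x)) :=
    Finset.measurable_prod _ fun e _ =>
      (measurable_farPart _ _).comp (measurable_onPair_map W.toSymKernel e)
  have step1 : ENNReal.ofReal (p ^ (T.card + κ)) *
      ∫⁻ x : V → unitInterval, ∏ e ∈ edges H₁, bigPart a (W.onPair (e.map x)) ≤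
      ENNReal.ofReal (M * p ^ ((edges H).card + κ)) := by
    refine (mul_le_mul' le_rfl hbig).trans ?_
    rw [← ENNReal.ofReal_mul (rp _).le]
    refine ENNReal.ofReal_le_ofReal ?_
    rw [mul_left_comm, ← Real.rpow_add hp]
    refine mul_le_mul_of_nonneg_left ?_ hM0
    refine Real.rpow_le_rpow_of_exponent_ge hp hp1.le ?_
    linarith
  have step2 : ENNReal.ofReal (p ^ ((1 - κ) * T.card)) *
      ∫⁻ x : V → unitInterval, (∏ e ∈ T, farPart p (p ^ (1 + k)) (W.onPair (e.map x))) *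
          ∏ e ∈ edges H \ T, bigPart a (W.onPair (e.map x)) ≤
      ENNReal.ofReal (M * p ^ ((edges H).card + κ)) := by
    -- The exponents `2 + γ` and `1 + γ - 3 k` belong to arcs inside and outside `H₁`.
    by_cases hext : ((edges H₁).card : ℝ) - (verts H₁).card = gam K * coverNum H₁
    · obtain ⟨D, π, L, hD, hDL, hL, hgain⟩ := hgood.2 H H₁ hHK hmin h₁ hne hext
      have hb := lintegral_kernels_le hD hDL hm hp
        (fun e q => if e ∈ T then farPart p (p ^ (1 + k)) (W.onPair q) else
          bigPart a (W.onPair q)) ?_ ?_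
        (fun v => if H₁.Adj v (π v) then 2 + gam K else 1 + gam K - 3 * k) ?_ ?_
      · have e1 : ∀ x : V → unitInterval,
            (∏ e ∈ T, farPart p (p ^ (1 + k)) (W.onPair (e.map x))) *
              ∏ e ∈ edges H \ T, bigPart a (W.onPair (e.map x)) =
            ∏ e ∈ edges H, if e ∈ T then farPart p (p ^ (1 + k)) (W.onPair (e.map x)) else
              bigPart a (W.onPair (e.map x)) := by
          intro x
          rw [← Finset.prod_sdiff hT, mul_comm]
          congr 1
          · exact Finset.prod_congr rfl fun e he => by simp [(Finset.mem_sdiff.1 he).2]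
          · exact Finset.prod_congr rfl fun e he => by simp [he]
        simp only [e1]
        refine (mul_le_mul' le_rfl hb).trans ?_
        rw [← ENNReal.ofReal_mul (rp _).le]
        refine ENNReal.ofReal_le_ofReal ?_
        rw [mul_left_comm, ← Real.rpow_add hp]
        refine mul_le_mul_of_nonneg_left ?_ hM0
        refine Real.rpow_le_rpow_of_exponent_ge hp hp1.le ?_
        rw [Finset.sum_ite, Finset.sum_const, Finset.sum_const, nsmul_eq_mul, nsmul_eq_mul]
        set j : ℝ := ((D.filter fun v => ¬ H₁.Adj v (π v)).card : ℝ) with hj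
        have hsplit : ((D.filter fun v => H₁.Adj v (π v)).card : ℝ) = D.card - j := by
          have := Finset.card_filter_add_card_filter_not (s := D) (fun v => H₁.Adj v (π v))
          rw [hj, ← this]; push_cast; ring
        have hjn : j ≤ n := by
          rw [hj, hn]; exact_mod_cast Finset.card_le_univ _
        have hj0 : 0 ≤ j := Nat.cast_nonneg _
        rw [hsplit]
        have h5 : (E + 1) * κ * j ≤ (E + 1) * κ * n := by gcongr
        have h6 : κ * T.card ≤ κ * E := by gcongr
        have h7 : 0 ≤ (E + 1) * κ * n := by positivity
        have h8 : 0 ≤ E * κ := by positivity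
        have hgain' : ((edges H₁).card : ℝ) + (E + 1) * (2 * n + 2) * κ ≤
            L.card + D.card + gam K * D.card / 2 - j / 2 := by
          rw [hj]; convert hgain
        rw [hk]
        nlinarith
      · intro e
        by_cases he : e ∈ T
        · simp only [he, if_true]; exact measurable_comp_onPair W (measurable_farPart _ _)
        · simp only [he, if_false]; exact measurable_comp_onPair W (measurable_bigPart _)
      · intro e q
        by_cases he : e ∈ T
        · simp only [he, if_true]; exact farPart_le_one _ _ _
        · simp only [he, if_false]; exact bigPart_onPair_le_one _ _ _
      · intro v hv
        by_cases h : H₁.Adj v (π v)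
        · have h' : s(v, π v) ∉ T := by
            have := mk_mem_edges.2 h
            rw [hE₁, Finset.mem_sdiff] at this
            exact this.2
          simp only [h, h', if_true, if_false]; exact hmass
        · have h' : s(v, π v) ∈ T := by
            by_contra h'
            refine h (mk_mem_edges.1 ?_)
            rw [hE₁, Finset.mem_sdiff]
            exact ⟨mk_mem_edges.2 (hD.2.2 v hv), h'⟩
          simp only [h, h', if_true, if_false]; exact hfar
      · intro z hz
        obtain ⟨u, hu, hzu⟩ := hL z hz
        refine ⟨u, Finset.disjoint_left.1 hDL hu, h₁ hzu, fun b => ?_⟩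
        have h' : s(z, u) ∉ T := by
          have := mk_mem_edges.2 hzu
          rw [hE₁, Finset.mem_sdiff] at this
          exact this.2
        simp only [h', if_false]
        exact degree_bigPart_le hW b
    · have hgap := hgood.1 H₁ (h₁.trans hHK) hext
      have e1 : ∫⁻ x : V → unitInterval, (∏ e ∈ T, farPart p (p ^ (1 + k)) (W.onPair (e.map x))) *
          ∏ e ∈ edges H \ T, bigPart a (W.onPair (e.map x)) ≤
          ENNReal.ofReal (M * p ^ ((verts H₁).card + gam K * coverNum H₁)) := by
        refine le_trans (lintegral_mono fun x => ?_) hbig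
        rw [hE₁]
        refine (mul_le_mul' (Finset.prod_le_one' fun e _ => farPart_le_one _ _ _) le_rfl).trans ?_
        rw [one_mul]
      refine (mul_le_mul' le_rfl e1).trans ?_
      rw [← ENNReal.ofReal_mul (rp _).le]
      refine ENNReal.ofReal_le_ofReal ?_
      rw [mul_left_comm, ← Real.rpow_add hp]
      refine mul_le_mul_of_nonneg_left ?_ hM0
      refine Real.rpow_le_rpow_of_exponent_ge hp hp1.le ?_
      have h6 : κ * T.card ≤ κ * E := by gcongr
      have h7 : 0 ≤ (E + 1) * κ * n := by positivity
      nlinarith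
  have hE1 : 1 ≤ E := by
    have : 1 ≤ T.card := Finset.card_pos.2 hTne
    have : (1 : ℝ) ≤ T.card := by exact_mod_cast this
    linarith
  have hfbm : Measurable fun x : V → unitInterval =>
      (∏ e ∈ T, farPart p (p ^ (1 + k)) (W.onPair (e.map x))) *
        ∏ e ∈ edges H \ T, bigPart a (W.onPair (e.map x)) := hfm.mul (hbm _)
  refine (lintegral_mono hpt).trans ?_
  rw [lintegral_add_left ((hbm _).const_mul _), lintegral_const_mul _ (hbm _),
    lintegral_const_mul _ hfbm]
  refine (add_le_add step1 step2).trans ?_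
  rw [← ENNReal.ofReal_add (by positivity) (by positivity)]
  refine ENNReal.ofReal_le_ofReal ?_
  have : 0 ≤ M * p ^ ((edges H).card + κ) := by positivity
  nlinarith

/-- Up to a negligible error, only large values of `W` matter. -/
theorem lintegral_abs_le {K H : SimpleGraph V} (hHK : H ≤ K) (hmin : MinDegTwo H)
    {m p κ : ℝ} (hm : 1 ≤ m) (hp : 0 < p) (hp1 : p < 1) (hκ : 0 < κ)
    (hgood : IsGoodExponent K (((edges K).card + 1) * (2 * Fintype.card V + 2)) κ)
    {W : Graphon} (hW : IsRegular p W)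
    (hmass : ∫⁻ x, ∫⁻ y, bigPart (p ^ (1 - κ)) (W.onPair s(x, y)) ≤
      ENNReal.ofReal (m * p ^ (2 + gam K)))
    (hfar : ∫⁻ x, ∫⁻ y, farPart p (p ^ (1 + ((edges K).card + 1) * κ)) (W.onPair s(x, y)) ≤
      ENNReal.ofReal (m * p ^ (1 + gam K - 3 * (((edges K).card + 1) * κ)))) :
    ∫⁻ x : V → unitInterval, ∏ e ∈ edges H, ENNReal.ofReal |W.onPair (e.map x) - p| ≤
      (∫⁻ x : V → unitInterval, ∏ e ∈ edges H, bigPart (p ^ (1 - κ)) (W.onPair (e.map x))) +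
      ENNReal.ofReal (2 ^ (edges K).card *
        (((edges K).card + 1) * (m ^ Fintype.card V * p ^ ((edges H).card + κ)))) := by
  set a := p ^ (1 - κ) with ha
  have hpa : p ≤ a := by
    calc p = p ^ (1 : ℝ) := (Real.rpow_one p).symm
      _ ≤ a := Real.rpow_le_rpow_of_exponent_ge hp hp1.le (by linarith)
  set F : Finset (Sym2 V) → (V → unitInterval) → ℝ≥0∞ := fun T x =>
    (∏ e ∈ T, smallPart p a (W.onPair (e.map x))) *
      ∏ e ∈ edges H \ T, bigPart a (W.onPair (e.map x)) with hF
  have hFm : ∀ T, Measurable (F T) := fun T =>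
    (Finset.measurable_prod _ fun e _ =>
      (measurable_smallPart _ _).comp (measurable_onPair_map W.toSymKernel e)).mul
    (Finset.measurable_prod _ fun e _ =>
      (measurable_bigPart _).comp (measurable_onPair_map W.toSymKernel e))
  have h1 : ∀ x : V → unitInterval, ∏ e ∈ edges H, ENNReal.ofReal |W.onPair (e.map x) - p| ≤
      (∏ e ∈ edges H, bigPart a (W.onPair (e.map x))) +
        ∑ T ∈ (edges H).powerset.erase ∅, F T x := by
    intro x
    -- Split every factor into its small and its large part, and expand the product.
    refine (Finset.prod_le_prod' fun e _ => abs_sub_le_small_add_big hp.le hpa).trans ?_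
    rw [Finset.prod_add, ← Finset.add_sum_erase _ _ (Finset.empty_mem_powerset (edges H))]
    simp [hF]
  refine (lintegral_mono h1).trans ?_
  have hbm : Measurable fun x : V → unitInterval =>
      ∏ e ∈ edges H, bigPart a (W.onPair (e.map x)) := Finset.measurable_prod _ fun e _ =>
    (measurable_bigPart _).comp (measurable_onPair_map W.toSymKernel e)
  rw [lintegral_add_left hbm,
    lintegral_finsetSum _ fun T _ => hFm T]
  gcongr
  refine (Finset.sum_le_card_nsmul _ _ (ENNReal.ofReal
    (((edges K).card + 1) * (m ^ Fintype.card V * p ^ ((edges H).card + κ)))) fun T hT => ?_).trans ?_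
  · rw [Finset.mem_erase, Finset.mem_powerset] at hT
    exact lintegral_small_mul_big_le hHK hmin hm hp hp1 hκ hgood hW hmass hfar hT.2
      (Finset.nonempty_iff_ne_empty.2 hT.1)
  · rw [nsmul_eq_mul, ← ENNReal.ofReal_natCast, ← ENNReal.ofReal_mul (Nat.cast_nonneg _)]
    refine ENNReal.ofReal_le_ofReal ?_
    have h2 : (0 : ℝ) ≤ ((edges K).card + 1) * (m ^ Fintype.card V * p ^ ((edges H).card + κ)) := by
      have : 0 ≤ m := zero_le_one.trans hm
      have := Real.rpow_pos_of_pos hp ((edges H).card + κ)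
      positivity
    refine mul_le_mul_of_nonneg_right ?_ h2
    have h3 : ((edges H).powerset.erase ∅).card ≤ 2 ^ (edges K).card := by
      refine (Finset.card_erase_le).trans ?_
      rw [Finset.card_powerset]
      exact Nat.pow_le_pow_right (by norm_num) (Finset.card_le_card (edges_mono hHK))
    exact_mod_cast h3

end SmallValues

/-! ### Hubs and the contributing subgraphs -/

section Hubs

open scoped ENNReal

variable {V : Type*} [Fintype V] [DecidableEq V]

/-- Every vertex is covered by some maximum two-matching. -/
theorem exists_twoMatching_mem {H : SimpleGraph V} {v : V} (hv : v ∈ verts H) :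
    ∃ D π, IsTwoMatching H D π ∧ (D.card : ℝ) = 2 * coverNum H ∧ v ∈ D := by
  classical
  obtain ⟨A, C, D, π, hhc, hD, hDc, hmin, hcard⟩ := exists_halfCover_twoMatching H
  by_cases hvD : v ∈ D
  · exact ⟨D, π, hD, hDc, hvD⟩
  obtain ⟨e1, e2⟩ := hD.slack hDc hmin
  have hCA : ∀ x ∈ C, x ∉ A := fun x hx => Finset.disjoint_right.1 hhc.2.2.1 hx
  have fA : ∀ x ∈ A, halfFun A C x = 1 := fun x hx => by simp [halfFun, hx]
  have fC : ∀ x ∈ C, halfFun A C x = 1 / 2 := fun x hx => by simp [halfFun, hx, hCA x hx]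
  have fZ : ∀ x, x ∉ A → x ∉ C → halfFun A C x = 0 := fun x h h' => by simp [halfFun, h, h']
  have hv0 := e2 v hv hvD
  have hvA : v ∉ A := fun h => by rw [fA v h] at hv0; norm_num at hv0
  have hvC : v ∉ C := fun h => by rw [fC v h] at hv0; norm_num at hv0
  obtain ⟨a, ha⟩ := mem_verts.1 hv
  have haA : a ∈ A := by
    rcases hhc.2.2.2 v a ha with h | h | h
    · exact absurd h hvA
    · exact h
    · exact absurd h.1 hvC
  have hAD : ∀ x ∈ A, x ∈ D := by
    intro x hx; by_contra h
    have := e2 x (hhc.1 hx) h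
    rw [fA x hx] at this; norm_num at this
  have hCD : ∀ x ∈ C, x ∈ D := by
    intro x hx; by_contra h
    have := e2 x (hhc.2.1 hx) h
    rw [fC x hx] at this; norm_num at this
  have hπA : ∀ x ∈ A, π x ∉ A ∧ π x ∉ C := by
    intro x hx
    have h := e1 x (hAD x hx)
    rw [fA x hx] at h
    constructor
    · intro h'; rw [fA _ h'] at h; norm_num at h
    · intro h'; rw [fC _ h'] at h; norm_num at h
  have hπC : ∀ x ∈ C, π x ∈ C := by
    intro x hx
    have h := e1 x (hCD x hx)
    rw [fC x hx] at h
    by_contra h'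
    by_cases h'' : π x ∈ A
    · rw [fA _ h''] at h; norm_num at h
    · rw [fZ _ h'' h'] at h; norm_num at h
  -- Rematch `a` to `v`, and keep the other partners.
  have hallA : ∀ s ⊆ A, s.card ≤ (s.biUnion fun x => Finset.univ.filter fun z =>
      (H.Adj x z ∧ (x = a → z = v)) ∧ z ∉ A ∧ z ∉ C).card := by
    intro s hs
    have hinj : Set.InjOn (fun x => if x = a then v else π x) s := by
      intro x hx y hy hxy
      have hne : ∀ x ∈ s, π x ≠ v := fun x hx h => hvD (h ▸ hD.1 x (hAD x (hs hx)))
      by_cases h1 : x = a <;> by_cases h2 : y = a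
      · rw [h1, h2]
      · simp only [h1, h2, if_true, if_false] at hxy
        exact absurd hxy.symm (hne y hy)
      · simp only [h1, h2, if_true, if_false] at hxy
        exact absurd hxy (hne x hx)
      · simp only [h1, h2, if_false] at hxy
        exact hD.2.1 (hAD x (hs hx)) (hAD y (hs hy)) hxy
    rw [← Finset.card_image_of_injOn hinj]
    refine Finset.card_le_card fun z hz => ?_
    obtain ⟨x, hx, rfl⟩ := Finset.mem_image.1 hz
    simp only [Finset.mem_biUnion, Finset.mem_filter, Finset.mem_univ, true_and]
    refine ⟨x, hx, ?_⟩
    by_cases hxa : x = a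
    · subst hxa; simp [ha.symm, hvA, hvC]
    · simp [hxa, hD.2.2 x (hAD x (hs hx)), hπA x (hs hx)]
  have hallC : ∀ s ⊆ C, s.card ≤ (s.biUnion fun x => Finset.univ.filter fun z =>
      (H.Adj x z ∧ (x = a → z = v)) ∧ z ∈ C).card := by
    intro s hs
    rw [← Finset.card_image_of_injOn (s := s) (f := π) fun x hx y hy h =>
      hD.2.1 (hCD x (hs hx)) (hCD y (hs hy)) h]
    refine Finset.card_le_card fun z hz => ?_
    obtain ⟨x, hx, rfl⟩ := Finset.mem_image.1 hz
    simp only [Finset.mem_biUnion, Finset.mem_filter, Finset.mem_univ, true_and]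
    exact ⟨x, hx, ⟨hD.2.2 x (hCD x (hs hx)), fun h => absurd haA (h ▸ hCA x (hs hx))⟩,
      hπC x (hs hx)⟩
  obtain ⟨D', π', hD', hc', hR⟩ := exists_twoMatching_of_hall (H := H) hhc.2.2.1
    (fun x y => H.Adj x y ∧ (x = a → y = v)) (fun _ _ h => h.1) hallA hallC
  have hc'' : (D'.card : ℝ) = 2 * coverNum H := by rw [hc']; push_cast; linarith
  have haD : a ∈ D' := by
    by_contra h
    have := (hD'.slack hc'' hmin).2 a (hhc.1 haA) h
    rw [fA a haA] at this; norm_num at this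
  refine ⟨D', π', hD', hc'', ?_⟩
  rcases hR a haD with ⟨_, h, _⟩ | ⟨_, _, h⟩ | ⟨h, _⟩
  · exact h.2 rfl ▸ hD'.1 a haD
  · exact absurd haA h
  · exact absurd haA (hCA a h)

theorem measurable_edgeFun {k : Sym2 V → Sym2 unitInterval → ℝ≥0∞}
    (hkm : ∀ e, Measurable fun q : _ × _ => k e s(q.1, q.2))
    {X : V → Set unitInterval} (hX : ∀ v, MeasurableSet (X v)) (e : Sym2 V) :
    Measurable (edgeFun k X e) := by
  induction e using Sym2.ind with
  | _ u v =>
    refine Measurable.indicator ?_ ?_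
    · have h : Measurable fun x : V → unitInterval => (x u, x v) :=
        (measurable_pi_apply u).prodMk (measurable_pi_apply v)
      exact (hkm s(u, v)).comp h
    · simp only [Sym2.mem_iff, forall_eq_or_imp, forall_eq]
      exact (measurable_pi_apply u (hX u)).inter (measurable_pi_apply v (hX v))

theorem prod_half_pow {H : SimpleGraph V} {D : Finset V} (hc : (D.card : ℝ) = 2 * coverNum H)
    {p γ : ℝ} (hp : 0 < p) (y : V → ℝ) (hy : ∀ v, 0 ≤ y v) :
    ∏ v ∈ D, (y v * p ^ (2 + γ)) ^ (1 / 2 : ℝ) =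
      (∏ v ∈ D, y v ^ (1 / 2 : ℝ)) * p ^ ((2 + γ) * coverNum H) := by
  have h : ∀ v ∈ D, (y v * p ^ (2 + γ)) ^ (1 / 2 : ℝ) =
      y v ^ (1 / 2 : ℝ) * p ^ ((2 + γ) / 2) := by
    intro v _
    rw [Real.mul_rpow (hy v) (Real.rpow_nonneg hp.le _), ← Real.rpow_mul hp.le]
    congr 2; ring
  rw [Finset.prod_congr rfl h, Finset.prod_mul_distrib, Finset.prod_const,
    ← Real.rpow_mul_natCast hp.le, hc]
  congr 2; ring

/-- The copies of `H` in which exactly the vertices of the valid set `S` are hubs, where `A` is the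
set of hubs and `B` the set of points of low degree. By `IsValid.arcs`, there are `2 |S|` arcs with
one end in `A`, and all the other arcs have both ends in `B`. -/
theorem lintegral_valid_le {H : SimpleGraph V} {S : Finset V} (hS : IsValid H S)
    {φ : Sym2 unitInterval → ℝ≥0∞} (hφm : Measurable fun q : _ × _ => φ s(q.1, q.2))
    (hφ1 : ∀ q, φ q ≤ 1) {p γ z w : ℝ} (hp : 0 < p) (hz : 0 ≤ z) (hw : 0 ≤ w)
    (hd : ∀ a, ∫⁻ t, φ s(t, a) ≤ ENNReal.ofReal p) {A B : Set unitInterval}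
    (hA : MeasurableSet A) (hB : MeasurableSet B)
    (hmA : ∫⁻ a in A, ∫⁻ t, φ s(a, t) ≤ ENNReal.ofReal (z * p ^ (2 + γ)))
    (hmB : ∫⁻ a in B, ∫⁻ t in B, φ s(a, t) ≤ ENNReal.ofReal (w * p ^ (2 + γ))) :
    ∫⁻ x : V → unitInterval,
        ∏ e ∈ edges H, edgeFun (fun _ => φ) (fun v => if v ∈ S then A else B) e x ≤
      ENNReal.ofReal (z ^ S.card * w ^ (coverNum H - S.card) *
        p ^ ((verts H).card + γ * coverNum H)) := by
  obtain ⟨D, π, hD, hc⟩ := exists_twoMatching H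
  obtain ⟨hSD, hind, hcount⟩ := hS.arcs hD hc
  set X : V → Set unitInterval := fun v => if v ∈ S then A else B with hX
  have hXm : ∀ v, MeasurableSet (X v) := fun v => by
    simp only [hX]; split_ifs <;> assumption
  have hg : ∀ z, ∃ u, z ∈ verts H \ D → H.Adj z u := by
    intro z
    by_cases h : z ∈ verts H \ D
    · obtain ⟨u, hu⟩ := mem_verts.1 (Finset.mem_sdiff.1 h).1
      exact ⟨u, fun _ => hu⟩
    · exact ⟨z, fun h' => absurd h' h⟩
  choose g hg using hg
  set y : V → ℝ := fun v => if v ∈ S ∨ π v ∈ S then z else w with hy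
  have hy0 : ∀ v, 0 ≤ y v := fun v => by simp only [hy]; split_ifs <;> assumption
  have hswap : ∀ s : Set unitInterval, ∫⁻ a in s, ∫⁻ t in A, φ s(a, t) ≤
      ENNReal.ofReal (z * p ^ (2 + γ)) := by
    intro s
    refine le_trans ?_ hmA
    rw [lintegral_lintegral_swap hφm.aemeasurable]
    refine lintegral_mono fun a => ?_
    simp only [Sym2.eq_swap (b := a)]
    exact setLIntegral_le_lintegral _ _
  have h := lintegral_edgeFun_le (S := ∅) (g := g) hD (L := verts H \ D) Finset.disjoint_sdiff
    (Finset.disjoint_empty_left _) (Finset.disjoint_empty_left _)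
    (fun z hz => ⟨fun h => (Finset.mem_sdiff.1 h).2
      (hD.mem_of_adj hc (hg z hz) (Finset.mem_sdiff.1 hz).2), hg z hz⟩) (fun _ => φ)
    (fun _ => hφm) (fun _ => hφ1) X hXm (fun v => y v * p ^ (2 + γ)) (fun _ => p) 0 le_rfl
    (fun v => mul_nonneg (hy0 v) (Real.rpow_nonneg hp.le _)) (fun _ => hp.le) (by
      intro v hv
      by_cases h1 : v ∈ S
      · simp only [hX, hy, h1, if_true, true_or]
        exact (lintegral_mono fun a => setLIntegral_le_lintegral _ _).trans hmA
      · by_cases h2 : π v ∈ S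
        · simp only [hX, hy, h1, h2, if_true, if_false, or_true]
          exact hswap B
        · simp only [hX, hy, h1, h2, if_false, or_false]
          exact hmB)
    (fun z _ a _ => hd a) ∅ MeasurableSet.empty (by simp)
  simp only [Finset.prod_empty, mul_one] at h
  refine h.trans (ENNReal.ofReal_le_ofReal (le_of_eq ?_))
  rw [Finset.card_empty, pow_zero, mul_one, Finset.prod_const, prod_half_pow hc hp y hy0]
  have e1 : ∏ v ∈ D, y v ^ (1 / 2 : ℝ) = z ^ S.card * w ^ (coverNum H - S.card) := by
    have e2 : ∀ v, y v ^ (1 / 2 : ℝ) =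
        if v ∈ S ∨ π v ∈ S then z ^ (1 / 2 : ℝ) else w ^ (1 / 2 : ℝ) := fun v => by
      simp only [hy]; split_ifs <;> rfl
    simp only [e2]
    rw [Finset.prod_ite, Finset.prod_const, Finset.prod_const, hcount, pow_mul]
    have e3 := Finset.card_filter_add_card_filter_not (s := D) (fun v => v ∈ S ∨ π v ∈ S)
    have e4 : ((D.filter fun v => ¬ (v ∈ S ∨ π v ∈ S)).card : ℝ) = 2 * coverNum H - 2 * S.card := by
      rw [← hc, ← e3, hcount]; push_cast; ring
    congr 1
    · congr 1
      rw [← Real.rpow_mul_natCast hz]; norm_num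
    · rw [← Real.rpow_mul_natCast hw, e4]
      congr 1; ring
  rw [e1, mul_assoc, ← Real.rpow_natCast p, ← Real.rpow_add hp,
    card_sdiff_verts hD.subset_verts, hc]
  congr 2; ring

/-- Value `1` on `S` completes a cover of the rest to a cover of `H`. -/
theorem coverNum_le_card_add_deleteVerts {H : SimpleGraph V} {S : Finset V} (hSH : S ⊆ verts H) :
    coverNum H ≤ S.card + coverNum (deleteVerts H S) := by
  obtain ⟨A, C, -, -, hhc, -, -, -, hcard⟩ := exists_halfCover_twoMatching (deleteVerts H S)
  have hsub : ∀ v ∈ verts (deleteVerts H S), v ∈ verts H \ S := fun v hv =>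
    Finset.mem_sdiff.2 (verts_deleteVerts hv)
  have hsum := sum_halfFun (S := verts H \ S) (fun v hv => hsub v (hhc.1 hv))
    (fun v hv => hsub v (hhc.2.1 hv)) hhc.2.2.1
  have hcov : IsFracVertexCover H fun v => if v ∈ S then 1 else halfFun A C v := by
    have h0 : ∀ v, 0 ≤ if v ∈ S then 1 else halfFun A C v := fun v => by
      unfold halfFun; split_ifs <;> norm_num
    refine ⟨fun v _ => h0 v, fun u v huv => ?_⟩
    have hu := h0 u
    have hv := h0 v
    by_cases h1 : u ∈ S
    · simp only [h1, if_true] at hu ⊢; linarith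
    · by_cases h2 : v ∈ S
      · simp only [h2, if_true] at hv ⊢; linarith
      · simp only [h1, h2, if_false]
        exact hhc.isFracVertexCover.2 u v ⟨huv, h1, h2⟩
  refine (coverNum_le hcov).trans (le_of_eq ?_)
  rw [← Finset.sum_sdiff hSH, Finset.sum_congr rfl fun v hv =>
    if_neg (Finset.mem_sdiff.1 hv).2, hsum, Finset.sum_congr rfl fun v hv => if_pos hv, hcard]
  simp [add_comm]

/-- The copies of `H` in which the set `S` of hubs is not valid are negligible. Each hub contributes
its measure, of order `p ^ (1 + γ)`, and the rest of `H` is estimated separately. If the cover number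
of the rest is larger than `c(H) - |S|`, this gains a factor `p ^ (γ / 2)`. Otherwise, since `S` is
not valid, a maximum two-matching of the rest misses a vertex; it is a leaf attached to a point of
low degree, which gains a factor `η`. -/
theorem lintegral_not_valid_le {H : SimpleGraph V} {S : Finset V} (hSH : S ⊆ verts H)
    (hS : ¬ IsValid H S)
    {φ : Sym2 unitInterval → ℝ≥0∞} (hφm : Measurable fun q : _ × _ => φ s(q.1, q.2))
    (hφ1 : ∀ q, φ q ≤ 1) {p γ m b η : ℝ} (hp : 0 < p) (hp1 : p ≤ 1) (hγ : 0 ≤ γ) (hm : 1 ≤ m)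
    (hb : 1 ≤ b) (hη : 0 ≤ η)
    (hd : ∀ a, ∫⁻ t, φ s(t, a) ≤ ENNReal.ofReal p) {A B : Set unitInterval}
    (hA : MeasurableSet A) (hB : MeasurableSet B)
    (hmass : ∫⁻ a, ∫⁻ t, φ s(a, t) ≤ ENNReal.ofReal (m * p ^ (2 + γ)))
    (hAb : volume A ≤ ENNReal.ofReal (b * p ^ (1 + γ)))
    (hBd : ∀ a ∈ B, ∫⁻ t, φ s(t, a) ≤ ENNReal.ofReal (η * p)) :
    ∫⁻ x : V → unitInterval,
        ∏ e ∈ edges H, edgeFun (fun _ => φ) (fun v => if v ∈ S then A else B) e x ≤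
      ENNReal.ofReal ((m * b) ^ Fintype.card V * (p ^ (γ / 2) + η) *
        p ^ ((verts H).card + γ * coverNum H)) := by
  set H' := deleteVerts H S with hH'
  obtain ⟨D, π, hD', hc⟩ := exists_twoMatching H'
  have hD := hD'.mono (deleteVerts_le H S)
  have hDH : D ⊆ verts H := hD.subset_verts
  have hSD : Disjoint S D :=
    Finset.disjoint_right.2 fun v hv => (verts_deleteVerts (hD'.subset_verts hv)).2
  set L := verts H \ (S ∪ D) with hL
  have hLm : ∀ z, z ∈ L ↔ z ∈ verts H ∧ z ∉ S ∧ z ∉ D := fun z => by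
    simp [hL, Finset.mem_sdiff, Finset.mem_union]
  set X : V → Set unitInterval := fun v => if v ∈ S then A else B with hX
  have hXm : ∀ v, MeasurableSet (X v) := fun v => by
    simp only [hX]; split_ifs <;> assumption
  have hg : ∀ z, ∃ u, z ∈ L → u ∉ L ∧ H.Adj z u ∧ (z ∈ verts H' → u ∉ S) := by
    intro z
    by_cases hz : z ∈ L
    · obtain ⟨hz1, hz2, hz3⟩ := (hLm z).1 hz
      by_cases h : z ∈ verts H'
      · obtain ⟨u, hu⟩ := mem_verts.1 h
        have huD := hD'.mem_of_adj hc hu hz3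
        exact ⟨u, fun _ => ⟨fun h => ((hLm u).1 h).2.2 huD, hu.1, fun _ => hu.2.2⟩⟩
      · obtain ⟨u, hu⟩ := mem_verts.1 hz1
        have huS : u ∈ S := by
          by_contra huS
          exact h (left_mem_verts (H := H') (v := u) ⟨hu, hz2, huS⟩)
        exact ⟨u, fun _ => ⟨fun h => ((hLm u).1 h).2.1 huS, hu, fun h' => absurd h' h⟩⟩
    · exact ⟨z, fun h => absurd h hz⟩
  choose g hg using hg
  have hm0 : 0 ≤ m := zero_le_one.trans hm
  have hb0 : 0 ≤ b := zero_le_one.trans hb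
  have hLcard : (L.card : ℝ) = (verts H).card - S.card - 2 * coverNum H' := by
    have h1 : ((verts H \ (S ∪ D)).card : ℝ) + (S ∪ D).card = (verts H).card := by
      exact_mod_cast Finset.card_sdiff_add_card_eq_card (Finset.union_subset hSH hDH)
    rw [Finset.card_union_of_disjoint hSD] at h1
    push_cast at h1
    rw [hL, ← hc]; linarith
  set n := Fintype.card V with hn
  -- Every vertex of `S` has an edge, so its position is confined to `A`.
  have hind : ∀ x : V → unitInterval, ∏ e ∈ edges H, edgeFun (fun _ => φ) X e x ≤
      (∏ e ∈ edges H, edgeFun (fun _ => φ) X e x) * ∏ s ∈ S, A.indicator 1 (x s) := by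
    intro x
    by_cases h : ∀ s ∈ S, x s ∈ A
    · rw [Finset.prod_congr rfl fun s hs => Set.indicator_of_mem (h s hs) _]
      simp
    · push Not at h
      obtain ⟨s, hs, hxs⟩ := h
      obtain ⟨u, hu⟩ := mem_verts.1 (hSH hs)
      rw [Finset.prod_eq_zero (mk_mem_edges.2 hu)]
      · exact bot_le
      · refine edgeFun_eq_zero fun hall => hxs ?_
        have := hall s (by simp)
        simpa only [hX, hs, if_true] using this
  have main : ∀ d : V → ℝ, (∀ z, 0 ≤ d z) → (∀ z ∈ L, ∀ a ∈ X (g z), ∫⁻ t, φ s(t, a) ≤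
      ENNReal.ofReal (d z)) → ∀ r, ∏ z ∈ L, d z = r * p ^ L.card → 0 ≤ r →
      ∫⁻ x : V → unitInterval, ∏ e ∈ edges H, edgeFun (fun _ => φ) X e x ≤
        ENNReal.ofReal ((m * b) ^ n *
          (r * p ^ ((verts H).card + γ * (S.card + coverNum H')))) := by
    intro d hd0 hd1 r hr hr0
    have h := lintegral_edgeFun_le (S := S) (g := g) hD (L := L)
      (Finset.disjoint_left.2 fun v hv hv' => ((hLm v).1 hv').2.2 hv) hSD
      (Finset.disjoint_left.2 fun v hv hv' => ((hLm v).1 hv').2.1 hv)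
      (fun z hz => ⟨(hg z hz).1, (hg z hz).2.1⟩) (fun _ => φ)
      (fun _ => hφm) (fun _ => hφ1) X hXm (fun v => m * p ^ (2 + γ)) d (b * p ^ (1 + γ))
      (by positivity) (fun v => by positivity) hd0 (fun v hv =>
        ((lintegral_mono fun a => setLIntegral_le_lintegral _ _).trans
          (setLIntegral_le_lintegral _ _)).trans hmass) hd1 A hA hAb
    refine ((lintegral_mono hind).trans h).trans (ENNReal.ofReal_le_ofReal ?_)
    rw [hr, prod_half_pow hc hp (fun _ => m) (fun _ => hm0), mul_pow, Finset.prod_const]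
    have e1 : (m ^ (1 / 2 : ℝ)) ^ D.card ≤ m ^ n := by
      have h2 : m ^ (1 / 2 : ℝ) ≤ m := by
        calc m ^ (1 / 2 : ℝ) ≤ m ^ (1 : ℝ) := Real.rpow_le_rpow_of_exponent_le hm (by norm_num)
          _ = m := Real.rpow_one m
      calc (m ^ (1 / 2 : ℝ)) ^ D.card ≤ m ^ D.card := by gcongr
        _ ≤ m ^ n := pow_le_pow_right₀ hm (Finset.card_le_univ D)
    have e2 : b ^ S.card ≤ b ^ n := pow_le_pow_right₀ hb (Finset.card_le_univ S)
    have e3 : p ^ ((2 + γ) * coverNum H') * p ^ L.card * (p ^ (1 + γ)) ^ S.card =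
        p ^ ((verts H).card + γ * (S.card + coverNum H')) := by
      rw [← Real.rpow_natCast p, ← Real.rpow_mul_natCast hp.le, ← Real.rpow_add hp,
        ← Real.rpow_add hp, hLcard]
      congr 1; ring
    rw [← e3, mul_pow]
    calc (m ^ (1 / 2 : ℝ)) ^ D.card * p ^ ((2 + γ) * coverNum H') * (r * p ^ L.card) *
          (b ^ S.card * (p ^ (1 + γ)) ^ S.card)
        = ((m ^ (1 / 2 : ℝ)) ^ D.card * b ^ S.card) *
          (r * (p ^ ((2 + γ) * coverNum H') * p ^ L.card * (p ^ (1 + γ)) ^ S.card)) := by ring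
      _ ≤ (m ^ n * b ^ n) *
          (r * (p ^ ((2 + γ) * coverNum H') * p ^ L.card * (p ^ (1 + γ)) ^ S.card)) := by
        gcongr
  have hM : 0 ≤ (m * b) ^ n := by positivity
  have rp : ∀ r : ℝ, 0 < p ^ r := fun r => Real.rpow_pos_of_pos hp r
  rcases lt_or_ge (coverNum H) (S.card + coverNum H') with hgt | hle
  · refine (main (fun _ => p) (fun _ => hp.le) (fun z _ a _ => hd a) 1 (by simp) zero_le_one).trans
      (ENNReal.ofReal_le_ofReal ?_)
    -- Cover numbers are half-integers.
    have hhalf : coverNum H + 1 / 2 ≤ S.card + coverNum H' := by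
      obtain ⟨D₀, π₀, -, hc₀⟩ := exists_twoMatching H
      have h1 : (D₀.card : ℝ) < ((2 * S.card + D.card : ℕ) : ℝ) := by
        push_cast; linarith
      have h2 : ((D₀.card + 1 : ℕ) : ℝ) ≤ ((2 * S.card + D.card : ℕ) : ℝ) := by
        exact_mod_cast (Nat.cast_lt.1 h1)
      push_cast at h2
      linarith
    have h3 : p ^ ((verts H).card + γ * (S.card + coverNum H')) ≤
        p ^ (γ / 2) * p ^ ((verts H).card + γ * coverNum H) := by
      rw [← Real.rpow_add hp]
      refine Real.rpow_le_rpow_of_exponent_ge hp hp1 ?_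
      nlinarith
    rw [one_mul, mul_assoc]
    refine mul_le_mul_of_nonneg_left (h3.trans ?_) hM
    exact mul_le_mul_of_nonneg_right (by linarith) (rp _).le
  · have hnot : ¬ verts H' ⊆ D := fun h => hS (isValid_of_perfect hSH hc hle h)
    obtain ⟨z₀, hz₀, hz₀D⟩ := Finset.not_subset.1 hnot
    have hz₀' := verts_deleteVerts hz₀
    have hz₀L : z₀ ∈ L := (hLm z₀).2 ⟨hz₀'.1, hz₀'.2, hz₀D⟩
    refine (main (fun z => if z = z₀ then η * p else p) ?_ ?_ η ?_ hη).trans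
      (ENNReal.ofReal_le_ofReal ?_)
    · intro z; split_ifs <;> positivity
    · intro z hz a ha
      by_cases h : z = z₀
      · subst h
        simp only [if_true]
        have : g z ∉ S := (hg z hz).2.2 hz₀
        simp only [hX, this, if_false] at ha
        exact hBd a ha
      · simp only [h, if_false]; exact hd a
    · have : ∀ z, (if z = z₀ then η * p else p) = (if z = z₀ then η else 1) * p := fun z => by
        split_ifs <;> ring
      simp only [this]
      rw [Finset.prod_mul_distrib, Finset.prod_const, Finset.prod_ite_eq', if_pos hz₀L]
    · rw [show (S.card : ℝ) + coverNum H' = coverNum H from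
        le_antisymm hle (coverNum_le_card_add_deleteVerts hSH), mul_assoc]
      refine mul_le_mul_of_nonneg_left ?_ hM
      refine mul_le_mul_of_nonneg_right ?_ (rp _).le
      linarith [rp (γ / 2)]

/-- The copies of `H` in which a given vertex lies in a set contributing little to the mass. -/
theorem lintegral_vertex_le {H : SimpleGraph V} {v₀ : V} (hv₀ : v₀ ∈ verts H)
    {φ : Sym2 unitInterval → ℝ≥0∞} (hφm : Measurable fun q : _ × _ => φ s(q.1, q.2))
    (hφ1 : ∀ q, φ q ≤ 1) {p γ m σ : ℝ} (hp : 0 < p) (hm : 1 ≤ m) (hσ : 0 ≤ σ)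
    (hd : ∀ a, ∫⁻ t, φ s(t, a) ≤ ENNReal.ofReal p) {A : Set unitInterval}
    (hA : MeasurableSet A)
    (hmass : ∫⁻ a, ∫⁻ t, φ s(a, t) ≤ ENNReal.ofReal (m * p ^ (2 + γ)))
    (hmA : ∫⁻ a in A, ∫⁻ t, φ s(a, t) ≤ ENNReal.ofReal (σ * p ^ (2 + γ))) :
    ∫⁻ x : V → unitInterval,
        ∏ e ∈ edges H, edgeFun (fun _ => φ) (fun v => if v = v₀ then A else Set.univ) e x ≤
      ENNReal.ofReal (m ^ Fintype.card V * σ ^ (1 / 2 : ℝ) *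
        p ^ ((verts H).card + γ * coverNum H)) := by
  -- The two-matching is chosen such that an arc starts at `v₀`; its mass is bounded by `σ`.
  obtain ⟨D, π, hD, hc, hvD⟩ := exists_twoMatching_mem hv₀
  set X : V → Set unitInterval := fun v => if v = v₀ then A else Set.univ with hX
  have hXm : ∀ v, MeasurableSet (X v) := fun v => by
    simp only [hX]; split_ifs
    · exact hA
    · exact MeasurableSet.univ
  have hg : ∀ z, ∃ u, z ∈ verts H \ D → H.Adj z u := by
    intro z
    by_cases h : z ∈ verts H \ D
    · obtain ⟨u, hu⟩ := mem_verts.1 (Finset.mem_sdiff.1 h).1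
      exact ⟨u, fun _ => hu⟩
    · exact ⟨z, fun h' => absurd h' h⟩
  choose g hg using hg
  have hm0 : 0 ≤ m := zero_le_one.trans hm
  set y : V → ℝ := fun v => if v = v₀ then σ else m with hy
  have hy0 : ∀ v, 0 ≤ y v := fun v => by simp only [hy]; split_ifs <;> assumption
  have h := lintegral_edgeFun_le (S := ∅) (g := g) hD (L := verts H \ D) Finset.disjoint_sdiff
    (Finset.disjoint_empty_left _) (Finset.disjoint_empty_left _)
    (fun z hz => ⟨fun h => (Finset.mem_sdiff.1 h).2
      (hD.mem_of_adj hc (hg z hz) (Finset.mem_sdiff.1 hz).2), hg z hz⟩) (fun _ => φ)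
    (fun _ => hφm) (fun _ => hφ1) X hXm (fun v => y v * p ^ (2 + γ)) (fun _ => p) 0 le_rfl
    (fun v => mul_nonneg (hy0 v) (Real.rpow_nonneg hp.le _)) (fun _ => hp.le) (by
      intro v hv
      by_cases h1 : v = v₀
      · simp only [hX, hy, h1, if_true]
        exact (lintegral_mono fun a => setLIntegral_le_lintegral _ _).trans hmA
      · simp only [hy, h1, if_false]
        exact ((lintegral_mono fun a => setLIntegral_le_lintegral _ _).trans
          (setLIntegral_le_lintegral _ _)).trans hmass)
    (fun z _ a _ => hd a) ∅ MeasurableSet.empty (by simp)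
  simp only [Finset.prod_empty, mul_one] at h
  refine h.trans (ENNReal.ofReal_le_ofReal ?_)
  rw [Finset.card_empty, pow_zero, mul_one, Finset.prod_const, prod_half_pow hc hp y hy0]
  have e1 : ∏ v ∈ D, y v ^ (1 / 2 : ℝ) ≤ m ^ Fintype.card V * σ ^ (1 / 2 : ℝ) := by
    rw [← Finset.mul_prod_erase _ _ hvD, mul_comm]
    have h2 : m ^ (1 / 2 : ℝ) ≤ m := by
      calc m ^ (1 / 2 : ℝ) ≤ m ^ (1 : ℝ) := Real.rpow_le_rpow_of_exponent_le hm (by norm_num)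
        _ = m := Real.rpow_one m
    have h3 : ∏ v ∈ D.erase v₀, y v ^ (1 / 2 : ℝ) = (m ^ (1 / 2 : ℝ)) ^ (D.erase v₀).card := by
      rw [← Finset.prod_const]
      exact Finset.prod_congr rfl fun v hv => by simp [hy, Finset.ne_of_mem_erase hv]
    have h4 : y v₀ = σ := by simp [hy]
    rw [h3, h4]
    refine mul_le_mul_of_nonneg_right ?_ (Real.rpow_nonneg hσ _)
    calc (m ^ (1 / 2 : ℝ)) ^ (D.erase v₀).card ≤ m ^ (D.erase v₀).card := by gcongr
      _ ≤ m ^ Fintype.card V := pow_le_pow_right₀ hm (Finset.card_le_univ _)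
  have e2 : p ^ ((2 + γ) * coverNum H) * p ^ (verts H \ D).card =
      p ^ ((verts H).card + γ * coverNum H) := by
    rw [← Real.rpow_natCast p, ← Real.rpow_add hp, card_sdiff_verts hD.subset_verts, hc]
    congr 1; ring
  rw [mul_assoc, e2]
  exact mul_le_mul_of_nonneg_right e1 (Real.rpow_nonneg hp.le _)

open Classical in
/-- The main estimate for the copies of `H`: `A` is the set of hubs, `B` the set of points of low
degree, and the remaining points carry little mass. -/
theorem lintegral_hubs_le (H : SimpleGraph V)
    {φ : Sym2 unitInterval → ℝ≥0∞} (hφm : Measurable fun q : _ × _ => φ s(q.1, q.2))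
    (hφ1 : ∀ q, φ q ≤ 1) {p γ m b η σ z w : ℝ} (hp : 0 < p) (hp1 : p ≤ 1) (hγ : 0 ≤ γ) (hm : 1 ≤ m)
    (hb : 1 ≤ b) (hη : 0 ≤ η) (hσ : 0 ≤ σ) (hz : 0 ≤ z) (hw : 0 ≤ w)
    (hd : ∀ a, ∫⁻ t, φ s(t, a) ≤ ENNReal.ofReal p) {A B : Set unitInterval}
    (hA : MeasurableSet A) (hB : MeasurableSet B)
    (hmass : ∫⁻ a, ∫⁻ t, φ s(a, t) ≤ ENNReal.ofReal (m * p ^ (2 + γ)))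
    (hAb : volume A ≤ ENNReal.ofReal (b * p ^ (1 + γ)))
    (hBd : ∀ a ∈ B, ∫⁻ t, φ s(t, a) ≤ ENNReal.ofReal (η * p))
    (hrest : ∫⁻ a in (A ∪ B)ᶜ, ∫⁻ t, φ s(a, t) ≤ ENNReal.ofReal (σ * p ^ (2 + γ)))
    (hmA : ∫⁻ a in A, ∫⁻ t, φ s(a, t) ≤ ENNReal.ofReal (z * p ^ (2 + γ)))
    (hmB : ∫⁻ a in B, ∫⁻ t in B, φ s(a, t) ≤ ENNReal.ofReal (w * p ^ (2 + γ))) :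
    ∫⁻ x : V → unitInterval, ∏ e ∈ edges H, φ (e.map x) ≤
      ENNReal.ofReal (((∑ S ∈ (Finset.univ : Finset (Finset V)).filter (fun S => IsValid H S),
        z ^ S.card * w ^ (coverNum H - S.card)) +
        (Fintype.card V * (m ^ Fintype.card V * σ ^ (1 / 2 : ℝ)) +
        2 ^ Fintype.card V * ((m * b) ^ Fintype.card V * (p ^ (γ / 2) + η)))) *
        p ^ ((verts H).card + γ * coverNum H)) := by
  set q := p ^ ((verts H).card + γ * coverNum H) with hq
  have hq0 : 0 ≤ q := Real.rpow_nonneg hp.le _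
  set n := Fintype.card V with hn
  set X : Finset V → V → Set unitInterval := fun S v => if v ∈ S then A else B with hX
  set R : V → V → Set unitInterval := fun v₀ v => if v = v₀ then (A ∪ B)ᶜ else Set.univ with hR
  have hXm : ∀ S v, MeasurableSet (X S v) := fun S v => by
    simp only [hX]; split_ifs <;> assumption
  have hRm : ∀ v₀ v, MeasurableSet (R v₀ v) := fun v₀ v => by
    simp only [hR]; split_ifs
    · exact (hA.union hB).compl
    · exact MeasurableSet.univ
  set F : (V → Set unitInterval) → (V → unitInterval) → ℝ≥0∞ := fun X x =>
    ∏ e ∈ edges H, edgeFun (fun _ => φ) X e x with hF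
  have hFm : ∀ X : V → Set unitInterval, (∀ v, MeasurableSet (X v)) → Measurable (F X) :=
    fun X hX => Finset.measurable_prod _ fun e _ => measurable_edgeFun (fun _ => hφm) hX e
  -- Either some vertex lies outside `A ∪ B`, or the positions are described by the set `S` of
  -- vertices in `A`.
  have hpt : ∀ x : V → unitInterval, ∏ e ∈ edges H, φ (e.map x) ≤
      ∑ v ∈ verts H, F (R v) x + ∑ S ∈ (verts H).powerset, F (X S) x := by
    intro x
    have hev : ∀ e ∈ edges H, ∀ v ∈ e, v ∈ verts H := by
      intro e he v hv
      obtain ⟨u, rfl⟩ := hv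
      exact left_mem_verts (mk_mem_edges.1 he)
    by_cases h : ∃ v ∈ verts H, x v ∈ (A ∪ B)ᶜ
    · obtain ⟨v, hv, hxv⟩ := h
      refine le_trans (le_of_eq ?_) (le_self_add.trans' (Finset.single_le_sum
        (f := fun v => F (R v) x) (fun _ _ => bot_le) hv))
      refine Finset.prod_congr rfl fun e he => (edgeFun_eq (k := fun _ => φ) fun u hu => ?_).symm
      by_cases huv : u = v
      · simp only [hR, huv, if_true]; exact hxv
      · simp only [hR, huv, if_false]; exact Set.mem_univ _
    · push Not at h
      refine le_trans (le_of_eq ?_) (le_add_self.trans' (Finset.single_le_sum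
        (f := fun S => F (X S) x) (fun _ _ => bot_le)
        (Finset.mem_powerset.2 (Finset.filter_subset (fun v => x v ∈ A) (verts H)))))
      refine Finset.prod_congr rfl fun e he => (edgeFun_eq (k := fun _ => φ) fun u hu => ?_).symm
      have huH := hev e he u hu
      by_cases hu' : x u ∈ A
      · simp only [hX, Finset.mem_filter, huH, hu', and_self, if_true]
      · simp only [hX, Finset.mem_filter, hu', and_false, if_false]
        have := h u huH
        simp only [Set.mem_compl_iff, not_not] at this
        exact this.resolve_left hu'
  refine (lintegral_mono hpt).trans ?_
  have hm1 : Measurable fun x => ∑ v ∈ verts H, F (R v) x :=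
    Finset.measurable_sum _ fun v _ => hFm _ (hRm v)
  rw [lintegral_add_left hm1, lintegral_finsetSum _ fun v _ => hFm _ (hRm v),
    lintegral_finsetSum _ fun S _ => hFm _ (hXm S),
    ← Finset.sum_filter_add_sum_filter_not (verts H).powerset (fun S => IsValid H S)]
  have hm0 : 0 ≤ m := zero_le_one.trans hm
  have hb0 : 0 ≤ b := zero_le_one.trans hb
  have hσ0 : 0 ≤ σ ^ (1 / 2 : ℝ) := Real.rpow_nonneg hσ _
  have hpγ : 0 ≤ p ^ (γ / 2) := Real.rpow_nonneg hp.le _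
  have b1 : ∑ v ∈ verts H, ∫⁻ x, F (R v) x ≤
      ENNReal.ofReal (n * (m ^ n * σ ^ (1 / 2 : ℝ)) * q) := by
    refine (Finset.sum_le_card_nsmul _ _ _ fun v hv =>
      lintegral_vertex_le hv hφm hφ1 hp hm hσ hd (hA.union hB).compl hmass hrest).trans ?_
    rw [nsmul_eq_mul, ← ENNReal.ofReal_natCast, ← ENNReal.ofReal_mul (Nat.cast_nonneg _),
      mul_assoc (n : ℝ)]
    refine ENNReal.ofReal_le_ofReal (mul_le_mul_of_nonneg_right ?_ (by positivity))
    exact_mod_cast Finset.card_le_univ _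
  have b2 : ∑ S ∈ (verts H).powerset.filter (fun S => ¬ IsValid H S), ∫⁻ x, F (X S) x ≤
      ENNReal.ofReal (2 ^ n * ((m * b) ^ n * (p ^ (γ / 2) + η)) * q) := by
    refine (Finset.sum_le_card_nsmul _ _ _ fun S hS =>
      lintegral_not_valid_le (Finset.mem_powerset.1 (Finset.mem_filter.1 hS).1)
        (Finset.mem_filter.1 hS).2 hφm hφ1 hp hp1 hγ hm hb hη hd hA hB hmass hAb hBd).trans ?_
    rw [nsmul_eq_mul, ← ENNReal.ofReal_natCast, ← ENNReal.ofReal_mul (Nat.cast_nonneg _),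
      mul_assoc (2 ^ n : ℝ)]
    refine ENNReal.ofReal_le_ofReal (mul_le_mul_of_nonneg_right ?_ (by positivity))
    have : ((verts H).powerset.filter (fun S => ¬ IsValid H S)).card ≤ 2 ^ n := by
      refine (Finset.card_filter_le _ _).trans ?_
      rw [Finset.card_powerset]
      exact Nat.pow_le_pow_right (by norm_num) (Finset.card_le_univ _)
    exact_mod_cast this
  have hterm : ∀ S : Finset V, 0 ≤ z ^ S.card * w ^ (coverNum H - S.card) := fun S =>
    mul_nonneg (pow_nonneg hz _) (Real.rpow_nonneg hw _)
  have b3 : ∑ S ∈ (verts H).powerset.filter (fun S => IsValid H S), ∫⁻ x, F (X S) x ≤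
      ENNReal.ofReal ((∑ S ∈ (Finset.univ : Finset (Finset V)).filter (fun S => IsValid H S),
        z ^ S.card * w ^ (coverNum H - S.card)) * q) := by
    rw [Finset.sum_mul, ENNReal.ofReal_sum_of_nonneg fun S _ => mul_nonneg (hterm S) hq0]
    refine (Finset.sum_le_sum fun S hS => lintegral_valid_le (Finset.mem_filter.1 hS).2 hφm hφ1 hp
      hz hw hd hA hB hmA hmB).trans ?_
    exact Finset.sum_le_sum_of_subset (Finset.filter_subset_filter _ (Finset.subset_univ _))
  have hs0 : 0 ≤ ∑ S ∈ (Finset.univ : Finset (Finset V)).filter (fun S => IsValid H S),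
      z ^ S.card * w ^ (coverNum H - S.card) := Finset.sum_nonneg fun S _ => hterm S
  refine (add_le_add b1 (add_le_add b3 b2)).trans (le_of_eq ?_)
  rw [← ENNReal.ofReal_add (by positivity) (by positivity),
    ← ENNReal.ofReal_add (by positivity) (by positivity)]
  congr 1; ring

end Hubs

/-! ### Choosing the thresholds -/

section Thresholds

open scoped ENNReal

variable {V : Type*} [Fintype V] [DecidableEq V]

/-- The values in `[a, ε)`, rescaled to lie in `[0, 1]`. -/
noncomputable def cutPart (a ε x : ℝ) : ℝ≥0∞ :=
  {x : ℝ | x < ε}.indicator (fun x => bigPart a x * ENNReal.ofReal ε⁻¹) x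

theorem cutPart_of_lt {a ε x : ℝ} (h : x < ε) :
    cutPart a ε x = bigPart a x * ENNReal.ofReal ε⁻¹ :=
  Set.indicator_of_mem (s := {x : ℝ | x < ε}) h _

theorem cutPart_le (a ε x : ℝ) : cutPart a ε x ≤ bigPart a x * ENNReal.ofReal ε⁻¹ :=
  Set.indicator_le_self _ (fun x => bigPart a x * ENNReal.ofReal ε⁻¹) _

theorem cutPart_le_one {a ε : ℝ} (hε : 0 < ε) (x : ℝ) : cutPart a ε x ≤ 1 := by
  by_cases h : x < ε
  · rw [cutPart_of_lt h]
    refine (mul_le_mul' (bigPart_le a x) le_rfl).trans ?_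
    rw [← ENNReal.ofReal_mul' (inv_nonneg.2 hε.le), ENNReal.ofReal_le_one, ← div_eq_mul_inv,
      div_le_one hε]
    exact h.le
  · rw [cutPart, Set.indicator_of_notMem (s := {x : ℝ | x < ε}) h]; exact bot_le

theorem measurable_cutPart (a ε : ℝ) : Measurable (cutPart a ε) :=
  ((measurable_bigPart a).mul_const _).indicator measurableSet_Iio

/-- If no edge of `H` is bad, only the values above a small constant `ε` matter. A value below `ε` on
an edge `e₀` gives a factor `ε`. After rescaling, the mass of these values may be larger by `1 / ε`,
but since `e₀` is not bad, it lies on at most one arc of a suitable maximum two-matching, so that the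
loss is `ε ^ (-1 / 2)` only. -/
theorem lintegral_big_le_add {H : SimpleGraph V} (hmin : MinDegTwo H)
    (hbad : ∀ e, ¬ IsBadEdge H e) {m p γ a ε : ℝ} (hm : 1 ≤ m) (hp : 0 < p) (hp1 : p < 1)
    (hε : 0 < ε) (hε1 : ε ≤ 1) {W : Graphon} (hW : IsRegular p W)
    (hmass : ∫⁻ x, ∫⁻ y, bigPart a (W.onPair s(x, y)) ≤ ENNReal.ofReal (m * p ^ (2 + γ))) :
    ∫⁻ x : V → unitInterval, ∏ e ∈ edges H, bigPart a (W.onPair (e.map x)) ≤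
      (∫⁻ x : V → unitInterval, ∏ e ∈ edges H, bigPart ε (W.onPair (e.map x))) +
      ENNReal.ofReal ((edges H).card * (m ^ Fintype.card V * ε ^ (1 / 2 : ℝ) *
        p ^ ((verts H).card + γ * coverNum H))) := by
  classical
  have hm0 : 0 ≤ m := zero_le_one.trans hm
  set k : Sym2 V → Sym2 V → Sym2 unitInterval → ℝ≥0∞ := fun e₀ e q =>
    if e = e₀ then cutPart a ε (W.onPair q) else bigPart a (W.onPair q) with hk
  have hkm : ∀ e₀ e, Measurable fun q : _ × _ => k e₀ e s(q.1, q.2) := by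
    intro e₀ e
    simp only [hk]
    split_ifs
    · exact measurable_comp_onPair W (measurable_cutPart a ε)
    · exact measurable_comp_onPair W (measurable_bigPart a)
  have hk1 : ∀ e₀ e q, k e₀ e q ≤ 1 := by
    intro e₀ e q
    simp only [hk]
    split_ifs
    · exact cutPart_le_one hε _
    · exact bigPart_onPair_le_one _ _ _
  have hkmx : ∀ e₀ : Sym2 V, Measurable fun x : V → unitInterval =>
      ∏ e ∈ edges H, k e₀ e (e.map x) := by
    intro e₀
    refine Finset.measurable_prod _ fun e _ => ?_
    simp only [hk]
    split_ifs
    · exact (measurable_cutPart a ε).comp (measurable_onPair_map W.toSymKernel e)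
    · exact (measurable_bigPart a).comp (measurable_onPair_map W.toSymKernel e)
  have hpt : ∀ x : V → unitInterval, ∏ e ∈ edges H, bigPart a (W.onPair (e.map x)) ≤
      (∏ e ∈ edges H, bigPart ε (W.onPair (e.map x))) +
        ∑ e₀ ∈ edges H, ENNReal.ofReal ε * ∏ e ∈ edges H, k e₀ e (e.map x) := by
    intro x
    by_cases h : ∃ e₀ ∈ edges H, W.onPair (e₀.map x) < ε
    · obtain ⟨e₀, he₀, hx⟩ := h
      refine le_trans (le_of_eq ?_) (le_add_self.trans' (Finset.single_le_sum
        (f := fun e₀ => ENNReal.ofReal ε * ∏ e ∈ edges H, k e₀ e (e.map x))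
        (fun _ _ => bot_le) he₀))
      rw [← Finset.mul_prod_erase _ _ he₀, ← Finset.mul_prod_erase _ (fun e => k e₀ e (e.map x)) he₀]
      have e1 : k e₀ e₀ (e₀.map x) = bigPart a (W.onPair (e₀.map x)) * ENNReal.ofReal ε⁻¹ := by
        simp only [hk, if_true]; exact cutPart_of_lt hx
      have e2 : ∏ e ∈ (edges H).erase e₀, k e₀ e (e.map x) =
          ∏ e ∈ (edges H).erase e₀, bigPart a (W.onPair (e.map x)) :=
        Finset.prod_congr rfl fun e he => by simp [hk, Finset.ne_of_mem_erase he]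
      have e3 : ENNReal.ofReal ε * ENNReal.ofReal ε⁻¹ = 1 := by
        rw [← ENNReal.ofReal_mul hε.le, mul_inv_cancel₀ hε.ne', ENNReal.ofReal_one]
      rw [e1, e2]
      calc _ = (ENNReal.ofReal ε * ENNReal.ofReal ε⁻¹) * (bigPart a (W.onPair (e₀.map x)) *
            ∏ e ∈ (edges H).erase e₀, bigPart a (W.onPair (e.map x))) := by rw [e3, one_mul]
        _ = _ := by ring
    · push Not at h
      refine le_trans (Finset.prod_le_prod' fun e he => ?_) le_self_add
      rw [bigPart_of_le (h e he)]
      exact bigPart_le _ _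
  refine (lintegral_mono hpt).trans ?_
  have hbm : Measurable fun x : V → unitInterval =>
      ∏ e ∈ edges H, bigPart ε (W.onPair (e.map x)) := Finset.measurable_prod _ fun e _ =>
    (measurable_bigPart _).comp (measurable_onPair_map W.toSymKernel e)
  rw [lintegral_add_left hbm, lintegral_finsetSum _ fun e₀ _ => (hkmx e₀).const_mul _]
  gcongr
  have hterm : ∀ e₀ ∈ edges H,
      ∫⁻ x : V → unitInterval, ENNReal.ofReal ε * ∏ e ∈ edges H, k e₀ e (e.map x) ≤
      ENNReal.ofReal (m ^ Fintype.card V * ε ^ (1 / 2 : ℝ) *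
        p ^ ((verts H).card + γ * coverNum H)) := by
    intro e₀ he₀
    rw [lintegral_const_mul _ (hkmx e₀)]
    induction e₀ using Sym2.ind with
    | _ u₀ v₀ =>
    -- The exponent with `p ^ s = ε` turns the constant `ε⁻¹` into a power of `p`.
    set s := Real.log ε / Real.log p with hs
    have hlp : Real.log p < 0 := Real.log_neg hp hp1
    have hs0 : 0 ≤ s := div_nonneg_of_nonpos (Real.log_nonpos hε.le hε1) hlp.le
    have hps : p ^ s = ε := by
      rw [Real.rpow_def_of_pos hp, hs, mul_div_cancel₀ _ hlp.ne, Real.exp_log hε]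
    obtain ⟨D, π, hD, hc, hns⟩ := exists_twoMatching_not_swap (mk_mem_edges.1 he₀) (hbad _)
    have hb := lintegral_kernels_le hD (L := verts H \ D) Finset.disjoint_sdiff hm hp
      (k s(u₀, v₀)) (hkm _) (hk1 _) (fun v => if s(v, π v) = s(u₀, v₀) then 2 + γ - s else 2 + γ)
      (by
        intro v hv
        by_cases h : s(v, π v) = s(u₀, v₀)
        · simp only [hk, h, if_true]
          refine (lintegral_mono fun a => lintegral_mono fun c => cutPart_le _ _ _).trans ?_
          have h1 : ∀ y, Measurable fun c => bigPart a (W.onPair s(y, c)) := fun y =>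
            (measurable_comp_onPair W (measurable_bigPart a)).comp measurable_prodMk_left
          have h2 : Measurable fun y => ∫⁻ c, bigPart a (W.onPair s(y, c)) :=
            (measurable_comp_onPair W (measurable_bigPart a)).lintegral_prod_right'
          have h3 : ∫⁻ y, ∫⁻ c, bigPart a (W.onPair s(y, c)) * ENNReal.ofReal ε⁻¹ =
              (∫⁻ y, ∫⁻ c, bigPart a (W.onPair s(y, c))) * ENNReal.ofReal ε⁻¹ := by
            rw [← lintegral_mul_const _ h2]
            exact lintegral_congr fun y => lintegral_mul_const _ (h1 y)
          refine (h3.le.trans (mul_le_mul' hmass le_rfl)).trans (le_of_eq ?_)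
          rw [← ENNReal.ofReal_mul (by positivity), mul_assoc, ← hps, ← Real.rpow_neg hp.le,
            ← Real.rpow_add hp]
          rfl
        · simp only [hk, h, if_false]; exact hmass)
      (by
        intro z hz
        rw [Finset.mem_sdiff] at hz
        -- A leaf is attached through an edge other than `e₀`, as its degree is at least `2`.
        obtain ⟨u, hu, hne⟩ : ∃ u, H.Adj z u ∧ s(z, u) ≠ s(u₀, v₀) := by
          by_cases h : z = u₀
          · obtain ⟨u, hu, hne⟩ := hmin.exists_ne hz.1 v₀
            refine ⟨u, hu, fun h' => hne ?_⟩
            subst h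
            rcases Sym2.eq_iff.1 h' with h'' | h''
            · exact h''.2
            · rw [h''.2, h''.1]
          · obtain ⟨u, hu, hne⟩ := hmin.exists_ne hz.1 u₀
            refine ⟨u, hu, fun h' => ?_⟩
            rcases Sym2.eq_iff.1 h' with h'' | h''
            · exact h h''.1
            · exact hne h''.2
        refine ⟨u, fun h => (Finset.mem_sdiff.1 h).2 (hD.mem_of_adj hc hu hz.2), hu, fun y => ?_⟩
        simp only [hk, hne, if_false]
        exact degree_bigPart_le hW y)
    refine (mul_le_mul' le_rfl hb).trans ?_
    rw [← ENNReal.ofReal_mul hε.le]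
    refine ENNReal.ofReal_le_ofReal ?_
    have hsum : (2 + γ) * D.card - s ≤
        ∑ v ∈ D, if s(v, π v) = s(u₀, v₀) then 2 + γ - s else 2 + γ := by
      have e1 : ∀ v, (if s(v, π v) = s(u₀, v₀) then 2 + γ - s else 2 + γ) =
          (2 + γ) - if s(v, π v) = s(u₀, v₀) then s else 0 := fun v => by split_ifs <;> ring
      simp only [e1]
      rw [Finset.sum_sub_distrib, Finset.sum_const, nsmul_eq_mul, ← Finset.sum_filter,
        Finset.sum_const, nsmul_eq_mul]
      have e2 : (D.filter fun v => s(v, π v) = s(u₀, v₀)).card ≤ 1 := by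
        refine Finset.card_le_one.2 fun v hv w hw => ?_
        obtain ⟨hvD, hv⟩ := Finset.mem_filter.1 hv
        obtain ⟨hwD, hw⟩ := Finset.mem_filter.1 hw
        rcases Sym2.eq_iff.1 hv with h | h <;> rcases Sym2.eq_iff.1 hw with h' | h'
        · rw [h.1, h'.1]
        · exact absurd ⟨h.1 ▸ hvD, h.1 ▸ h.2, h'.1 ▸ h'.2⟩ hns
        · exact absurd ⟨h'.1 ▸ hwD, h'.1 ▸ h'.2, h.1 ▸ h.2⟩ hns
        · rw [h.1, h'.1]
      have e3 : ((D.filter fun v => s(v, π v) = s(u₀, v₀)).card : ℝ) ≤ 1 := by exact_mod_cast e2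
      nlinarith
    have e1 : ε * p ^ ((∑ v ∈ D, if s(v, π v) = s(u₀, v₀) then 2 + γ - s else 2 + γ) / 2 +
        (verts H \ D).card) ≤ ε ^ (1 / 2 : ℝ) * p ^ ((verts H).card + γ * coverNum H) := by
      rw [← hps, ← Real.rpow_mul hp.le, ← Real.rpow_add hp, ← Real.rpow_add hp]
      refine Real.rpow_le_rpow_of_exponent_ge hp hp1.le ?_
      rw [card_sdiff_verts hD.subset_verts]
      rw [hc] at hsum ⊢
      linarith
    calc _ = m ^ Fintype.card V * (ε * p ^ ((∑ v ∈ D, if s(v, π v) = s(u₀, v₀) then 2 + γ - s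
            else 2 + γ) / 2 + (verts H \ D).card)) := by ring
      _ ≤ m ^ Fintype.card V * (ε ^ (1 / 2 : ℝ) * p ^ ((verts H).card + γ * coverNum H)) := by
        gcongr
      _ = _ := by ring
  refine (Finset.sum_le_card_nsmul _ _ _ hterm).trans (le_of_eq ?_)
  rw [nsmul_eq_mul, ← ENNReal.ofReal_natCast, ← ENNReal.ofReal_mul (Nat.cast_nonneg _)]

/-- The mass of the hubs `A` counts twice, up to the pairs of hubs. -/
theorem two_mul_mass_add_le {φ : Sym2 unitInterval → ℝ≥0∞}
    (hφm : Measurable fun q : _ × _ => φ s(q.1, q.2)) (hφ1 : ∀ q, φ q ≤ 1)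
    {A B : Set unitInterval} (hA : MeasurableSet A) (hAB : B ⊆ Aᶜ) :
    (∫⁻ a in A, ∫⁻ t, φ s(a, t)) + (∫⁻ a in A, ∫⁻ t, φ s(a, t)) +
        ∫⁻ a in B, ∫⁻ t in B, φ s(a, t) ≤
      (∫⁻ a, ∫⁻ t, φ s(a, t)) + volume A * volume A := by
  have hm : ∀ s : Set unitInterval, Measurable fun a => ∫⁻ t in s, φ s(a, t) := fun s =>
    hφm.lintegral_prod_right'
  have hsplit : ∀ s : Set unitInterval, ∫⁻ a in s, ∫⁻ t, φ s(a, t) =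
      (∫⁻ a in s, ∫⁻ t in A, φ s(a, t)) + ∫⁻ a in s, ∫⁻ t in Aᶜ, φ s(a, t) := by
    intro s
    rw [← lintegral_add_left (hm A)]
    refine lintegral_congr fun a => ?_
    exact (lintegral_add_compl _ hA).symm
  have e1 : ∫⁻ a in A, ∫⁻ t in Aᶜ, φ s(a, t) = ∫⁻ a in Aᶜ, ∫⁻ t in A, φ s(a, t) := by
    rw [lintegral_lintegral_swap hφm.aemeasurable]
    exact lintegral_congr fun a => lintegral_congr fun b => by rw [Sym2.eq_swap]
  have e2 : ∫⁻ a in A, ∫⁻ t in A, φ s(a, t) ≤ volume A * volume A := by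
    refine (lintegral_mono fun a => lintegral_mono fun t => hφ1 _).trans ?_
    simp
  have e3 : ∫⁻ a in B, ∫⁻ t in B, φ s(a, t) ≤ ∫⁻ a in Aᶜ, ∫⁻ t in Aᶜ, φ s(a, t) :=
    (lintegral_mono fun a => lintegral_mono_set hAB).trans (lintegral_mono_set hAB)
  have e4 : ∫⁻ a, ∫⁻ t, φ s(a, t) = (∫⁻ a in A, ∫⁻ t, φ s(a, t)) +
      ∫⁻ a in Aᶜ, ∫⁻ t, φ s(a, t) := (lintegral_add_compl _ hA).symm
  rw [e4, hsplit A, hsplit Aᶜ, e1]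
  calc _ ≤ (∫⁻ a in A, ∫⁻ t in A, φ s(a, t)) + (∫⁻ a in Aᶜ, ∫⁻ t in A, φ s(a, t)) +
        (volume A * volume A + (∫⁻ a in Aᶜ, ∫⁻ t in A, φ s(a, t))) +
        ∫⁻ a in Aᶜ, ∫⁻ t in Aᶜ, φ s(a, t) := by gcongr
    _ = _ := by ring

/-- By pigeonhole, there is a gap between consecutive thresholds such that the points with a degree
in the gap carry little mass. `A` consists of the points above the gap, the hubs, and `B` of the
points below it. -/
theorem exists_hubs {φ : Sym2 unitInterval → ℝ≥0∞}
    (hφm : Measurable fun q : _ × _ => φ s(q.1, q.2)) (hφ1 : ∀ q, φ q ≤ 1)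
    {p q m : ℝ} (hp : 0 < p) (hq : 0 < q) (hm : 0 ≤ m)
    (hmass : ∫⁻ a, ∫⁻ t, φ s(a, t) ≤ ENNReal.ofReal (m * q)) {η : ℕ → ℝ} (hη0 : ∀ j, 0 < η j)
    (hη : Antitone η) {J : ℕ} (hJ : 0 < J) :
    ∃ j < J, ∃ A B : Set unitInterval, MeasurableSet A ∧ MeasurableSet B ∧
      volume A ≤ ENNReal.ofReal (m * q / (η j * p)) ∧
      (∀ a ∈ B, ∫⁻ t, φ s(t, a) ≤ ENNReal.ofReal (η (j + 1) * p)) ∧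
      ∫⁻ a in (A ∪ B)ᶜ, ∫⁻ t, φ s(a, t) ≤ ENNReal.ofReal (m / J * q) ∧
      ∃ z w : ℝ, 0 ≤ z ∧ 0 ≤ w ∧ ∫⁻ a in A, ∫⁻ t, φ s(a, t) = ENNReal.ofReal (z * q) ∧
        ∫⁻ a in B, ∫⁻ t in B, φ s(a, t) = ENNReal.ofReal (w * q) ∧
        ∀ m' : ℝ, 0 ≤ m' → ∫⁻ a, ∫⁻ t, φ s(a, t) ≤ ENNReal.ofReal (m' * q) →
          2 * z + w ≤ m' + (m * q / (η j * p)) ^ 2 / q := by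
  set deg : unitInterval → ℝ≥0∞ := fun a => ∫⁻ t, φ s(a, t) with hdeg
  have hdm : Measurable deg := hφm.lintegral_prod_right'
  set A : ℕ → Set unitInterval := fun j => {a | ENNReal.ofReal (η j * p) ≤ deg a} with hA
  set B : ℕ → Set unitInterval := fun j => {a | deg a < ENNReal.ofReal (η (j + 1) * p)} with hB
  have hAm : ∀ j, MeasurableSet (A j) := fun j => measurableSet_le measurable_const hdm
  have hBm : ∀ j, MeasurableSet (B j) := fun j => measurableSet_lt hdm measurable_const
  set R : ℕ → Set unitInterval := fun j => (A j ∪ B j)ᶜ with hR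
  have hRmem : ∀ j a, a ∈ R j ↔ deg a < ENNReal.ofReal (η j * p) ∧
      ENNReal.ofReal (η (j + 1) * p) ≤ deg a := by
    intro j a
    simp only [hR, Set.mem_compl_iff, Set.mem_union, not_or]
    exact Iff.and (not_le (a := ENNReal.ofReal (η j * p)) (b := deg a))
      (not_lt (a := deg a) (b := ENNReal.ofReal (η (j + 1) * p)))
  have hdisj : Pairwise fun i j => Disjoint (R i) (R j) := by
    have key : ∀ i j, i < j → Disjoint (R i) (R j) := by
      intro i j hij
      refine Set.disjoint_left.2 fun a hi hj => ?_
      have h1 := ((hRmem i a).1 hi).2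
      have h2 := ((hRmem j a).1 hj).1
      refine absurd (h1.trans_lt h2) (not_lt.2 (ENNReal.ofReal_le_ofReal ?_))
      exact mul_le_mul_of_nonneg_right (hη hij) hp.le
    intro i j hij
    rcases lt_or_gt_of_ne hij with h | h
    · exact key i j h
    · exact (key j i h).symm
  obtain ⟨j, hj, hRj⟩ : ∃ j ∈ Finset.range J,
      ∫⁻ a in R j, deg a ≤ ENNReal.ofReal (m / J * q) := by
    by_contra hcon
    push Not at hcon
    have h1 := ENNReal.sum_lt_sum_of_nonempty (Finset.nonempty_range_iff.2 hJ.ne') hcon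
    rw [← lintegral_biUnion_finset (fun i _ j _ hij => hdisj hij)
      (fun j _ => ((hAm j).union (hBm j)).compl), Finset.sum_const, Finset.card_range,
      nsmul_eq_mul, ← ENNReal.ofReal_natCast, ← ENNReal.ofReal_mul (Nat.cast_nonneg _)] at h1
    have h2 := (h1.trans_le (setLIntegral_le_lintegral _ _)).trans_le hmass
    have h3 : (J : ℝ) * (m / J * q) = m * q := by
      have : (J : ℝ) ≠ 0 := by exact_mod_cast hJ.ne'
      field_simp
    rw [h3] at h2
    exact lt_irrefl _ h2
  have hηp : 0 < η j * p := mul_pos (hη0 j) hp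
  have hvol : volume (A j) ≤ ENNReal.ofReal (m * q / (η j * p)) := by
    have h := (mul_meas_ge_le_lintegral hdm (ENNReal.ofReal (η j * p))
      (μ := (volume : Measure unitInterval))).trans hmass
    rw [ENNReal.ofReal_div_of_pos hηp, ENNReal.le_div_iff_mul_le
      (Or.inl (ENNReal.ofReal_pos.2 hηp).ne') (Or.inl ENNReal.ofReal_ne_top), mul_comm]
    exact h
  have hAB : B j ⊆ (A j)ᶜ := by
    intro a ha h
    have h1 : deg a < ENNReal.ofReal (η (j + 1) * p) := ha
    have h2 : ENNReal.ofReal (η j * p) ≤ deg a := h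
    refine absurd (h2.trans_lt h1) (not_lt.2 (ENNReal.ofReal_le_ofReal ?_))
    exact mul_le_mul_of_nonneg_right (hη (Nat.le_succ j)) hp.le
  have fin1 : ∫⁻ a in A j, deg a ≠ ∞ := ne_top_of_le_ne_top ENNReal.ofReal_ne_top
    ((setLIntegral_le_lintegral _ _).trans hmass)
  have fin2 : ∫⁻ a in B j, ∫⁻ t in B j, φ s(a, t) ≠ ∞ := ne_top_of_le_ne_top ENNReal.ofReal_ne_top
    (((lintegral_mono fun a => setLIntegral_le_lintegral _ _).trans
      (setLIntegral_le_lintegral _ _)).trans hmass)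
  refine ⟨j, Finset.mem_range.1 hj, A j, B j, hAm j, hBm j, hvol, ?_, hRj,
    (∫⁻ a in A j, deg a).toReal / q, (∫⁻ a in B j, ∫⁻ t in B j, φ s(a, t)).toReal / q,
    by positivity, by positivity, ?_, ?_, ?_⟩
  · intro a ha
    have : deg a < ENNReal.ofReal (η (j + 1) * p) := ha
    refine le_trans (le_of_eq ?_) this.le
    exact lintegral_congr fun t => by rw [Sym2.eq_swap]
  · rw [div_mul_cancel₀ _ hq.ne', ENNReal.ofReal_toReal fin1]
  · rw [div_mul_cancel₀ _ hq.ne', ENNReal.ofReal_toReal fin2]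
  · intro m' hm' hmass'
    have h := (two_mul_mass_add_le hφm hφ1 (hAm j) hAB).trans
      (add_le_add hmass' (mul_le_mul' hvol hvol))
    rw [← ENNReal.ofReal_mul (by positivity), ← ENNReal.ofReal_add (by positivity) (by positivity)]
      at h
    have h2 := ENNReal.toReal_mono ENNReal.ofReal_ne_top h
    rw [ENNReal.toReal_ofReal (by positivity), ENNReal.toReal_add (ENNReal.add_ne_top.2 ⟨fin1, fin1⟩) fin2,
      ENNReal.toReal_add fin1 fin1] at h2
    rw [mul_div_assoc', ← add_div, div_le_iff₀ hq, add_mul, div_mul_cancel₀ _ hq.ne']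
    linarith

end Thresholds

/-! ### The upper bound for the homomorphism density -/

section UpperBound

open scoped ENNReal

variable {V : Type*} [Fintype V] [DecidableEq V]

theorem onPair_addConst (F : SymKernel) (a : ℝ) (q : Sym2 unitInterval) :
    (F.addConst a).onPair q = F.onPair q + a := by
  induction q using Sym2.ind with
  | _ x y => rfl

theorem addConst_neg_addConst (F : SymKernel) (a : ℝ) : (F.addConst (-a)).addConst a = F := by
  cases F
  simp [SymKernel.addConst]

theorem hom_le_of_lintegral_le {H : SimpleGraph V} {F : SymKernel} {r : ℝ} (hr : 0 ≤ r)
    (h : ∫⁻ x : V → unitInterval, ∏ e ∈ edges H, ENNReal.ofReal |F.onPair (e.map x)| ≤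
      ENNReal.ofReal r) : hom H F ≤ r := by
  refine (le_abs_self _).trans ?_
  rw [← ENNReal.ofReal_le_ofReal_iff hr, ← Real.norm_eq_abs, ofReal_norm]
  refine (enorm_integral_le_lintegral_enorm _).trans (le_trans (le_of_eq ?_) h)
  refine lintegral_congr fun x => ?_
  rw [← ofReal_norm, Real.norm_eq_abs, edgeProd, Finset.abs_prod,
    ENNReal.ofReal_prod_of_nonneg fun _ _ => abs_nonneg _]

theorem ofReal_add_add_le {a b c d : ℝ} (ha : 0 ≤ a) (hb : 0 ≤ b) (hc : 0 ≤ c)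
    (h : a + b + c ≤ d) :
    ENNReal.ofReal a + ENNReal.ofReal b + ENNReal.ofReal c ≤ ENNReal.ofReal d := by
  rw [← ENNReal.ofReal_add ha hb, ← ENNReal.ofReal_add (add_nonneg ha hb) hc]
  exact ENNReal.ofReal_le_ofReal h

open Classical in
/-- The homomorphism density of a `p`-regular graphon is at most `p ^ e(K) * P_K(z, w)`, up to a
small error; `2 z + w` is bounded by the normalized mass `m'` of the values above `ε`. The bounds
`t1` to `t5` make the following errors small: values below `ε`, vertices with a degree between two
thresholds, the two kinds of invalid sets of hubs, and values below `p ^ (1 - κ)`. -/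
theorem exists_hom_le {K : SimpleGraph V} (hγ : 0 < gam K)
    (hbad : ∀ H, IsContributing K H → ∀ e, ¬ IsBadEdge H e) {m p κ ε t m' : ℝ} {η : ℕ → ℝ} {J : ℕ}
    (hm : 1 ≤ m) (hp : 0 < p) (hp1 : p < 1) (hκ : 0 < κ) (ht : 0 ≤ t)
    (hgood : IsGoodExponent K (((edges K).card + 1) * (2 * Fintype.card V + 2)) κ)
    {W : Graphon} (hW : IsRegular p W)
    (hmass : ∫⁻ x, ∫⁻ y, bigPart (p ^ (1 - κ)) (W.onPair s(x, y)) ≤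
      ENNReal.ofReal (m * p ^ (2 + gam K)))
    (hfar : ∫⁻ x, ∫⁻ y, farPart p (p ^ (1 + ((edges K).card + 1) * κ)) (W.onPair s(x, y)) ≤
      ENNReal.ofReal (m * p ^ (1 + gam K - 3 * (((edges K).card + 1) * κ))))
    (hε : p ^ (1 - κ) ≤ ε) (hε1 : ε ≤ 1)
    (hm' : 0 ≤ m') (hmass' : ∫⁻ x, ∫⁻ y, bigPart ε (W.onPair s(x, y)) ≤
      ENNReal.ofReal (m' * p ^ (2 + gam K)))
    (hη : ∀ j, 0 < η j) (hη1 : ∀ j, η j ≤ 1) (hηa : Antitone η) (hJ : 0 < J)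
    (t1 : (edges K).card * (m ^ Fintype.card V * ε ^ (1 / 2 : ℝ)) ≤ t)
    (t2 : Fintype.card V * (m ^ Fintype.card V * (m / J) ^ (1 / 2 : ℝ)) ≤ t)
    (t3 : ∀ j, 2 ^ Fintype.card V * ((m * (m / η j)) ^ Fintype.card V * η (j + 1)) ≤ t)
    (t4 : 2 ^ Fintype.card V * ((m * (m / η J)) ^ Fintype.card V * p ^ (gam K / 2)) ≤ t)
    (t5 : 2 ^ (edges K).card * (((edges K).card + 1) * (m ^ Fintype.card V * p ^ κ)) ≤ t) :
    ∃ z w : ℝ, 0 ≤ z ∧ 0 ≤ w ∧ 2 * z + w ≤ m' + (m / η J) ^ 2 * p ^ gam K ∧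
      hom K W.toSymKernel ≤ p ^ (edges K).card * (contribPoly K z w +
        (Finset.univ : Finset (SimpleGraph V)).card * (5 * t)) := by
  set γ := gam K with hγd
  set n := Fintype.card V with hn
  set E := (edges K).card with hE
  have hm0 : 0 < m := zero_lt_one.trans_le hm
  have rp : ∀ r : ℝ, 0 < p ^ r := fun r => Real.rpow_pos_of_pos hp r
  have hε0 : 0 < ε := (rp _).trans_le hε
  have hφm := measurable_comp_onPair W (measurable_bigPart ε)
  have hbb : ∀ x, bigPart ε x ≤ bigPart (p ^ (1 - κ)) x := by
    intro x
    rcases le_or_gt ε x with h | h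
    · rw [bigPart_of_le h, bigPart_of_le (hε.trans h)]
    · rw [bigPart_of_lt h]; exact bot_le
  have hmassε : ∫⁻ x, ∫⁻ y, bigPart ε (W.onPair s(x, y)) ≤ ENNReal.ofReal (m * p ^ (2 + γ)) :=
    (lintegral_mono fun x => lintegral_mono fun y => hbb _).trans hmass
  obtain ⟨j, hj, A, B, hA, hB, hAv, hBd, hR, z, w, hz, hw, hmA, hmB, hzw⟩ :=
    exists_hubs (φ := fun q => bigPart ε (W.onPair q)) hφm
      (fun q => bigPart_onPair_le_one _ _ _) hp (rp (2 + γ)) hm0.le hmassε hη hηa hJ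
  have hbj : m / η j ≤ m / η J := by
    have := hηa hj.le
    have := hη J
    gcongr
  have hvj : m * p ^ (2 + γ) / (η j * p) = m / η j * p ^ (1 + γ) := by
    have h1 : p ^ (2 + γ) = p * p ^ (1 + γ) := by
      rw [show 2 + γ = 1 + (1 + γ) by ring, Real.rpow_add hp, Real.rpow_one]
    have := (hη j).ne'
    rw [h1]; field_simp
  rw [hvj] at hAv hzw
  refine ⟨z, w, hz, hw, ?_, ?_⟩
  · refine (hzw m' hm' hmass').trans ?_
    have h1 : (m / η j * p ^ (1 + γ)) ^ 2 / p ^ (2 + γ) = (m / η j) ^ 2 * p ^ γ := by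
      rw [mul_pow, ← Real.rpow_mul_natCast hp.le, mul_div_assoc, ← Real.rpow_sub hp]
      congr 2; push_cast; ring
    rw [h1]
    have : 0 ≤ m / η j := div_nonneg hm0.le (hη j).le
    gcongr
  -- The deviation from the constant `p` has zero marginals.
  set U := W.toSymKernel.addConst (-p) with hU
  have hUW : W.toSymKernel = U.addConst p := (addConst_neg_addConst _ _).symm
  have hUb : ∀ x y, |U.toFun x y| ≤ 1 := by
    intro x y
    have h0 := W.nonneg' x y
    have h1 := W.le_one' x y
    show |W.toFun x y + -p| ≤ 1
    rw [abs_le]; constructor <;> linarith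
  have hU0 : ∀ x, ∫ y, U.toFun x y = 0 := by
    intro x
    show ∫ y, (W.toFun x y + -p) = 0
    have hint : Integrable fun y => W.toFun x y :=
      Integrable.of_bound (C := 1) (W.measurable'.comp measurable_prodMk_left).aestronglyMeasurable
        (Filter.Eventually.of_forall fun y => by
          rw [Real.norm_eq_abs, abs_of_nonneg (W.nonneg' _ _)]; exact W.le_one' _ _)
    rw [integral_add hint (integrable_const _), hW x]
    simp
  have hUq : ∀ q, U.onPair q = W.onPair q - p := fun q => by
    rw [hU, onPair_addConst]; rfl
  set P : SimpleGraph V → ℝ := fun H =>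
    ∑ S ∈ (Finset.univ : Finset (Finset V)).filter (fun S => IsValid H S),
      z ^ S.card * w ^ (coverNum H - S.card) with hP
  have hP0 : ∀ H, 0 ≤ P H := fun H => Finset.sum_nonneg fun S _ =>
    mul_nonneg (pow_nonneg hz _) (Real.rpow_nonneg hw _)
  have hmn : 0 ≤ m ^ n := by positivity
  have hE0 : (0 : ℝ) ≤ E + 1 := add_nonneg (Nat.cast_nonneg _) zero_le_one
  have hpκt : m ^ n * p ^ κ ≤ t := by
    refine le_trans ?_ t5
    have h1 : (1 : ℝ) ≤ 2 ^ E * (E + 1) := by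
      have h2 : (1 : ℝ) ≤ 2 ^ E := one_le_pow₀ (by norm_num)
      have h3 : (0 : ℝ) ≤ E := Nat.cast_nonneg _
      nlinarith
    have h4 : 0 ≤ m ^ n * p ^ κ := mul_nonneg hmn (rp _).le
    rw [← mul_assoc]
    nlinarith
  have hmain : ∀ H, H ≤ K → p ^ (E - (edges H).card) * hom H U ≤
      p ^ E * ((if IsContributing K H then P H else 0) + 5 * t) := by
    intro H hHK
    have hEH : (edges H).card ≤ E := Finset.card_le_card (edges_mono hHK)
    suffices hs : hom H U ≤ p ^ (edges H).card *
        ((if IsContributing K H then P H else 0) + 5 * t) by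
      calc _ ≤ p ^ (E - (edges H).card) * (p ^ (edges H).card *
            ((if IsContributing K H then P H else 0) + 5 * t)) := by gcongr
        _ = _ := by rw [← mul_assoc, ← pow_add, Nat.sub_add_cancel hEH]
    have hif0 : 0 ≤ if IsContributing K H then P H else 0 := by
      split_ifs
      · exact hP0 H
      · exact le_rfl
    by_cases hmin : MinDegTwo H
    swap
    · rw [hom_eq_zero hmin hUb hU0]; positivity
    refine hom_le_of_lintegral_le (by positivity) ?_
    simp only [hUq]
    refine (lintegral_abs_le hHK hmin hm hp hp1 hκ hgood hW hmass hfar).trans ?_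
    have hsmall : 2 ^ E * ((E + 1) * (m ^ n * p ^ ((edges H).card + κ))) ≤
        p ^ (edges H).card * t := by
      rw [Real.rpow_add hp, Real.rpow_natCast]
      calc _ = p ^ (edges H).card * (2 ^ E * ((E + 1) * (m ^ n * p ^ κ))) := by ring
        _ ≤ _ := by gcongr
    by_cases hc : ((edges H).card : ℝ) - (verts H).card = coverNum H * γ
    · have hcon : IsContributing K H := ⟨hHK, hmin, hc⟩
      simp only [hcon, if_true]
      have hexp : p ^ ((verts H).card + γ * coverNum H) = p ^ (edges H).card := by
        rw [← Real.rpow_natCast p]; congr 1; linarith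
      have b1 := lintegral_big_le_add hmin (hbad H hcon) hm hp hp1 hε0 hε1 hW hmass
      have b2 := lintegral_hubs_le H (φ := fun q => bigPart ε (W.onPair q)) hφm
        (fun q => bigPart_onPair_le_one _ _ _) hp hp1.le hγ.le hm
        (b := m / η j) (by rw [one_le_div (hη j)]; linarith [hη1 j]) (hη (j + 1)).le
        (σ := m / J) (by positivity) hz hw (degree_bigPart_le hW) hA hB hmassε hAv hBd hR hmA.le
        hmB.le
      rw [hexp] at b1 b2
      refine (add_le_add (b1.trans (add_le_add b2 le_rfl)) le_rfl).trans ?_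
      have hpe : 0 ≤ p ^ (edges H).card := by positivity
      have s1 : ((edges H).card : ℝ) * (m ^ n * ε ^ (1 / 2 : ℝ) * p ^ (edges H).card) ≤
          p ^ (edges H).card * t := by
        have h1 : ((edges H).card : ℝ) ≤ E := by exact_mod_cast hEH
        have h2 : 0 ≤ m ^ n * ε ^ (1 / 2 : ℝ) := by positivity
        calc _ = p ^ (edges H).card * ((edges H).card * (m ^ n * ε ^ (1 / 2 : ℝ))) := by ring
          _ ≤ p ^ (edges H).card * (E * (m ^ n * ε ^ (1 / 2 : ℝ))) := by gcongr
          _ ≤ _ := by gcongr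
      have s2 : 2 ^ n * ((m * (m / η j)) ^ n * (p ^ (γ / 2) + η (j + 1))) ≤ 2 * t := by
        have h0 : 0 ≤ m / η j := div_nonneg hm0.le (hη j).le
        have h1 : 2 ^ n * ((m * (m / η j)) ^ n * p ^ (γ / 2)) ≤
            2 ^ n * ((m * (m / η J)) ^ n * p ^ (γ / 2)) := by
          have := rp (γ / 2)
          gcongr
        have h2 := t3 j
        rw [mul_add, mul_add]
        linarith
      have hPH := hP0 H
      have hη' := (hη (j + 1)).le
      have hηj : 0 ≤ m / η j := div_nonneg hm0.le (hη j).le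
      have hpγ := (rp (γ / 2)).le
      have hpk := (rp ((edges H).card + κ)).le
      have hεh : 0 ≤ ε ^ (1 / 2 : ℝ) := Real.rpow_nonneg hε0.le _
      refine ofReal_add_add_le (by positivity)
        (mul_nonneg (Nat.cast_nonneg _) (mul_nonneg (mul_nonneg hmn hεh) hpe))
        (mul_nonneg (by positivity) (mul_nonneg hE0 (mul_nonneg hmn hpk))) ?_
      have s3 : (P H + (n * (m ^ n * (m / J) ^ (1 / 2 : ℝ)) +
          2 ^ n * ((m * (m / η j)) ^ n * (p ^ (γ / 2) + η (j + 1))))) * p ^ (edges H).card ≤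
          (P H + 3 * t) * p ^ (edges H).card := by
        gcongr; linarith
      have s4 := add_le_add (add_le_add s3 s1) hsmall
      refine s4.trans (le_of_eq ?_)
      ring
    · have hcon : ¬ IsContributing K H := fun h => hc h.2.2
      simp only [hcon, if_false, zero_add]
      have hgap := hgood.1 H hHK (by rw [mul_comm]; exact hc)
      refine (add_le_add (lintegral_big_le H hm hp hW hmass) le_rfl).trans ?_
      have hpk := (rp ((edges H).card + κ)).le
      rw [← ENNReal.ofReal_add (mul_nonneg hmn (rp _).le)
        (mul_nonneg (by positivity) (mul_nonneg hE0 (mul_nonneg hmn hpk)))]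
      refine ENNReal.ofReal_le_ofReal ?_
      have h1 : p ^ ((verts H).card + γ * coverNum H) ≤ p ^ ((edges H).card + κ) := by
        refine Real.rpow_le_rpow_of_exponent_ge hp hp1.le ?_
        have h2 : κ ≤ (E + 1) * (2 * n + 2) * κ := by
          have h3 : (0 : ℝ) ≤ E := Nat.cast_nonneg _
          have h4 : (0 : ℝ) ≤ n := Nat.cast_nonneg _
          have h5 : (1 : ℝ) ≤ (E + 1) * (2 * n + 2) := by nlinarith
          nlinarith
        linarith
      have h2 : m ^ n * p ^ ((verts H).card + γ * coverNum H) ≤ p ^ (edges H).card * t := by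
        calc _ ≤ m ^ n * p ^ ((edges H).card + κ) := by gcongr
          _ = p ^ (edges H).card * (m ^ n * p ^ κ) := by
            rw [Real.rpow_add hp, Real.rpow_natCast]; ring
          _ ≤ _ := by gcongr
      have h3 : 0 ≤ p ^ (edges H).card * t := by positivity
      linarith
  rw [hUW, hom_addConst K U hUb p]
  refine (Finset.sum_le_sum (g := fun H => p ^ E *
    ((if IsContributing K H then P H else 0) + 5 * t)) fun H hH => ?_).trans ?_
  · exact hmain H (Finset.mem_filter.1 hH).2
  · rw [← Finset.mul_sum]
    refine mul_le_mul_of_nonneg_left ?_ (by positivity)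
    refine (Finset.sum_le_sum_of_subset_of_nonneg (Finset.subset_univ _) fun H _ _ => ?_).trans ?_
    · have : 0 ≤ if IsContributing K H then P H else 0 := by
        split_ifs
        · exact hP0 H
        · exact le_rfl
      positivity
    · rw [Finset.sum_add_distrib, Finset.sum_const, nsmul_eq_mul, ← Finset.sum_filter, contribPoly]
      exact le_of_eq (by simp only [hP]; congr!)

end UpperBound

/-! ### The asymptotic lower bound for the entropy -/

section EntropyLowerBound

open scoped ENNReal

theorem exists_mul_sqrt_le {C t : ℝ} (hC : 0 ≤ C) (ht : 0 < t) :
    ∃ x : ℝ, 0 < x ∧ x ≤ 1 ∧ C * x ^ (1 / 2 : ℝ) ≤ t := by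
  have h0 : 0 < C + t := by linarith
  have h1 : 0 ≤ t / (C + t) := by positivity
  have h2 : t / (C + t) ≤ 1 := (div_le_one h0).2 (by linarith)
  refine ⟨(t / (C + t)) ^ 2, by positivity, pow_le_one₀ h1 h2, ?_⟩
  rw [← Real.sqrt_eq_rpow, Real.sqrt_sq h1, mul_div_assoc', div_le_iff₀ h0]
  nlinarith

/-- Thresholds that decrease fast enough. -/
theorem exists_fast_decreasing {m t : ℝ} (hm : 0 < m) (ht : 0 < t) (n : ℕ) :
    ∃ η : ℕ → ℝ, (∀ j, 0 < η j) ∧ (∀ j, η j ≤ 1) ∧ Antitone η ∧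
      ∀ j, 2 ^ n * ((m * (m / η j)) ^ n * η (j + 1)) ≤ t := by
  set f : ℝ → ℝ := fun y => min y (t / (2 ^ n * (m * (m / y)) ^ n)) with hf
  set η : ℕ → ℝ := fun j => f^[j] 1 with hη
  have hs : ∀ j, η (j + 1) = f (η j) := fun j => Function.iterate_succ_apply' f j 1
  have h0 : ∀ j, 0 < η j := by
    intro j
    induction j with
    | zero => exact one_pos
    | succ j ih => rw [hs]; simp only [hf]; positivity
  have hanti : Antitone η := antitone_nat_of_succ_le fun j => by rw [hs]; exact min_le_left _ _
  refine ⟨η, h0, fun j => hanti (Nat.zero_le j), hanti, fun j => ?_⟩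
  have hj := h0 j
  have hpos : 0 < 2 ^ n * (m * (m / η j)) ^ n := by positivity
  rw [← mul_assoc, hs, ← le_div_iff₀' hpos]
  exact min_le_right _ _

theorem tendsto_log_one_div : Tendsto (fun p : ℝ => Real.log (1 / p)) (𝓝[>] 0) atTop := by
  simp only [one_div]
  exact Real.tendsto_log_atTop.comp tendsto_inv_nhdsGT_zero

theorem tendsto_rpow_zero {r : ℝ} (hr : 0 < r) :
    Tendsto (fun p : ℝ => p ^ r) (𝓝[>] 0) (𝓝 0) := by
  have h := (Real.continuousAt_rpow_const 0 r (Or.inr hr.le)).tendsto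
  rw [Real.zero_rpow hr.ne'] at h
  exact h.mono_left nhdsWithin_le_nhds

theorem eventually_mul_rpow_le {r C t : ℝ} (hr : 0 < r) (ht : 0 < t) :
    ∀ᶠ p in 𝓝[>] (0 : ℝ), C * p ^ r ≤ t := by
  have h := (tendsto_rpow_zero hr).const_mul C
  rw [mul_zero] at h
  exact (h.eventually (gt_mem_nhds ht)).mono fun p h => h.le

theorem eventually_mul_rpow_mul_log_le {r C t : ℝ} (hr : 0 < r) (ht : 0 < t) :
    ∀ᶠ p in 𝓝[>] (0 : ℝ), C * (p ^ r * Real.log (1 / p)) ≤ t := by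
  have h := (tendsto_log_mul_rpow_nhdsGT_zero hr).const_mul (-C)
  rw [mul_zero] at h
  refine (h.eventually (gt_mem_nhds ht)).mono fun p h => ?_
  rw [one_div, Real.log_inv]
  refine le_trans (le_of_eq ?_) h.le
  ring

theorem eventually_lt_one : ∀ᶠ p in 𝓝[>] (0 : ℝ), 0 < p ∧ p < 1 :=
  Ioo_mem_nhdsGT one_pos

variable {V : Type*} [Fintype V]

/-- A `p`-regular graphon whose entropy is of order at most `p ^ (2 + γ) log (1 / p)` has at most about
`P_K(z, w)` times the expected number of copies of `K`, where `2 z + w` is bounded by the normalized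
entropy. -/
theorem eventually_exists_hom_le {K : SimpleGraph V} (hγ : 0 < gam K)
    (hbad : ∀ H, IsContributing K H → ∀ e, ¬ IsBadEdge H e) (M : ℝ) {τ : ℝ} (hτ : 0 < τ) :
    ∀ᶠ p in 𝓝[>] (0 : ℝ), ∀ W : Graphon, IsRegular p W →
      entropy p W ≤ M * (p ^ (2 + gam K) * Real.log (1 / p)) →
      ∃ z w : ℝ, 0 ≤ z ∧ 0 ≤ w ∧
        2 * z + w ≤ entropy p W / (p ^ (2 + gam K) * Real.log (1 / p)) + τ ∧
        hom K W.toSymKernel ≤ p ^ (edges K).card * (contribPoly K z w + τ) := by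
  classical
  set γ := gam K with hγd
  set n := Fintype.card V with hn
  set E := (edges K).card with hE
  set N : ℝ := ((Finset.univ : Finset (SimpleGraph V)).card : ℝ) with hN
  have hN0 : 0 ≤ N := Nat.cast_nonneg _
  -- The constants are chosen in the order `κ`, `m`, then `ε`, `J` and `η`; only then is `p` taken
  -- small in terms of all of them.
  set t := τ / (5 * (N + 1)) with htd
  have ht : 0 < t := by positivity
  have hNt : N * (5 * t) ≤ τ := by
    rw [htd, mul_div_assoc', mul_div_assoc', div_le_iff₀ (by positivity)]
    nlinarith
  set M' := max M 1 with hM'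
  have hM1 : 1 ≤ M' := le_max_right _ _
  have hM0 : 0 < M' := by linarith
  obtain ⟨κ, hgood, hκ, hκ1⟩ := ((eventually_isGoodExponent hγ hbad
    ((E + 1) * (2 * n + 2))).and eventually_lt_one).exists
  set k : ℝ := (E + 1) * κ with hk
  have hk0 : 0 < k := by positivity
  set m := 2 * M' / κ + 1 with hm
  have hm1 : 1 ≤ m := by
    have : 0 ≤ 2 * M' / κ := by positivity
    linarith
  have hm0 : 0 < m := by linarith
  have hmn : 0 ≤ m ^ n := by positivity
  obtain ⟨ε, hε, hε1, t1⟩ := exists_mul_sqrt_le (C := E * m ^ n) (t := t) (by positivity) ht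
  obtain ⟨y, hy, -, hyt⟩ := exists_mul_sqrt_le (C := n * m ^ n) (t := t) (by positivity) ht
  obtain ⟨J, hJ⟩ := exists_nat_ge (m / y)
  have hJ0 : (0 : ℝ) < J := (by positivity : 0 < m / y).trans_le hJ
  have hJ' : 0 < J := by exact_mod_cast hJ0
  have t2 : n * (m ^ n * (m / J) ^ (1 / 2 : ℝ)) ≤ t := by
    rw [← mul_assoc]
    refine le_trans ?_ hyt
    have : m / J ≤ y := by
      rw [div_le_iff₀ hJ0]; rw [div_le_iff₀ hy] at hJ; linarith
    gcongr
  obtain ⟨η, hη, hη1, hηa, t3⟩ := exists_fast_decreasing hm0 ht n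
  filter_upwards [eventually_lt_one, eventually_mul_rpow_le (C := 1) (r := 1 - κ) (by linarith) hε,
    eventually_mul_rpow_le (C := 2 ^ n * (m * (m / η J)) ^ n) (r := γ / 2) (by linarith) ht,
    eventually_mul_rpow_le (C := 2 ^ E * ((E + 1) * m ^ n)) hκ ht,
    eventually_mul_rpow_le (C := (m / η J) ^ 2) hγ (half_pos hτ),
    eventually_mul_rpow_mul_log_le (C := 9 * M') hk0 hm0,
    tendsto_log_one_div.eventually_ge_atTop (2 / κ),
    tendsto_log_one_div.eventually_ge_atTop (2 * M' * (1 - Real.log ε) / τ + (1 - Real.log ε)),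
    tendsto_log_one_div.eventually_gt_atTop (1 - Real.log ε)]
    with p hp hpε p4 p5 p6 p7 pL1 pL2 pL3
  intro W hW hI
  obtain ⟨hp, hp1⟩ := hp
  set L := Real.log (1 / p) with hL
  have hLp : Real.log p = - L := by rw [hL, one_div, Real.log_inv, neg_neg]
  have hκL : 2 ≤ κ * L := by rwa [div_le_iff₀' hκ] at pL1
  have hL0 : 0 < L := (by positivity : 0 < 2 / κ).trans_le pL1
  have rp : ∀ r : ℝ, 0 < p ^ r := fun r => Real.rpow_pos_of_pos hp r
  set q := p ^ (2 + γ) with hq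
  have hq0 : 0 < q := rp _
  have hI0 := entropy_nonneg hp hp1 W
  have hI' : entropy p W ≤ M' * (q * L) := hI.trans (by gcongr; exact le_max_left _ _)
  have hmass : ∫⁻ x, ∫⁻ y, bigPart (p ^ (1 - κ)) (W.onPair s(x, y)) ≤
      ENNReal.ofReal (m * q) := by
    have e1 : Real.log (p ^ (1 - κ) / p) = κ * L := by
      rw [Real.log_div (rp _).ne' hp.ne', Real.log_rpow hp, hLp]; ring
    have h1 : 0 < Real.log (p ^ (1 - κ) / p) - 1 := by rw [e1]; linarith
    refine (mass_bigPart_le hp hp1 (rp _) h1 W).trans (ENNReal.ofReal_le_ofReal ?_)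
    rw [e1] at h1 ⊢
    rw [inv_mul_le_iff₀ h1]
    refine hI'.trans ?_
    have h2 : M' * L ≤ (κ * L - 1) * m := by
      have h3 : (κ * L - 1) * m = (κ * L - 1) * (2 * M' / κ) + (κ * L - 1) := by rw [hm]; ring
      have h4 : κ * L / 2 * (2 * M' / κ) = M' * L := by field_simp
      have h5 : κ * L / 2 * (2 * M' / κ) ≤ (κ * L - 1) * (2 * M' / κ) := by
        have : 0 ≤ 2 * M' / κ := by positivity
        exact mul_le_mul_of_nonneg_right (by linarith) this
      linarith
    calc M' * (q * L) = M' * L * q := by ring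
      _ ≤ (κ * L - 1) * m * q := by gcongr
      _ = _ := by ring
  have hfar : ∫⁻ x, ∫⁻ y, farPart p (p ^ (1 + k)) (W.onPair s(x, y)) ≤
      ENNReal.ofReal (m * p ^ (1 + γ - 3 * k)) := by
    refine (mass_farPart_le hp hp1 hk0.le W).trans (ENNReal.ofReal_le_ofReal ?_)
    have e1 : p ^ (-(1 + 2 * k)) * q = p ^ (1 + γ - 3 * k) * p ^ k := by
      rw [hq, ← Real.rpow_add hp, ← Real.rpow_add hp]; congr 1; ring
    have := rp (1 + γ - 3 * k)
    have := rp (-(1 + 2 * k))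
    calc 9 * p ^ (-(1 + 2 * k)) * entropy p W ≤ 9 * p ^ (-(1 + 2 * k)) * (M' * (q * L)) := by
          gcongr
      _ = (9 * M' * L) * (p ^ (-(1 + 2 * k)) * q) := by ring
      _ = p ^ (1 + γ - 3 * k) * (9 * M' * (p ^ k * L)) := by rw [e1]; ring
      _ ≤ p ^ (1 + γ - 3 * k) * m := by gcongr
      _ = _ := mul_comm _ _
  have e2 : Real.log (ε / p) = L + Real.log ε := by
    rw [Real.log_div hε.ne' hp.ne', hLp]; ring
  set L' := L + Real.log ε - 1 with hL'
  have hL'0 : 0 < L' := by linarith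
  -- Values above the constant `ε` cost `(1 + o(1)) log (1 / p)` per unit of mass, which gives the sharp
  -- constant.
  have hmass' : ∫⁻ x, ∫⁻ y, bigPart ε (W.onPair s(x, y)) ≤
      ENNReal.ofReal (entropy p W / (q * L') * q) := by
    have h1 : 0 < Real.log (ε / p) - 1 := by rw [e2]; exact hL'0
    refine (mass_bigPart_le hp hp1 hε h1 W).trans (ENNReal.ofReal_le_ofReal (le_of_eq ?_))
    rw [e2, ← hL']
    field_simp
  obtain ⟨z, w, hz, hw, hzw, hhom⟩ := exists_hom_le (t := t) (m' := entropy p W / (q * L')) hγ hbad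
    hm1 hp hp1 hκ ht.le hgood hW hmass hfar (by linarith) hε1 (by positivity) hmass' hη hη1
    hηa hJ' (by rw [← mul_assoc]; exact t1) t2 t3 (by rw [← mul_assoc]; exact p4)
    (by rw [← mul_assoc, ← mul_assoc] at *; linarith)
  refine ⟨z, w, hz, hw, ?_, ?_⟩
  -- Replacing `L' = log (ε / p) - 1` by `log (1 / p)` costs only `τ / 2`, as the normalized entropy is
  -- bounded.
  · have h1 : entropy p W / (q * L') ≤ entropy p W / (q * L) + τ / 2 := by
      set I := entropy p W / q with hIq
      have hIL : I ≤ M' * L := by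
        rw [hIq, div_le_iff₀ hq0]; linarith
      have hIn : 0 ≤ I := by positivity
      have h2 : M' * (1 - Real.log ε) ≤ τ / 2 * L' := by
        have h3 : 2 * M' * (1 - Real.log ε) / τ ≤ L' := by linarith
        rw [div_le_iff₀ hτ] at h3
        linarith
      rw [← div_div, ← div_div, ← hIq, ← sub_le_iff_le_add', div_sub_div _ _ hL'0.ne' hL0.ne',
        div_le_iff₀ (by positivity)]
      have h3 : I * L - L' * I = I * (1 - Real.log ε) := by rw [hL']; ring
      have h4 : 0 ≤ 1 - Real.log ε := by have := Real.log_nonpos hε.le hε1; linarith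
      rw [h3]
      calc I * (1 - Real.log ε) ≤ M' * L * (1 - Real.log ε) := by gcongr
        _ = M' * (1 - Real.log ε) * L := by ring
        _ ≤ τ / 2 * L' * L := by gcongr
        _ = _ := by ring
    linarith
  · refine hhom.trans ?_
    gcongr

/-! ### The polynomial and its minimization problem -/

theorem continuous_contribPoly (K : SimpleGraph V) :
    Continuous fun q : ℝ × ℝ => contribPoly K q.1 q.2 := by
  classical
  unfold contribPoly
  refine continuous_finsetSum _ fun H _ => continuous_finsetSum _ fun A hA => ?_
  refine (continuous_fst.pow _).mul (continuous_snd.rpow_const fun _ => Or.inr ?_)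
  have := (Finset.mem_filter.1 hA).2.card_le
  linarith

theorem contribPoly_zero (K : SimpleGraph V) : contribPoly K 0 0 = 1 := by
  classical
  unfold contribPoly
  -- The empty subgraph gives the constant term; the other terms have positive degree.
  rw [Finset.sum_eq_single ⊥]
  · rw [Finset.sum_eq_single ∅]
    · simp [coverNum_bot]
    · intro A hA hne
      have := (Finset.mem_filter.1 hA).2.1
      rw [verts_bot, Finset.subset_empty] at this
      exact absurd this hne
    · intro h
      obtain ⟨S, hS⟩ := exists_isValid (⊥ : SimpleGraph V)
      have h1 := hS.1
      rw [verts_bot, Finset.subset_empty] at h1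
      subst h1
      exact absurd (Finset.mem_filter.2 ⟨Finset.mem_univ _, hS⟩) h
  · intro H hH hne
    refine Finset.sum_eq_zero fun A hA => ?_
    have hc := one_le_coverNum hne
    by_cases h : A.card = 0
    · rw [h]
      simp only [Nat.cast_zero, sub_zero]
      rw [Real.zero_rpow (by linarith), mul_zero]
    · rw [zero_pow h, zero_mul]
  · intro h
    exact absurd (Finset.mem_filter.2 ⟨Finset.mem_univ _, isContributing_bot K⟩) h

theorem rhoValues_nonempty {K : SimpleGraph V} (hγ : 0 < gam K) {δ : ℝ} (hδ : 0 < δ) :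
    (rhoValues K δ).Nonempty := by
  classical
  obtain ⟨H, hne, hH⟩ := exists_contributing hγ
  obtain ⟨A, hA⟩ := exists_isValid H
  refine ⟨_, 1 + δ, 1 + δ, by linarith, by linarith, ?_, rfl⟩
  have h0 : (0 : ℝ) < 1 + δ := by linarith
  have hnn : ∀ (H : SimpleGraph V) (A : Finset V),
      0 ≤ (1 + δ) ^ A.card * (1 + δ) ^ (coverNum H - (A.card : ℝ)) := fun H A => by positivity
  unfold contribPoly
  refine le_trans ?_ (Finset.single_le_sum (f := fun H => ∑ A ∈ (Finset.univ : Finset (Finset V)).filter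
    (fun A => IsValid H A), (1 + δ) ^ A.card * (1 + δ) ^ (coverNum H - (A.card : ℝ)))
    (fun H _ => Finset.sum_nonneg fun A _ => hnn H A)
    (Finset.mem_filter.2 ⟨Finset.mem_univ H, hH⟩))
  refine le_trans ?_ (Finset.single_le_sum (fun A _ => hnn H A)
    (Finset.mem_filter.2 ⟨Finset.mem_univ A, hA⟩))
  rw [← Real.rpow_natCast, ← Real.rpow_add h0, add_sub_cancel]
  calc 1 + δ = (1 + δ) ^ (1 : ℝ) := (Real.rpow_one _).symm
    _ ≤ _ := Real.rpow_le_rpow_of_exponent_le (by linarith) (one_le_coverNum hne)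

/-- The minimum in the definition of `ρ` is attained, at a point other than the origin. -/
theorem exists_isLeast_rho {K : SimpleGraph V} (hγ : 0 < gam K) {δ : ℝ} (hδ : 0 < δ) :
    IsLeast (rhoValues K δ) (rho K δ) ∧ 0 < rho K δ := by
  obtain ⟨s₀, z₀, w₀, hz₀, hw₀, hP₀, hs₀⟩ := rhoValues_nonempty hγ hδ
  have hs0 : 0 ≤ s₀ := by rw [hs₀]; positivity
  set T : Set (ℝ × ℝ) := (Set.Icc 0 s₀ ×ˢ Set.Icc 0 (2 * s₀)) ∩
    {q | 1 + δ ≤ contribPoly K q.1 q.2} with hT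
  have hTc : IsCompact T := (isCompact_Icc.prod isCompact_Icc).inter_right
    (isClosed_le continuous_const (continuous_contribPoly K))
  have hTne : T.Nonempty := ⟨(z₀, w₀), ⟨⟨⟨hz₀, by linarith⟩, ⟨hw₀, by linarith⟩⟩, hP₀⟩⟩
  obtain ⟨⟨z, w⟩, ⟨⟨⟨hz, hz1⟩, ⟨hw, hw1⟩⟩, hP⟩, hmin⟩ := hTc.exists_isMinOn hTne
    (f := fun q : ℝ × ℝ => q.1 + q.2 / 2) (by fun_prop)
  have hle : z + w / 2 ≤ s₀ := by
    rw [hs₀]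
    exact hmin (show ((z₀, w₀) : ℝ × ℝ) ∈ T from
      ⟨⟨⟨hz₀, by linarith⟩, ⟨hw₀, by linarith⟩⟩, hP₀⟩)
  have hleast : IsLeast (rhoValues K δ) (z + w / 2) := by
    refine ⟨⟨z, w, hz, hw, hP, rfl⟩, ?_⟩
    rintro s ⟨z', w', hz', hw', hP', rfl⟩
    rcases le_or_gt (z' + w' / 2) s₀ with h | h
    · exact hmin (show ((z', w') : ℝ × ℝ) ∈ T from
        ⟨⟨⟨hz', by linarith⟩, ⟨hw', by linarith⟩⟩, hP'⟩)
    · exact hle.trans h.le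
  have hrho : rho K δ = z + w / 2 := hleast.csInf_eq
  refine ⟨hrho ▸ hleast, ?_⟩
  rw [hrho]
  by_contra hcon
  have h1 : z = 0 := by simp only at hz hw; linarith
  have h2 : w = 0 := by simp only at hz hw; linarith
  have hP' : 1 + δ ≤ contribPoly K z w := hP
  rw [h1, h2, contribPoly_zero] at hP'
  linarith

/-- Points that almost satisfy the constraint almost attain the minimum. -/
theorem exists_slack {K : SimpleGraph V} {δ τ : ℝ} (hτ : 0 < τ) :
    ∃ τ' > 0, ∀ z w : ℝ, 0 ≤ z → 0 ≤ w → 1 + δ ≤ contribPoly K z w + τ' →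
      rho K δ - τ ≤ z + w / 2 := by
  set s := rho K δ - τ with hs
  set T : Set (ℝ × ℝ) := (Set.Icc 0 s ×ˢ Set.Icc 0 (2 * s)) ∩ {q | q.1 + q.2 / 2 ≤ s} with hT
  have hTc : IsCompact T := (isCompact_Icc.prod isCompact_Icc).inter_right
    (isClosed_le (by fun_prop) continuous_const)
  have hmem : ∀ z w : ℝ, 0 ≤ z → 0 ≤ w → z + w / 2 ≤ s → ((z, w) : ℝ × ℝ) ∈ T :=
    fun z w hz hw h => ⟨⟨⟨hz, by linarith⟩, ⟨hw, by linarith⟩⟩, h⟩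
  rcases T.eq_empty_or_nonempty with he | hne
  -- If the triangle `z + w / 2 ≤ s` is empty, there is nothing to prove; otherwise `P_K` attains a
  -- maximum less than `1 + δ` on it.
  · refine ⟨1, one_pos, fun z w hz hw _ => ?_⟩
    by_contra hcon
    have := hmem z w hz hw (not_le.1 hcon).le
    rw [he] at this
    exact this
  · obtain ⟨⟨z₁, w₁⟩, ⟨⟨⟨hz₁, -⟩, ⟨hw₁, -⟩⟩, h₁⟩, hmax⟩ := hTc.exists_isMaxOn hne
      (continuous_contribPoly K).continuousOn
    have h₁' : z₁ + w₁ / 2 ≤ s := h₁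
    have hlt : contribPoly K z₁ w₁ < 1 + δ := by
      by_contra hcon
      have h2 : rho K δ ≤ z₁ + w₁ / 2 := by
        refine csInf_le ⟨0, ?_⟩ ⟨z₁, w₁, hz₁, hw₁, not_lt.1 hcon, rfl⟩
        rintro x ⟨z', w', hz', hw', -, rfl⟩
        positivity
      linarith
    refine ⟨(1 + δ - contribPoly K z₁ w₁) / 2, by linarith, fun z w hz hw h => ?_⟩
    by_contra hcon
    have h3 : contribPoly K z w ≤ contribPoly K z₁ w₁ := hmax (hmem z w hz hw (not_le.1 hcon).le)
    linarith

/-- The lower bound for the entropy of admissible graphons. -/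
theorem eventually_le_entropy {K : SimpleGraph V} (hγ : 0 < gam K)
    (hbad : ∀ H, IsContributing K H → ∀ e, ¬ IsBadEdge H e) {δ τ : ℝ} (hτ : 0 < τ) :
    ∀ᶠ p in 𝓝[>] (0 : ℝ), ∀ W : Graphon, IsAdmissible K δ p W →
      (2 * rho K δ - τ) * (p ^ (2 + gam K) * Real.log (1 / p)) ≤ entropy p W := by
  obtain ⟨τ', hτ', hslack⟩ := exists_slack (K := K) (δ := δ) (τ := τ / 4) (by linarith)
  filter_upwards [eventually_lt_one, tendsto_log_one_div.eventually_gt_atTop 0,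
    eventually_exists_hom_le hγ hbad (2 * rho K δ - τ)
    (τ := min τ' (τ / 4)) (lt_min hτ' (by linarith))] with p hp hL h W hW
  by_contra hcon
  rw [not_le] at hcon
  obtain ⟨z, w, hz, hw, hzw, hhom⟩ := h W hW.1 hcon.le
  have hq : 0 < p ^ (2 + gam K) * Real.log (1 / p) := mul_pos (Real.rpow_pos_of_pos hp.1 _) hL
  have hE : 0 < p ^ (edges K).card := pow_pos hp.1 _
  have h1 : 1 + δ ≤ contribPoly K z w + τ' := by
    have h2 := hW.2.trans hhom
    rw [mul_comm, mul_le_mul_iff_right₀ hE] at h2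
    linarith [min_le_left τ' (τ / 4)]
  have h3 := hslack z w hz hw h1
  have h4 : entropy p W / (p ^ (2 + gam K) * Real.log (1 / p)) < 2 * rho K δ - τ := by
    rwa [div_lt_iff₀ hq]
  have := min_le_right τ' (τ / 4)
  linarith

end EntropyLowerBound

/-! ### Step kernels -/

section StepKernels

variable {V : Type*} [Fintype V] [DecidableEq V] {κ : Type*} [Fintype κ] [MeasurableSpace κ]
  [MeasurableSingletonClass κ]

theorem measureReal_map_singleton {blk : unitInterval → κ} (hblk : Measurable blk) (i : κ) :
    (volume.map blk).real {i} = volume.real (blk ⁻¹' {i}) := by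
  rw [measureReal_def, measureReal_def, Measure.map_apply hblk (measurableSet_singleton i)]

theorem integral_comp_block {blk : unitInterval → κ} (hblk : Measurable blk) (f : κ → ℝ) :
    ∫ x, f (blk x) = ∑ i, volume.real (blk ⁻¹' {i}) * f i := by
  have : IsProbabilityMeasure (volume.map blk) := Measure.isProbabilityMeasure_map hblk.aemeasurable
  rw [← integral_map hblk.aemeasurable (measurable_of_countable f).aestronglyMeasurable,
    integral_fintype Integrable.of_finite]
  simp only [measureReal_map_singleton hblk, smul_eq_mul]

theorem integral_pi_comp_block {blk : unitInterval → κ} (hblk : Measurable blk)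
    (g : (V → κ) → ℝ) : ∫ x : V → unitInterval, g (fun v => blk (x v)) =
      ∑ B : V → κ, (∏ v, volume.real (blk ⁻¹' {B v})) * g B := by
  have : IsProbabilityMeasure (volume.map blk) := Measure.isProbabilityMeasure_map hblk.aemeasurable
  have hm : Measurable fun (x : V → unitInterval) v => blk (x v) :=
    measurable_pi_lambda _ fun v => hblk.comp (measurable_pi_apply v)
  have hmap : (volume : Measure (V → unitInterval)).map (fun x v => blk (x v)) =
      Measure.pi fun _ => volume.map blk :=
    Measure.pi_map_pi fun _ => hblk.aemeasurable
  rw [← integral_map hm.aemeasurable (measurable_of_countable g).aestronglyMeasurable, hmap,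
    integral_fintype Integrable.of_finite]
  refine Finset.sum_congr rfl fun B _ => ?_
  rw [smul_eq_mul, measureReal_def, Measure.pi_singleton, ENNReal.toReal_prod]
  congr 1
  exact Finset.prod_congr rfl fun v _ => measureReal_map_singleton hblk (B v)

theorem edgeProd_step (K : SimpleGraph V) {F : SymKernel} {blk : unitInterval → κ} {φ : Sym2 κ → ℝ}
    (hF : ∀ x y, F.toFun x y = φ s(blk x, blk y)) (x : V → unitInterval) :
    edgeProd K F x = ∏ e ∈ edges K, φ (e.map fun v => blk (x v)) := by
  refine Finset.prod_congr rfl fun e _ => ?_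
  induction e using Sym2.ind with
  | _ u v => exact hF (x u) (x v)

theorem hom_step (K : SimpleGraph V) {F : SymKernel} {blk : unitInterval → κ}
    (hblk : Measurable blk) {φ : Sym2 κ → ℝ} (hF : ∀ x y, F.toFun x y = φ s(blk x, blk y)) :
    hom K F = ∑ B : V → κ, (∏ v, volume.real (blk ⁻¹' {B v})) * ∏ e ∈ edges K, φ (e.map B) := by
  rw [← integral_pi_comp_block hblk fun B => ∏ e ∈ edges K, φ (e.map B)]
  exact integral_congr_ae (Filter.Eventually.of_forall (edgeProd_step K hF))

theorem volume_Ico_unitInterval {s t : ℝ} (hs : 0 ≤ s) (hst : s ≤ t) (ht : t ≤ 1) :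
    volume.real {x : unitInterval | s ≤ (x : ℝ) ∧ (x : ℝ) < t} = t - s := by
  have h := unitInterval.measurePreserving_coe.measure_preimage
    (measurableSet_Ico (a := s) (b := t)).nullMeasurableSet
  have e : {x : unitInterval | s ≤ (x : ℝ) ∧ (x : ℝ) < t} = Subtype.val ⁻¹' Set.Ico s t := rfl
  rw [measureReal_def, e, h, Measure.restrict_apply measurableSet_Ico,
    Set.inter_eq_left.2 (show Set.Ico s t ⊆ unitInterval from
      fun x hx => ⟨hs.trans hx.1, hx.2.le.trans ht⟩), Real.volume_Ico,
    ENNReal.toReal_ofReal (by linarith)]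

theorem volume_Ici_unitInterval {s : ℝ} (hs : 0 ≤ s) (hs1 : s ≤ 1) :
    volume.real {x : unitInterval | s ≤ (x : ℝ)} = 1 - s := by
  have h := unitInterval.measurePreserving_coe.measure_preimage
    (measurableSet_Ici (a := s)).nullMeasurableSet
  have e : {x : unitInterval | s ≤ (x : ℝ)} = Subtype.val ⁻¹' Set.Ici s := rfl
  have e2 : Set.Ici s ∩ unitInterval = Set.Icc s 1 := by
    ext x; exact ⟨fun hx => ⟨hx.1, hx.2.2⟩, fun hx => ⟨hx.1, hs.trans hx.1, hx.2⟩⟩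
  rw [measureReal_def, e, h, Measure.restrict_apply measurableSet_Ici, e2, Real.volume_Icc,
    ENNReal.toReal_ofReal (by linarith)]

end StepKernels

/-! ### The extremal graphons -/

section Construction

/-- The blocks `[0, a)`, `[a, p - c)`, `[p - c, p)` and `[p, 1]`, numbered from `0` to `3`. Points
in block `0` are the hubs; block `2` is a clique; block `1` completes the neighborhood of the
hubs. -/
noncomputable def blockOf (p a c : ℝ) (x : unitInterval) : Fin 4 :=
  if (x : ℝ) < a then 0 else if (x : ℝ) < p - c then 1 else if (x : ℝ) < p then 2 else 3

/-- The values on the blocks; the last row and column are chosen to make the graphon `p`-regular. -/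
noncomputable def blockVal (p a c : ℝ) : Fin 4 → Fin 4 → ℝ :=
  ![![1, 1, 1, 0], ![1, p, p, p - a], ![1, p, 1, p - a - c],
    ![0, p - a, p - a - c, (p - (p - a - c) * (p - a + c)) / (1 - p)]]

theorem blockVal_symm (p a c : ℝ) (i j : Fin 4) : blockVal p a c i j = blockVal p a c j i := by
  fin_cases i <;> fin_cases j <;> rfl

theorem measurable_blockOf (p a c : ℝ) : Measurable (blockOf p a c) := by
  have h : ∀ s : ℝ, MeasurableSet {x : unitInterval | (x : ℝ) < s} := fun s =>
    measurableSet_lt measurable_subtype_coe measurable_const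
  exact Measurable.ite (h a) measurable_const (Measurable.ite (h _) measurable_const
    (Measurable.ite (h p) measurable_const measurable_const))

/-- The block graphon with the values `blockVal`. They are truncated to `[0, 1]`, which has no
effect for the parameters of interest. -/
noncomputable def blockGraphon (p a c : ℝ) : BlockGraphon 3 where
  toFun x y := max 0 (min 1 (blockVal p a c (blockOf p a c x) (blockOf p a c y)))
  measurable' := by
    have h : Measurable fun q : unitInterval × unitInterval =>
        (blockOf p a c q.1, blockOf p a c q.2) :=
      ((measurable_blockOf p a c).comp measurable_fst).prodMk
        ((measurable_blockOf p a c).comp measurable_snd)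
    exact (measurable_of_countable fun r : Fin 4 × Fin 4 =>
      max 0 (min 1 (blockVal p a c r.1 r.2))).comp h
  symm' x y := by rw [blockVal_symm]
  nonneg' _ _ := le_max_left _ _
  le_one' _ _ := max_le zero_le_one (min_le_left _ _)
  part i := {x | blockOf p a c x = i}
  interval i := by
    constructor
    intro x hx y hy z hz
    have h1 : (x : ℝ) ≤ z := hz.1
    have h2 : (z : ℝ) ≤ y := hz.2
    have hx' : blockOf p a c x = i := hx
    have hy' : blockOf p a c y = i := hy
    show blockOf p a c z = i
    rw [← hx'] at hy' ⊢
    unfold blockOf at *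
    clear hx hy hx' hz
    split_ifs at * <;> first | rfl | (exfalso; linarith) | simp_all
  disj i j hij := Set.disjoint_left.2 fun x hi hj => hij (Eq.trans (Eq.symm hi) hj)
  cover := Set.eq_univ_of_forall fun x => Set.mem_iUnion.2 ⟨blockOf p a c x, rfl⟩
  val i j := max 0 (min 1 (blockVal p a c i j))
  const i j x hx y hy := by
    have hx' : blockOf p a c x = i := hx
    have hy' : blockOf p a c y = j := hy
    rw [hx', hy']

/-- The parameters for which `blockGraphon p a c` is `p`-regular. -/
structure GoodParams (p a c : ℝ) : Prop where
  a_pos : 0 < a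
  c_pos : 0 < c
  lt : a + c < p
  le_half : p ≤ 1 / 2

variable {p a c : ℝ}

/-- The lengths of the blocks. -/
noncomputable def blockLen (p a c : ℝ) : Fin 4 → ℝ := ![a, p - a - c, c, 1 - p]

theorem len_eq (h : GoodParams p a c) (i : Fin 4) :
    (blockGraphon p a c).len i = blockLen p a c i := by
  obtain ⟨h1, h2, h3, h4⟩ := h
  have key : ∀ s : Set unitInterval, (∀ x, blockOf p a c x = i ↔ x ∈ s) →
      (blockGraphon p a c).len i = volume.real s := by
    intro s hs
    have : (blockGraphon p a c).part i = s := Set.ext hs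
    rw [BlockGraphon.len, this]
  have hb : ∀ x : unitInterval, ¬ (x : ℝ) < a → ¬ (x : ℝ) < p - c → ¬ (x : ℝ) < p →
      p ≤ (x : ℝ) := fun x _ _ h => not_lt.1 h
  fin_cases i
  · refine (key {x | 0 ≤ (x : ℝ) ∧ (x : ℝ) < a} fun x => ?_).trans ?_
    · have := x.2.1
      show _ ↔ 0 ≤ (x : ℝ) ∧ (x : ℝ) < a
      unfold blockOf
      split_ifs <;> simp_all
    · rw [volume_Ico_unitInterval le_rfl h1.le (by linarith)]
      simp [blockLen]
  · refine (key {x | a ≤ (x : ℝ) ∧ (x : ℝ) < p - c} fun x => ?_).trans ?_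
    · show _ ↔ a ≤ (x : ℝ) ∧ (x : ℝ) < p - c
      unfold blockOf
      split_ifs <;> simp_all
    · rw [volume_Ico_unitInterval h1.le (by linarith) (by linarith)]
      simp [blockLen]; ring
  · refine (key {x | p - c ≤ (x : ℝ) ∧ (x : ℝ) < p} fun x => ?_).trans ?_
    · show _ ↔ p - c ≤ (x : ℝ) ∧ (x : ℝ) < p
      unfold blockOf
      split_ifs with g1 g2 g3
      · simp; intro; linarith
      · simp; intro; linarith
      · simp_all
      · simp_all
    · rw [volume_Ico_unitInterval (by linarith) (by linarith) (by linarith)]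
      simp [blockLen]
  · refine (key {x | p ≤ (x : ℝ)} fun x => ?_).trans ?_
    · show _ ↔ p ≤ (x : ℝ)
      unfold blockOf
      split_ifs with g1 g2 g3
      · simp; linarith
      · simp; linarith
      · simp_all
      · simp_all
    · rw [volume_Ici_unitInterval (by linarith) (by linarith)]
      simp [blockLen]

theorem le_blockVal_last (h : GoodParams p a c) :
    p ≤ (p - (p - a - c) * (p - a + c)) / (1 - p) ∧
      (p - (p - a - c) * (p - a + c)) / (1 - p) ≤ p + 2 * (2 * a * p + c ^ 2) := by
  obtain ⟨h1, h2, h3, h4⟩ := h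
  have h5 : 0 < 1 - p := by linarith
  have h6 : 0 < p := by linarith
  have h7 : a * a ≤ a * p := by gcongr; linarith
  have h8 : 0 ≤ a * p := by positivity
  rw [le_div_iff₀ h5, div_le_iff₀ h5]
  constructor
  · nlinarith
  · have h9 : 0 ≤ (2 * a * p + c ^ 2) * (1 - 2 * p) := mul_nonneg (by positivity) (by linarith)
    nlinarith

theorem blockVal_mem (h : GoodParams p a c) (i j : Fin 4) :
    0 ≤ blockVal p a c i j ∧ blockVal p a c i j ≤ 1 := by
  have h0 := le_blockVal_last h
  obtain ⟨h1, h2, h3, h4⟩ := h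
  have h5 : 0 < 1 - p := by linarith
  have h6 : (p - (p - a - c) * (p - a + c)) / (1 - p) ≤ 1 := by
    rw [div_le_one h5]
    have : 0 ≤ (p - a - c) * (p - a + c) := mul_nonneg (by linarith) (by linarith)
    linarith
  fin_cases i <;> fin_cases j <;> simp [blockVal] <;> (constructor <;> linarith)

theorem val_eq (h : GoodParams p a c) (i j : Fin 4) :
    (blockGraphon p a c).val i j = blockVal p a c i j := by
  obtain ⟨h1, h2⟩ := blockVal_mem h i j
  show max 0 (min 1 (blockVal p a c i j)) = _
  rw [min_eq_right h2, max_eq_right h1]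

/-- The values on the blocks, as a function of unordered pairs of blocks. -/
noncomputable def blockPair (p a c : ℝ) : Sym2 (Fin 4) → ℝ :=
  Sym2.lift ⟨blockVal p a c, blockVal_symm p a c⟩

theorem toFun_eq (h : GoodParams p a c) (x y : unitInterval) :
    (blockGraphon p a c).toFun x y = blockPair p a c s(blockOf p a c x, blockOf p a c y) :=
  val_eq h _ _

theorem volume_fiber (h : GoodParams p a c) (i : Fin 4) :
    volume.real (blockOf p a c ⁻¹' {i}) = blockLen p a c i := len_eq h i

theorem isRegular_blockGraphon (h : GoodParams p a c) :
    IsRegular p (blockGraphon p a c).toGraphon := by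
  intro x
  have e : ∀ y, (blockGraphon p a c).toFun x y =
      blockVal p a c (blockOf p a c x) (blockOf p a c y) := fun y => toFun_eq h x y
  have h5 : 1 - p ≠ 0 := by linarith [h.le_half]
  simp only [e]
  rw [integral_comp_block (measurable_blockOf p a c)]
  simp only [volume_fiber h]
  -- One identity for each of the four rows of values.
  generalize blockOf p a c x = i
  fin_cases i <;> simp [Fin.sum_univ_four, blockLen, blockVal] <;> (try field_simp) <;> ring

variable {V : Type*} [Fintype V] [DecidableEq V]

theorem hom_blockGraphon (h : GoodParams p a c) (K : SimpleGraph V) :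
    hom K (blockGraphon p a c).toSymKernel =
      ∑ B : V → Fin 4, (∏ v, blockLen p a c (B v)) * ∏ e ∈ edges K, blockPair p a c (e.map B) := by
  rw [hom_step K (measurable_blockOf p a c) (toFun_eq h)]
  simp only [volume_fiber h]

theorem hom_blockGraphon_addConst (h : GoodParams p a c) (K : SimpleGraph V) (t : ℝ) :
    hom K ((blockGraphon p a c).toSymKernel.addConst t) =
      ∑ B : V → Fin 4, (∏ v, blockLen p a c (B v)) *
        ∏ e ∈ edges K, (blockPair p a c (e.map B) + t) := by
  rw [hom_step K (measurable_blockOf p a c) (φ := fun q => blockPair p a c q + t)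
    fun x y => congrArg (· + t) (toFun_eq h x y)]
  simp only [volume_fiber h]

theorem homBlock_blockGraphon (h : GoodParams p a c) (K : SimpleGraph V) (B : V → Fin 4) :
    homBlock K (blockGraphon p a c) B =
      (∏ v, blockLen p a c (B v)) * ∏ e ∈ edges K, blockPair p a c (e.map B) := by
  have hpart : ∀ i, MeasurableSet ((blockGraphon p a c).part i) := fun i =>
    measurable_blockOf p a c (measurableSet_singleton i)
  have hm : MeasurableSet {x : V → unitInterval | ∀ v, x v ∈ (blockGraphon p a c).part (B v)} := by
    have : {x : V → unitInterval | ∀ v, x v ∈ (blockGraphon p a c).part (B v)} =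
        Set.univ.pi fun v => (blockGraphon p a c).part (B v) := by
      ext x; simp
    rw [this]
    exact MeasurableSet.univ_pi fun v => hpart _
  rw [homBlock, ← integral_indicator hm]
  have e : ∀ x : V → unitInterval,
      {x : V → unitInterval | ∀ v, x v ∈ (blockGraphon p a c).part (B v)}.indicator
        (fun x => edgeProd K (blockGraphon p a c).toSymKernel x) x =
      (fun B' : V → Fin 4 => if B' = B then ∏ e ∈ edges K, blockPair p a c (e.map B') else 0)
        fun v => blockOf p a c (x v) := by
    intro x
    by_cases hx : (fun v => blockOf p a c (x v)) = B
    · rw [Set.indicator_of_mem, edgeProd_step K (toFun_eq h)]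
      · simp only [hx, if_true]
      · exact fun v => congrFun hx v
    · rw [Set.indicator_of_notMem]
      · simp only [hx, if_false]
      · exact fun hx' => hx (funext hx')
  rw [integral_congr_ae (Filter.Eventually.of_forall e), integral_pi_comp_block
    (measurable_blockOf p a c) fun B' : V → Fin 4 =>
      if B' = B then ∏ e ∈ edges K, blockPair p a c (e.map B') else 0]
  simp only [volume_fiber h, mul_ite, mul_zero]
  simp

theorem entropy_blockGraphon (h : GoodParams p a c) :
    entropy p (blockGraphon p a c).toGraphon =
      ∑ i, ∑ j, blockLen p a c i * blockLen p a c j * entropyFn p (blockVal p a c i j) := by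
  have e : ∀ x y, (blockGraphon p a c).toFun x y =
      blockVal p a c (blockOf p a c x) (blockOf p a c y) := fun x y => toFun_eq h x y
  rw [entropy]
  simp only [e]
  have e2 : ∀ i, ∫ y, entropyFn p (blockVal p a c i (blockOf p a c y)) =
      ∑ j, blockLen p a c j * entropyFn p (blockVal p a c i j) := by
    intro i
    rw [integral_comp_block (measurable_blockOf p a c) fun j => entropyFn p (blockVal p a c i j)]
    simp only [volume_fiber h]
  simp only [e2]
  rw [integral_comp_block (measurable_blockOf p a c) fun i =>
    ∑ j, blockLen p a c j * entropyFn p (blockVal p a c i j)]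
  simp only [volume_fiber h, Finset.mul_sum, mul_assoc]

end Construction

/-! ### The positions of the vertices in the blocks -/

section Patterns

variable {V : Type*} [Fintype V] [DecidableEq V]

/-- The pairs of blocks on which the extremal graphon has the value `1`. -/
def IsOneBlock (i j : Fin 4) : Prop := (i = 0 ∧ j ≠ 3) ∨ (j = 0 ∧ i ≠ 3) ∨ (i = 2 ∧ j = 2)

theorem IsOneBlock.symm {i j : Fin 4} (h : IsOneBlock i j) : IsOneBlock j i := by
  unfold IsOneBlock at *; tauto

theorem IsOneBlock.ne_three {i j : Fin 4} (h : IsOneBlock i j) : i ≠ 3 := by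
  rcases h with ⟨rfl, -⟩ | ⟨-, h⟩ | ⟨rfl, -⟩
  · decide
  · exact h
  · decide

/-- The edges of `K` that `B` sends into blocks of value `1`. -/
def oneGraph (K : SimpleGraph V) (B : V → Fin 4) : SimpleGraph V where
  Adj u v := K.Adj u v ∧ IsOneBlock (B u) (B v)
  symm := ⟨fun _ _ h => ⟨h.1.symm, h.2.symm⟩⟩
  loopless := ⟨fun v h => K.loopless.irrefl v h.1⟩

theorem oneGraph_le (K : SimpleGraph V) (B : V → Fin 4) : oneGraph K B ≤ K := fun _ _ h => h.1

/-- The weights of the fractional vertex cover of the edges in blocks of value `1`. -/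
noncomputable def blockCover : Fin 4 → ℝ := ![1, 0, 1 / 2, 0]

/-- The lengths of the blocks are of order `p ^ blockExp`. -/
noncomputable def blockExp (γ : ℝ) : Fin 4 → ℝ := ![1 + γ, 1, 1 + γ / 2, 0]

theorem blockExp_eq (γ : ℝ) (i : Fin 4) :
    blockExp γ i = (if i ≠ 3 then 1 else 0) + γ * blockCover i := by
  fin_cases i <;> simp [blockExp, blockCover] <;> ring

theorem blockCover_nonneg (i : Fin 4) : 0 ≤ blockCover i := by
  fin_cases i <;> simp [blockCover]

theorem IsOneBlock.one_le {i j : Fin 4} (h : IsOneBlock i j) :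
    1 ≤ blockCover i + blockCover j := by
  have hi := blockCover_nonneg i
  have hj := blockCover_nonneg j
  rcases h with ⟨rfl, -⟩ | ⟨rfl, -⟩ | ⟨rfl, rfl⟩
  · have : blockCover 0 = 1 := rfl
    linarith
  · have : blockCover 0 = 1 := rfl
    linarith
  · have : blockCover 2 = 1 / 2 := rfl
    linarith

theorem sum_blockExp (γ : ℝ) (B : V → Fin 4) :
    ∑ v, blockExp γ (B v) = ((Finset.univ.filter fun v => B v ≠ 3).card : ℝ) +
      γ * ∑ v, blockCover (B v) := by
  simp only [blockExp_eq]
  rw [Finset.sum_add_distrib, Finset.mul_sum, ← Finset.sum_filter, Finset.sum_const, nsmul_eq_mul,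
    mul_one]

theorem isFracVertexCover_oneGraph (K : SimpleGraph V) (B : V → Fin 4) :
    IsFracVertexCover (oneGraph K B) fun v => blockCover (B v) :=
  ⟨fun _ _ => blockCover_nonneg _, fun _ _ h => h.2.one_le⟩

theorem verts_oneGraph_subset (K : SimpleGraph V) (B : V → Fin 4) :
    verts (oneGraph K B) ⊆ Finset.univ.filter fun v => B v ≠ 3 := by
  intro v hv
  obtain ⟨w, hw⟩ := mem_verts.1 hv
  exact Finset.mem_filter.2 ⟨Finset.mem_univ _, hw.2.ne_three⟩

theorem coverNum_oneGraph_le (K : SimpleGraph V) (B : V → Fin 4) :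
    coverNum (oneGraph K B) ≤ ∑ v, blockCover (B v) :=
  (coverNum_le (isFracVertexCover_oneGraph K B)).trans
    (Finset.sum_le_sum_of_subset_of_nonneg (Finset.subset_univ _) fun _ _ _ =>
      blockCover_nonneg _)

theorem card_edges_oneGraph_le {K : SimpleGraph V} (hγ : 0 < gam K) (B : V → Fin 4) :
    ((edges (oneGraph K B)).card : ℝ) ≤ ∑ v, blockExp (gam K) (B v) := by
  have h1 := sub_le_gam_mul (oneGraph_le K B)
  have h2 := coverNum_oneGraph_le K B
  have h3 : ((verts (oneGraph K B)).card : ℝ) ≤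
      ((Finset.univ.filter fun v => B v ≠ 3).card : ℝ) := by
    exact_mod_cast Finset.card_le_card (verts_oneGraph_subset K B)
  rw [sum_blockExp]
  nlinarith

/-- If the position `B` is not negligible, then the edges in blocks of value `1` attain the maximum
in the definition of `γ(K)`, they cover all the vertices outside the last block, and `blockCover` is
a minimum cover. -/
theorem oneGraph_of_tight {K : SimpleGraph V} (hγ : 0 < gam K) {B : V → Fin 4}
    (h : ∑ v, blockExp (gam K) (B v) ≤ (edges (oneGraph K B)).card) :
    (∀ v, B v ≠ 3 → v ∈ verts (oneGraph K B)) ∧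
      ((edges (oneGraph K B)).card : ℝ) - (verts (oneGraph K B)).card =
        gam K * coverNum (oneGraph K B) ∧
      ∑ v ∈ verts (oneGraph K B), blockCover (B v) = coverNum (oneGraph K B) := by
  have h1 := sub_le_gam_mul (oneGraph_le K B)
  have h2 := coverNum_oneGraph_le K B
  have h3 : ((verts (oneGraph K B)).card : ℝ) ≤
      ((Finset.univ.filter fun v => B v ≠ 3).card : ℝ) := by
    exact_mod_cast Finset.card_le_card (verts_oneGraph_subset K B)
  rw [sum_blockExp] at h
  have h4 : gam K * coverNum (oneGraph K B) ≤ gam K * ∑ v, blockCover (B v) := by gcongr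
  have h5 : (Finset.univ.filter fun v => B v ≠ 3).card ≤ (verts (oneGraph K B)).card := by
    have : ((Finset.univ.filter fun v => B v ≠ 3).card : ℝ) ≤ (verts (oneGraph K B)).card := by
      linarith
    exact_mod_cast this
  have h6 := Finset.eq_of_subset_of_card_le (verts_oneGraph_subset K B) h5
  have h7 : gam K * ∑ v, blockCover (B v) ≤ gam K * coverNum (oneGraph K B) := by linarith
  refine ⟨fun v hv => ?_, by linarith, ?_⟩
  · rw [h6]; exact Finset.mem_filter.2 ⟨Finset.mem_univ _, hv⟩
  · refine le_antisymm ?_ (coverNum_le (isFracVertexCover_oneGraph K B))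
    refine le_trans ?_ (le_of_mul_le_mul_left h7 hγ)
    exact Finset.sum_le_sum_of_subset_of_nonneg (Finset.subset_univ _) fun _ _ _ =>
      blockCover_nonneg _

/-! ### Bounds for the weight of a position -/

variable {p a c : ℝ}

theorem blockVal_of_isOneBlock {i j : Fin 4} (h : IsOneBlock i j) : blockVal p a c i j = 1 := by
  revert h
  unfold IsOneBlock
  fin_cases i <;> fin_cases j <;> simp [blockVal]

theorem blockVal_le_of_not (h : GoodParams p a c) {i j : Fin 4} (hij : ¬ IsOneBlock i j) :
    blockVal p a c i j ≤ 3 * p := by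
  have h0 := (le_blockVal_last h).2
  obtain ⟨h1, h2, h3, h4⟩ := h
  have h5 : 2 * a * p + c ^ 2 ≤ 2 * p * p := by nlinarith
  have h6 : (p - (p - a - c) * (p - a + c)) / (1 - p) ≤ 3 * p := by nlinarith
  revert hij
  unfold IsOneBlock
  fin_cases i <;> fin_cases j <;> simp [blockVal] <;> linarith

theorem le_blockVal_of_not (h : GoodParams p a c) {i j : Fin 4} (hij : ¬ IsOneBlock i j)
    (h1 : i = 0 → j ≠ 3) (h2 : j = 0 → i ≠ 3) : p - a - c ≤ blockVal p a c i j := by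
  have h0 := (le_blockVal_last h).1
  obtain ⟨g1, g2, g3, g4⟩ := h
  revert hij h1 h2
  unfold IsOneBlock
  fin_cases i <;> fin_cases j <;> simp [blockVal] <;> linarith

theorem blockLen_nonneg (h : GoodParams p a c) (i : Fin 4) : 0 ≤ blockLen p a c i := by
  obtain ⟨g1, g2, g3, g4⟩ := h
  fin_cases i <;> simp [blockLen] <;> linarith

theorem prod_edges_ite {K G : SimpleGraph V} (hG : G ≤ K) (x y : ℝ) :
    ∏ e ∈ edges K, (if e ∈ edges G then x else y) =
      x ^ (edges G).card * y ^ ((edges K).card - (edges G).card) := by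
  rw [Finset.prod_ite, Finset.prod_const, Finset.prod_const, Finset.filter_mem_eq_inter,
    Finset.inter_eq_right.2 (edges_mono hG), ← Finset.card_sdiff_of_subset (edges_mono hG),
    Finset.sdiff_eq_filter]

/-- The upper bound for the weight of a position; it also holds if `t ≤ p` is added to the values. -/
theorem weight_le (h : GoodParams p a c) (K : SimpleGraph V) (B : V → Fin 4) {γ Z t : ℝ} (hZ : 1 ≤ Z)
    (ha : a ≤ Z * p ^ (1 + γ)) (hc : c ≤ Z * p ^ (1 + γ / 2)) (ht : 0 ≤ t) (htp : t ≤ p) :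
    0 ≤ (∏ v, blockLen p a c (B v)) * ∏ e ∈ edges K, (blockPair p a c (e.map B) + t) ∧
    (∏ v, blockLen p a c (B v)) * ∏ e ∈ edges K, (blockPair p a c (e.map B) + t) ≤
      Z ^ Fintype.card V * 4 ^ (edges K).card *
        p ^ ((∑ v, blockExp γ (B v)) + (edges K).card - (edges (oneGraph K B)).card) := by
  have hp : 0 < p := by linarith [h.a_pos, h.c_pos, h.lt]
  have hp1 := h.le_half
  have hG := oneGraph_le K B
  have hlen : ∀ i, blockLen p a c i ≤ Z * p ^ blockExp γ i := by
    intro i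
    have g1 := h.a_pos
    have g2 := h.c_pos
    fin_cases i <;> simp only [blockLen, blockExp]
    · exact ha
    · simp; nlinarith
    · exact hc
    · simp; linarith
  have hnn : ∀ e : Sym2 V, 0 ≤ blockPair p a c (e.map B) + t := by
    intro e
    induction e using Sym2.ind with
    | _ u v => exact add_nonneg (blockVal_mem h _ _).1 ht
  have hval : ∀ e ∈ edges K, blockPair p a c (e.map B) + t ≤
      if e ∈ edges (oneGraph K B) then 4 else 4 * p := by
    intro e he
    induction e using Sym2.ind with
    | _ u v =>
    by_cases h1 : IsOneBlock (B u) (B v)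
    · rw [if_pos ((mk_mem_edges (H := oneGraph K B)).2 ⟨mk_mem_edges.1 he, h1⟩)]
      have : blockPair p a c (s(u, v).map B) ≤ 1 := (blockVal_mem h _ _).2
      linarith
    · rw [if_neg fun h2 => h1 ((mk_mem_edges (H := oneGraph K B)).1 h2).2]
      have : blockPair p a c (s(u, v).map B) ≤ 3 * p := blockVal_le_of_not h h1
      linarith
  have hl0 : 0 ≤ ∏ v, blockLen p a c (B v) := Finset.prod_nonneg fun v _ => blockLen_nonneg h _
  refine ⟨mul_nonneg hl0 (Finset.prod_nonneg fun e _ => hnn e), ?_⟩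
  have e1 : ∏ v, blockLen p a c (B v) ≤ Z ^ Fintype.card V * p ^ ∑ v, blockExp γ (B v) := by
    refine (Finset.prod_le_prod (fun v _ => blockLen_nonneg h _) fun v _ => hlen _).trans ?_
    rw [Finset.prod_mul_distrib, Finset.prod_const, Finset.card_univ, Real.rpow_sum_of_pos hp]
  have e2 : ∏ e ∈ edges K, (blockPair p a c (e.map B) + t) ≤
      4 ^ (edges K).card * p ^ ((edges K).card - (edges (oneGraph K B)).card) := by
    refine (Finset.prod_le_prod (fun e _ => hnn e) hval).trans (le_of_eq ?_)
    rw [prod_edges_ite hG, mul_pow, ← mul_assoc, ← pow_add,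
      Nat.add_sub_cancel' (Finset.card_le_card (edges_mono hG))]
  refine (mul_le_mul e1 e2 (Finset.prod_nonneg fun e _ => hnn e) (by positivity)).trans (le_of_eq ?_)
  rw [add_sub_assoc, Real.rpow_add hp, ← Nat.cast_sub (Finset.card_le_card (edges_mono hG)),
    Real.rpow_natCast]
  ring

/-- The lower bound for the weight of a position. -/
theorem le_weight (h : GoodParams p a c) (K : SimpleGraph V) (B : V → Fin 4) {γ z w x : ℝ}
    (hz : 0 ≤ z) (ha : a = z * p ^ (1 + γ)) (hc : c = √w * p ^ (1 + γ / 2))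
    (hx : p ≤ x) (hx1 : x ≤ 1) (hacx : a + c ≤ x * p)
    (hB : ∀ u v, K.Adj u v → B u = 0 → B v ≠ 3) :
    (1 - x) ^ (Fintype.card V + (edges K).card) * ((∏ v, ![z, 1, √w, 1] (B v)) *
        p ^ ((∑ v, blockExp γ (B v)) + (edges K).card - (edges (oneGraph K B)).card)) ≤
      (∏ v, blockLen p a c (B v)) * ∏ e ∈ edges K, blockPair p a c (e.map B) := by
  have hp : 0 < p := by linarith [h.a_pos, h.c_pos, h.lt]
  have hG := oneGraph_le K B
  have h1x : 0 ≤ 1 - x := by linarith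
  have hx0 : 0 ≤ x := hp.le.trans hx
  have hcoef : ∀ i : Fin 4, 0 ≤ (![z, 1, √w, 1] : Fin 4 → ℝ) i := by
    intro i
    fin_cases i <;> simp [hz]
  have rp : ∀ r : ℝ, 0 < p ^ r := fun r => Real.rpow_pos_of_pos hp r
  have hlen : ∀ i : Fin 4, (1 - x) * ((![z, 1, √w, 1] : Fin 4 → ℝ) i * p ^ blockExp γ i) ≤
      blockLen p a c i := by
    intro i
    have key : ∀ y : ℝ, 0 ≤ y → (1 - x) * y ≤ y := fun y hy => by nlinarith
    fin_cases i <;> simp only [blockLen, blockExp]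
    · simp only [ha]; exact key _ (mul_nonneg hz (rp _).le)
    · simp; linarith
    · simp only [hc]; exact key _ (mul_nonneg (Real.sqrt_nonneg w) (rp _).le)
    · simp; linarith
  have hval : ∀ e ∈ edges K, (1 - x) * (if e ∈ edges (oneGraph K B) then 1 else p) ≤
      blockPair p a c (e.map B) := by
    intro e he
    induction e using Sym2.ind with
    | _ u v =>
    have he' := mk_mem_edges.1 he
    by_cases h1 : IsOneBlock (B u) (B v)
    · rw [if_pos ((mk_mem_edges (H := oneGraph K B)).2 ⟨he', h1⟩)]
      have : blockPair p a c (s(u, v).map B) = 1 := blockVal_of_isOneBlock h1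
      linarith
    · rw [if_neg fun h2 => h1 ((mk_mem_edges (H := oneGraph K B)).1 h2).2]
      have : p - a - c ≤ blockPair p a c (s(u, v).map B) :=
        le_blockVal_of_not h h1 (hB u v he') (hB v u he'.symm)
      linarith
  have e1 : (1 - x) ^ Fintype.card V * ((∏ v, ![z, 1, √w, 1] (B v)) * p ^ ∑ v, blockExp γ (B v)) ≤
      ∏ v, blockLen p a c (B v) := by
    refine le_trans (le_of_eq ?_) (Finset.prod_le_prod (fun v _ => ?_) fun v _ => hlen (B v))
    · rw [Finset.prod_mul_distrib, Finset.prod_mul_distrib, Finset.prod_const, Finset.card_univ,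
        Real.rpow_sum_of_pos hp]
    · exact mul_nonneg h1x (mul_nonneg (hcoef _) (rp _).le)
  have hif : ∀ e : Sym2 V, 0 ≤ if e ∈ edges (oneGraph K B) then 1 else p := fun e => by
    split_ifs
    · exact zero_le_one
    · exact hp.le
  have e2 : (1 - x) ^ (edges K).card * p ^ ((edges K).card - (edges (oneGraph K B)).card) ≤
      ∏ e ∈ edges K, blockPair p a c (e.map B) := by
    refine le_trans (le_of_eq ?_) (Finset.prod_le_prod (fun e _ => ?_) hval)
    · rw [Finset.prod_mul_distrib, Finset.prod_const, prod_edges_ite hG, one_pow, one_mul]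
    · exact mul_nonneg h1x (hif e)
  refine le_trans (le_of_eq ?_) (mul_le_mul e1 e2 (by positivity)
    (Finset.prod_nonneg fun v _ => blockLen_nonneg h _))
  rw [add_sub_assoc, Real.rpow_add hp, ← Nat.cast_sub (Finset.card_le_card (edges_mono hG)),
    Real.rpow_natCast]
  ring

/-! ### The positions belonging to valid sets -/

open Classical in
/-- The position of the vertices of `K` belonging to a contributing subgraph `H` with a cover
`s` equal to `1` on `S`. The neighbors of `S` outside `H` are forced to lie in block `1`. -/
noncomputable def position (K H : SimpleGraph V) (S : Finset V) (s : V → ℝ) (v : V) : Fin 4 :=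
  if v ∈ S then 0 else if v ∈ verts H ∧ s v = 1 / 2 then 2
  else if v ∈ verts H ∨ ∃ u ∈ S, K.Adj u v then 1 else 3

theorem position_eq_zero {K H : SimpleGraph V} {S : Finset V} {s : V → ℝ} {v : V} :
    position K H S s v = 0 ↔ v ∈ S := by
  unfold position
  split_ifs <;> simp_all

theorem position_eq_two {K H : SimpleGraph V} {S : Finset V} {s : V → ℝ} {v : V} :
    position K H S s v = 2 ↔ v ∉ S ∧ v ∈ verts H ∧ s v = 1 / 2 := by
  unfold position
  split_ifs <;> simp_all

theorem position_eq_three {K H : SimpleGraph V} {S : Finset V} {s : V → ℝ} {v : V} :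
    position K H S s v = 3 ↔ v ∉ S ∧ v ∉ verts H ∧ ∀ u ∈ S, ¬ K.Adj u v := by
  unfold position
  split_ifs with h1 h2 h3 <;> simp_all
  tauto

end Patterns

/-! ### The number of copies of `K` in the extremal graphons -/

section HomLowerBound

variable {V : Type*} [Fintype V] [DecidableEq V]

/-- `s` is a minimum fractional vertex cover of `H` witnessing that `S` is valid. -/
structure IsWitness (H : SimpleGraph V) (S : Finset V) (s : V → ℝ) : Prop where
  subset : S ⊆ verts H
  cover : IsMinFracVertexCover H s
  eq_one : ∀ v ∈ S, s v = 1
  eq_zero_or : ∀ v ∈ verts H, v ∉ S → s v = 0 ∨ s v = 1 / 2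

theorem IsValid.exists_isWitness {H : SimpleGraph V} {S : Finset V} (h : IsValid H S) :
    ∃ s, IsWitness H S s := by
  obtain ⟨h1, s, h2, h3, h4⟩ := h
  exact ⟨s, h1, h2, h3, h4⟩

variable {K H : SimpleGraph V} {S : Finset V} {s : V → ℝ}

theorem position_ne_three_of_adj {u v : V} (huv : K.Adj u v) (hu : position K H S s u = 0) :
    position K H S s v ≠ 3 := fun hv =>
  (position_eq_three.1 hv).2.2 u (position_eq_zero.1 hu) huv

theorem position_ne_three {v : V} (hv : v ∈ verts H) : position K H S s v ≠ 3 := fun h =>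
  (position_eq_three.1 h).2.1 hv

theorem IsWitness.blockCover_position (h : IsWitness H S s) (v : V) :
    blockCover (position K H S s v) = if v ∈ verts H then s v else 0 := by
  unfold position
  by_cases hS : v ∈ S
  · rw [if_pos hS, if_pos (h.subset hS), h.eq_one v hS]; rfl
  · rw [if_neg hS]
    by_cases hv : v ∈ verts H
    · rcases h.eq_zero_or v hv hS with h0 | h0
      · rw [if_neg (by rw [h0]; norm_num), if_pos (Or.inl hv), if_pos hv, h0]; rfl
      · rw [if_pos ⟨hv, h0⟩, if_pos hv, h0]; rfl
    · rw [if_neg fun h => hv h.1, if_neg hv]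
      split_ifs <;> rfl

theorem IsWitness.sum_blockCover (h : IsWitness H S s) :
    ∑ v, blockCover (position K H S s v) = coverNum H := by
  simp only [h.blockCover_position, ← h.cover.2]
  rw [← Finset.sum_filter]
  exact Finset.sum_congr (by ext v; simp) fun _ _ => rfl

theorem IsWitness.le_oneGraph (h : IsWitness H S s) (hHK : H ≤ K) :
    H ≤ oneGraph K (position K H S s) := by
  intro u v huv
  refine ⟨hHK huv, ?_⟩
  have hu := left_mem_verts huv
  have hv := right_mem_verts huv
  by_cases hSu : u ∈ S
  · exact Or.inl ⟨position_eq_zero.2 hSu, position_ne_three hv⟩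
  by_cases hSv : v ∈ S
  · exact Or.inr (Or.inl ⟨position_eq_zero.2 hSv, position_ne_three hu⟩)
  have h1 := h.cover.1.2 u v huv
  refine Or.inr (Or.inr ⟨position_eq_two.2 ⟨hSu, hu, ?_⟩, position_eq_two.2 ⟨hSv, hv, ?_⟩⟩) <;>
  rcases h.eq_zero_or u hu hSu with h2 | h2 <;> rcases h.eq_zero_or v hv hSv with h3 | h3 <;> linarith

/-- The edges in blocks of value `1` are those of `H`, and one pendant edge for each of the forced
vertices outside `H`. -/
theorem IsWitness.exists_pendant (h : IsWitness H S s) (hγ : 0 < gam K) (hH : IsContributing K H) :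
    (∑ v, blockExp (gam K) (position K H S s v) =
      (edges (oneGraph K (position K H S s))).card) ∧
    ∃ f : V → V, ∀ u v, (oneGraph K (position K H S s)).Adj u v →
        H.Adj u v ∨ (u ∉ verts H ∧ v = f u ∧ v ∈ verts H) ∨
          (v ∉ verts H ∧ u = f v ∧ u ∈ verts H) := by
  set B := position K H S s with hB
  have hex : ∀ x, ∃ u, x ∉ verts H → B x ≠ 3 → u ∈ S ∧ K.Adj u x := by
    intro x
    by_cases h1 : x ∉ verts H ∧ B x ≠ 3
    · have h2 : x ∉ S := fun h2 => h1.1 (h.subset h2)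
      by_contra hcon
      refine h1.2 (position_eq_three.2 ⟨h2, h1.1, fun u hu hux => hcon ⟨u, fun _ _ => ⟨hu, hux⟩⟩⟩)
    · exact ⟨x, fun h2 h3 => absurd ⟨h2, h3⟩ h1⟩
  choose f hf using hex
  set Y := Finset.univ.filter fun v => B v ≠ 3 with hY
  set X := Y \ verts H with hX
  have hXm : ∀ x ∈ X, x ∉ verts H ∧ B x ≠ 3 := by
    intro x hx
    obtain ⟨h1, h2⟩ := Finset.mem_sdiff.1 hx
    exact ⟨h2, (Finset.mem_filter.1 h1).2⟩
  have hfX : ∀ x ∈ X, f x ∈ S ∧ K.Adj (f x) x := fun x hx => hf x (hXm x hx).1 (hXm x hx).2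
  have hinj : Set.InjOn (fun x => s(f x, x)) X := by
    intro x hx y hy hxy
    rcases Sym2.eq_iff.1 hxy with ⟨-, h1⟩ | ⟨-, h1⟩
    · exact h1
    · exact absurd (h.subset (hfX y hy).1) (h1 ▸ (hXm x hx).1)
  have hdisj : Disjoint (edges H) (X.image fun x => s(f x, x)) := by
    rw [Finset.disjoint_left]
    rintro e he he'
    obtain ⟨x, hx, rfl⟩ := Finset.mem_image.1 he'
    exact (hXm x hx).1 (right_mem_verts (mk_mem_edges.1 he))
  have hsub : edges H ∪ (X.image fun x => s(f x, x)) ⊆ edges (oneGraph K B) := by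
    refine Finset.union_subset (edges_mono (h.le_oneGraph hH.1)) ?_
    intro e he
    obtain ⟨x, hx, rfl⟩ := Finset.mem_image.1 he
    exact (mk_mem_edges (H := oneGraph K B)).2
      ⟨(hfX x hx).2, Or.inl ⟨position_eq_zero.2 (hfX x hx).1, (hXm x hx).2⟩⟩
  have hcard : (edges H ∪ (X.image fun x => s(f x, x))).card = (edges H).card + X.card := by
    rw [Finset.card_union_of_disjoint hdisj, Finset.card_image_of_injOn hinj]
  have hYX : (Y.card : ℝ) = X.card + (verts H).card := by
    have h1 : verts H ⊆ Y := fun v hv =>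
      Finset.mem_filter.2 ⟨Finset.mem_univ _, position_ne_three hv⟩
    exact_mod_cast (Finset.card_sdiff_add_card_eq_card h1).symm
  have hsum : ∑ v, blockExp (gam K) (B v) = ((edges H).card : ℝ) + X.card := by
    rw [sum_blockExp, h.sum_blockCover]
    have := hH.2.2
    linarith
  have hle := card_edges_oneGraph_le hγ B
  rw [hsum] at hle ⊢
  -- By `card_edges_oneGraph_le` there is no room for further edges.
  have heq := Finset.eq_of_subset_of_card_le hsub (by rw [hcard]; exact_mod_cast hle)
  refine ⟨by rw [← heq, hcard]; push_cast; ring, f, fun u v huv => ?_⟩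
  · have h1 : s(u, v) ∈ edges (oneGraph K B) := mk_mem_edges.2 huv
    rw [← heq] at h1
    rcases Finset.mem_union.1 h1 with h2 | h2
    · exact Or.inl (mk_mem_edges.1 h2)
    · obtain ⟨x, hx, hxe⟩ := Finset.mem_image.1 h2
      have h3 := h.subset (hfX x hx).1
      rcases Sym2.eq_iff.1 hxe with ⟨rfl, rfl⟩ | ⟨rfl, rfl⟩
      · exact Or.inr (Or.inr ⟨(hXm _ hx).1, rfl, h3⟩)
      · exact Or.inr (Or.inl ⟨(hXm _ hx).1, rfl, h3⟩)

/-- `H` is the largest subgraph of minimum degree `2` of the graph of edges in blocks of value `1`,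
hence it is determined by the position. -/
theorem IsWitness.le_of_le_oneGraph (h : IsWitness H S s) (hγ : 0 < gam K) (hH : IsContributing K H)
    {H' : SimpleGraph V} (hmin : MinDegTwo H') (hle : H' ≤ oneGraph K (position K H S s)) :
    H' ≤ H := by
  obtain ⟨-, f, hf⟩ := h.exists_pendant hγ hH
  have key : ∀ u v, H'.Adj u v → u ∈ verts H := by
    intro u v huv
    by_contra hu
    obtain ⟨w, hw, hne⟩ := hmin.exists_ne (left_mem_verts huv) (f u)
    rcases hf u w (hle hw) with h1 | ⟨-, h1, -⟩ | ⟨-, -, h1⟩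
    · exact hu (left_mem_verts h1)
    · exact hne h1
    · exact hu h1
  intro u v huv
  rcases hf u v (hle huv) with h1 | ⟨h1, -, -⟩ | ⟨h1, -, -⟩
  · exact h1
  · exact absurd (key u v huv) h1
  · exact absurd (key v u huv.symm) h1

theorem IsWitness.prod_position (h : IsWitness H S s) (z : ℝ) {w : ℝ} (hw : 0 ≤ w) :
    ∏ v, (![z, 1, √w, 1] : Fin 4 → ℝ) (position K H S s v) =
      z ^ S.card * w ^ (coverNum H - S.card) := by
  set B := position K H S s with hB
  have e1 : ∀ i : Fin 4, (![z, 1, √w, 1] : Fin 4 → ℝ) i =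
      (if i = 0 then z else 1) * (if i = 2 then √w else 1) := by
    intro i; fin_cases i <;> simp
  have e2 : ∀ i : Fin 4, blockCover i = (if i = 0 then 1 else 0) + (if i = 2 then 1 / 2 else 0) := by
    intro i; fin_cases i <;> simp [blockCover]
  have hS : (Finset.univ.filter fun v => B v = 0) = S := by
    ext v; simp [hB, position_eq_zero]
  have hsum := h.sum_blockCover (K := K)
  simp only [e2, ← hB, Finset.sum_add_distrib, ← Finset.sum_filter, Finset.sum_const, nsmul_eq_mul,
    hS] at hsum
  simp only [e1, Finset.prod_mul_distrib, ← Finset.prod_filter, Finset.prod_const, hS]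
  congr 1
  rw [Real.sqrt_eq_rpow, ← Real.rpow_natCast, ← Real.rpow_mul hw]
  congr 1
  linarith

variable {p a c : ℝ}

/-- The extremal graphons contain essentially `P_K(z, w)` times as many copies of `K` as expected. -/
theorem le_hom_blockGraphon (h : GoodParams p a c) (hγ : 0 < gam K) {z w x : ℝ} (hz : 0 ≤ z)
    (hw : 0 ≤ w) (ha : a = z * p ^ (1 + gam K)) (hc : c = √w * p ^ (1 + gam K / 2)) (hx : p ≤ x)
    (hx1 : x ≤ 1) (hacx : a + c ≤ x * p) :
    (1 - x) ^ (Fintype.card V + (edges K).card) * (contribPoly K z w * p ^ (edges K).card) ≤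
      hom K (blockGraphon p a c).toSymKernel := by
  classical
  have hwit : ∀ q : Σ _ : SimpleGraph V, Finset V, ∃ s, IsValid q.1 q.2 → IsWitness q.1 q.2 s := by
    intro q
    by_cases hq : IsValid q.1 q.2
    · obtain ⟨s, hs⟩ := hq.exists_isWitness
      exact ⟨s, fun _ => hs⟩
    · exact ⟨0, fun h => absurd h hq⟩
  choose s hs using hwit
  set I : Finset (Σ _ : SimpleGraph V, Finset V) :=
    (Finset.univ.filter fun H => IsContributing K H).sigma
      fun H => Finset.univ.filter fun A => IsValid H A with hI
  have hmem : ∀ q ∈ I, IsContributing K q.1 ∧ IsValid q.1 q.2 := by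
    intro q hq
    obtain ⟨h1, h2⟩ := Finset.mem_sigma.1 hq
    exact ⟨(Finset.mem_filter.1 h1).2, (Finset.mem_filter.1 h2).2⟩
  have hpoly : contribPoly K z w = ∑ q ∈ I, z ^ q.2.card * w ^ (coverNum q.1 - q.2.card) := by
    rw [hI, Finset.sum_sigma]
    unfold contribPoly
    congr!
  set pos : (Σ _ : SimpleGraph V, Finset V) → V → Fin 4 := fun q => position K q.1 q.2 (s q) with hpos
  -- The position determines `S` as the set of vertices in block `0`, and `H` as the largest subgraph
  -- of minimum degree `2` in the graph of edges in blocks of value `1`.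
  have hinj : Set.InjOn pos I := by
    intro q hq q' hq' heq
    obtain ⟨h1, h2⟩ := hmem q hq
    obtain ⟨h1', h2'⟩ := hmem q' hq'
    have hS : q.2 = q'.2 := by
      ext v
      rw [← position_eq_zero (K := K) (H := q.1) (s := s q),
        ← position_eq_zero (K := K) (H := q'.1) (s := s q')]
      rw [show position K q.1 q.2 (s q) = position K q'.1 q'.2 (s q') from heq]
    have heq' : position K q.1 q.2 (s q) = position K q'.1 q'.2 (s q') := heq
    have hle := (hs q h2).le_oneGraph h1.1
    have hle' := (hs q' h2').le_oneGraph h1'.1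
    rw [heq'] at hle
    rw [← heq'] at hle'
    have hH : q.1 = q'.1 := le_antisymm ((hs q' h2').le_of_le_oneGraph hγ h1' h1.2.1 hle)
      ((hs q h2).le_of_le_oneGraph hγ h1 h1'.2.1 hle')
    obtain ⟨H, S⟩ := q
    obtain ⟨H', S'⟩ := q'
    simp only at hH hS
    subst hH hS
    rfl
  rw [hom_blockGraphon h, hpoly, Finset.sum_mul, Finset.mul_sum]
  have hnn : ∀ B : V → Fin 4,
      0 ≤ (∏ v, blockLen p a c (B v)) * ∏ e ∈ edges K, blockPair p a c (e.map B) := by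
    intro B
    refine mul_nonneg (Finset.prod_nonneg fun v _ => blockLen_nonneg h _)
      (Finset.prod_nonneg fun e _ => ?_)
    induction e using Sym2.ind with
    | _ u v => exact (blockVal_mem h _ _).1
  refine le_trans ?_ (Finset.sum_le_sum_of_subset_of_nonneg (Finset.subset_univ (I.image pos))
    fun B _ _ => hnn B)
  rw [Finset.sum_image hinj]
  refine Finset.sum_le_sum fun q hq => ?_
  obtain ⟨h1, h2⟩ := hmem q hq
  have hq' := hs q h2
  have hw' := le_weight h K (pos q) (γ := gam K) hz ha hc hx hx1 hacx fun u v huv hu =>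
    position_ne_three_of_adj huv hu
  have e1 := (hq'.exists_pendant hγ h1).1
  have e2 : ∑ v, blockExp (gam K) (pos q v) + ((edges K).card : ℝ) -
      ((edges (oneGraph K (pos q))).card : ℝ) = ((edges K).card : ℝ) := by
    have : ∑ v, blockExp (gam K) (pos q v) = ((edges (oneGraph K (pos q))).card : ℝ) := e1
    linarith
  rw [e2, Real.rpow_natCast] at hw'
  have e3 : ∏ v, (![z, 1, √w, 1] : Fin 4 → ℝ) (pos q v) =
      z ^ q.2.card * w ^ (coverNum q.1 - q.2.card) := hq'.prod_position z hw
  rw [e3] at hw'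
  exact hw'

/-- All terms of `P_K` but the constant one are homogeneous of degree at least `1`. -/
theorem one_add_mul_le_contribPoly (K : SimpleGraph V) {z w z' w' θ : ℝ} (hz : 0 ≤ z) (hw : 0 ≤ w)
    (hθ : 0 ≤ θ) (hz' : (1 + θ) * z ≤ z') (hw' : (1 + θ) * w ≤ w') :
    1 + (1 + θ) * (contribPoly K z w - 1) ≤ contribPoly K z' w' := by
  classical
  have h1 : ∀ H A, IsValid H A → H ≠ (⊥ : SimpleGraph V) →
      (1 + θ) * (z ^ A.card * w ^ (coverNum H - A.card)) ≤
        z' ^ A.card * w' ^ (coverNum H - A.card) := by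
    intro H A hA hH
    have h2 : (0:ℝ) ≤ coverNum H - A.card := by linarith [hA.card_le]
    have h3 := one_le_coverNum hH
    have h4 : 0 ≤ z' := le_trans (by positivity) hz'
    calc (1 + θ) * (z ^ A.card * w ^ (coverNum H - A.card))
        ≤ (1 + θ) ^ coverNum H * (z ^ A.card * w ^ (coverNum H - A.card)) := by
          gcongr
          exact Real.self_le_rpow_of_one_le (by linarith) h3
      _ = ((1 + θ) * z) ^ A.card * ((1 + θ) * w) ^ (coverNum H - A.card) := by
          rw [mul_pow, Real.mul_rpow (by linarith) hw]
          have : (1 + θ) ^ coverNum H = (1 + θ) ^ A.card * (1 + θ) ^ (coverNum H - A.card) := by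
            rw [← Real.rpow_natCast, ← Real.rpow_add (by linarith)]
            congr 1; ring
          rw [this]; ring
      _ ≤ _ := by gcongr
  have hbot : ∀ A : Finset V, IsValid ⊥ A ↔ A = ∅ := by
    intro A
    constructor
    · intro hA
      have := hA.1
      rw [verts_bot] at this
      exact Finset.subset_empty.1 this
    · rintro rfl
      obtain ⟨S, hS⟩ := exists_isValid (⊥ : SimpleGraph V)
      have := hS.1
      rw [verts_bot] at this
      rwa [Finset.subset_empty.1 this] at hS
  have key : ∀ z w : ℝ, contribPoly K z w = 1 +
      ∑ H ∈ ((Finset.univ : Finset (SimpleGraph V)).filter fun H => IsContributing K H).erase ⊥,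
        ∑ A ∈ (Finset.univ : Finset (Finset V)).filter fun A => IsValid H A,
          z ^ A.card * w ^ (coverNum H - (A.card : ℝ)) := by
    intro z w
    have e : contribPoly K z w =
        ∑ H ∈ (Finset.univ : Finset (SimpleGraph V)).filter fun H => IsContributing K H,
          ∑ A ∈ (Finset.univ : Finset (Finset V)).filter fun A => IsValid H A,
            z ^ A.card * w ^ (coverNum H - (A.card : ℝ)) := by
      unfold contribPoly
      congr!
    rw [e, ← Finset.add_sum_erase _ _
      (Finset.mem_filter.2 ⟨Finset.mem_univ _, isContributing_bot K⟩)]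
    congr 1
    rw [Finset.filter_congr fun A _ => hbot A, Finset.filter_eq' Finset.univ,
      if_pos (Finset.mem_univ _), Finset.sum_singleton]
    simp [coverNum_bot]
  rw [key z w, key z' w', add_sub_cancel_left, Finset.mul_sum]
  refine add_le_add_right (Finset.sum_le_sum fun H hH => ?_) _
  rw [Finset.mul_sum]
  refine Finset.sum_le_sum fun A hA => ?_
  exact h1 H A (Finset.mem_filter.1 hA).2 (Finset.ne_of_mem_erase hH)

end HomLowerBound

/-! ### The entropy of the extremal graphons -/

section BlockEntropy

theorem entropyFn_le_sq_div {p y : ℝ} (hp : 0 < p) (hp1 : p < 1) (hy : 0 ≤ y) (hy1 : y ≤ 1) :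
    entropyFn p y ≤ (y - p) ^ 2 / (p * (1 - p)) := by
  have key : ∀ x q : ℝ, 0 ≤ x → 0 < q → x * Real.log (x / q) ≤ x * (x / q - 1) := by
    intro x q hx hq
    rcases hx.eq_or_lt with rfl | hx
    · simp
    · exact mul_le_mul_of_nonneg_left (Real.log_le_sub_one_of_pos (div_pos hx hq)) hx.le
  have h1 : 0 < 1 - p := by linarith
  refine (add_le_add (key y p hy hp) (key (1 - y) (1 - p) (by linarith) h1)).trans (le_of_eq ?_)
  field_simp
  ring

theorem entropyFn_self {p : ℝ} (hp : 0 < p) (hp1 : p < 1) : entropyFn p p = 0 := by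
  have h1 : 1 - p ≠ 0 := by linarith
  simp [entropyFn, div_self hp.ne', div_self h1]

theorem entropyFn_one (p : ℝ) : entropyFn p 1 = Real.log (1 / p) := by simp [entropyFn]

variable {p a c : ℝ}

theorem entropy_blockGraphon_eq (h : GoodParams p a c) :
    entropy p (blockGraphon p a c).toGraphon =
      (2 * a * p - a ^ 2 + c ^ 2) * Real.log (1 / p) + 2 * a * (1 - p) * entropyFn p 0 +
        2 * (p - a - c) * (1 - p) * entropyFn p (p - a) +
        2 * c * (1 - p) * entropyFn p (p - a - c) + (1 - p) ^ 2 *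
          entropyFn p ((p - (p - a - c) * (p - a + c)) / (1 - p)) := by
  have hp : 0 < p := by linarith [h.a_pos, h.c_pos, h.lt]
  have hp1 : p < 1 := by linarith [h.le_half]
  rw [entropy_blockGraphon h]
  simp only [Fin.sum_univ_four, blockLen, blockVal, Matrix.cons_val, entropyFn_one,
    entropyFn_self hp hp1]
  ring

theorem le_entropy_blockGraphon (h : GoodParams p a c) :
    (2 * a * p - a ^ 2 + c ^ 2) * Real.log (1 / p) ≤ entropy p (blockGraphon p a c).toGraphon := by
  have hp : 0 < p := by linarith [h.a_pos, h.c_pos, h.lt]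
  have hp1 : p < 1 := by linarith [h.le_half]
  have nn : ∀ i j, 0 ≤ entropyFn p (blockVal p a c i j) := fun i j =>
    entropyFn_nonneg hp hp1 (blockVal_mem h i j).1 (blockVal_mem h i j).2
  have h1 : 0 ≤ entropyFn p 0 := nn 0 3
  have h2 : 0 ≤ entropyFn p (p - a) := nn 1 3
  have h3 : 0 ≤ entropyFn p (p - a - c) := nn 2 3
  have h4 : 0 ≤ entropyFn p ((p - (p - a - c) * (p - a + c)) / (1 - p)) := nn 3 3
  rw [entropy_blockGraphon_eq h]
  obtain ⟨ha, hc, hlt, -⟩ := h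
  have hr : 0 ≤ 1 - p := by linarith
  have hb : 0 ≤ p - a - c := by linarith
  have g1 := mul_nonneg (mul_nonneg (mul_nonneg zero_le_two ha.le) hr) h1
  have g2 := mul_nonneg (mul_nonneg (mul_nonneg zero_le_two hb) hr) h2
  have g3 := mul_nonneg (mul_nonneg (mul_nonneg zero_le_two hc.le) hr) h3
  have g4 := mul_nonneg (sq_nonneg (1 - p)) h4
  linarith

/-- The blocks of value `1` carry the factor `log (1 / p)`; the cost of restoring regularity in the last
row and column is only of order `a p + c ^ 2`. -/
theorem entropy_blockGraphon_le (h : GoodParams p a c) :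
    entropy p (blockGraphon p a c).toGraphon ≤
      (2 * a * p + c ^ 2) * (Real.log (1 / p) + 7) := by
  have hp : 0 < p := by linarith [h.a_pos, h.c_pos, h.lt]
  have hp1 : p < 1 := by linarith [h.le_half]
  have hr : 0 < 1 - p := by linarith
  have hL : 0 ≤ Real.log (1 / p) := Real.log_nonneg (by rw [le_div_iff₀ hp]; linarith)
  have key : ∀ i j, (1 - p) * entropyFn p (blockVal p a c i j) ≤
      (blockVal p a c i j - p) ^ 2 / p := by
    intro i j
    have h1 := entropyFn_le_sq_div hp hp1 (blockVal_mem h i j).1 (blockVal_mem h i j).2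
    refine (mul_le_mul_of_nonneg_left h1 hr.le).trans (le_of_eq ?_)
    field_simp
  have h1 : (1 - p) * entropyFn p 0 ≤ p := by
    refine (key 0 3).trans (le_of_eq ?_)
    show (0 - p) ^ 2 / p = p
    field_simp; ring
  have h2 : (1 - p) * entropyFn p (p - a) ≤ a ^ 2 / p := by
    refine (key 1 3).trans (le_of_eq ?_)
    show (p - a - p) ^ 2 / p = _
    ring
  have h3 : (1 - p) * entropyFn p (p - a - c) ≤ a + c := by
    refine (key 2 3).trans ?_
    show (p - a - c - p) ^ 2 / p ≤ _
    rw [div_le_iff₀ hp]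
    nlinarith [h.a_pos, h.c_pos, h.lt]
  have h4 : (1 - p) * entropyFn p ((p - (p - a - c) * (p - a + c)) / (1 - p)) ≤
      8 * p * (2 * a * p + c ^ 2) := by
    refine (key 3 3).trans ?_
    obtain ⟨e1, e2⟩ := le_blockVal_last h
    show ((p - (p - a - c) * (p - a + c)) / (1 - p) - p) ^ 2 / p ≤ _
    set y := (p - (p - a - c) * (p - a + c)) / (1 - p) with hy
    rw [div_le_iff₀ hp]
    have e3 : 0 ≤ 2 * a * p + c ^ 2 := by have := h.a_pos; positivity
    have e4 : 2 * a * p + c ^ 2 ≤ 2 * p * p := by nlinarith [h.a_pos, h.c_pos, h.lt]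
    nlinarith
  rw [entropy_blockGraphon_eq h]
  obtain ⟨ha, hc, hlt, hp2⟩ := h
  have hb : 0 ≤ p - a - c := by linarith
  have g1 : 2 * a * (1 - p) * entropyFn p 0 ≤ 2 * a * p := by
    have := mul_le_mul_of_nonneg_left h1 (mul_nonneg zero_le_two ha.le)
    linarith
  have g2 : 2 * (p - a - c) * (1 - p) * entropyFn p (p - a) ≤ 2 * a ^ 2 := by
    have := mul_le_mul_of_nonneg_left h2 (mul_nonneg zero_le_two hb)
    have e : 2 * (p - a - c) * (a ^ 2 / p) ≤ 2 * p * (a ^ 2 / p) := by gcongr; linarith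
    have e' : 2 * p * (a ^ 2 / p) = 2 * a ^ 2 := by field_simp
    linarith
  have g3 : 2 * c * (1 - p) * entropyFn p (p - a - c) ≤ 2 * c * (a + c) := by
    have := mul_le_mul_of_nonneg_left h3 (mul_nonneg zero_le_two hc.le)
    linarith
  have g4 : (1 - p) ^ 2 * entropyFn p ((p - (p - a - c) * (p - a + c)) / (1 - p)) ≤
      4 * (2 * a * p + c ^ 2) := by
    have e1 := mul_le_mul_of_nonneg_left h4 hr.le
    have e2 : (1 - p) * (8 * p * (2 * a * p + c ^ 2)) ≤ 4 * (2 * a * p + c ^ 2) := by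
      have e3 : 0 ≤ 2 * a * p + c ^ 2 := by positivity
      have e4 : (1 - p) * (8 * p) ≤ 4 := by nlinarith
      nlinarith
    linarith
  have g5 : 0 ≤ a ^ 2 * Real.log (1 / p) := by positivity
  have g6 : a * a ≤ a * p := by gcongr; linarith
  have g7 : a * c ≤ a * p := by gcongr; linarith
  nlinarith

end BlockEntropy

/-! ### The parameters of the extremal graphons -/

section Parameters

/-- The measure of the set of hubs, `z p ^ (1 + γ)`; the correction by `1 / log (1 / p)` provides room for the
lower order terms. -/
noncomputable def hubLen (γ z p : ℝ) : ℝ :=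
  ((1 + (Real.log (1 / p))⁻¹) * z + (Real.log (1 / p))⁻¹) * p ^ (1 + γ)

/-- The measure of the clique, `√w p ^ (1 + γ / 2)`, with a correction as in `hubLen`. -/
noncomputable def cliqueLen (γ w p : ℝ) : ℝ :=
  √((1 + (Real.log (1 / p))⁻¹) * w + (Real.log (1 / p))⁻¹) * p ^ (1 + γ / 2)

/-- The bounds for the parameters that are used below. -/
structure ParamBounds (γ z w p : ℝ) : Prop where
  pos : 0 < p
  lt_one : p < 1
  one_le_log : 1 ≤ Real.log (1 / p)
  good : GoodParams p (hubLen γ z p) (cliqueLen γ w p)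
  hub_le : hubLen γ z p ≤ (2 * z + 2 * w + 2) * p ^ (1 + γ)
  clique_le : cliqueLen γ w p ≤ (2 * z + 2 * w + 2) * p ^ (1 + γ / 2)
  sum_le : hubLen γ z p + cliqueLen γ w p ≤ 2 * (2 * z + 2 * w + 2) * p ^ (γ / 2) * p
  small : 4 * (2 * z + 2 * w + 2) * p ^ (γ / 2) ≤ 1
  le_hub : (Real.log (1 / p))⁻¹ * p ^ (1 + γ) ≤ hubLen γ z p
  le_clique : (Real.log (1 / p))⁻¹ * p ^ (1 + γ / 2) ≤ cliqueLen γ w p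

theorem eventually_paramBounds {γ z w : ℝ} (hγ : 0 < γ) (hz : 0 ≤ z) (hw : 0 ≤ w) :
    ∀ᶠ p in 𝓝[>] (0 : ℝ), ParamBounds γ z w p := by
  filter_upwards [eventually_lt_one, tendsto_log_one_div.eventually_ge_atTop 1,
    Ioo_mem_nhdsGT (show (0 : ℝ) < 1 / 2 by norm_num),
    eventually_mul_rpow_le (r := γ / 2) (C := 4 * (2 * z + 2 * w + 2)) (t := 1) (by linarith)
      one_pos] with p hp hL hhalf hsmall
  obtain ⟨hp, hp1⟩ := hp
  set Z := 2 * z + 2 * w + 2 with hZ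
  set θ := (Real.log (1 / p))⁻¹ with hθ
  have hθ0 : 0 < θ := inv_pos.2 (by linarith)
  have hθ1 : θ ≤ 1 := inv_le_one_of_one_le₀ hL
  have hr : ∀ r : ℝ, 0 < p ^ r := fun r => Real.rpow_pos_of_pos hp r
  have h1 : 0 ≤ θ * z := by positivity
  have h2 : 0 ≤ θ * w := by positivity
  have h3 : θ * z ≤ z := by nlinarith
  have h4 : θ * w ≤ w := by nlinarith
  have e1 : (1 + θ) * z + θ ≤ Z := by nlinarith
  have e2 : θ ≤ (1 + θ) * z + θ := by nlinarith
  have e3 : θ ≤ √((1 + θ) * w + θ) := by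
    refine Real.le_sqrt_of_sq_le ?_
    nlinarith
  have e4 : √((1 + θ) * w + θ) ≤ Z := by
    refine Real.sqrt_le_iff.2 ⟨by linarith, ?_⟩
    have : 1 ≤ Z := by linarith
    nlinarith
  have a1 : hubLen γ z p ≤ Z * p ^ (1 + γ) := mul_le_mul_of_nonneg_right e1 (hr _).le
  have a2 : cliqueLen γ w p ≤ Z * p ^ (1 + γ / 2) := mul_le_mul_of_nonneg_right e4 (hr _).le
  have a3 : θ * p ^ (1 + γ) ≤ hubLen γ z p := mul_le_mul_of_nonneg_right e2 (hr _).le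
  have a4 : θ * p ^ (1 + γ / 2) ≤ cliqueLen γ w p := mul_le_mul_of_nonneg_right e3 (hr _).le
  have a5 : hubLen γ z p + cliqueLen γ w p ≤ 2 * Z * p ^ (γ / 2) * p := by
    have b1 : p ^ (1 + γ) ≤ p ^ (1 + γ / 2) :=
      Real.rpow_le_rpow_of_exponent_ge hp hp1.le (by linarith)
    have b2 : p ^ (1 + γ / 2) = p ^ (γ / 2) * p := by
      rw [add_comm, Real.rpow_add hp, Real.rpow_one]
    have b3 : Z * p ^ (1 + γ) ≤ Z * p ^ (1 + γ / 2) :=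
      mul_le_mul_of_nonneg_left b1 (by linarith)
    calc _ ≤ 2 * (Z * p ^ (1 + γ / 2)) := by linarith
      _ = _ := by rw [b2]; ring
  refine ⟨hp, hp1, hL, ⟨?_, ?_, ?_, hhalf.2.le⟩, a1, a2, a5, hsmall, a3, a4⟩
  · exact lt_of_lt_of_le (mul_pos hθ0 (hr _)) a3
  · exact lt_of_lt_of_le (mul_pos hθ0 (hr _)) a4
  · refine a5.trans_lt ?_
    nlinarith

variable {V : Type*} [Fintype V] [DecidableEq V]

/-- The extremal graphons belonging to the point `(z, w)`. -/
noncomputable def extremal (γ z w p : ℝ) : BlockGraphon 3 :=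
  blockGraphon p (hubLen γ z p) (cliqueLen γ w p)

/-- The correction in `hubLen` and `cliqueLen` raises the density by a relative amount of order
`1 / log (1 / p)`, which exceeds the losses, as these are powers of `p`. -/
theorem eventually_isAdmissible {K : SimpleGraph V} (hγ : 0 < gam K) {δ z w : ℝ} (hδ : 0 < δ)
    (hz : 0 ≤ z) (hw : 0 ≤ w) (hzw : 1 + δ ≤ contribPoly K z w) :
    ∀ᶠ p in 𝓝[>] (0 : ℝ), IsAdmissible K δ p (extremal (gam K) z w p).toGraphon := by
  set Z := 2 * z + 2 * w + 2 with hZ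
  set N := Fintype.card V + (edges K).card with hN
  filter_upwards [eventually_paramBounds hγ hz hw,
    eventually_mul_rpow_mul_log_le (r := gam K / 2) (C := N * (2 * Z) * (1 + 2 * δ)) (t := δ / 2)
      (by linarith) (by linarith),
    eventually_mul_rpow_mul_log_le (r := 1) (C := N * (1 + 2 * δ)) (t := δ / 2)
      one_pos (by linarith)] with p hP h1 h2
  refine ⟨isRegular_blockGraphon hP.good, ?_⟩
  set L := Real.log (1 / p) with hL
  have hL1 := hP.one_le_log
  have hp := hP.pos
  have hsmall := hP.small
  rw [← hZ] at hsmall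
  rw [Real.rpow_one] at h2
  set x := 2 * Z * p ^ (gam K / 2) + p with hx
  have hx0 : 0 ≤ 2 * Z * p ^ (gam K / 2) := by positivity
  have hx1 : x ≤ 1 := by linarith [hP.good.le_half]
  have hθ0 : 0 ≤ L⁻¹ := inv_nonneg.2 (by linarith)
  have hθ1 : L⁻¹ ≤ 1 := inv_le_one_of_one_le₀ hL1
  have hzz : 0 ≤ (1 + L⁻¹) * z + L⁻¹ := by positivity
  have hww : 0 ≤ (1 + L⁻¹) * w + L⁻¹ := by positivity
  have hom := le_hom_blockGraphon hP.good hγ hzz hww rfl rfl (x := x) (by linarith) hx1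
    (by have := hP.sum_le; rw [← hZ] at this; nlinarith)
  refine le_trans ?_ hom
  have hpoly := one_add_mul_le_contribPoly K hz hw hθ0 (z' := (1 + L⁻¹) * z + L⁻¹)
    (w' := (1 + L⁻¹) * w + L⁻¹) (by linarith) (by linarith)
  have hpoly' : 1 + δ + δ * L⁻¹ ≤ contribPoly K ((1 + L⁻¹) * z + L⁻¹) ((1 + L⁻¹) * w + L⁻¹) := by
    nlinarith
  have hbern : 1 - N * x ≤ (1 - x) ^ N := by
    have := one_add_mul_le_pow (a := -x) (by linarith) N
    rw [← sub_eq_add_neg] at this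
    linarith
  rw [← mul_assoc]
  refine mul_le_mul_of_nonneg_right ?_ (pow_nonneg hp.le _)
  have h3 : N * x * (1 + 2 * δ) ≤ δ * L⁻¹ := by
    rw [← div_eq_mul_inv, le_div_iff₀ (by linarith)]
    rw [hx]
    linarith
  have h4 : 1 + δ ≤ (1 - N * x) * (1 + δ + δ * L⁻¹) := by
    have : N * x * (1 + δ + δ * L⁻¹) ≤ N * x * (1 + 2 * δ) := by
      have : 0 ≤ N * x := mul_nonneg (Nat.cast_nonneg _) (by linarith)
      refine mul_le_mul_of_nonneg_left ?_ this
      nlinarith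
    nlinarith
  refine h4.trans ((mul_le_mul_of_nonneg_right hbern ?_).trans
    (mul_le_mul_of_nonneg_left hpoly' (pow_nonneg (by linarith) _)))
  positivity

/-- The entropy is `(2 a p + c ^ 2) log (1 / p)` to first order, with `a` and `c` the measures of the hubs
and of the clique. -/
theorem tendsto_entropy_extremal {γ z w : ℝ} (hγ : 0 < γ) (hz : 0 ≤ z) (hw : 0 ≤ w) :
    Tendsto (fun p => entropy p (extremal γ z w p).toGraphon / (p ^ (2 + γ) * Real.log (1 / p)))
      (𝓝[>] 0) (𝓝 (2 * z + w)) := by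
  set Z := 2 * z + 2 * w + 2 with hZ
  set s : ℝ → ℝ := fun p =>
    2 * ((1 + (Real.log (1 / p))⁻¹) * z + (Real.log (1 / p))⁻¹) +
      ((1 + (Real.log (1 / p))⁻¹) * w + (Real.log (1 / p))⁻¹) with hs
  have hθ : Tendsto (fun p : ℝ => (Real.log (1 / p))⁻¹) (𝓝[>] 0) (𝓝 0) :=
    tendsto_inv_atTop_zero.comp tendsto_log_one_div
  have hst : Tendsto s (𝓝[>] 0) (𝓝 (2 * z + w)) := by
    have := ((((hθ.const_add 1).mul_const z).add hθ).const_mul 2).add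
      (((hθ.const_add 1).mul_const w).add hθ)
    rwa [show 2 * ((1 + 0) * z + 0) + ((1 + 0) * w + 0) = 2 * z + w by ring] at this
  have hlow : Tendsto (fun p => s p - Z ^ 2 * p ^ γ) (𝓝[>] 0) (𝓝 (2 * z + w)) := by
    simpa using hst.sub ((tendsto_rpow_zero hγ).const_mul (Z ^ 2))
  have hup : Tendsto (fun p => s p * (1 + 7 * (Real.log (1 / p))⁻¹)) (𝓝[>] 0) (𝓝 (2 * z + w)) := by
    simpa using hst.mul ((hθ.const_mul 7).const_add 1)
  have hq : ∀ p, ParamBounds γ z w p → 0 < p ^ (2 + γ) * Real.log (1 / p) ∧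
      2 * hubLen γ z p * p + cliqueLen γ w p ^ 2 = s p * p ^ (2 + γ) := by
    intro p hP
    have hp := hP.pos
    have hL := hP.one_le_log
    refine ⟨mul_pos (Real.rpow_pos_of_pos hp _) (by linarith), ?_⟩
    have hθ0 : 0 ≤ (Real.log (1 / p))⁻¹ := inv_nonneg.2 (by linarith)
    have e1 : p ^ (1 + γ) * p = p ^ (2 + γ) := by
      rw [← Real.rpow_add_one hp.ne']; congr 1; ring
    have e2 : (p ^ (1 + γ / 2)) ^ 2 = p ^ (2 + γ) := by
      rw [← Real.rpow_mul_natCast hp.le]; congr 1; push_cast; ring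
    rw [hubLen, cliqueLen, mul_pow, Real.sq_sqrt (by positivity), e2, hs, ← e1]
    ring
  refine tendsto_of_tendsto_of_tendsto_of_le_of_le' hlow hup ?_ ?_
  · filter_upwards [eventually_paramBounds hγ hz hw] with p hP
    obtain ⟨h1, h2⟩ := hq p hP
    have hp := hP.pos
    have hL := hP.one_le_log
    rw [le_div_iff₀ h1]
    refine le_trans ?_ (le_entropy_blockGraphon hP.good)
    have h3 : hubLen γ z p ^ 2 ≤ Z ^ 2 * p ^ γ * p ^ (2 + γ) := by
      have e : Z ^ 2 * p ^ γ * p ^ (2 + γ) = (Z * p ^ (1 + γ)) ^ 2 := by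
        rw [mul_pow, ← Real.rpow_mul_natCast hp.le, mul_assoc, ← Real.rpow_add hp]
        congr 2; push_cast; ring
      rw [e]
      exact pow_le_pow_left₀ hP.good.a_pos.le hP.hub_le 2
    rw [← mul_assoc]
    refine mul_le_mul_of_nonneg_right ?_ (by linarith)
    linarith
  · filter_upwards [eventually_paramBounds hγ hz hw] with p hP
    obtain ⟨h1, h2⟩ := hq p hP
    have hL := hP.one_le_log
    rw [div_le_iff₀ h1]
    refine (entropy_blockGraphon_le hP.good).trans (le_of_eq ?_)
    rw [h2]
    have : Real.log (1 / p) ≠ 0 := by linarith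
    field_simp

end Parameters

/-! ### Small and large blocks -/

section Blocks

theorem eventually_logloglog {ε : ℝ} (hε : 0 < ε) : ∀ᶠ p in 𝓝[>] (0 : ℝ),
    1 ≤ Real.log (Real.log (Real.log (1 / p))) ∧
      Real.log (Real.log (Real.log (1 / p))) ≤ ε * Real.log (1 / p) := by
  have h2 : ∀ᶠ x : ℝ in atTop, 1 ≤ Real.log (Real.log x) ∧ Real.log (Real.log x) ≤ ε * x := by
    filter_upwards [(Real.tendsto_log_atTop.comp Real.tendsto_log_atTop).eventually_ge_atTop 1,
      Real.isLittleO_log_id_atTop.bound hε, eventually_gt_atTop (1 : ℝ)] with x h1 h2 h3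
    have h4 : 0 < Real.log x := Real.log_pos h3
    refine ⟨h1, (Real.log_le_self h4.le).trans ?_⟩
    rw [Real.norm_of_nonneg h4.le, id, Real.norm_of_nonneg (by linarith)] at h2
    exact h2
  exact tendsto_log_one_div.eventually h2

theorem ParamBounds.blockLen_le {γ z w p : ℝ} (hz : 0 ≤ z) (hw : 0 ≤ w) (h : ParamBounds γ z w p)
    (i : Fin 4) : blockLen p (hubLen γ z p) (cliqueLen γ w p) i ≤
      (2 * z + 2 * w + 2) * p ^ blockExp γ i := by
  have g1 := h.good.a_pos
  have g2 := h.good.c_pos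
  have g3 := h.pos
  have g4 := h.lt_one
  fin_cases i <;> simp only [blockLen, blockExp]
  · exact h.hub_le
  · simp; nlinarith
  · exact h.clique_le
  · simp; nlinarith

theorem ParamBounds.le_blockLen {γ z w p : ℝ} (h : ParamBounds γ z w p)
    (i : Fin 4) : (Real.log (1 / p))⁻¹ / 2 * p ^ blockExp γ i ≤
      blockLen p (hubLen γ z p) (cliqueLen γ w p) i := by
  have g1 := h.good.a_pos
  have g2 := h.good.c_pos
  have g3 := h.pos
  have g4 := h.good.le_half
  have g5 : (Real.log (1 / p))⁻¹ ≤ 1 := inv_le_one_of_one_le₀ h.one_le_log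
  have g6 := h.sum_le
  have g7 := h.small
  have g8 := h.le_hub
  have g9 := h.le_clique
  fin_cases i <;> simp only [blockLen, blockExp]
  · simp at *; linarith
  · simp at *; nlinarith
  · simp at *; linarith
  · simp at *; linarith

/-- Outside the blocks of value `1` and the blocks between the hubs and the last block, the values
are close to `p`. -/
theorem abs_blockVal_sub_le {p a c : ℝ} (h : GoodParams p a c) {i j : Fin 4}
    (hij : ¬ IsOneBlock i j) (h1 : i = 0 → j ≠ 3) (h2 : j = 0 → i ≠ 3) :
    |blockVal p a c i j - p| ≤ 6 * (a + c) := by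
  have h0 := le_blockVal_last h
  have h3 := le_blockVal_of_not h hij h1 h2
  obtain ⟨g1, g2, g3, g4⟩ := h
  have h5 : 2 * (2 * a * p + c ^ 2) ≤ 6 * (a + c) := by nlinarith
  have h6 : blockVal p a c i j ≤ p + 6 * (a + c) := by
    revert hij h1 h2
    unfold IsOneBlock
    fin_cases i <;> fin_cases j <;> simp [blockVal] <;> linarith
  rw [abs_le]
  constructor <;> linarith

theorem blockVal_eq_self {p a c : ℝ} {i j : Fin 4} (hij : ¬ IsOneBlock i j) (hi : i ≠ 3)
    (hj : j ≠ 3) : blockVal p a c i j = p := by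
  revert hij hi hj
  unfold IsOneBlock
  fin_cases i <;> fin_cases j <;> simp [blockVal]

theorem IsOneBlock.le_blockExp {γ : ℝ} (hγ : 0 < γ) {i j : Fin 4} (hij : IsOneBlock i j) :
    2 + γ ≤ blockExp γ i + blockExp γ j := by
  revert hij
  unfold IsOneBlock
  fin_cases i <;> fin_cases j <;> simp [blockExp] <;> linarith

/-- The parameters of the extremal graphons `extremal γ z w (p t)`, where `p t` tends to `0` from
the right. -/
structure ExtremalFamily {ι : Type*} (γ z w : ℝ) (l : Filter ι) (p : ι → ℝ) : Prop where
  γ_pos : 0 < γ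
  z_nonneg : 0 ≤ z
  w_nonneg : 0 ≤ w
  pos : 0 < 2 * z + w
  tendsto : Tendsto p l (𝓝[>] 0)

namespace ExtremalFamily

variable {ι : Type*} {γ z w : ℝ} {l : Filter ι} {p : ι → ℝ}

theorem bounds (H : ExtremalFamily γ z w l p) : ∀ᶠ t in l, ParamBounds γ z w (p t) :=
  H.tendsto.eventually (eventually_paramBounds H.γ_pos H.z_nonneg H.w_nonneg)

theorem entropy_bounds (H : ExtremalFamily γ z w l p) : ∀ᶠ t in l,
    (2 * z + w) / 2 * (p t ^ (2 + γ) * Real.log (1 / p t)) ≤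
        entropy (p t) (extremal γ z w (p t)).toGraphon ∧
      entropy (p t) (extremal γ z w (p t)).toGraphon ≤
        2 * (2 * z + w) * (p t ^ (2 + γ) * Real.log (1 / p t)) := by
  have h := (tendsto_entropy_extremal H.γ_pos H.z_nonneg H.w_nonneg).comp H.tendsto
  have hpos := H.pos
  filter_upwards [H.bounds, h.eventually (Ioo_mem_nhds
    (show (2 * z + w) / 2 < 2 * z + w by linarith)
    (show 2 * z + w < 2 * (2 * z + w) by linarith))] with t hP ht
  have hq : 0 < p t ^ (2 + γ) * Real.log (1 / p t) :=
    mul_pos (Real.rpow_pos_of_pos hP.pos _) (by linarith [hP.one_le_log])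
  exact ⟨((lt_div_iff₀ hq).1 ht.1).le, ((div_lt_iff₀ hq).1 ht.2).le⟩

/-- A block whose total weight is of order `p ^ (2 + γ)` is small, since the entropy is larger by a factor
`log (1 / p)`. -/
theorem isSmallBlock_of_le (H : ExtremalFamily γ z w l p) {i j : Fin 4} {C : ℝ}
    (h : ∀ᶠ t in l, blockLen (p t) (hubLen γ z (p t)) (cliqueLen γ w (p t)) i *
      blockLen (p t) (hubLen γ z (p t)) (cliqueLen γ w (p t)) j *
        blockVal (p t) (hubLen γ z (p t)) (cliqueLen γ w (p t)) i j ≤ C * p t ^ (2 + γ)) :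
    IsSmallBlock l p (fun t => extremal γ z w (p t)) i j := by
  have h1 : (fun t => (extremal γ z w (p t)).len i * (extremal γ z w (p t)).len j *
      (extremal γ z w (p t)).val i j) =O[l] fun t => p t ^ (2 + γ) := by
    refine IsBigO.of_bound C ?_
    filter_upwards [h, H.bounds] with t ht hP
    rw [extremal, len_eq hP.good, len_eq hP.good, val_eq hP.good, Real.norm_of_nonneg,
      Real.norm_of_nonneg (Real.rpow_nonneg hP.pos.le _)]
    · exact ht
    · exact mul_nonneg (mul_nonneg (blockLen_nonneg hP.good _) (blockLen_nonneg hP.good _))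
        (blockVal_mem hP.good _ _).1
  refine h1.trans_isLittleO (isLittleO_iff.2 fun ε hε => ?_)
  have hpos := H.pos
  filter_upwards [H.bounds, H.entropy_bounds,
    H.tendsto.eventually (eventually_logloglog (ε := ε * ((2 * z + w) / 2)) (by positivity))]
    with t hP hE hM
  obtain ⟨hM1, hM2⟩ := hM
  have hq : 0 < p t ^ (2 + γ) := Real.rpow_pos_of_pos hP.pos _
  have hM0 : 0 < Real.log (Real.log (Real.log (1 / p t))) := by linarith
  have hL := hP.one_le_log
  have hE0 : 0 ≤ entropy (p t) (extremal γ z w (p t)).toGraphon :=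
    entropy_nonneg hP.pos hP.lt_one _
  rw [Real.norm_of_nonneg hq.le, Real.norm_of_nonneg (by positivity), mul_left_comm,
    inv_mul_eq_div, le_div_iff₀ hM0]
  calc p t ^ (2 + γ) * Real.log (Real.log (Real.log (1 / p t)))
      ≤ p t ^ (2 + γ) * (ε * ((2 * z + w) / 2) * Real.log (1 / p t)) := by gcongr
    _ = ε * ((2 * z + w) / 2 * (p t ^ (2 + γ) * Real.log (1 / p t))) := by ring
    _ ≤ _ := mul_le_mul_of_nonneg_left hE.1 hε.le

/-- A block whose total weight is at least of the order of the entropy is not small. -/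
theorem not_isSmallBlock [NeBot l] (H : ExtremalFamily γ z w l p) {i j : Fin 4}
    (h : ∀ᶠ t in l, p t ^ (2 + γ) * Real.log (1 / p t) ≤
      blockLen (p t) (hubLen γ z (p t)) (cliqueLen γ w (p t)) i *
      blockLen (p t) (hubLen γ z (p t)) (cliqueLen γ w (p t)) j *
        blockVal (p t) (hubLen γ z (p t)) (cliqueLen γ w (p t)) i j) :
    ¬ IsSmallBlock l p (fun t => extremal γ z w (p t)) i j := by
  intro hsmall
  have hpos := H.pos
  have hb := hsmall.bound (show 0 < (4 * (2 * z + w))⁻¹ by positivity)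
  obtain ⟨t, ht, hP, hE, hM, hb⟩ := (h.and (H.bounds.and (H.entropy_bounds.and
    ((H.tendsto.eventually (eventually_logloglog one_pos)).and hb)))).exists
  have hL := hP.one_le_log
  have hq : 0 < p t ^ (2 + γ) * Real.log (1 / p t) :=
    mul_pos (Real.rpow_pos_of_pos hP.pos _) (by linarith)
  have hE0 : 0 ≤ entropy (p t) (extremal γ z w (p t)).toGraphon :=
    entropy_nonneg hP.pos hP.lt_one _
  have hM' := inv_le_one_of_one_le₀ hM.1
  have hM0 : 0 ≤ (Real.log (Real.log (Real.log (1 / p t))))⁻¹ := inv_nonneg.2 (by linarith [hM.1])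
  have e1 : (extremal γ z w (p t)).len i * (extremal γ z w (p t)).len j *
      (extremal γ z w (p t)).val i j = blockLen (p t) (hubLen γ z (p t)) (cliqueLen γ w (p t)) i *
      blockLen (p t) (hubLen γ z (p t)) (cliqueLen γ w (p t)) j *
        blockVal (p t) (hubLen γ z (p t)) (cliqueLen γ w (p t)) i j := by
    rw [extremal, len_eq hP.good, len_eq hP.good, val_eq hP.good]
  simp only [e1] at hb
  rw [Real.norm_of_nonneg (hq.le.trans ht), Real.norm_of_nonneg (mul_nonneg hM0 hE0)] at hb
  have h2 : (Real.log (Real.log (Real.log (1 / p t))))⁻¹ *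
      entropy (p t) (extremal γ z w (p t)).toGraphon ≤
      2 * (2 * z + w) * (p t ^ (2 + γ) * Real.log (1 / p t)) :=
    (mul_le_of_le_one_left hE0 hM').trans hE.2
  have h3 : (4 * (2 * z + w))⁻¹ * (2 * (2 * z + w) * (p t ^ (2 + γ) * Real.log (1 / p t))) =
      (p t ^ (2 + γ) * Real.log (1 / p t)) / 2 := by field_simp; ring
  have h4 := mul_le_mul_of_nonneg_left h2 (show 0 ≤ (4 * (2 * z + w))⁻¹ by positivity)
  linarith

/-- Lengths of blocks deviate from powers of `p` by logarithmic factors at most, which a strict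
inequality between exponents absorbs. -/
theorem le_len_mul_len (H : ExtremalFamily γ z w l p) {i j : Fin 4}
    (hij : blockExp γ i + blockExp γ j < 1 + γ) (C : ℝ) :
    ∀ᶠ t in l, C * (p t ^ (1 + γ) * Real.log (1 / p t)) ≤
      blockLen (p t) (hubLen γ z (p t)) (cliqueLen γ w (p t)) i *
        blockLen (p t) (hubLen γ z (p t)) (cliqueLen γ w (p t)) j := by
  set s := blockExp γ i + blockExp γ j with hs
  -- A third of the gap is spent on each of the three logarithms.
  set r := (1 + γ - s) / 3 with hr
  filter_upwards [H.bounds, H.tendsto.eventually (eventually_mul_rpow_mul_log_le (r := r)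
    (C := max 1 (4 * C)) (t := 1) (by linarith) one_pos)] with t hP ht
  have hp := hP.pos
  have hL := hP.one_le_log
  set L := Real.log (1 / p t) with hLdef
  have hL0 : 0 < L := by linarith
  set x := p t ^ r * L with hx
  have hx0 : 0 < x := mul_pos (Real.rpow_pos_of_pos hp _) hL0
  have hm1 : 1 ≤ max 1 (4 * C) := le_max_left _ _
  have hm2 : 4 * C ≤ max 1 (4 * C) := le_max_right _ _
  have hx1 : x ≤ 1 := by nlinarith
  have hx3 : 4 * C * x ^ 3 ≤ 1 := by
    have : x ^ 3 ≤ x := by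
      have := pow_le_pow_of_le_one hx0.le hx1 (show 1 ≤ 3 by norm_num)
      rwa [pow_one] at this
    calc 4 * C * x ^ 3 ≤ max 1 (4 * C) * x ^ 3 := by gcongr
      _ ≤ max 1 (4 * C) * x := by gcongr
      _ ≤ 1 := ht
  have e1 : p t ^ (1 + γ) = p t ^ s * (p t ^ r) ^ 3 := by
    rw [← Real.rpow_mul_natCast hp.le, ← Real.rpow_add hp, hr]
    congr 1; push_cast; ring
  have hs0 : 0 < p t ^ s := Real.rpow_pos_of_pos hp _
  refine le_trans ?_ (mul_le_mul (hP.le_blockLen i) (hP.le_blockLen j) ?_ (blockLen_nonneg hP.good _))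
  · have e2 : L⁻¹ / 2 * p t ^ blockExp γ i * (L⁻¹ / 2 * p t ^ blockExp γ j) =
        p t ^ s * (L⁻¹) ^ 2 / 4 := by
      rw [hs, Real.rpow_add hp]; ring
    rw [e2, e1]
    have e3 : p t ^ s * L⁻¹ ^ 2 / 4 - C * (p t ^ s * (p t ^ r) ^ 3 * L) =
        p t ^ s * L⁻¹ ^ 2 / 4 * (1 - 4 * C * x ^ 3) := by
      rw [hx]; field_simp
    have : 0 ≤ p t ^ s * L⁻¹ ^ 2 / 4 * (1 - 4 * C * x ^ 3) :=
      mul_nonneg (by positivity) (by linarith)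
    linarith
  · exact mul_nonneg (div_nonneg (inv_nonneg.2 hL0.le) zero_le_two) (Real.rpow_nonneg hp.le _)

theorem isSmallBlock_of_isOneBlock (H : ExtremalFamily γ z w l p) {i j : Fin 4}
    (hij : IsOneBlock i j) : IsSmallBlock l p (fun t => extremal γ z w (p t)) i j := by
  refine H.isSmallBlock_of_le (C := (2 * z + 2 * w + 2) * (2 * z + 2 * w + 2)) ?_
  filter_upwards [H.bounds] with t hP
  have hp := hP.pos
  have hz := H.z_nonneg
  have hw := H.w_nonneg
  rw [blockVal_of_isOneBlock hij, mul_one]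
  refine (mul_le_mul (hP.blockLen_le hz hw i) (hP.blockLen_le hz hw j)
    (blockLen_nonneg hP.good _) (by positivity)).trans ?_
  rw [mul_mul_mul_comm, ← Real.rpow_add hp]
  exact mul_le_mul_of_nonneg_left (Real.rpow_le_rpow_of_exponent_ge hp hP.lt_one.le
    (hij.le_blockExp H.γ_pos)) (by positivity)

theorem isSmallBlock_of_le_blockExp (H : ExtremalFamily γ z w l p) {i j : Fin 4}
    (hij : ¬ IsOneBlock i j) (hi : i ≠ 3) (hj : j ≠ 3) (h : 1 + γ ≤ blockExp γ i + blockExp γ j) :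
    IsSmallBlock l p (fun t => extremal γ z w (p t)) i j := by
  refine H.isSmallBlock_of_le (C := (2 * z + 2 * w + 2) * (2 * z + 2 * w + 2)) ?_
  filter_upwards [H.bounds] with t hP
  have hp := hP.pos
  have hz := H.z_nonneg
  have hw := H.w_nonneg
  rw [blockVal_eq_self hij hi hj]
  have e1 := (mul_le_mul (hP.blockLen_le hz hw i) (hP.blockLen_le hz hw j)
    (blockLen_nonneg hP.good _) (by positivity))
  refine (mul_le_mul_of_nonneg_right e1 hp.le).trans ?_
  rw [mul_mul_mul_comm, ← Real.rpow_add hp, mul_assoc, ← Real.rpow_add_one hp.ne']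
  exact mul_le_mul_of_nonneg_left (Real.rpow_le_rpow_of_exponent_ge hp hP.lt_one.le
    (by linarith)) (by positivity)

theorem le_blockExp_of_isSmallBlock [NeBot l] (H : ExtremalFamily γ z w l p) {i j : Fin 4}
    (hij : ¬ IsOneBlock i j) (hi : i ≠ 3) (hj : j ≠ 3)
    (h : IsSmallBlock l p (fun t => extremal γ z w (p t)) i j) :
    1 + γ ≤ blockExp γ i + blockExp γ j := by
  by_contra hcon
  refine H.not_isSmallBlock ?_ h
  filter_upwards [H.bounds, H.le_len_mul_len (not_le.1 hcon) 1] with t hP ht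
  rw [blockVal_eq_self hij hi hj]
  refine le_trans (le_of_eq ?_) (mul_le_mul_of_nonneg_right ht hP.pos.le)
  rw [show 2 + γ = 1 + γ + 1 by ring, Real.rpow_add_one hP.pos.ne']
  ring

end ExtremalFamily

end Blocks

/-! ### The conditions on the extremal graphons -/

section Conditions

variable {V : Type*} [Fintype V] [DecidableEq V] {K : SimpleGraph V}

/-- Two further edges at a vertex `u` can be added to the edges in blocks of value `1`, and covered
by raising the weight of `u` by `η`, only if `γ(K)` is large. -/
theorem two_le_gam_mul (hγ : 0 < gam K) {B : V → Fin 4}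
    (h : ∑ v, blockExp (gam K) (B v) ≤ (edges (oneGraph K B)).card) {u v v' : V} (hv : K.Adj u v)
    (hv' : K.Adj u v') (hne : v ≠ v') (h1 : ¬ IsOneBlock (B u) (B v))
    (h2 : ¬ IsOneBlock (B u) (B v')) (hu3 : B u ≠ 3) (hv3 : B v ≠ 3) (hv3' : B v' ≠ 3) {η : ℝ}
    (hη : 0 ≤ η) (hc : 1 ≤ blockCover (B u) + η + blockCover (B v))
    (hc' : 1 ≤ blockCover (B u) + η + blockCover (B v')) : 2 ≤ gam K * η := by
  obtain ⟨hverts, hext, hmin⟩ := oneGraph_of_tight hγ h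
  set G := oneGraph K B with hG
  set G' : SimpleGraph V := G ⊔ SimpleGraph.fromEdgeSet {s(u, v), s(u, v')} with hG'
  have hadj : ∀ x y, G'.Adj x y → G.Adj x y ∨ (x = u ∧ y = v ∨ x = v ∧ y = u) ∨
      (x = u ∧ y = v' ∨ x = v' ∧ y = u) := by
    intro x y hxy
    rw [hG', SimpleGraph.sup_adj, SimpleGraph.fromEdgeSet_adj] at hxy
    rcases hxy with hxy | ⟨hxy, -⟩
    · exact Or.inl hxy
    · rcases hxy with hxy | hxy
      · exact Or.inr (Or.inl (Sym2.eq_iff.1 hxy))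
      · exact Or.inr (Or.inr (Sym2.eq_iff.1 hxy))
  have hG'K : G' ≤ K := by
    intro x y hxy
    rcases hadj x y hxy with h3 | (⟨rfl, rfl⟩ | ⟨rfl, rfl⟩) | (⟨rfl, rfl⟩ | ⟨rfl, rfl⟩)
    · exact h3.1
    · exact hv
    · exact hv.symm
    · exact hv'
    · exact hv'.symm
  have hVV : verts G' = verts G := by
    refine Finset.Subset.antisymm (fun x hx => ?_) (verts_mono le_sup_left)
    obtain ⟨y, hxy⟩ := mem_verts.1 hx
    rcases hadj x y hxy with h3 | (⟨rfl, rfl⟩ | ⟨rfl, rfl⟩) | (⟨rfl, rfl⟩ | ⟨rfl, rfl⟩)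
    · exact left_mem_verts h3
    all_goals exact hverts _ (by assumption)
  have hcover : IsFracVertexCover G' fun x => blockCover (B x) + if x = u then η else 0 := by
    have hnn : ∀ x, 0 ≤ if x = u then η else 0 := fun x => by split_ifs <;> linarith
    refine ⟨fun x _ => add_nonneg (blockCover_nonneg _) (hnn x), fun x y hxy => ?_⟩
    have hx := hnn x
    have hy := hnn y
    have hx' := blockCover_nonneg (B x)
    have hy' := blockCover_nonneg (B y)
    have hu : (if u = u then η else 0) = η := if_pos rfl
    rcases hadj x y hxy with h3 | (⟨rfl, rfl⟩ | ⟨rfl, rfl⟩) | (⟨rfl, rfl⟩ | ⟨rfl, rfl⟩)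
    · have := h3.2.one_le
      linarith
    all_goals (beta_reduce; rw [hu]; linarith)
  have hcn := coverNum_le hcover
  rw [hVV, Finset.sum_add_distrib, hmin, Finset.sum_ite_eq', if_pos (hverts u hu3)] at hcn
  have hcard : (edges G).card + 2 ≤ (edges G').card := by
    have n1 : s(u, v) ∉ insert s(u, v') (edges G) := by
      rw [Finset.mem_insert, not_or]
      refine ⟨fun h3 => ?_, fun h3 => h1 (mk_mem_edges.1 h3).2⟩
      rcases Sym2.eq_iff.1 h3 with ⟨-, h4⟩ | ⟨-, h4⟩
      · exact hne h4
      · exact hv.ne h4.symm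
    have n2 : s(u, v') ∉ edges G := fun h3 => h2 (mk_mem_edges.1 h3).2
    rw [show (edges G).card + 2 = (insert s(u, v) (insert s(u, v') (edges G))).card by
      rw [Finset.card_insert_of_notMem n1, Finset.card_insert_of_notMem n2]]
    refine Finset.card_le_card ?_
    refine Finset.insert_subset ?_ (Finset.insert_subset ?_ (edges_mono le_sup_left))
    · refine mk_mem_edges.2 (Or.inr ?_)
      rw [SimpleGraph.fromEdgeSet_adj]
      exact ⟨Or.inl rfl, hv.ne⟩
    · refine mk_mem_edges.2 (Or.inr ?_)
      rw [SimpleGraph.fromEdgeSet_adj]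
      exact ⟨Or.inr rfl, hv'.ne⟩
  have hcard' : ((edges G).card : ℝ) + 2 ≤ (edges G').card := by exact_mod_cast hcard
  have hgam := sub_le_gam_mul hG'K
  rw [hVV] at hgam
  have h5 : gam K * coverNum G' ≤ gam K * (coverNum G + η) := mul_le_mul_of_nonneg_left hcn hγ.le
  linarith

namespace ExtremalFamily

variable {ι : Type*} {z w : ℝ} {l : Filter ι} {p : ι → ℝ}

/-- A non-negligible position has the largest possible order of magnitude, and it avoids the blocks of
value `0`. -/
theorem of_not_isNegligible (H : ExtremalFamily (gam K) z w l p) {B : V → Fin 4}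
    (hB : ¬ IsNegligible K l p (fun t => extremal (gam K) z w (p t)) B) :
    ∑ v, blockExp (gam K) (B v) ≤ (edges (oneGraph K B)).card ∧
      ∀ u v, K.Adj u v → B u = 0 → B v ≠ 3 := by
  constructor
  · by_contra hcon
    refine hB (isLittleO_iff.2 fun ε hε => ?_)
    set Z := 2 * z + 2 * w + 2 with hZ
    have hz := H.z_nonneg
    have hw := H.w_nonneg
    filter_upwards [H.bounds, H.tendsto.eventually (eventually_mul_rpow_le
      (r := ∑ v, blockExp (gam K) (B v) - (edges (oneGraph K B)).card)
      (C := Z ^ Fintype.card V * 4 ^ (edges K).card) (t := ε) (sub_pos.2 (not_le.1 hcon)) hε)]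
      with t hP ht
    have hp := hP.pos
    obtain ⟨h1, h2⟩ := weight_le hP.good K B (γ := gam K) (Z := Z) (t := 0) (by linarith) hP.hub_le
      hP.clique_le le_rfl hp.le
    simp only [add_zero] at h1 h2
    rw [extremal, homBlock_blockGraphon hP.good, Real.norm_of_nonneg h1,
      Real.norm_of_nonneg (pow_nonneg hp.le _)]
    refine h2.trans ?_
    rw [show ∑ v, blockExp (gam K) (B v) + ((edges K).card : ℝ) - (edges (oneGraph K B)).card =
      (∑ v, blockExp (gam K) (B v) - (edges (oneGraph K B)).card) + ((edges K).card : ℝ) by ring,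
      Real.rpow_add hp, Real.rpow_natCast, ← mul_assoc]
    exact mul_le_mul_of_nonneg_right ht (pow_nonneg hp.le _)
  · intro u v huv hu hv
    refine hB (isLittleO_iff.2 fun ε hε => ?_)
    filter_upwards [H.bounds] with t hP
    have h0 : blockPair (p t) (hubLen (gam K) z (p t)) (cliqueLen (gam K) w (p t))
        (s(u, v).map B) = 0 := by
      show blockVal _ _ _ (B u) (B v) = 0
      rw [hu, hv]; rfl
    rw [extremal, homBlock_blockGraphon hP.good,
      Finset.prod_eq_zero (mk_mem_edges.2 huv) h0, mul_zero, norm_zero]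
    positivity

/-- A somewhat important block is one of the blocks `(1, 1)`, `(1, 2)` and `(2, 1)`. -/
theorem of_isSomewhatImportant {γ : ℝ} (H : ExtremalFamily γ z w l p) {i j : Fin 4}
    (h : IsSomewhatImportant l p (fun t => extremal γ z w (p t)) i j) :
    ¬ IsOneBlock i j ∧ i ≠ 3 ∧ j ≠ 3 ∧ 1 + γ ≤ blockExp γ i + blockExp γ j := by
  obtain ⟨⟨hi, hj, hs⟩, hne⟩ := h
  have : NeBot l := ⟨fun hl => hne (by rw [hl]; exact eventually_bot)⟩
  have h1 : ¬ IsOneBlock i j := by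
    intro h1
    refine hne ?_
    filter_upwards [H.bounds] with t hP
    rw [extremal, val_eq hP.good, blockVal_of_isOneBlock h1]
  exact ⟨h1, hi, hj, H.le_blockExp_of_isSmallBlock h1 hi hj hs⟩

/-- Two edges with a common vertex in somewhat important blocks contradict `two_le_gam_mul`. -/
theorem somewhat (H : ExtremalFamily (gam K) z w l p) {B : V → Fin 4}
    (hB : ¬ IsNegligible K l p (fun t => extremal (gam K) z w (p t)) B) {u v v' : V}
    (hv : K.Adj u v) (hv' : K.Adj u v')
    (h : IsSomewhatImportant l p (fun t => extremal (gam K) z w (p t)) (B u) (B v))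
    (h' : IsSomewhatImportant l p (fun t => extremal (gam K) z w (p t)) (B u) (B v')) : v = v' := by
  by_contra hne
  have hγ := H.γ_pos
  obtain ⟨h1, hu3, hv3, h2⟩ := H.of_isSomewhatImportant h
  obtain ⟨h1', -, hv3', h2'⟩ := H.of_isSomewhatImportant h'
  have key := fun η => two_le_gam_mul (η := η) hγ (H.of_not_isNegligible hB).1 hv hv' hne h1 h1'
    hu3 hv3 hv3'
  -- Raising the weight of the common vertex by `1` contradicts `γ ≤ 1`.
  rcases le_or_gt (gam K) 1 with hg | hg
  · have := key 1 zero_le_one (by linarith [blockCover_nonneg (B u), blockCover_nonneg (B v)])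
      (by linarith [blockCover_nonneg (B u), blockCover_nonneg (B v')])
    linarith
  · -- Blocks `(1, 1)` are unimportant for `γ > 1`, hence both edges have an end in block `2`.
    have e : ∀ i j : Fin 4, ¬ IsOneBlock i j → i ≠ 3 → j ≠ 3 →
        1 + gam K ≤ blockExp (gam K) i + blockExp (gam K) j →
        1 ≤ blockCover i + 1 / 2 + blockCover j ∧ gam K ≤ 2 := by
      intro i j hij hi hj hle
      revert hij hi hj hle
      unfold IsOneBlock
      fin_cases i <;> fin_cases j <;> simp [blockExp, blockCover]
      · intro; linarith
      · intro; constructor <;> linarith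
      · intro; constructor <;> linarith
    have e1 := e _ _ h1 hu3 hv3 h2
    have e2 := e _ _ h1' hu3 hv3' h2'
    have := key (1 / 2) (by norm_num) e1.1 e2.1
    linarith [e1.2]

/-- An unimportant block met by a non-negligible position has lengths whose exponents have sum less than
`1 + γ`, and a value close to `p`. -/
theorem unimportant (H : ExtremalFamily (gam K) z w l p) {B : V → Fin 4}
    (hB : ¬ IsNegligible K l p (fun t => extremal (gam K) z w (p t)) B) {u v : V} (hv : K.Adj u v)
    (h : ¬ IsImportant l p (fun t => extremal (gam K) z w (p t)) (B u) (B v)) :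
    (∀ ε : ℝ, 0 < ε → ∀ᶠ t in l,
        (1 - ε) * ((p t)⁻¹ * entropy (p t) (extremal (gam K) z w (p t)).toGraphon) ≤
          (extremal (gam K) z w (p t)).len (B u) * (extremal (gam K) z w (p t)).len (B v)) ∧
      (fun t => (extremal (gam K) z w (p t)).val (B u) (B v) - p t) =o[l] p := by
  have hγ := H.γ_pos
  have hAR := (H.of_not_isNegligible hB).2
  have n1 : B u = 0 → B v ≠ 3 := hAR u v hv
  have n2 : B v = 0 → B u ≠ 3 := hAR v u hv.symm
  have h1 : ¬ IsOneBlock (B u) (B v) := fun h1 =>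
    h ⟨h1.ne_three, h1.symm.ne_three, H.isSmallBlock_of_isOneBlock h1⟩
  have hexp : blockExp (gam K) (B u) + blockExp (gam K) (B v) < 1 + gam K := by
    by_cases h3 : B u ≠ 3 ∧ B v ≠ 3
    · by_contra hcon
      exact h ⟨h3.1, h3.2, H.isSmallBlock_of_le_blockExp h1 h3.1 h3.2 (not_lt.1 hcon)⟩
    · revert n1 n2 h3 h1
      unfold IsOneBlock
      generalize B u = i
      generalize B v = j
      fin_cases i <;> fin_cases j <;> simp [blockExp] <;> linarith
  constructor
  · intro ε hε
    filter_upwards [H.bounds, H.entropy_bounds, H.le_len_mul_len hexp (2 * (2 * z + w))]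
      with t hP hE ht
    have hp := hP.pos
    rw [extremal, len_eq hP.good, len_eq hP.good]
    have hE0 : 0 ≤ entropy (p t) (extremal (gam K) z w (p t)).toGraphon :=
      entropy_nonneg hP.pos hP.lt_one _
    have e1 : 0 ≤ (p t)⁻¹ * entropy (p t) (extremal (gam K) z w (p t)).toGraphon := by positivity
    have e2 : (p t)⁻¹ * entropy (p t) (extremal (gam K) z w (p t)).toGraphon ≤
        2 * (2 * z + w) * (p t ^ (1 + gam K) * Real.log (1 / p t)) := by
      rw [inv_mul_le_iff₀ hp]
      refine hE.2.trans (le_of_eq ?_)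
      rw [show 2 + gam K = 1 + gam K + 1 by ring, Real.rpow_add_one hp.ne']
      ring
    have e3 : (1 - ε) * ((p t)⁻¹ * entropy (p t) (extremal (gam K) z w (p t)).toGraphon) ≤
        (p t)⁻¹ * entropy (p t) (extremal (gam K) z w (p t)).toGraphon := by nlinarith
    exact e3.trans (e2.trans ht)
  · refine isLittleO_iff.2 fun ε hε => ?_
    filter_upwards [H.bounds, H.tendsto.eventually (eventually_mul_rpow_le (r := gam K / 2)
      (C := 12 * (2 * z + 2 * w + 2)) (t := ε) (by linarith) hε)] with t hP ht
    have hp := hP.pos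
    have h4 := abs_blockVal_sub_le hP.good h1 n1 n2
    have h5 := hP.sum_le
    rw [extremal, val_eq hP.good, Real.norm_eq_abs, Real.norm_of_nonneg hp.le]
    have h6 := mul_le_mul_of_nonneg_right ht hp.le
    linarith

theorem not_too_many (H : ExtremalFamily (gam K) z w l p) :
    (fun t => hom K ((extremal (gam K) z w (p t)).toSymKernel.addConst (p t))) =O[l]
      fun t => p t ^ (edges K).card := by
  set Z := 2 * z + 2 * w + 2 with hZ
  have hz := H.z_nonneg
  have hw := H.w_nonneg
  have hγ := H.γ_pos
  refine IsBigO.of_bound (∑ _B : V → Fin 4, Z ^ Fintype.card V * 4 ^ (edges K).card) ?_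
  filter_upwards [H.bounds] with t hP
  have hp := hP.pos
  have h1 := fun B => weight_le hP.good K B (γ := gam K) (Z := Z) (t := p t) (by linarith) hP.hub_le
    hP.clique_le hp.le le_rfl
  rw [extremal, hom_blockGraphon_addConst hP.good, Real.norm_of_nonneg
    (Finset.sum_nonneg fun B _ => (h1 B).1), Real.norm_of_nonneg (pow_nonneg hp.le _),
    Finset.sum_mul]
  refine Finset.sum_le_sum fun B _ => (h1 B).2.trans ?_
  refine mul_le_mul_of_nonneg_left ?_ (by positivity)
  rw [← Real.rpow_natCast]
  exact Real.rpow_le_rpow_of_exponent_ge hp hP.lt_one.le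
    (by linarith [card_edges_oneGraph_le hγ B])

theorem le_len {γ : ℝ} (H : ExtremalFamily γ z w l p) : ∀ᶠ t in l, ∀ i,
    p t ^ (2 + γ) ≤ blockLen (p t) (hubLen γ z (p t)) (cliqueLen γ w (p t)) i := by
  have hγ := H.γ_pos
  filter_upwards [H.bounds, H.tendsto.eventually (eventually_mul_rpow_mul_log_le (r := 1)
    (C := 2) (t := 1) one_pos one_pos)] with t hP ht i
  have hp := hP.pos
  have hL := hP.one_le_log
  rw [Real.rpow_one] at ht
  refine le_trans ?_ (hP.le_blockLen i)
  have e1 : p t ≤ (Real.log (1 / p t))⁻¹ / 2 := by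
    rw [le_div_iff₀ two_pos, ← one_div, le_div_iff₀ (by linarith)]
    linarith
  have e2 : blockExp γ i ≤ 1 + γ := by
    fin_cases i <;> simp [blockExp] <;> linarith
  rw [show 2 + γ = 1 + (1 + γ) by ring, Real.rpow_add hp, Real.rpow_one]
  have e3 := Real.rpow_le_rpow_of_exponent_ge hp hP.lt_one.le e2
  exact mul_le_mul e1 e3 (Real.rpow_nonneg hp.le _) (hp.le.trans e1)

theorem le_val {γ : ℝ} (H : ExtremalFamily γ z w l p) {i j : Fin 4} (hi : i ≠ 3) (hj : j ≠ 3) :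
    ∀ᶠ t in l, p t ≤ (extremal γ z w (p t)).val i j := by
  filter_upwards [H.bounds] with t hP
  rw [extremal, val_eq hP.good]
  by_cases h1 : IsOneBlock i j
  · rw [blockVal_of_isOneBlock h1]
    exact hP.lt_one.le
  · rw [blockVal_eq_self h1 hi hj]

theorem lowerBoundConditions (H : ExtremalFamily (gam K) z w l p) {δ : ℝ} (hδ : 0 < δ)
    (hzw : 1 + δ ≤ contribPoly K z w) {n : ι → ℕ} (hn : Tendsto n l atTop)
    (hnp : (fun t => (Real.log (n t) / (n t : ℝ)) ^
      (1 / (2 * ((edges K).card : ℝ) - 2 - gam K))) =o[l] p) :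
    LowerBoundConditions K l n p (fun t => extremal (gam K) z w (p t)) := by
  have hγ := H.γ_pos
  have hpos := H.pos
  -- By assumption `log n / n` is much smaller than `p ^ D`, where `D ≥ γ + 4`. So it is much smaller
  -- than every quantity that is at least `p ^ (3 + γ)`.
  set D := 2 * ((edges K).card : ℝ) - 2 - gam K with hDdef
  have hD : gam K + 4 ≤ D := by linarith [gam_add_three_le hγ]
  have hp0 : ∀ᶠ t in l, 0 < p t ∧ p t < 1 := H.bounds.mono fun t hP => ⟨hP.pos, hP.lt_one⟩
  have hn' : Tendsto (fun t => (n t : ℝ)) l atTop := tendsto_natCast_atTop_atTop.comp hn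
  have hlogn : ∀ᶠ t in l, 1 ≤ Real.log (n t) :=
    (Real.tendsto_log_atTop.comp hn').eventually_ge_atTop 1
  have hnpos : ∀ᶠ t in l, (0 : ℝ) < n t := hn'.eventually_gt_atTop 0
  have hlog : (fun t => Real.log (n t) / (n t : ℝ)) =o[l] fun t => p t ^ D := by
    refine (hnp.rpow (show 0 < D by linarith) (hp0.mono fun t h => h.1.le)).congr' ?_ .rfl
    filter_upwards [hlogn, hnpos] with t h1 h2
    rw [← Real.rpow_mul (div_nonneg (by linarith) h2.le), one_div_mul_cancel (by linarith),
      Real.rpow_one]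
  have hpow : ∀ F : ι → ℝ, (∀ᶠ t in l, p t ^ (3 + gam K) ≤ F t) →
      (fun t => Real.log (n t) / (n t : ℝ)) =o[l] F := by
    intro F hF
    refine hlog.trans_isBigO (IsBigO.of_bound 1 ?_)
    filter_upwards [hF, hp0] with t h1 h2
    have h3 : 0 ≤ p t ^ (3 + gam K) := Real.rpow_nonneg h2.1.le _
    rw [Real.norm_of_nonneg (Real.rpow_nonneg h2.1.le _), Real.norm_of_nonneg (h3.trans h1), one_mul]
    exact (Real.rpow_le_rpow_of_exponent_ge h2.1 h2.2.le (by linarith)).trans h1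
  have hle1 : ∀ᶠ t in l, p t ^ (3 + gam K) ≤ p t ^ (2 + gam K) := hp0.mono fun t h =>
    Real.rpow_le_rpow_of_exponent_ge h.1 h.2.le (by linarith)
  have hinv : (fun t => (n t : ℝ)⁻¹) =O[l] fun t => Real.log (n t) / (n t : ℝ) := by
    refine IsBigO.of_bound 1 ?_
    filter_upwards [hlogn, hnpos] with t h1 h2
    rw [Real.norm_of_nonneg (by positivity), Real.norm_of_nonneg (by positivity), one_mul,
      div_eq_mul_inv]
    exact le_mul_of_one_le_left (by positivity) h1
  refine ⟨?_, ?_, ?_, ?_, ?_, ?_, ?_, ?_, ?_, ?_, ?_, ?_, H.not_too_many⟩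
  · have h1 : (fun t => Real.log (Real.log (n t)) / (n t : ℝ)) =O[l]
        fun t => Real.log (n t) / (n t : ℝ) := by
      refine IsBigO.of_bound 1 ?_
      filter_upwards [hlogn, hnpos] with t h1 h2
      have h3 : 0 ≤ Real.log (Real.log (n t)) := Real.log_nonneg h1
      rw [Real.norm_of_nonneg (by positivity), Real.norm_of_nonneg (by positivity), one_mul]
      gcongr
      exact Real.log_le_self (by linarith)
    refine h1.trans_isLittleO (hpow _ ?_)
    filter_upwards [hp0] with t h
    have := Real.rpow_le_rpow_of_exponent_ge h.1 h.2.le (show 1 ≤ 3 + gam K by linarith)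
    rwa [Real.rpow_one] at this
  · exact (isLittleO_one_iff ℝ).2 (H.tendsto.mono_right nhdsWithin_le_nhds)
  · exact H.bounds.mono fun t hP => isRegular_blockGraphon hP.good
  · refine H.bounds.mono fun t hP => ?_
    rw [extremal, len_eq hP.good]
    exact le_rfl
  · exact ⟨δ, hδ, (H.tendsto.eventually (eventually_isAdmissible hγ hδ H.z_nonneg H.w_nonneg
      hzw)).mono fun t h => h.2⟩
  · refine hpow _ ?_
    filter_upwards [H.entropy_bounds, H.bounds, hle1,
      (tendsto_log_one_div.comp H.tendsto).eventually_ge_atTop (((2 * z + w) / 2)⁻¹)]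
      with t hE hP h1 h2
    have h3 : 0 ≤ p t ^ (2 + gam K) := Real.rpow_nonneg hP.pos.le _
    have h4 : 1 ≤ (2 * z + w) / 2 * Real.log (1 / p t) := by
      have h5 : ((2 * z + w) / 2)⁻¹ ≤ Real.log (1 / p t) := h2
      rwa [inv_le_iff_one_le_mul₀' (by positivity)] at h5
    refine h1.trans (le_trans ?_ hE.1)
    nlinarith
  · have h1 : (fun t => entropy (p t) (extremal (gam K) z w (p t)).toGraphon) =O[l]
        fun t => Real.log (n t) / (n t : ℝ) * (p t ^ (2 + gam K) * (n t : ℝ)) := by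
      refine IsBigO.of_bound (2 * (2 * z + w)) ?_
      filter_upwards [H.entropy_bounds, H.bounds, hlog.bound one_pos, hlogn, hnpos]
        with t hE hP h1 h2 h3
      have hp := hP.pos
      -- Since `p ^ D ≥ 1 / n` with `D ≥ 1`, the logarithm of `1 / p` is at most that of `n`.
      have h4 : Real.log (1 / p t) ≤ Real.log (n t) := by
        rw [Real.norm_of_nonneg (by positivity), Real.norm_of_nonneg (Real.rpow_nonneg hp.le _),
          one_mul, div_le_iff₀ h3] at h1
        have h5 : 1 ≤ p t ^ D * n t := h2.trans h1
        have h6 : p t ^ D ≤ p t := by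
          have := Real.rpow_le_rpow_of_exponent_ge hp hP.lt_one.le (show 1 ≤ D by linarith)
          rwa [Real.rpow_one] at this
        refine Real.log_le_log (by positivity) ?_
        rw [div_le_iff₀ hp]
        nlinarith
      have hE0 : 0 ≤ entropy (p t) (extremal (gam K) z w (p t)).toGraphon :=
        entropy_nonneg hP.pos hP.lt_one _
      have h7 : 0 ≤ p t ^ (2 + gam K) := Real.rpow_nonneg hp.le _
      rw [Real.norm_of_nonneg hE0, Real.norm_of_nonneg (by positivity)]
      refine hE.2.trans (mul_le_mul_of_nonneg_left ?_ (by linarith))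
      calc p t ^ (2 + gam K) * Real.log (1 / p t) ≤ p t ^ (2 + gam K) * Real.log (n t) := by gcongr
        _ = _ := by field_simp
    refine h1.trans_isLittleO ((hlog.mul_isBigO (isBigO_refl _ _)).congr' .rfl ?_)
    filter_upwards [hp0] with t h2
    rw [← mul_assoc, ← Real.rpow_add h2.1, ← Real.rpow_natCast]
    congr 2
    push_cast
    rw [hDdef]; ring
  · intro i
    refine hinv.trans_isLittleO (hpow _ ?_)
    filter_upwards [H.bounds, H.le_len, hle1] with t hP h1 h2
    rw [extremal, len_eq hP.good]
    exact h2.trans (h1 i)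
  · intro i j hi hj
    refine ⟨H.le_val hi hj, ?_⟩
    by_cases h1 : IsOneBlock i j
    · exact Or.inr (H.isSmallBlock_of_isOneBlock h1)
    · refine Or.inl (H.bounds.mono fun t hP => ?_)
      rw [extremal, val_eq hP.good, blockVal_eq_self h1 hi hj]
  · exact fun B hB u v v' hv hv' h h' => H.somewhat hB hv hv' h h'
  · exact fun B hB u v hv h => H.unimportant hB hv h
  · intro i j hij
    refine hpow _ ?_
    filter_upwards [H.bounds, H.le_len, H.le_val hij.1 hij.2.1] with t hP h1 h2
    have hp := hP.pos
    have h3 : (extremal (gam K) z w (p t)).len i =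
        blockLen (p t) (hubLen (gam K) z (p t)) (cliqueLen (gam K) w (p t)) i := by
      rw [extremal, len_eq hP.good]
    rw [h3, show 3 + gam K = 1 + (2 + gam K) by ring, Real.rpow_add hp, Real.rpow_one]
    exact mul_le_mul h2 (h1 i) (Real.rpow_nonneg hp.le _) (hp.le.trans h2)

end ExtremalFamily

end Conditions

/-! ### The asymptotics of the minimum entropy -/

section MinEntropy

theorem isEquivalent_of_tendsto_div {f : ℝ → ℝ} {κ γ : ℝ} (hκ : 0 < κ)
    (h : Tendsto (fun p => f p / (p ^ (2 + γ) * Real.log (1 / p))) (𝓝[>] 0) (𝓝 κ)) :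
    f ~[𝓝[>] 0] fun p => κ * p ^ (2 + γ) * Real.log (1 / p) := by
  have hne : ∀ᶠ p in 𝓝[>] (0 : ℝ), κ * p ^ (2 + γ) * Real.log (1 / p) ≠ 0 := by
    filter_upwards [eventually_lt_one, tendsto_log_one_div.eventually_gt_atTop 0] with p hp hL
    have := Real.rpow_pos_of_pos hp.1 (2 + γ)
    positivity
  rw [isEquivalent_iff_tendsto_one hne]
  have h1 := h.div_const κ
  rw [div_self hκ.ne'] at h1
  refine h1.congr fun p => ?_
  rw [Pi.div_apply, div_div, mul_comm _ κ, mul_assoc]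

variable {V : Type*} [Fintype V] [DecidableEq V]

/-- The lower bound `eventually_le_entropy` for all admissible graphons meets the entropy of the extremal
ones. -/
theorem tendsto_minEntropy {K : SimpleGraph V} (hγ : 0 < gam K)
    (hbad : ∀ H, IsContributing K H → ∀ e, ¬ IsBadEdge H e) {δ z w : ℝ} (hδ : 0 < δ)
    (hz : 0 ≤ z) (hw : 0 ≤ w) (hzw : 1 + δ ≤ contribPoly K z w) (hρ : 2 * z + w = 2 * rho K δ) :
    Tendsto (fun p => minEntropy K δ p / (p ^ (2 + gam K) * Real.log (1 / p))) (𝓝[>] 0)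
      (𝓝 (2 * rho K δ)) := by
  have hq : ∀ᶠ p in 𝓝[>] (0 : ℝ), 0 < p ^ (2 + gam K) * Real.log (1 / p) := by
    filter_upwards [eventually_lt_one, tendsto_log_one_div.eventually_gt_atTop 0] with p hp hL
    exact mul_pos (Real.rpow_pos_of_pos hp.1 _) hL
  refine tendsto_order.2 ⟨fun x hx => ?_, fun x hx => ?_⟩
  · filter_upwards [hq, eventually_isAdmissible hγ hδ hz hw hzw,
      eventually_le_entropy hγ hbad (δ := δ) (τ := (2 * rho K δ - x) / 2) (by linarith)]
      with p hqp hadm hle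
    rw [lt_div_iff₀ hqp]
    refine lt_of_lt_of_le (b := (2 * rho K δ - (2 * rho K δ - x) / 2) *
      (p ^ (2 + gam K) * Real.log (1 / p))) ?_ (le_csInf ⟨_, _, hadm, rfl⟩ ?_)
    · exact mul_lt_mul_of_pos_right (by linarith) hqp
    · rintro s ⟨W, hW, rfl⟩
      exact hle W hW
  · have h := tendsto_entropy_extremal hγ hz hw
    rw [hρ] at h
    filter_upwards [hq, eventually_lt_one, eventually_isAdmissible hγ hδ hz hw hzw,
      h.eventually (gt_mem_nhds hx)] with p hqp hp hadm hlt
    refine lt_of_le_of_lt ?_ hlt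
    refine div_le_div_of_nonneg_right (csInf_le ⟨0, ?_⟩ ⟨_, hadm, rfl⟩) hqp.le
    rintro s ⟨W, -, rfl⟩
    exact entropy_nonneg hp.1 hp.2 W

end MinEntropy

end RegularTail

theorem theorem2p12 {V : Type*} [Fintype V] (K : SimpleGraph V)
    (hK : ∀ v, ∃ w, K.Adj v w)
    (hcore : ¬ (RegularTail.twoCore K).IsCycles)
    (hbad : ∀ H : SimpleGraph V, RegularTail.IsContributing K H →
      ∀ e : Sym2 V, ¬ RegularTail.IsBadEdge H e)
    (δ : ℝ) (hδ : 0 < δ) :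
    IsLeast (RegularTail.rhoValues K δ) (RegularTail.rho K δ) ∧
    (fun p : ℝ => RegularTail.minEntropy K δ p) ~[𝓝[>] (0 : ℝ)]
      (fun p : ℝ => 2 * RegularTail.rho K δ * p ^ (2 + RegularTail.gam K) * Real.log (1 / p)) ∧
    ∃ (m : ℕ) (W : ℝ → RegularTail.BlockGraphon m),
      (∀ᶠ p in 𝓝[>] (0 : ℝ), RegularTail.IsAdmissible K δ p (W p).toGraphon) ∧
      (fun p : ℝ => RegularTail.entropy p (W p).toGraphon) ~[𝓝[>] (0 : ℝ)]
        (fun p : ℝ =>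
          2 * RegularTail.rho K δ * p ^ (2 + RegularTail.gam K) * Real.log (1 / p)) ∧
      ∀ (ι : Type) (l : Filter ι) (n : ι → ℕ) (p : ι → ℝ),
        Tendsto n l atTop → Tendsto p l (𝓝[>] (0 : ℝ)) →
        (fun t => (Real.log (n t) / (n t : ℝ)) ^
          (1 / (2 * ((RegularTail.edges K).card : ℝ) - 2 - RegularTail.gam K))) =o[l] p →
        RegularTail.LowerBoundConditions K l n p (fun t => W (p t)) := by
  classical
  have hγ := RegularTail.gam_pos hcore
  obtain ⟨hleast, hρpos⟩ := RegularTail.exists_isLeast_rho hγ hδ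
  obtain ⟨z, w, hz, hw, hzw, hρ⟩ := hleast.1
  have hρ' : 2 * z + w = 2 * RegularTail.rho K δ := by linarith
  have hent := RegularTail.tendsto_entropy_extremal hγ hz hw
  rw [hρ'] at hent
  refine ⟨hleast, RegularTail.isEquivalent_of_tendsto_div (by linarith)
    (RegularTail.tendsto_minEntropy hγ hbad hδ hz hw hzw hρ'), 3,
    RegularTail.extremal (RegularTail.gam K) z w,
    RegularTail.eventually_isAdmissible hγ hδ hz hw hzw,
    RegularTail.isEquivalent_of_tendsto_div (by linarith) hent, fun ι l n p hn hp hnp => ?_⟩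
  have hfam : RegularTail.ExtremalFamily (RegularTail.gam K) z w l p :=
    ⟨hγ, hz, hw, by linarith, hp⟩
  exact hfam.lowerBoundConditions hδ hzw hn hnp
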